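/- **Setting.** Let $f,g:\mathbb R^{d_x}\times\mathbb R^{d_y}\to\mathbb R$, $y^*(x)=\arg\min_y g(x,y)$, $\Phi(x)=f(x,y^*(x))$, with $\Phi$ bounded below, and $z^*(x)=\arg\min_z\frac12\langle\nabla^2_{yy}g(x,y^*(x))z,z\rangle-\langle\nabla_yf(x,y^*(x)),z\rangle$. Norms are Euclidean (operator norm for matrices). Let $\mu,l_{g,1},L_{x,0},L_{x,1},L_{y,0},L_{y,1},\sigma_{g,1}>0$ and $l_{g,2},l_{f,0},\sigma_{f,1},\sigma_{g,2}\ge0$. Assume: 1. $f$ is differentiable, and for all $w=(x,y)$, $w'=(x',y')$ with $\|w-w'\|\le1/\sqrt{2(L_{x,1}^2+L_{y,1}^2)}$: $\|\nabla_xf(w)-\nabla_xf(w')\|\le(L_{x,0}+L_{x,1}\|\nabla_xf(w)\|)\|w-w'\|$ and $\|\nabla_yf(w)-\nabla_yf(w')\|\le(L_{y,0}+L_{y,1}\|\nabla_yf(w)\|)\|w-w'\|$. 2. $\|\nabla_yf(x,y^*(x))\|\le l_{f,0}$ for all $x$; $g(x,\cdot)$ is $\mu$-strongly convex for all $x$;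 $\nabla g$ is $l_{g,1}$-Lipschitz jointly in $(x,y)$; $g$ is twice continuously differentiable, and $\nabla^2_{xy}g$, $\nabla^2_{yy}g$ are $l_{g,2}$-Lipschitz jointly in $(x,y)$. 3. For samples $\xi\sim\mathcal D_f$ and $\pi,\zeta\sim\mathcal D_g$, the oracles $\nabla_xF(x,y;\xi)$, $\nabla_yF(x,y;\xi)$, $\nabla_yG(x,y;\pi)$, $\nabla^2_{xy}G(x,y;\zeta)$, $\nabla^2_{yy}G(x,y;\zeta)$ are measurable and unbiased for the corresponding derivatives of $f$ and $g$; those of $F$ have variance at most $\sigma_{f,1}^2$, the two second-order ones have variance at most $\sigma_{g,2}^2$, and $\Pr\{\|\nabla_yG(x,y;\pi)-\nabla_yg(x,y)\|\ge\lambda\}\le2\exp(-2\lambda^2/\sigma_{g,1}^2)$ for all $\lambda>0$. **Algorithm (SLIP).** Given $x_0,y_0^{init},z_0$ and $m_0=0$, run $T_0$ steps $y\leftarrow y-\alpha^{init}\nabla_yG(x_0,y;\tilde\pi_t)$ from $y_0^{init}$ to obtain $y_0$. Then for $t=0,\dots,T-1$ draw fresh independent $\xi_t,\xi_t'\sim\mathcal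 D_f$ and $\pi_t,\zeta_t,\zeta'_t\sim\mathcal D_g$ and set $y_{t+1}=y_t-\alpha\nabla_yG(x_t,y_t;\pi_t)$, $z_{t+1}=z_t-\gamma[\nabla^2_{yy}G(x_t,y_t;\zeta_t)z_t-\nabla_yF(x_t,y_t;\xi_t)]$, $m_{t+1}=\beta m_t+(1-\beta)[\nabla_xF(x_t,y_t;\xi_t')-\nabla^2_{xy}G(x_t,y_t;\zeta_t')z_t]$, $x_{t+1}=x_t-\eta\,m_{t+1}/\|m_{t+1}\|$ (with $x_{t+1}=x_t$ if $m_{t+1}=0$). **Parameters.** Put $L_0=\sqrt{1+l_{g,1}^2/\mu^2}\,\big(L_{x,0}+L_{x,1}\frac{l_{g,1}l_{f,0}}{\mu}+\frac{l_{g,1}}{\mu}(L_{y,0}+L_{y,1}l_{f,0})+l_{f,0}\frac{l_{g,1}l_{g,2}+l_{g,2}\mu}{\mu^2}\big)$, $L_1=\sqrt{1+l_{g,1}^2/\mu^2}\,L_{x,1}$, $\rho=\sqrt{2(1+l_{g,1}^2/\mu^2)(L_{x,1}^2+L_{y,1}^2)}$, $S=\sigma_{f,1}^2+2l_{f,0}^2\sigma_{g,2}^2/\mu^2$,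 $\Delta_0=\Phi(x_0)-\inf\Phi$, $\Delta_{y,0}=\|y_0-y^*(x_0)\|$, $\Delta_{z,0}=\|z_0-z^*(x_0)\|$, $Q=\frac{e\,l_{g,1}\Delta_0L_0}{\mu\delta}$, $R=\frac{e\,l_{g,1}\Delta_0L_0^3\sigma_{g,1}^2}{\mu^3\delta}$, $E_1=e^{\mu/(2l_{g,1})}$, $E_2=e^{\mu l_{g,1}\Delta_{z,0}^2/(2\Delta_0L_0)}$, $E_3=e^{\mu\Delta_{y,0}^2L_0/(2l_{g,1}\Delta_0)}$, $B=(2^{21}R/\epsilon^4)^4$, $A=\big(32Q/(\epsilon^2(1-\beta))\big)^2$, and read $a/0$ as $+\infty$ inside minima. For $\delta\in(0,1)$ and $\epsilon>0$ let $$\alpha^{init}=\min\Big\{\tfrac1{2l_{g,1}},\tfrac{\mu}{2048L_1^2\sigma_{g,1}^2\log(e/\delta)}\Big\},\qquad T_0=\Big\lceil\tfrac{\log(256L_1^2\|y_0^{init}-y^*(x_0)\|^2)}{\log(2/(2-\mu\alpha^{init}))}\Big\rceil$$ (with $T_0=0$ if this is negative or $y_0^{init}=y^*(x_0)$), $$1-\beta=\min\Big\{1,\tfrac{\mu}{16l_{g,1}},\tfrac{16Q}{\epsilon^2},\tfrac{\mu^2\epsilon^2}{64\cdot1024\,L_0^2\sigma_{g,1}^2\log^2B},\tfrac{\min\{1,\mu^2/(32l_{g,1}^2)\}\epsilon^2}{S},\tfrac{l_{g,1}^2}{8\sigma_{g,2}^2},\tfrac{\mu^2}{16\sigma_{g,2}^2},\tfrac{32Q}{\epsilon^2E_1},\tfrac{32Q}{\epsilon^2E_2},\tfrac{32Q}{\epsilon^2E_3}\Big\},$$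 $$\eta=\min\Big\{\tfrac18\min\Big(\tfrac1{L_1},\tfrac{\epsilon}{L_0},\tfrac{\epsilon\Delta_0}{\Delta_{y,0}^2L_0^2},\tfrac{\Delta_0}{\|\nabla\Phi(x_0)\|},\tfrac{\epsilon\Delta_0}{l_{g,1}^2\Delta_{z,0}^2},\tfrac{\mu\epsilon}{l_{g,1}L_0\log A}\Big)(1-\beta),\tfrac1\rho\Big\},$$ $\gamma=(1-\beta)/\mu$, $\alpha=8\gamma$, $T=\lceil4\Delta_0/(\eta\epsilon)\rceil$. Call $\epsilon$ *admissible* (at the warm-start output $y_0$) if $$\epsilon\le\min\Big\{\tfrac{L_0}{L_1},\Delta_{y,0}L_0,\tfrac{8l_{g,1}L_0}{\mu\rho},\sqrt{16Q},4R^{1/4},\sqrt{\tfrac{32Q}{E_1}},\sqrt{\tfrac{32Q}{E_2}},\sqrt{\tfrac{32Q}{E_3}},\tfrac{\Delta_0L_0}{\|\nabla\Phi(x_0)\|},\tfrac{L_0\sigma_{g,1}}{\sigma_{g,2}},\tfrac{L_0\sigma_{g,1}}{\sqrt{\mu l_{g,1}}},(2^{21}R)^{1/4}e^{-l_{g,1}\sqrt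 S/(512L_0\sigma_{g,1})}\Big\}.$$ **Theorem.** $\Phi$ is differentiable, and for all $\delta\in(0,1)$ and $\epsilon>0$, with probability at least $1-2\delta$ over the lower-level samples $(\tilde\pi_t),(\pi_t)$ the following holds: if $\epsilon$ is admissible, then $$\frac1T\sum_{t=0}^{T-1}\mathbb E\|\nabla\Phi(x_t)\|\le14\,\epsilon ,$$ where $\mathbb E$ is the expectation over all $\xi_t,\xi_t',\zeta_t,\zeta_t'$ with the lower-level samples held fixed. Moreover, whenever $\epsilon$ is admissible, the total number $T_0+5T$ of oracle calls is at most $C\,\epsilon^{-4}\,(1+|\log\frac1\epsilon|+|\log\frac1\delta|)^k$, i.e. $\widetilde O(\epsilon^{-4})$, where $k$ and $C$ depend only on the constants of the assumptions and, in the case of $C$, also on $\Delta_0$ and $\|y_0^{init}-y^*(x_0)\|$. -/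

import Mathlib

noncomputable section

namespace SLIP

open MeasureTheory

/-- Euclidean space `ℝ^d`. -/
abbrev Vec (d : ℕ) : Type := EuclideanSpace ℝ (Fin d)

/-- A minimizer of `h` (well defined up to choice whenever `h` attains its minimum). -/
def argmin {E : Type*} [Nonempty E] (h : E → ℝ) : E :=
  Classical.epsilon fun y => ∀ y', h y ≤ h y'

/-- Euclidean norm of a pair `(x, y)` of vectors. -/
def pairNorm {dx dy : ℕ} (x : Vec dx) (y : Vec dy) : ℝ :=
  √(‖x‖ ^ 2 + ‖y‖ ^ 2)

/-! ### The bilevel problem and its stochastic oracles -/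

/-- The data of a stochastic bilevel problem: the upper-level function `f`, the lower-level
function `g`, and the stochastic oracles.  Samples for `F` live in `Ξ`, samples for `G` in `Z`. -/
structure Problem (dx dy : ℕ) (Ξ Z : Type*) where
  /-- upper-level function `f(x, y)` -/
  f : Vec dx → Vec dy → ℝ
  /-- lower-level function `g(x, y)` -/
  g : Vec dx → Vec dy → ℝ
  /-- oracle `∇ₓF(x, y; ξ)` -/
  Fx : Vec dx → Vec dy → Ξ → Vec dx
  /-- oracle `∇ᵧF(x, y; ξ)` -/
  Fy : Vec dx → Vec dy → Ξ → Vec dy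
  /-- oracle `∇ᵧG(x, y; π)` -/
  Gy : Vec dx → Vec dy → Z → Vec dy
  /-- oracle `∇²ₓᵧG(x, y; ζ)`, mapping `ℝ^dy` to `ℝ^dx` -/
  Gxy : Vec dx → Vec dy → Z → (Vec dy →L[ℝ] Vec dx)
  /-- oracle `∇²ᵧᵧG(x, y; ζ)` -/
  Gyy : Vec dx → Vec dy → Z → (Vec dy →L[ℝ] Vec dy)

/-- Partial gradient in the first variable. -/
def gradX {dx dy : ℕ} (h : Vec dx → Vec dy → ℝ) (x : Vec dx) (y : Vec dy) : Vec dx :=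
  gradient (fun x' => h x' y) x

/-- Partial gradient in the second variable. -/
def gradY {dx dy : ℕ} (h : Vec dx → Vec dy → ℝ) (x : Vec dx) (y : Vec dy) : Vec dy :=
  gradient (fun y' => h x y') y

/-- The mixed second derivative `∇²ₓᵧ h(x, y)`, a `dx × dy` matrix: the Jacobian in `y` of `∇ₓh`. -/
def hessXY {dx dy : ℕ} (h : Vec dx → Vec dy → ℝ) (x : Vec dx) (y : Vec dy) :
    Vec dy →L[ℝ] Vec dx :=
  fderiv ℝ (fun y' => gradX h x y') y

/-- The second derivative `∇²ᵧᵧ h(x, y)`: the Jacobian in `y` of `∇ᵧh`. -/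
def hessYY {dx dy : ℕ} (h : Vec dx → Vec dy → ℝ) (x : Vec dx) (y : Vec dy) :
    Vec dy →L[ℝ] Vec dy :=
  fderiv ℝ (fun y' => gradY h x y') y

namespace Problem

variable {dx dy : ℕ} {Ξ Z : Type*} (P : Problem dx dy Ξ Z)

/-- The lower-level solution `y*(x) = argmin_y g(x, y)`. -/
def yStar (x : Vec dx) : Vec dy :=
  argmin (P.g x)

/-- `z*(x) = argmin_z ½⟨∇²ᵧᵧ g(x, y*(x)) z, z⟩ - ⟨∇ᵧf(x, y*(x)), z⟩`. -/
def zStar (x : Vec dx) : Vec dy :=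
  argmin fun z =>
    (1 / 2) * inner ℝ (hessYY P.g x (P.yStar x) z) z - inner ℝ (gradY P.f x (P.yStar x)) z

/-- The bilevel objective `Φ(x) = f(x, y*(x))`. -/
def Φ (x : Vec dx) : ℝ :=
  P.f x (P.yStar x)

/-- The optimality gap `Φ(x₀) - inf Φ`. -/
def gap (x₀ : Vec dx) : ℝ :=
  P.Φ x₀ - ⨅ x, P.Φ x

end Problem

/-! ### Constants and assumptions -/

/-- The constants of the problem class. -/
structure Consts where
  μ : ℝ
  lg1 : ℝ
  lg2 : ℝ
  lf0 : ℝ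
  Lx0 : ℝ
  Lx1 : ℝ
  Ly0 : ℝ
  Ly1 : ℝ
  σf1 : ℝ
  σg1 : ℝ
  σg2 : ℝ

/-- Signs of the constants. -/
structure Consts.Valid (c : Consts) : Prop where
  μ_pos : 0 < c.μ
  lg1_pos : 0 < c.lg1
  lg2_nonneg : 0 ≤ c.lg2
  lf0_nonneg : 0 ≤ c.lf0
  Lx0_pos : 0 < c.Lx0
  Lx1_pos : 0 < c.Lx1
  Ly0_pos : 0 < c.Ly0
  Ly1_pos : 0 < c.Ly1
  σf1_nonneg : 0 ≤ c.σf1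
  σg1_pos : 0 < c.σg1
  σg2_nonneg : 0 ≤ c.σg2

namespace Consts

variable (c : Consts)

/-- The constant `L₀` of the relaxed smoothness of `Φ`. -/
def L0 : ℝ :=
  √(1 + c.lg1 ^ 2 / c.μ ^ 2) *
    (c.Lx0 + c.Lx1 * (c.lg1 * c.lf0 / c.μ) + c.lg1 / c.μ * (c.Ly0 + c.Ly1 * c.lf0)
      + c.lf0 * ((c.lg1 * c.lg2 + c.lg2 * c.μ) / c.μ ^ 2))

/-- The constant `L₁` of the relaxed smoothness of `Φ`. -/
def L1 : ℝ :=
  √(1 + c.lg1 ^ 2 / c.μ ^ 2) * c.Lx1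

/-- The quantity `√(2 (1 + l_{g,1}² / μ²) (L_{x,1}² + L_{y,1}²))`. -/
def invRadius : ℝ :=
  √(2 * (1 + c.lg1 ^ 2 / c.μ ^ 2) * (c.Lx1 ^ 2 + c.Ly1 ^ 2))

/-- The quantity `σ_{f,1}² + 2 l_{f,0}² σ_{g,2}² / μ²`. -/
def noise : ℝ :=
  c.σf1 ^ 2 + 2 * c.lf0 ^ 2 * c.σg2 ^ 2 / c.μ ^ 2

end Consts

section Assumptions

variable {dx dy : ℕ} {Ξ Z : Type*}

/-- `f` is differentiable and relaxed `(L_{x,0}, L_{x,1}, L_{y,0}, L_{y,1})`-smooth. -/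
structure RelaxedSmooth (c : Consts) (P : Problem dx dy Ξ Z) : Prop where
  differentiable : Differentiable ℝ fun w : Vec dx × Vec dy => P.f w.1 w.2
  smooth_x : ∀ x y x' y', pairNorm (x - x') (y - y') ≤ 1 / √(2 * (c.Lx1 ^ 2 + c.Ly1 ^ 2)) →
    ‖gradX P.f x y - gradX P.f x' y'‖
      ≤ (c.Lx0 + c.Lx1 * ‖gradX P.f x y‖) * pairNorm (x - x') (y - y')
  smooth_y : ∀ x y x' y', pairNorm (x - x') (y - y') ≤ 1 / √(2 * (c.Lx1 ^ 2 + c.Ly1 ^ 2)) →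
    ‖gradY P.f x y - gradY P.f x' y'‖
      ≤ (c.Ly0 + c.Ly1 * ‖gradY P.f x y‖) * pairNorm (x - x') (y - y')

/-- The assumptions on the lower level. -/
structure LowerLevel (c : Consts) (P : Problem dx dy Ξ Z) : Prop where
  bounded : ∀ x, ‖gradY P.f x (P.yStar x)‖ ≤ c.lf0
  strongConvex : ∀ x, StrongConvexOn Set.univ c.μ (P.g x)
  contDiff : ContDiff ℝ 2 fun w : Vec dx × Vec dy => P.g w.1 w.2
  smooth : ∀ x y x' y',
    pairNorm (gradX P.g x y - gradX P.g x' y') (gradY P.g x y - gradY P.g x' y')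
      ≤ c.lg1 * pairNorm (x - x') (y - y')
  hessXY_lipschitz : ∀ x y x' y',
    ‖hessXY P.g x y - hessXY P.g x' y'‖ ≤ c.lg2 * pairNorm (x - x') (y - y')
  hessYY_lipschitz : ∀ x y x' y',
    ‖hessYY P.g x y - hessYY P.g x' y'‖ ≤ c.lg2 * pairNorm (x - x') (y - y')

/-- `X` is an unbiased estimator of `a` under `D`. -/
def Unbiased {S E : Type*} [MeasurableSpace S] [NormedAddCommGroup E] [NormedSpace ℝ E]
    (D : Measure S) (X : S → E) (a : E) : Prop :=
  Integrable X D ∧ ∫ s, X s ∂D = a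

/-- `𝔼‖X - a‖² ≤ σ²` under `D`. -/
def VarianceLE {S E : Type*} [MeasurableSpace S] [NormedAddCommGroup E]
    (D : Measure S) (X : S → E) (a : E) (σ : ℝ) : Prop :=
  Integrable (fun s => ‖X s - a‖ ^ 2) D ∧ ∫ s, ‖X s - a‖ ^ 2 ∂D ≤ σ ^ 2

/-- The assumptions on the stochastic oracles: measurable, unbiased, of bounded variance, with
light-tailed lower-level gradient noise. Matrices carry the operator norm. -/
structure OracleAssumption [MeasurableSpace Ξ] [MeasurableSpace Z] (c : Consts)
    (P : Problem dx dy Ξ Z) (Df : Measure Ξ) (Dg : Measure Z) : Prop where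
  meas_Fx : Measurable fun p : Vec dx × Vec dy × Ξ => P.Fx p.1 p.2.1 p.2.2
  meas_Fy : Measurable fun p : Vec dx × Vec dy × Ξ => P.Fy p.1 p.2.1 p.2.2
  meas_Gy : Measurable fun p : Vec dx × Vec dy × Z => P.Gy p.1 p.2.1 p.2.2
  meas_Gxy : Measurable fun p : Vec dx × Vec dy × Z => P.Gxy p.1 p.2.1 p.2.2
  meas_Gyy : Measurable fun p : Vec dx × Vec dy × Z => P.Gyy p.1 p.2.1 p.2.2
  unbiased_Fx : ∀ x y, Unbiased Df (P.Fx x y) (gradX P.f x y)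
  unbiased_Fy : ∀ x y, Unbiased Df (P.Fy x y) (gradY P.f x y)
  unbiased_Gy : ∀ x y, Unbiased Dg (P.Gy x y) (gradY P.g x y)
  unbiased_Gxy : ∀ x y, Unbiased Dg (P.Gxy x y) (hessXY P.g x y)
  unbiased_Gyy : ∀ x y, Unbiased Dg (P.Gyy x y) (hessYY P.g x y)
  var_Fx : ∀ x y, VarianceLE Df (P.Fx x y) (gradX P.f x y) c.σf1
  var_Fy : ∀ x y, VarianceLE Df (P.Fy x y) (gradY P.f x y) c.σf1
  tail_Gy : ∀ x y, ∀ l : ℝ, 0 < l →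
    Dg.real {s | l ≤ ‖P.Gy x y s - gradY P.g x y‖} ≤ 2 * Real.exp (-2 * l ^ 2 / c.σg1 ^ 2)
  var_Gxy : ∀ x y, VarianceLE Dg (P.Gxy x y) (hessXY P.g x y) c.σg2
  var_Gyy : ∀ x y, VarianceLE Dg (P.Gyy x y) (hessYY P.g x y) c.σg2

end Assumptions

/-! ### The algorithm -/

section Algorithm

variable {dx dy : ℕ} {Ξ Z : Type*}

/-- SGD with distributional drift: after `n` steps, the iterate and the number of oracle calls. -/
def sgdDD (P : Problem dx dy Ξ Z) (xs : ℕ → Vec dx) (y₀ : Vec dy) (a : ℝ) (s : ℕ → Z) :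
    ℕ → Vec dy × ℕ
  | 0 => (y₀, 0)
  | n + 1 =>
    let p := sgdDD P xs y₀ a s n
    (p.1 - a • P.Gy (xs n) p.1 (s n), p.2 + 1)

/-- The state of the algorithm, together with the number of oracle calls made so far. -/
structure State (dx dy : ℕ) where
  x : Vec dx
  y : Vec dy
  z : Vec dy
  m : Vec dx
  calls : ℕ

/-- The step sizes of the main loop. -/
structure StepSizes where
  α : ℝ
  β : ℝ
  γ : ℝ
  η : ℝ

/-- The randomness of the lower level: the samples `π̃_t` of the warm start and the samples `π_t`
of the lower-level updates in the main loop. -/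
abbrev LowerSample (Z : Type*) : Type _ := (ℕ → Z) × (ℕ → Z)

/-- The remaining randomness: in iteration `t` the samples `((ξ_t, ξ'_t), (ζ_t, ζ'_t))`. -/
abbrev UpperSample (Ξ Z : Type*) : Type _ := ℕ → (Ξ × Ξ) × (Z × Z)

/-- All lower-level samples are independent with law `Dg`. -/
def lowerLaw [MeasurableSpace Z] (Dg : Measure Z) [IsProbabilityMeasure Dg] :
    Measure (LowerSample Z) :=
  (Measure.infinitePi fun _ : ℕ => Dg).prod (Measure.infinitePi fun _ : ℕ => Dg)

/-- All `ξ_t, ξ'_t` have law `Df`, all `ζ_t, ζ'_t` have law `Dg`, and all are independent. -/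
def upperLaw [MeasurableSpace Ξ] [MeasurableSpace Z] (Df : Measure Ξ) (Dg : Measure Z)
    [IsProbabilityMeasure Df] [IsProbabilityMeasure Dg] : Measure (UpperSample Ξ Z) :=
  Measure.infinitePi fun _ : ℕ => (Df.prod Df).prod (Dg.prod Dg)

/-- One iteration of the main loop (five oracle calls). If the new momentum vanishes, `x` does
not move. -/
def step (P : Problem dx dy Ξ Z) (h : StepSizes) (s : State dx dy) (p : Z)
    (w : (Ξ × Ξ) × (Z × Z)) : State dx dy :=
  let ξ := w.1.1
  let ξ' := w.1.2
  let ζ := w.2.1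
  let ζ' := w.2.2
  let m' := h.β • s.m + (1 - h.β) • (P.Fx s.x s.y ξ' - P.Gxy s.x s.y ζ' s.z)
  { x := s.x - h.η • (‖m'‖⁻¹ • m')
    y := s.y - h.α • P.Gy s.x s.y p
    z := s.z - h.γ • (P.Gyy s.x s.y ζ s.z - P.Fy s.x s.y ξ)
    m := m'
    calls := s.calls + 5 }

/-- The iterates of the main loop. -/
def mainLoop (P : Problem dx dy Ξ Z) (h : StepSizes) (s₀ : State dx dy) (p : ℕ → Z)
    (w : UpperSample Ξ Z) : ℕ → State dx dy
  | 0 => s₀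
  | t + 1 => step P h (mainLoop P h s₀ p w t) (p t) (w t)

end Algorithm

/-! ### The choice of the parameters -/

section Parameters

/-- `min {m, a / b}`, where `a / 0 = +∞`. -/
def capRatio (m a b : ℝ) : ℝ :=
  if b = 0 then m else min m (a / b)

/-- The quantities `Δ₀`, `Δ_{y,0}`, `Δ_{z,0}` and `‖∇Φ(x₀)‖` at the start of the main loop. -/
structure InitData where
  Δ : ℝ
  Δy : ℝ
  Δz : ℝ
  Γ : ℝ

/-- Warm-start step size. -/
def alphaInit (c : Consts) (δ : ℝ) : ℝ :=
  min (1 / (2 * c.lg1))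
    (c.μ / (2048 * c.L1 ^ 2 * c.σg1 ^ 2 * Real.log (Real.exp 1 / δ)))

/-- Number of warm-start steps, where `r = ‖y₀^init - y*(x₀)‖`. -/
def warmSteps (c : Consts) (δ r : ℝ) : ℕ :=
  ⌈Real.log (256 * c.L1 ^ 2 * r ^ 2) / Real.log (2 / (2 - c.μ * alphaInit c δ))⌉₊

variable (c : Consts) (d : InitData) (δ ε : ℝ)

/-- The quantity `e l_{g,1} Δ₀ L₀ / (μ δ)`. -/
def baseQ : ℝ :=
  Real.exp 1 * c.lg1 * d.Δ * c.L0 / (c.μ * δ)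

/-- The quantity `e l_{g,1} Δ₀ L₀³ σ_{g,1}² / (μ³ δ)`. -/
def baseR : ℝ :=
  Real.exp 1 * c.lg1 * d.Δ * c.L0 ^ 3 * c.σg1 ^ 2 / (c.μ ^ 3 * δ)

def expo1 : ℝ := Real.exp (c.μ / (2 * c.lg1))

def expo2 : ℝ := Real.exp (c.μ * c.lg1 * d.Δz ^ 2 / (2 * d.Δ * c.L0))

def expo3 : ℝ := Real.exp (c.μ * d.Δy ^ 2 * c.L0 / (2 * c.lg1 * d.Δ))

/-- The smallness condition on `ε`. -/
structure EpsSmall : Prop where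
  h1 : ε ≤ c.L0 / c.L1
  h2 : ε ≤ d.Δy * c.L0
  h3 : ε ≤ 8 * c.lg1 * c.L0 / (c.μ * c.invRadius)
  h4 : ε ≤ √(16 * baseQ c d δ)
  h5 : ε ≤ 4 * baseR c d δ ^ (1 / 4 : ℝ)
  h6 : ε ≤ √(32 * baseQ c d δ / expo1 c)
  h7 : ε ≤ √(32 * baseQ c d δ / expo2 c d)
  h8 : ε ≤ √(32 * baseQ c d δ / expo3 c d)
  h9 : ε * d.Γ ≤ d.Δ * c.L0
  h10 : ε * c.σg2 ≤ c.L0 * c.σg1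
  h11 : ε ≤ c.L0 * c.σg1 / √(c.μ * c.lg1)
  h12 : ε ≤ (2 ^ 21 * baseR c d δ) ^ (1 / 4 : ℝ) *
    Real.exp (-(c.lg1 * √c.noise) / (512 * c.L0 * c.σg1))

def paramB : ℝ :=
  (2 ^ 21 * baseR c d δ / ε ^ 4) ^ 4

/-- The value of `1 - β`. -/
def oneSubBeta : ℝ :=
  let m₁ := min 1 (c.μ / (16 * c.lg1))
  let m₂ := min m₁ (16 * baseQ c d δ / ε ^ 2)
  let m₃ := min m₂ (c.μ ^ 2 * ε ^ 2 /
    (64 * 1024 * c.L0 ^ 2 * c.σg1 ^ 2 * Real.log (paramB c d δ ε) ^ 2))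
  let m₄ := capRatio m₃ (min 1 (c.μ ^ 2 / (32 * c.lg1 ^ 2)) * ε ^ 2) c.noise
  let m₅ := capRatio m₄ (c.lg1 ^ 2) (8 * c.σg2 ^ 2)
  let m₆ := capRatio m₅ (c.μ ^ 2) (16 * c.σg2 ^ 2)
  let m₇ := min m₆ (32 * baseQ c d δ / (ε ^ 2 * expo1 c))
  let m₈ := min m₇ (32 * baseQ c d δ / (ε ^ 2 * expo2 c d))
  min m₈ (32 * baseQ c d δ / (ε ^ 2 * expo3 c d))

def paramA : ℝ :=
  (32 * baseQ c d δ / (ε ^ 2 * oneSubBeta c d δ ε)) ^ 2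

/-- The upper-level step size. -/
def eta : ℝ :=
  let n₁ := min (1 / c.L1) (ε / c.L0)
  let n₂ := capRatio n₁ (ε * d.Δ) (d.Δy ^ 2 * c.L0 ^ 2)
  let n₃ := capRatio n₂ d.Δ d.Γ
  let n₄ := capRatio n₃ (ε * d.Δ) (c.lg1 ^ 2 * d.Δz ^ 2)
  let n₅ := min n₄ (c.μ * ε / (c.lg1 * c.L0 * Real.log (paramA c d δ ε)))
  min (1 / 8 * n₅ * oneSubBeta c d δ ε) (1 / c.invRadius)

def stepSizes : StepSizes where
  α := 8 * (oneSubBeta c d δ ε / c.μ)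
  β := 1 - oneSubBeta c d δ ε
  γ := oneSubBeta c d δ ε / c.μ
  η := eta c d δ ε

/-- The number `T = 4 Δ₀ / (η ε)` of iterations of the main loop, rounded up. -/
def horizon : ℕ :=
  ⌈4 * d.Δ / (eta c d δ ε * ε)⌉₊

end Parameters

/-! ### The complete run -/

section Run

variable {dx dy : ℕ} {Ξ Z : Type*} (c : Consts) (P : Problem dx dy Ξ Z) (δ ε : ℝ)
  (x₀ : Vec dx) (yInit z₀ : Vec dy) (ωL : LowerSample Z)

/-- Output `y₀` of the warm start, with its number of oracle calls. -/
def warmStart : Vec dy × ℕ :=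
  sgdDD P (fun _ => x₀) yInit (alphaInit c δ) ωL.1 (warmSteps c δ ‖yInit - P.yStar x₀‖)

/-- The initial quantities, where `y₀` is the output of the warm start. -/
def initData : InitData where
  Δ := P.gap x₀
  Δy := ‖(warmStart c P δ x₀ yInit ωL).1 - P.yStar x₀‖
  Δz := ‖z₀ - P.zStar x₀‖
  Γ := ‖gradient P.Φ x₀‖

/-- The state of the algorithm after `t` iterations of the main loop. -/
def run (ωU : UpperSample Ξ Z) (t : ℕ) : State dx dy :=
  mainLoop P (stepSizes c (initData c P δ x₀ yInit z₀ ωL) δ ε)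
    { x := x₀
      y := (warmStart c P δ x₀ yInit ωL).1
      z := z₀
      m := 0
      calls := (warmStart c P δ x₀ yInit ωL).2 } ωL.2 ωU t

/-- The number of iterations of the main loop. -/
def iterations : ℕ :=
  horizon c (initData c P δ x₀ yInit z₀ ωL) δ ε

/-- The smallness condition on `ε`, at the output of the warm start. -/
def Admissible : Prop :=
  EpsSmall c (initData c P δ x₀ yInit z₀ ωL) δ ε

end Run

end SLIP

end

open SLIP MeasureTheory

/-! Write q = 1 - β and d = ‖y_t - y*(x_t)‖. Implicit differentiation gives ∇Φ = ∇ₓf - ∇²ₓᵧg z* at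
(x, y*(x)), and Φ inherits a relaxed smoothness with the constants L₀, L₁
(`norm_gradient_Φ_sub_le`). Because f is relaxed smooth only locally, the lower-level error biases
the stochastic hypergradient by (L₀ + L₁‖∇Φ‖) d e^{ad} (`gradBias_le`). Second moments of d are
therefore not enough; exponential moments of d² are needed.

Two averages are played against each other. Freeze the lower-level samples and average over the
upper-level ones: the momentum error plus a multiple of the squared error of z contracts at rate
0.69 q up to a driving term in d (`exists_momErr_majorant`), and the gap of Φ plus 3η/q times this
error is a Lyapunov function. Summing gives, for every lower-level path, A ≤ 10 ε T + 80 W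
(`sum_upperMean_gradSize_le`). Here A is the sum of the means of ε + ‖∇Φ(x_t)‖, and W collects
exponential moments of d² above a decaying level, weighted by ε + ‖∇Φ(x_t)‖ and divided by B. Now
freeze the upper-level samples and average over the lower-level ones. Normalized steps change the
weight by a factor within 1 ± q/200 whatever the noise, so the weighted moment stays below twice the
mean weight (`lintegral_weightedMoment_le`). By Tonelli the mean of W is at most 2/B times the mean
of A. The inequality closes on itself, the mean of A is at most 20 ε T, and Markov's inequality
makes W small with probability 1 - δ (`measure_weightedMoment_le`). No union bound over time is
needed.

The initial error Θ = L₀ d₀/ε may be large. Its effect is at most e^{14.1 Θ} and is contracted away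
in about 28 Θ/q steps. During these steps the gradient stays controlled because the warm start
achieves L₁ d₀ ≤ 1/5 with probability 1 - δ (`measure_warmStart_le`); this is the other δ. The
numerical margins require Δ₀ L₀/ε² ≥ 1/2. In the opposite case the whole trajectory is so short that
the gradient stays of order ε on every path (`sum_norm_gradient_mainLoop_le`).

For the complexity, admissibility makes the entry with σ_{g,1} the smallest one in 1 - β
(`oneSubBeta_eq`) and bounds η from below by its entry with log A (`le_eta`). Hence T is of order
ε⁻⁴ times three logarithms. -/

namespace SLIP

/-! ### Relaxed Lipschitz bounds, positive operators and strong convexity -/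

section General

open Set Filter Topology

variable {E F : Type*} [NormedAddCommGroup E] [NormedSpace ℝ E]
  [NormedAddCommGroup F] [InnerProductSpace ℝ F]

/-- A local relaxed Lipschitz bound propagates to all distances with an exponential factor. -/
lemma norm_sub_le_of_local {V : Type*} [NormedAddCommGroup V] {G : E → V} {A B R : ℝ}
    (hA : 0 ≤ A) (hB : 0 ≤ B) (hR : 0 < R)
    (h : ∀ u v, ‖u - v‖ ≤ R → ‖G u - G v‖ ≤ (A + B * ‖G u‖) * ‖u - v‖) (u v : E) :
    ‖G u - G v‖ ≤ (A + B * ‖G u‖) * (‖u - v‖ * Real.exp (B * ‖u - v‖)) := by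
  -- The summand 1 keeps n positive when u = v.
  obtain ⟨n, hn⟩ := exists_nat_ge (‖u - v‖ / R + 1)
  have hn0 : (0 : ℝ) < n := lt_of_lt_of_le (by positivity) hn
  set e : ℝ := ‖u - v‖ / n with he
  have he0 : 0 ≤ e := by positivity
  have heR : e ≤ R := by
    rw [he, div_le_iff₀ hn0]
    have : ‖u - v‖ / R ≤ n := by linarith
    rwa [div_le_iff₀ hR, mul_comm] at this
  set p : ℕ → E := fun k => u + ((k : ℝ) / n) • (v - u) with hp
  have hstep : ∀ k, ‖p k - p (k + 1)‖ = e := by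
    intro k
    have : p k - p (k + 1) = (1 / (n : ℝ)) • (u - v) := by
      simp only [hp]; push_cast
      rw [add_sub_add_left_eq_sub, ← sub_smul, ← neg_sub u v, smul_neg, ← neg_smul]
      congr 1; field_simp; ring
    rw [this, norm_smul, he, Real.norm_of_nonneg (by positivity)]; ring
  set K := A + B * ‖G u‖ with hK
  have hK0 : 0 ≤ K := by positivity
  -- Along n equal pieces of length e ≤ R the quantity A + B‖G‖ grows at most by the factor 1 + B e
  -- per piece. Since (1 + B e)^n ≤ exp(B‖u - v‖), the final bound does not see the mesh.
  have key : ∀ k : ℕ, A + B * ‖G (p k)‖ ≤ K * (1 + B * e) ^ k ∧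
      ‖G u - G (p k)‖ ≤ K * (k * e * (1 + B * e) ^ k) := by
    intro k
    induction k with
    | zero => simp [hp, hK]
    | succ k ih =>
      have h1 := h (p k) (p (k + 1)) (by rw [hstep]; exact heR)
      rw [hstep] at h1
      have h2 : ‖G (p (k + 1))‖ ≤ ‖G (p k)‖ + ‖G (p k) - G (p (k + 1))‖ := by
        have := norm_sub_norm_le (G (p (k + 1))) (G (p k))
        rw [norm_sub_rev] at this; linarith
      have hp1 : (1 : ℝ) ≤ 1 + B * e := by nlinarith [mul_nonneg hB he0]
      have h3 : (A + B * ‖G (p k)‖) * e ≤ K * (1 + B * e) ^ k * e :=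
        mul_le_mul_of_nonneg_right ih.1 he0
      constructor
      · have : B * ‖G (p (k + 1))‖ ≤ B * ‖G (p k)‖ + B * ((A + B * ‖G (p k)‖) * e) := by
          rw [← mul_add]; exact mul_le_mul_of_nonneg_left (by linarith) hB
        calc A + B * ‖G (p (k + 1))‖ ≤ (A + B * ‖G (p k)‖) * (1 + B * e) := by linarith
          _ ≤ K * (1 + B * e) ^ k * (1 + B * e) :=
            mul_le_mul_of_nonneg_right ih.1 (by linarith)
          _ = _ := by ring
      · have h4 : ‖G u - G (p (k + 1))‖ ≤ ‖G u - G (p k)‖ + ‖G (p k) - G (p (k + 1))‖ :=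
          norm_sub_le_norm_sub_add_norm_sub _ _ _
        have h5 : (1 + B * e) ^ k ≤ (1 + B * e) ^ (k + 1) := pow_le_pow_right₀ hp1 (by simp)
        calc _ ≤ K * (k * e * (1 + B * e) ^ k) + K * (1 + B * e) ^ k * e := by linarith [ih.2]
          _ = K * ((k + 1) * e * (1 + B * e) ^ k) := by ring
          _ ≤ K * ((k + 1) * e * (1 + B * e) ^ (k + 1)) := by gcongr
          _ = _ := by push_cast; ring
  have hpn : p n = v := by simp [hp, hn0.ne']
  have h6 := (key n).2
  rw [hpn] at h6
  have hne : (n : ℝ) * e = ‖u - v‖ := by rw [he]; field_simp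
  have h7 : (1 + B * e) ^ n ≤ Real.exp (B * ‖u - v‖) := by
    calc (1 + B * e) ^ n ≤ Real.exp (B * e) ^ n := by
          gcongr; linarith [Real.add_one_le_exp (B * e)]
      _ = Real.exp (B * ‖u - v‖) := by rw [← Real.exp_nat_mul, ← hne]; ring_nf
  refine h6.trans ?_
  rw [hne]; gcongr

/-- Positivity tested at u - H u / c, together with the upper bound tested at H u, gives ‖H u‖² ≤ c
⟪H u, u⟫. No spectral theory is involved. -/
lemma norm_map_le_of_psd {H : F →L[ℝ] F} {c : ℝ}
    (hsym : ∀ u v, inner ℝ (H u) v = inner ℝ u (H v)) (h0 : ∀ u, 0 ≤ inner ℝ (H u) u)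
    (hc : 0 < c) (hub : ∀ u, inner ℝ (H u) u ≤ c * ‖u‖ ^ 2) (u : F) :
    ‖H u‖ ≤ c * ‖u‖ := by
  have h1 := h0 (u - (1 / c) • H u)
  have h2 : inner ℝ (H (u - (1 / c) • H u)) (u - (1 / c) • H u)
      = inner ℝ (H u) u - 2 * (1 / c) * ‖H u‖ ^ 2
        + (1 / c) ^ 2 * inner ℝ (H (H u)) (H u) := by
    have : inner ℝ (H (H u)) u = ‖H u‖ ^ 2 := by rw [hsym, real_inner_self_eq_norm_sq]
    simp only [map_sub, map_smul, inner_sub_left, inner_sub_right, inner_smul_left,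
      inner_smul_right, this, real_inner_self_eq_norm_sq]
    simp; ring
  rw [h2] at h1
  have h3 := hub (H u)
  have h4 := hub u
  have h5 : (1 / c) ^ 2 * inner ℝ (H (H u)) (H u) ≤ 1 / c * ‖H u‖ ^ 2 := by
    calc _ ≤ (1 / c) ^ 2 * (c * ‖H u‖ ^ 2) := by gcongr
      _ = _ := by field_simp
  have h6 : 1 / c * ‖H u‖ ^ 2 ≤ c * ‖u‖ ^ 2 := by linarith
  have h7 : ‖H u‖ ^ 2 ≤ (c * ‖u‖) ^ 2 := by
    have : ‖H u‖ ^ 2 ≤ c * (c * ‖u‖ ^ 2) := by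
      rw [one_div, inv_mul_le_iff₀ hc] at h6; exact h6
    nlinarith
  exact (sq_le_sq₀ (norm_nonneg _) (by positivity)).1 h7

/-- Divide the strong convexity inequality on the segment from x to y by t and let t tend to 0 from
the right. -/
lemma StrongConvexOn.add_inner_le [CompleteSpace F] {f : F → ℝ} {μ : ℝ} (hf : StrongConvexOn univ μ f) {x g : F}
    (hx : HasGradientAt f g x) (y : F) :
    f x + inner ℝ g (y - x) + μ / 2 * ‖y - x‖ ^ 2 ≤ f y := by
  have hd : HasDerivAt (fun t : ℝ => f (x + t • (y - x))) (inner ℝ g (y - x)) 0 := by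
    have h1 : HasDerivAt (fun t : ℝ => x + t • (y - x)) (y - x) 0 := by
      simpa using ((hasDerivAt_id (0 : ℝ)).smul_const (y - x)).const_add x
    have h2 : HasFDerivAt f (InnerProductSpace.toDual ℝ F g) (x + (0 : ℝ) • (y - x)) := by
      simpa using hx.hasFDerivAt
    have h3 := h2.comp_hasDerivAt (0 : ℝ) h1
    rw [InnerProductSpace.toDual_apply_apply] at h3
    exact h3
  have ht := hd.tendsto_slope_zero_right
  have hlim : Tendsto (fun t : ℝ => f y - f x - (1 - t) * (μ / 2 * ‖y - x‖ ^ 2)) (𝓝[>] 0)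
      (𝓝 (f y - f x - (1 - 0) * (μ / 2 * ‖y - x‖ ^ 2))) := by
    apply Tendsto.mono_left _ nhdsWithin_le_nhds
    exact Continuous.tendsto (by fun_prop) 0
  have := le_of_tendsto_of_tendsto ht hlim (by
    filter_upwards [Ioo_mem_nhdsGT (show (0 : ℝ) < 1 by norm_num)] with t ht
    have hc := hf.2 (mem_univ x) (mem_univ y) (show (0 : ℝ) ≤ 1 - t by linarith [ht.2])
      ht.1.le (by ring)
    have e1 : (1 - t) • x + t • y = x + t • (y - x) := by
      rw [sub_smul, one_smul, smul_sub]; abel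
    rw [e1] at hc
    simp only [smul_eq_mul, zero_add, zero_smul, add_zero] at hc ⊢
    rw [inv_mul_le_iff₀ ht.1]
    rw [norm_sub_rev] at hc
    nlinarith)
  linarith

lemma StrongConvexOn.inner_gradient_sub [CompleteSpace F] {f : F → ℝ} {μ : ℝ} (hf : StrongConvexOn univ μ f)
    {x y g g' : F} (hx : HasGradientAt f g x) (hy : HasGradientAt f g' y) :
    μ * ‖y - x‖ ^ 2 ≤ inner ℝ (g' - g) (y - x) := by
  have h1 := StrongConvexOn.add_inner_le hf hx y
  have h2 := StrongConvexOn.add_inner_le hf hy x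
  have h3 : inner ℝ g' (x - y) = - inner ℝ g' (y - x) := by rw [← inner_neg_right, neg_sub]
  rw [h3, norm_sub_rev x y] at h2
  rw [inner_sub_left]
  linarith

/-- The first-order inequality at the origin gives quadratic growth, hence coercivity. -/
lemma StrongConvexOn.exists_isMin [CompleteSpace F] [FiniteDimensional ℝ F] {f : F → ℝ} {μ : ℝ}
    (hf : StrongConvexOn univ μ f) (hμ : 0 < μ) (hd : Differentiable ℝ f) :
    ∃ y, ∀ y', f y ≤ f y' := by
  have : Tendsto f (cocompact F) atTop := by
    have hg := (hd 0).hasGradientAt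
    set g := gradient f 0
    have hb : ∀ y, f 0 - ‖g‖ * ‖y‖ + μ / 2 * ‖y‖ ^ 2 ≤ f y := by
      intro y
      have h1 := StrongConvexOn.add_inner_le hf hg y
      have h2 := abs_real_inner_le_norm g y
      rw [sub_zero] at h1
      linarith [neg_abs_le (inner ℝ g y)]
    refine tendsto_atTop_mono hb ?_
    have hq : Tendsto (fun r : ℝ => f 0 + r * (μ / 2 * r - ‖g‖)) atTop atTop := by
      refine tendsto_atTop_add_const_left _ _ (tendsto_id.atTop_mul_atTop₀ ?_)
      exact tendsto_atTop_add_const_right _ _ (tendsto_id.const_mul_atTop (by positivity))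
    refine (hq.comp (tendsto_norm_cocompact_atTop (E := F))).congr fun y => ?_
    simp only [Function.comp]; ring
  exact hd.continuous.exists_forall_le this

/-- Difference quotient of t ↦ ⟪G (x + t u), u⟫. Applied to a gradient it turns strong monotonicity
into a lower bound for the Hessian. -/
lemma le_inner_fderiv_of_strongly_monotone {G : F → F} {H : F →L[ℝ] F} {x : F} {μ : ℝ}
    (hG : HasFDerivAt G H x) (hmono : ∀ y, μ * ‖y - x‖ ^ 2 ≤ inner ℝ (G y - G x) (y - x)) (u : F) :
    μ * ‖u‖ ^ 2 ≤ inner ℝ (H u) u := by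
  have hd : HasDerivAt (fun t : ℝ => inner ℝ (G (x + t • u)) u) (inner ℝ (H u) u) 0 := by
    have h1 : HasDerivAt (fun t : ℝ => x + t • u) u 0 := by
      simpa using ((hasDerivAt_id (0 : ℝ)).smul_const u).const_add x
    have h2 : HasFDerivAt G H (x + (0 : ℝ) • u) := by simpa using hG
    have h3 := (h2.comp_hasDerivAt (0 : ℝ) h1).inner ℝ (hasDerivAt_const (0 : ℝ) u)
    simpa using h3
  refine ge_of_tendsto hd.tendsto_slope_zero_right ?_
  filter_upwards [self_mem_nhdsWithin] with t ht
  have ht : 0 < t := ht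
  have h1 := hmono (x + t • u)
  rw [add_sub_cancel_left, norm_smul, inner_smul_right, inner_sub_left, Real.norm_of_nonneg ht.le,
    mul_pow] at h1
  simp only [zero_add, zero_smul, add_zero, smul_eq_mul]
  rw [le_inv_mul_iff₀ ht]
  have : t * (t * (μ * ‖u‖ ^ 2)) ≤ t * (inner ℝ (G (x + t • u)) u - inner ℝ (G x) u) := by
    nlinarith
  exact le_of_mul_le_mul_left this ht

lemma argmin_spec {E : Type*} [Nonempty E] {h : E → ℝ} (hex : ∃ y, ∀ y', h y ≤ h y') (y' : E) :
    h (argmin h) ≤ h y' :=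
  Classical.epsilon_spec (p := fun y => ∀ y', h y ≤ h y') hex y'

end General

/-! ### Partial gradients and Hessian blocks of a function of two variables -/

section Geometry

open Set Filter Topology

variable {dx dy : ℕ}

lemma pairNorm_zero_left (y : Vec dy) : pairNorm (0 : Vec dx) y = ‖y‖ := by simp [pairNorm]

lemma pairNorm_zero_right (x : Vec dx) : pairNorm x (0 : Vec dy) = ‖x‖ := by simp [pairNorm]

lemma norm_le_pairNorm_left (x : Vec dx) (y : Vec dy) : ‖x‖ ≤ pairNorm x y :=
  Real.le_sqrt_of_sq_le (by nlinarith [sq_nonneg ‖y‖])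

lemma norm_le_pairNorm_right (x : Vec dx) (y : Vec dy) : ‖y‖ ≤ pairNorm x y :=
  Real.le_sqrt_of_sq_le (by nlinarith [sq_nonneg ‖x‖])

/-- The Riesz isomorphism as a linear map. -/
noncomputable def riesz (d : ℕ) : (Vec d →L[ℝ] ℝ) →L[ℝ] Vec d :=
  LinearMap.toContinuousLinearMap
    { toFun := fun l => (InnerProductSpace.toDual ℝ (Vec d)).symm l
      map_add' := fun a b => map_add _ a b
      map_smul' := fun a b => by simp }

lemma riesz_apply {d : ℕ} (l : Vec d →L[ℝ] ℝ) :
    riesz d l = (InnerProductSpace.toDual ℝ (Vec d)).symm l := rfl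

lemma inner_riesz {d : ℕ} (l : Vec d →L[ℝ] ℝ) (u : Vec d) : inner ℝ (riesz d l) u = l u := by
  rw [riesz_apply, InnerProductSpace.toDual_symm_apply]

variable {h : Vec dx → Vec dy → ℝ}

lemma hasGradientAt_gradY (hd : Differentiable ℝ fun w : Vec dx × Vec dy => h w.1 w.2)
    (x : Vec dx) (y : Vec dy) : HasGradientAt (h x) (gradY h x y) y := by
  have : DifferentiableAt ℝ (fun y' => h x y') y :=
    (hd (x, y)).comp y (f := fun y' => (x, y')) (by fun_prop)
  exact this.hasGradientAt

lemma gradY_eq (hd : Differentiable ℝ fun w : Vec dx × Vec dy => h w.1 w.2)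
    (x : Vec dx) (y : Vec dy) : gradY h x y =
      riesz dy ((fderiv ℝ (fun w : Vec dx × Vec dy => h w.1 w.2) (x, y)).comp
        (ContinuousLinearMap.inr ℝ (Vec dx) (Vec dy))) := by
  have h1 : HasFDerivAt (fun y' => h x y')
      ((fderiv ℝ (fun w : Vec dx × Vec dy => h w.1 w.2) (x, y)).comp
        (ContinuousLinearMap.inr ℝ (Vec dx) (Vec dy))) y :=
    (hd (x, y)).hasFDerivAt.comp y (f := fun y' => (x, y')) (hasFDerivAt_prodMk_right x y)
  rw [gradY, gradient, h1.fderiv, riesz_apply]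

lemma gradX_eq (hd : Differentiable ℝ fun w : Vec dx × Vec dy => h w.1 w.2)
    (x : Vec dx) (y : Vec dy) : gradX h x y =
      riesz dx ((fderiv ℝ (fun w : Vec dx × Vec dy => h w.1 w.2) (x, y)).comp
        (ContinuousLinearMap.inl ℝ (Vec dx) (Vec dy))) := by
  have h1 : HasFDerivAt (fun x' => h x' y)
      ((fderiv ℝ (fun w : Vec dx × Vec dy => h w.1 w.2) (x, y)).comp
        (ContinuousLinearMap.inl ℝ (Vec dx) (Vec dy))) x :=
    (hd (x, y)).hasFDerivAt.comp x (f := fun x' => (x', y)) (hasFDerivAt_prodMk_left x y)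
  rw [gradX, gradient, h1.fderiv, riesz_apply]

/-- The second derivative of a function of two variables. -/
noncomputable def secondDeriv (h : Vec dx → Vec dy → ℝ) (x : Vec dx) (y : Vec dy) :
    Vec dx × Vec dy →L[ℝ] Vec dx × Vec dy →L[ℝ] ℝ :=
  fderiv ℝ (fderiv ℝ fun w : Vec dx × Vec dy => h w.1 w.2) (x, y)

lemma secondDeriv_comm (hc : ContDiff ℝ 2 fun w : Vec dx × Vec dy => h w.1 w.2)
    (x : Vec dx) (y : Vec dy) (v w : Vec dx × Vec dy) :
    secondDeriv h x y v w = secondDeriv h x y w v :=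
  (hc.contDiffAt.isSymmSndFDerivAt (by simp)) v w

/-- Both partial gradients are linear images of the full derivative, so their joint derivatives are
blocks of one second derivative. Its symmetry later identifies the x-derivative of ∇ᵧg with the
transpose of `hessXY`. -/
lemma hasFDerivAt_gradY (hc : ContDiff ℝ 2 fun w : Vec dx × Vec dy => h w.1 w.2)
    (x : Vec dx) (y : Vec dy) :
    ∃ J : Vec dx × Vec dy →L[ℝ] Vec dy,
      HasFDerivAt (fun w : Vec dx × Vec dy => gradY h w.1 w.2) J (x, y) ∧
      ∀ v u, inner ℝ (J v) u = secondDeriv h x y v (0, u) := by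
  have hd : Differentiable ℝ fun w : Vec dx × Vec dy => h w.1 w.2 :=
    hc.differentiable (by norm_num)
  have h1 : HasFDerivAt (fderiv ℝ fun w : Vec dx × Vec dy => h w.1 w.2)
      (secondDeriv h x y) (x, y) :=
    ((hc.fderiv_right (m := 1) (by norm_num)).differentiable (by norm_num) (x, y)).hasFDerivAt
  let K : (Vec dx × Vec dy →L[ℝ] ℝ) →L[ℝ] Vec dy :=
    (riesz dy).comp ((ContinuousLinearMap.compL ℝ (Vec dy) (Vec dx × Vec dy) ℝ).flip
      (ContinuousLinearMap.inr ℝ (Vec dx) (Vec dy)))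
  refine ⟨K.comp (secondDeriv h x y), ?_, fun v u => ?_⟩
  · have h2 := K.hasFDerivAt.comp (x, y) h1
    have h3 : (fun w : Vec dx × Vec dy => gradY h w.1 w.2) =
        K ∘ fderiv ℝ fun w : Vec dx × Vec dy => h w.1 w.2 := by
      funext w
      exact gradY_eq hd w.1 w.2
    rw [h3]
    exact h2
  · simp [K, inner_riesz]

lemma hasFDerivAt_gradX (hc : ContDiff ℝ 2 fun w : Vec dx × Vec dy => h w.1 w.2)
    (x : Vec dx) (y : Vec dy) :
    ∃ J : Vec dx × Vec dy →L[ℝ] Vec dx,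
      HasFDerivAt (fun w : Vec dx × Vec dy => gradX h w.1 w.2) J (x, y) ∧
      ∀ v u, inner ℝ (J v) u = secondDeriv h x y v (u, 0) := by
  have hd : Differentiable ℝ fun w : Vec dx × Vec dy => h w.1 w.2 :=
    hc.differentiable (by norm_num)
  have h1 : HasFDerivAt (fderiv ℝ fun w : Vec dx × Vec dy => h w.1 w.2)
      (secondDeriv h x y) (x, y) :=
    ((hc.fderiv_right (m := 1) (by norm_num)).differentiable (by norm_num) (x, y)).hasFDerivAt
  let K : (Vec dx × Vec dy →L[ℝ] ℝ) →L[ℝ] Vec dx :=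
    (riesz dx).comp ((ContinuousLinearMap.compL ℝ (Vec dx) (Vec dx × Vec dy) ℝ).flip
      (ContinuousLinearMap.inl ℝ (Vec dx) (Vec dy)))
  refine ⟨K.comp (secondDeriv h x y), ?_, fun v u => ?_⟩
  · have h2 := K.hasFDerivAt.comp (x, y) h1
    have h3 : (fun w : Vec dx × Vec dy => gradX h w.1 w.2) =
        K ∘ fderiv ℝ fun w : Vec dx × Vec dy => h w.1 w.2 := by
      funext w
      exact gradX_eq hd w.1 w.2
    rw [h3]
    exact h2
  · simp [K, inner_riesz]

lemma hasFDerivAt_hessYY (hc : ContDiff ℝ 2 fun w : Vec dx × Vec dy => h w.1 w.2)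
    (x : Vec dx) (y : Vec dy) :
    HasFDerivAt (fun y' => gradY h x y') (hessYY h x y) y ∧
      ∀ v u, inner ℝ (hessYY h x y v) u = secondDeriv h x y (0, v) (0, u) := by
  obtain ⟨J, hJ, hJ'⟩ := hasFDerivAt_gradY hc x y
  have h1 : HasFDerivAt (fun y' => gradY h x y')
      (J.comp (ContinuousLinearMap.inr ℝ (Vec dx) (Vec dy))) y :=
    hJ.comp y (f := fun y' => (x, y')) (hasFDerivAt_prodMk_right x y)
  have h2 : hessYY h x y = J.comp (ContinuousLinearMap.inr ℝ (Vec dx) (Vec dy)) := h1.fderiv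
  rw [h2]
  exact ⟨h1, fun v u => by simp [hJ']⟩

lemma hasFDerivAt_hessXY (hc : ContDiff ℝ 2 fun w : Vec dx × Vec dy => h w.1 w.2)
    (x : Vec dx) (y : Vec dy) :
    HasFDerivAt (fun y' => gradX h x y') (hessXY h x y) y ∧
      ∀ v u, inner ℝ (hessXY h x y v) u = secondDeriv h x y (0, v) (u, 0) := by
  obtain ⟨J, hJ, hJ'⟩ := hasFDerivAt_gradX hc x y
  have h1 : HasFDerivAt (fun y' => gradX h x y')
      (J.comp (ContinuousLinearMap.inr ℝ (Vec dx) (Vec dy))) y :=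
    hJ.comp y (f := fun y' => (x, y')) (hasFDerivAt_prodMk_right x y)
  have h2 : hessXY h x y = J.comp (ContinuousLinearMap.inr ℝ (Vec dx) (Vec dy)) := h1.fderiv
  rw [h2]
  exact ⟨h1, fun v u => by simp [hJ']⟩

end Geometry

/-! ### The lower-level solution, the auxiliary solution and the hypergradient formula -/

section LowerLevelFacts

open Set Filter Topology

variable {dx dy : ℕ} {Ξ Z : Type*} {c : Consts} {P : Problem dx dy Ξ Z}

namespace LowerLevel

variable (hc : c.Valid) (hl : LowerLevel c P)

include hl in
lemma differentiable_g : Differentiable ℝ fun w : Vec dx × Vec dy => P.g w.1 w.2 :=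
  hl.contDiff.differentiable (by norm_num)

include hl in
lemma hasGradientAt_g (x : Vec dx) (y : Vec dy) : HasGradientAt (P.g x) (gradY P.g x y) y :=
  hasGradientAt_gradY hl.differentiable_g x y

include hc hl

lemma yStar_isMin (x : Vec dx) (y : Vec dy) : P.g x (P.yStar x) ≤ P.g x y :=
  argmin_spec (StrongConvexOn.exists_isMin (hl.strongConvex x) hc.μ_pos
    fun y => (hl.hasGradientAt_g x y).differentiableAt) y

lemma gradY_yStar (x : Vec dx) : gradY P.g x (P.yStar x) = 0 := by
  have h1 : IsLocalMin (P.g x) (P.yStar x) :=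
    Filter.Eventually.of_forall fun y => hl.yStar_isMin hc x y
  have h2 := h1.hasFDerivAt_eq_zero (hl.hasGradientAt_g x (P.yStar x)).hasFDerivAt
  simpa using h2

omit hc in
lemma inner_gradY_sub (x : Vec dx) (y y' : Vec dy) :
    c.μ * ‖y' - y‖ ^ 2 ≤ inner ℝ (gradY P.g x y' - gradY P.g x y) (y' - y) :=
  StrongConvexOn.inner_gradient_sub (hl.strongConvex x) (hl.hasGradientAt_g x y)
    (hl.hasGradientAt_g x y')

omit hc in
lemma norm_gradY_sub_le (x x' : Vec dx) (y y' : Vec dy) :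
    ‖gradY P.g x y - gradY P.g x' y'‖ ≤ c.lg1 * pairNorm (x - x') (y - y') :=
  (norm_le_pairNorm_right _ _).trans (hl.smooth x y x' y')

/-- Strong monotonicity of ∇ᵧg(x, ·) between the two solutions, against the Lipschitz dependence of
∇ᵧg on x at y*(x'), where ∇ᵧg(x', ·) vanishes. -/
lemma yStar_lipschitz (x x' : Vec dx) :
    ‖P.yStar x - P.yStar x'‖ ≤ c.lg1 / c.μ * ‖x - x'‖ := by
  have h1 := hl.inner_gradY_sub x (P.yStar x') (P.yStar x)
  rw [hl.gradY_yStar hc, zero_sub] at h1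
  have h2 := hl.norm_gradY_sub_le x' x (P.yStar x') (P.yStar x')
  rw [sub_self, pairNorm_zero_right, norm_sub_rev x' x] at h2
  have h3 : inner ℝ (-(gradY P.g x (P.yStar x'))) (P.yStar x - P.yStar x')
      ≤ c.lg1 * ‖x - x'‖ * ‖P.yStar x - P.yStar x'‖ := by
    refine (real_inner_le_norm _ _).trans ?_
    rw [norm_neg]
    rw [hl.gradY_yStar hc, zero_sub, norm_neg] at h2
    gcongr
  have h1' : c.μ * ‖P.yStar x - P.yStar x'‖ ^ 2 ≤
      c.lg1 * ‖x - x'‖ * ‖P.yStar x - P.yStar x'‖ := h1.trans h3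
  have hμ := hc.μ_pos
  have hlg := hc.lg1_pos
  rcases eq_or_lt_of_le (norm_nonneg (P.yStar x - P.yStar x')) with h0 | h0
  · rw [← h0]; positivity
  · rw [div_mul_eq_mul_div, le_div_iff₀ hμ]
    have : c.μ * ‖P.yStar x - P.yStar x'‖ ≤ c.lg1 * ‖x - x'‖ := by
      apply le_of_mul_le_mul_right _ h0; nlinarith
    linarith

lemma continuous_yStar : Continuous P.yStar := by
  have : LipschitzWith (Real.toNNReal (c.lg1 / c.μ)) P.yStar :=
    LipschitzWith.of_dist_le_mul fun x x' => by
      rw [dist_eq_norm, dist_eq_norm, Real.coe_toNNReal _ (by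
        have := hc.μ_pos; have := hc.lg1_pos; positivity)]
      exact hl.yStar_lipschitz hc x x'
  exact this.continuous

omit hc in
lemma hessYY_symm (x : Vec dx) (y : Vec dy) (u v : Vec dy) :
    inner ℝ (hessYY P.g x y u) v = inner ℝ u (hessYY P.g x y v) := by
  rw [real_inner_comm _ u, (hasFDerivAt_hessYY hl.contDiff x y).2,
    (hasFDerivAt_hessYY hl.contDiff x y).2, secondDeriv_comm hl.contDiff]

omit hc in
lemma le_inner_hessYY (x : Vec dx) (y : Vec dy) (u : Vec dy) :
    c.μ * ‖u‖ ^ 2 ≤ inner ℝ (hessYY P.g x y u) u :=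
  le_inner_fderiv_of_strongly_monotone (hasFDerivAt_hessYY hl.contDiff x y).1
    (fun y' => hl.inner_gradY_sub x y y') u

lemma norm_hessYY_le (x : Vec dx) (y : Vec dy) : ‖hessYY P.g x y‖ ≤ c.lg1 := by
  refine (hasFDerivAt_hessYY hl.contDiff x y).1.le_of_lip' hc.lg1_pos.le
    (Filter.Eventually.of_forall fun y' => ?_)
  have := hl.norm_gradY_sub_le x x y' y
  rwa [sub_self, pairNorm_zero_left] at this

lemma norm_hessXY_le (x : Vec dx) (y : Vec dy) : ‖hessXY P.g x y‖ ≤ c.lg1 := by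
  refine (hasFDerivAt_hessXY hl.contDiff x y).1.le_of_lip' hc.lg1_pos.le
    (Filter.Eventually.of_forall fun y' => ?_)
  have := (norm_le_pairNorm_left _ _).trans (hl.smooth x y' x y)
  rwa [sub_self, pairNorm_zero_left] at this

omit hc in
lemma norm_le_hessYY (x : Vec dx) (y : Vec dy) (u : Vec dy) :
    c.μ * ‖u‖ ≤ ‖hessYY P.g x y u‖ := by
  rcases eq_or_lt_of_le (norm_nonneg u) with h0 | h0
  · rw [← h0]; simp
  · apply le_of_mul_le_mul_right _ h0
    have := hl.le_inner_hessYY x y u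
    have h2 := real_inner_le_norm (hessYY P.g x y u) u
    nlinarith

/-- The operator 1 - a∇²ᵧᵧg is symmetric with quadratic form between 0 and (1 - aμ)‖u‖², so
`norm_map_le_of_psd` applies; strictness of aμ < 1 makes its constant positive. -/
lemma norm_sub_smul_hessYY_le {a : ℝ} (ha : 0 < a) (ha1 : a * c.lg1 ≤ 1) (ha2 : a * c.μ < 1)
    (x : Vec dx) (y : Vec dy) (u : Vec dy) :
    ‖u - a • hessYY P.g x y u‖ ≤ (1 - a * c.μ) * ‖u‖ := by
  have h := norm_map_le_of_psd (H := ContinuousLinearMap.id ℝ (Vec dy) - a • hessYY P.g x y)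
    (c := 1 - a * c.μ) ?_ ?_ (by linarith) ?_ u
  · simpa using h
  · intro u v
    simp [inner_sub_left, inner_sub_right, inner_smul_left, inner_smul_right, hl.hessYY_symm]
  · intro u
    simp only [sub_apply, ContinuousLinearMap.id_apply,
      smul_apply, inner_sub_left, real_inner_smul_left,
      real_inner_self_eq_norm_sq]
    have h1 := real_inner_le_norm (hessYY P.g x y u) u
    have h2 := (hessYY P.g x y).le_of_opNorm_le (hl.norm_hessYY_le hc x y) u
    have h3 : inner ℝ (hessYY P.g x y u) u ≤ c.lg1 * ‖u‖ * ‖u‖ :=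
      h1.trans (by gcongr)
    nlinarith [sq_nonneg ‖u‖, mul_le_mul_of_nonneg_left h3 ha.le,
      mul_le_mul_of_nonneg_right ha1 (sq_nonneg ‖u‖)]
  · intro u
    simp only [sub_apply, ContinuousLinearMap.id_apply,
      smul_apply, inner_sub_left, real_inner_smul_left,
      real_inner_self_eq_norm_sq]
    nlinarith [mul_le_mul_of_nonneg_left (hl.le_inner_hessYY x y u) ha.le]

/-- A gradient step contracts towards the lower-level solution. -/
lemma norm_gradStep_le {a : ℝ} (ha : 0 < a) (ha1 : a * c.lg1 ≤ 1) (ha2 : a * c.μ < 1)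
    (x : Vec dx) (y : Vec dy) :
    ‖y - a • gradY P.g x y - P.yStar x‖ ≤ (1 - a * c.μ) * ‖y - P.yStar x‖ := by
  -- Mean value inequality for the gradient map y ↦ y - a∇ᵧg(x, y), which fixes y*(x) and has
  -- derivative 1 - a∇²ᵧᵧg.
  have h := (convex_univ (𝕜 := ℝ) (E := Vec dy)).norm_image_sub_le_of_norm_hasFDerivWithin_le
    (f := fun y => y - a • gradY P.g x y)
    (f' := fun y => ContinuousLinearMap.id ℝ (Vec dy) - a • hessYY P.g x y)
    (C := 1 - a * c.μ) (x := P.yStar x) (y := y)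
    (fun y _ => ((hasFDerivAt_id y).sub
      ((hasFDerivAt_hessYY hl.contDiff x y).1.const_smul a)).hasFDerivWithinAt)
    (fun y _ => ContinuousLinearMap.opNorm_le_bound _ (by linarith) fun u => by
      simpa using hl.norm_sub_smul_hessYY_le hc ha ha1 ha2 x y u)
    (mem_univ _) (mem_univ _)
  simpa [hl.gradY_yStar hc] using h

lemma hessYY_surjective (x : Vec dx) (y : Vec dy) :
    Function.Surjective (hessYY P.g x y) := by
  have hinj : Function.Injective (hessYY P.g x y : Vec dy →ₗ[ℝ] Vec dy) := by
    rw [← LinearMap.ker_eq_bot, LinearMap.ker_eq_bot']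
    intro u hu
    have h1 := hl.norm_le_hessYY x y u
    have hu' : hessYY P.g x y u = 0 := hu
    rw [hu', norm_zero] at h1
    have h2 : ‖u‖ ≤ 0 := by nlinarith [hc.μ_pos]
    simpa using h2
  exact LinearMap.injective_iff_surjective.1 hinj

/-- Completing the square around a solution z0 of the linear system shows that z0 is the unique
minimizer. This also supplies the existence without which the choice made by `argmin` would be
arbitrary. -/
lemma hessYY_zStar (x : Vec dx) :
    hessYY P.g x (P.yStar x) (P.zStar x) = gradY P.f x (P.yStar x) := by
  set H := hessYY P.g x (P.yStar x) with hH
  set b := gradY P.f x (P.yStar x) with hb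
  obtain ⟨z0, hz0⟩ := hl.hessYY_surjective hc x (P.yStar x) b
  have key : ∀ z, ((1 / 2) * inner ℝ (H z) z - inner ℝ b z)
      = ((1 / 2) * inner ℝ (H z0) z0 - inner ℝ b z0)
        + 1 / 2 * inner ℝ (H (z - z0)) (z - z0) := by
    intro z
    have e1 : inner ℝ (H z) z0 = inner ℝ (H z0) z := by
      rw [hl.hessYY_symm, real_inner_comm]
    rw [← hz0, map_sub, inner_sub_left, inner_sub_right, inner_sub_right, e1]
    ring
  have hmin := argmin_spec (h := fun z => (1 / 2) * inner ℝ (H z) z - inner ℝ b z)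
    ⟨z0, fun z => by
      rw [key z]
      have := hl.le_inner_hessYY x (P.yStar x) (z - z0)
      have := mul_nonneg hc.μ_pos.le (sq_nonneg ‖z - z0‖)
      linarith⟩ z0
  change _ * inner ℝ (H (P.zStar x)) (P.zStar x) - inner ℝ b (P.zStar x) ≤ _ at hmin
  rw [key (P.zStar x)] at hmin
  have h1 := hl.le_inner_hessYY x (P.yStar x) (P.zStar x - z0)
  have h2 : ‖P.zStar x - z0‖ ^ 2 ≤ 0 := by
    by_contra hcon
    push Not at hcon
    have := mul_pos hc.μ_pos hcon
    linarith
  have h3 : P.zStar x = z0 := by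
    rw [← sub_eq_zero, ← norm_eq_zero]
    exact pow_eq_zero_iff (two_ne_zero) |>.1 (le_antisymm h2 (sq_nonneg _))
  rw [h3, hz0]

lemma norm_zStar_le (x : Vec dx) : ‖P.zStar x‖ ≤ c.lf0 / c.μ := by
  have h1 := hl.norm_le_hessYY x (P.yStar x) (P.zStar x)
  rw [hl.hessYY_zStar hc] at h1
  rw [le_div_iff₀ hc.μ_pos]
  linarith [hl.bounded x]

/-- The derivative of `y*` solves the linearized optimality condition. -/
lemma hasFDerivAt_yStar (x : Vec dx) :
    ∃ D : Vec dx →L[ℝ] Vec dy, HasFDerivAt P.yStar D x ∧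
      ∀ v u, inner ℝ (hessYY P.g x (P.yStar x) (D v)) u
        = - secondDeriv P.g x (P.yStar x) (v, 0) (0, u) := by
  obtain ⟨J, hJ, hJ'⟩ := hasFDerivAt_gradY hl.contDiff x (P.yStar x)
  set H := hessYY P.g x (P.yStar x) with hH
  have hHJ : ∀ k, J (0, k) = H k := fun k => by
    refine ext_inner_right ℝ fun u => ?_
    rw [hJ', (hasFDerivAt_hessYY hl.contDiff x (P.yStar x)).2]
  let e : Vec dy ≃ₗ[ℝ] Vec dy := LinearEquiv.ofBijective (H : Vec dy →ₗ[ℝ] Vec dy)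
    ⟨LinearMap.injective_iff_surjective.2 (hl.hessYY_surjective hc x _),
      hl.hessYY_surjective hc x _⟩
  have he : ∀ u, H (e.symm u) = u := fun u => e.apply_symm_apply u
  let D : Vec dx →L[ℝ] Vec dy := LinearMap.toContinuousLinearMap
    (-(e.symm : Vec dy →ₗ[ℝ] Vec dy) ∘ₗ (J : Vec dx × Vec dy →ₗ[ℝ] Vec dy) ∘ₗ
      LinearMap.inl ℝ (Vec dx) (Vec dy))
  have hD : ∀ v, H (D v) = - J (v, 0) := fun v => by simp [D, he]
  refine ⟨D, ?_, fun v u => by rw [hD, inner_neg_left, hJ']⟩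
  refine HasFDerivAt.of_isLittleO ?_
  have h1 := hJ.isLittleO
  -- Insert y*(x') into the linearization of ∇ᵧg at (x, y*(x)). Both gradients vanish, and y* is
  -- Lipschitz, so the Hessian applied to y*(x') - y*(x) - D(x' - x) is o(x' - x). The Hessian is
  -- bounded below, which removes it.
  have hcont : Tendsto (fun x' => (x', P.yStar x')) (𝓝 x) (𝓝 (x, P.yStar x)) :=
    (continuous_id.prodMk (hl.continuous_yStar hc)).tendsto x
  have h2 := h1.comp_tendsto hcont
  have h3 : (fun x' => H (P.yStar x' - P.yStar x - D (x' - x))) =o[𝓝 x] fun x' => x' - x := by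
    have h4 : ((fun p : Vec dx × Vec dy => p - (x, P.yStar x)) ∘ fun x' => (x', P.yStar x'))
        =O[𝓝 x] fun x' => x' - x := by
      refine Asymptotics.IsBigO.of_bound (max 1 (c.lg1 / c.μ))
        (Filter.Eventually.of_forall fun x' => ?_)
      simp only [Function.comp, Prod.mk_sub_mk, Prod.norm_mk]
      refine max_le ?_ ((hl.yStar_lipschitz hc x' x).trans ?_)
      · exact le_mul_of_one_le_left (norm_nonneg _) (le_max_left _ _)
      · gcongr; exact le_max_right _ _
    have h5 := (h2.trans_isBigO h4).neg_left
    refine h5.congr_left fun x' => ?_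
    simp only [Function.comp, hl.gradY_yStar hc, Prod.mk_sub_mk]
    have : J (x' - x, P.yStar x' - P.yStar x) = J (x' - x, 0) + H (P.yStar x' - P.yStar x) := by
      rw [← hHJ, ← map_add]; simp
    rw [this, map_sub H _ (D (x' - x)), hD]
    abel
  refine Asymptotics.IsBigO.trans_isLittleO ?_ h3
  refine Asymptotics.IsBigO.of_bound (1 / c.μ) (Filter.Eventually.of_forall fun x' => ?_)
  rw [one_div, le_inv_mul_iff₀ hc.μ_pos]
  exact hl.norm_le_hessYY x _ _

/-- The hypergradient formula. -/
lemma hasGradientAt_Φ (hf : Differentiable ℝ fun w : Vec dx × Vec dy => P.f w.1 w.2)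
    (x : Vec dx) : HasGradientAt P.Φ
      (gradX P.f x (P.yStar x) - hessXY P.g x (P.yStar x) (P.zStar x)) x := by
  obtain ⟨D, hD, hD'⟩ := hl.hasFDerivAt_yStar hc x
  have h1 : HasFDerivAt P.Φ ((fderiv ℝ (fun w : Vec dx × Vec dy => P.f w.1 w.2)
      (x, P.yStar x)).comp ((ContinuousLinearMap.id ℝ (Vec dx)).prod D)) x :=
    (hf (x, P.yStar x)).hasFDerivAt.comp x (f := fun x' => (x', P.yStar x'))
      ((hasFDerivAt_id x).prodMk hD)
  rw [hasGradientAt_iff_hasFDerivAt]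
  suffices h2 : InnerProductSpace.toDual ℝ (Vec dx)
      (gradX P.f x (P.yStar x) - hessXY P.g x (P.yStar x) (P.zStar x)) =
      (fderiv ℝ (fun w : Vec dx × Vec dy => P.f w.1 w.2) (x, P.yStar x)).comp
        ((ContinuousLinearMap.id ℝ (Vec dx)).prod D) by rw [h2]; exact h1
  ext v
  rw [InnerProductSpace.toDual_apply_apply]
  simp only [ContinuousLinearMap.comp_apply, ContinuousLinearMap.prod_apply,
    ContinuousLinearMap.id_apply]
  have e1 : ((v, D v) : Vec dx × Vec dy) = (v, 0) + (0, D v) := by simp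
  rw [e1, map_add, inner_sub_left, sub_eq_add_neg]
  congr 1
  · rw [gradX_eq hf, inner_riesz]; simp
  · have e2 : fderiv ℝ (fun w : Vec dx × Vec dy => P.f w.1 w.2) (x, P.yStar x) (0, D v)
        = inner ℝ (gradY P.f x (P.yStar x)) (D v) := by
      rw [gradY_eq hf, inner_riesz]; simp
    -- Adjoint trick: ⟪∇ᵧf, D v⟫ = ⟪H z*, D v⟫ = ⟪z*, H D v⟫, and H D v is minus a mixed block of
    -- the second derivative of g.
    rw [e2, ← hl.hessYY_zStar hc, hl.hessYY_symm, (hasFDerivAt_hessXY hl.contDiff x _).2,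
      real_inner_comm, hD', secondDeriv_comm hl.contDiff]

lemma gradient_Φ (hf : Differentiable ℝ fun w : Vec dx × Vec dy => P.f w.1 w.2)
    (x : Vec dx) : gradient P.Φ x =
      gradX P.f x (P.yStar x) - hessXY P.g x (P.yStar x) (P.zStar x) :=
  (hl.hasGradientAt_Φ hc hf x).gradient

lemma pairNorm_yStar_le (x x' : Vec dx) :
    pairNorm (x - x') (P.yStar x - P.yStar x') ≤ √(1 + c.lg1 ^ 2 / c.μ ^ 2) * ‖x - x'‖ := by
  have h := hl.yStar_lipschitz hc x x'
  have h2 : ‖P.yStar x - P.yStar x'‖ ^ 2 ≤ (c.lg1 / c.μ * ‖x - x'‖) ^ 2 := by gcongr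
  rw [pairNorm]
  refine Real.sqrt_le_iff.2 ⟨by positivity, ?_⟩
  rw [mul_pow, Real.sq_sqrt (by positivity)]
  rw [mul_pow, div_pow] at h2
  nlinarith

end LowerLevel

end LowerLevelFacts

/-! ### Relaxed smoothness of the bilevel objective and the bias of the estimators -/

section Smoothness

open Set Filter Topology

variable {dx dy : ℕ} {Ξ Z : Type*} {c : Consts} {P : Problem dx dy Ξ Z}

namespace Consts

/-- The constant `√(L_{x,1}² + L_{y,1}²)`. -/
noncomputable def expRate (c : Consts) : ℝ := √(c.Lx1 ^ 2 + c.Ly1 ^ 2)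

/-- The Lipschitz constant of `x ↦ (x, y*(x))`. -/
noncomputable def liftLip (c : Consts) : ℝ := √(1 + c.lg1 ^ 2 / c.μ ^ 2)

variable {c : Consts} (hc : c.Valid)

lemma one_le_liftLip (c : Consts) : 1 ≤ c.liftLip :=
  Real.le_sqrt_of_sq_le (by have : 0 ≤ c.lg1 ^ 2 / c.μ ^ 2 := by positivity
                            linarith)

include hc

omit hc in
lemma lg1_div_le_liftLip (c : Consts) : c.lg1 / c.μ ≤ c.liftLip :=
  Real.le_sqrt_of_sq_le (by rw [div_pow]; linarith)

lemma expRate_pos : 0 < c.expRate := by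
  have := hc.Lx1_pos
  exact Real.sqrt_pos.2 (by positivity)

omit hc in
lemma Lx1_le_expRate (c : Consts) : c.Lx1 ≤ c.expRate :=
  Real.le_sqrt_of_sq_le (by nlinarith [sq_nonneg c.Ly1])

omit hc in
lemma Ly1_le_expRate (c : Consts) : c.Ly1 ≤ c.expRate :=
  Real.le_sqrt_of_sq_le (by nlinarith [sq_nonneg c.Lx1])

lemma invRadius_eq : c.invRadius = √2 * c.liftLip * c.expRate := by
  have h := hc.μ_pos
  rw [invRadius, liftLip, expRate, Real.sqrt_mul (by positivity), Real.sqrt_mul (by positivity)]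

lemma invRadius_pos : 0 < c.invRadius := by
  rw [invRadius_eq hc]
  have := expRate_pos hc
  have := one_le_liftLip c
  positivity

lemma L1_pos : 0 < c.L1 := by
  have := hc.Lx1_pos
  have := hc.lg1_pos
  have := hc.μ_pos
  rw [L1]; positivity

/-- The part of `L₀` that multiplies `√(1 + l_{g,1}²/μ²)`. -/
lemma L0_eq : c.L0 = c.liftLip *
    ((c.Lx0 + c.Lx1 * (c.lg1 * c.lf0 / c.μ) + c.lg2 * (c.lf0 / c.μ))
      + c.lg1 * ((c.Ly0 + c.Ly1 * c.lf0 + c.lg2 * (c.lf0 / c.μ)) / c.μ)) := by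
  have := hc.μ_pos
  rw [L0, liftLip]; field_simp; ring

lemma L0_pos : 0 < c.L0 := by
  rw [L0_eq hc]
  obtain ⟨h1, h2, h3, h4, h5, h6, h7, h8, -, -, -⟩ := hc
  have := one_le_liftLip c
  positivity

end Consts

open Consts

variable (hc : c.Valid) (hs : RelaxedSmooth c P) (hl : LowerLevel c P)

include hc hs

omit hs in
-- This is where `invRadius` comes from: x ↦ (x, y*(x)) has Lipschitz constant `liftLip`, so moving
-- x by 1 / `invRadius` keeps the pair within the radius on which f is relaxed smooth.
lemma one_div_sqrt_eq : 1 / √(2 * (c.Lx1 ^ 2 + c.Ly1 ^ 2)) = c.liftLip * (1 / c.invRadius) := by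
  have h1 := one_le_liftLip c
  have h2 := expRate_pos hc
  rw [invRadius_eq hc, Real.sqrt_mul (by norm_num)]
  change 1 / (√2 * c.expRate) = _
  field_simp

/-- The iterate y may be farther from y*(x) than the radius of the assumption. The local bound is
chained, at the price of an exponential factor; this factor forces the later use of exponential
moments. -/
lemma RelaxedSmooth.norm_gradX_sub_le (x : Vec dx) (y y' : Vec dy) :
    ‖gradX P.f x y - gradX P.f x y'‖
      ≤ (c.Lx0 + c.Lx1 * ‖gradX P.f x y‖) * (‖y - y'‖ * Real.exp (c.Lx1 * ‖y - y'‖)) := by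
  have := hc.Lx1_pos
  refine norm_sub_le_of_local (R := 1 / √(2 * (c.Lx1 ^ 2 + c.Ly1 ^ 2))) hc.Lx0_pos.le
    hc.Lx1_pos.le (by positivity) (fun u v huv => ?_) y y'
  have h := hs.smooth_x x u x v
  rw [sub_self, pairNorm_zero_left] at h
  exact h huv

lemma RelaxedSmooth.norm_gradY_sub_le (x : Vec dx) (y y' : Vec dy) :
    ‖gradY P.f x y - gradY P.f x y'‖
      ≤ (c.Ly0 + c.Ly1 * ‖gradY P.f x y‖) * (‖y - y'‖ * Real.exp (c.Ly1 * ‖y - y'‖)) := by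
  have := hc.Lx1_pos
  refine norm_sub_le_of_local (R := 1 / √(2 * (c.Lx1 ^ 2 + c.Ly1 ^ 2))) hc.Ly0_pos.le
    hc.Ly1_pos.le (by positivity) (fun u v huv => ?_) y y'
  have h := hs.smooth_y x u x v
  rw [sub_self, pairNorm_zero_left] at h
  exact h huv

include hl

omit hs in
lemma norm_hessYY_zStar_sub_le {s : ℝ} (x x' : Vec dx) (y y' : Vec dy)
    (h : pairNorm (x - x') (y - y') ≤ s) (w : Vec dx) :
    ‖hessYY P.g x y (P.zStar w) - hessYY P.g x' y' (P.zStar w)‖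
      ≤ c.lg2 * (c.lf0 / c.μ) * s := by
  rw [← sub_apply]
  refine (ContinuousLinearMap.le_opNorm _ _).trans ?_
  have h1 := hl.hessYY_lipschitz x y x' y'
  have h2 := hl.norm_zStar_le hc w
  have h3 : c.lg2 * pairNorm (x - x') (y - y') ≤ c.lg2 * s :=
    mul_le_mul_of_nonneg_left h hc.lg2_nonneg
  calc _ ≤ (c.lg2 * s) * (c.lf0 / c.μ) := by
        gcongr
        · exact (norm_nonneg _).trans (h1.trans h3)
        · exact h1.trans h3
    _ = _ := by ring

omit hs in
lemma norm_hessXY_zStar_sub_le {s : ℝ} (x x' : Vec dx) (y y' : Vec dy)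
    (h : pairNorm (x - x') (y - y') ≤ s) (w : Vec dx) :
    ‖hessXY P.g x y (P.zStar w) - hessXY P.g x' y' (P.zStar w)‖
      ≤ c.lg2 * (c.lf0 / c.μ) * s := by
  rw [← sub_apply]
  refine (ContinuousLinearMap.le_opNorm _ _).trans ?_
  have h1 := hl.hessXY_lipschitz x y x' y'
  have h2 := hl.norm_zStar_le hc w
  have h3 : c.lg2 * pairNorm (x - x') (y - y') ≤ c.lg2 * s :=
    mul_le_mul_of_nonneg_left h hc.lg2_nonneg
  calc _ ≤ (c.lg2 * s) * (c.lf0 / c.μ) := by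
        gcongr
        · exact (norm_nonneg _).trans (h1.trans h3)
        · exact h1.trans h3
    _ = _ := by ring

/-- The auxiliary solution `z*` is locally Lipschitz. -/
lemma lg1_mul_norm_zStar_sub_le' (x x' : Vec dx) (hx : ‖x - x'‖ ≤ 1 / c.invRadius) :
    c.lg1 * ‖P.zStar x - P.zStar x'‖ ≤ c.liftLip * (c.lg1 *
      ((c.Ly0 + c.Ly1 * c.lf0 + c.lg2 * (c.lf0 / c.μ)) / c.μ)) * ‖x - x'‖ := by
  have hμ := hc.μ_pos
  have hp : pairNorm (x - x') (P.yStar x - P.yStar x') ≤ c.liftLip * ‖x - x'‖ :=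
    hl.pairNorm_yStar_le hc x x'
  have hs1 := one_le_liftLip c
  have hr : pairNorm (x - x') (P.yStar x - P.yStar x') ≤ 1 / √(2 * (c.Lx1 ^ 2 + c.Ly1 ^ 2)) := by
    rw [one_div_sqrt_eq hc]; exact hp.trans (by gcongr)
  have h1 := hl.norm_le_hessYY x' (P.yStar x') (P.zStar x - P.zStar x')
  rw [map_sub, hl.hessYY_zStar hc x'] at h1
  have h2 := norm_hessYY_zStar_sub_le hc hl x x' (P.yStar x) (P.yStar x') hp x
  rw [hl.hessYY_zStar hc x] at h2
  have h3 : ‖gradY P.f x (P.yStar x) - gradY P.f x' (P.yStar x')‖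
      ≤ (c.Ly0 + c.Ly1 * c.lf0) * (c.liftLip * ‖x - x'‖) := by
    refine (hs.smooth_y _ _ _ _ hr).trans ?_
    have := hc.Ly1_pos
    have := hc.Ly0_pos
    have := hl.bounded x
    have := hc.lf0_nonneg
    have : 0 ≤ pairNorm (x - x') (P.yStar x - P.yStar x') := Real.sqrt_nonneg _
    gcongr
  have h4 : ‖hessYY P.g x' (P.yStar x') (P.zStar x) - gradY P.f x' (P.yStar x')‖
      ≤ ‖gradY P.f x (P.yStar x) - hessYY P.g x' (P.yStar x') (P.zStar x)‖
        + ‖gradY P.f x (P.yStar x) - gradY P.f x' (P.yStar x')‖ := by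
    rw [norm_sub_rev (gradY P.f x (P.yStar x)) (hessYY P.g x' (P.yStar x') (P.zStar x))]
    exact norm_sub_le_norm_sub_add_norm_sub _ _ _
  have h5 : ‖P.zStar x - P.zStar x'‖ ≤ (c.Ly0 + c.Ly1 * c.lf0 + c.lg2 * (c.lf0 / c.μ)) / c.μ *
      (c.liftLip * ‖x - x'‖) := by
    rw [div_mul_eq_mul_div, le_div_iff₀ hμ]
    linarith
  calc _ ≤ c.lg1 * ((c.Ly0 + c.Ly1 * c.lf0 + c.lg2 * (c.lf0 / c.μ)) / c.μ *
      (c.liftLip * ‖x - x'‖)) := mul_le_mul_of_nonneg_left h5 hc.lg1_pos.le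
    _ = _ := by ring

lemma lg1_mul_norm_zStar_sub_le (x x' : Vec dx) (hx : ‖x - x'‖ ≤ 1 / c.invRadius) :
    c.lg1 * ‖P.zStar x - P.zStar x'‖ ≤ c.L0 * ‖x - x'‖ := by
  refine (lg1_mul_norm_zStar_sub_le' hc hs hl x x' hx).trans ?_
  rw [L0_eq hc]
  have := one_le_liftLip c
  obtain ⟨h1, h2, h3, h4, h5, h6, h7, h8, -, -, -⟩ := hc
  gcongr
  exact le_add_of_nonneg_left (by positivity)

/-- ∇ₓf at (x, y*(x)) differs from ∇Φ by ∇²ₓᵧg z*, and ‖z*‖ ≤ l_{f,0}/μ. It trades the relaxed bound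
in ∇ₓf for one in ∇Φ and produces the term L_{x,1} l_{g,1} l_{f,0}/μ of L₀. -/
lemma norm_gradX_yStar_le (x : Vec dx) :
    ‖gradX P.f x (P.yStar x)‖ ≤ ‖gradient P.Φ x‖ + c.lg1 * c.lf0 / c.μ := by
  have h := hl.gradient_Φ hc hs.differentiable x
  have h1 : gradX P.f x (P.yStar x) = gradient P.Φ x + hessXY P.g x (P.yStar x) (P.zStar x) := by
    rw [h]; abel
  rw [h1]
  refine (norm_add_le _ _).trans ?_
  gcongr
  refine ((hessXY P.g x (P.yStar x)).le_of_opNorm_le (hl.norm_hessXY_le hc x _) _).trans ?_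
  rw [mul_div_assoc]
  exact mul_le_mul_of_nonneg_left (hl.norm_zStar_le hc x) hc.lg1_pos.le

/-- Relaxed smoothness of the bilevel objective. -/
lemma norm_gradient_Φ_sub_le (x x' : Vec dx) (hx : ‖x - x'‖ ≤ 1 / c.invRadius) :
    ‖gradient P.Φ x - gradient P.Φ x'‖ ≤ (c.L0 + c.L1 * ‖gradient P.Φ x‖) * ‖x - x'‖ := by
  have hμ := hc.μ_pos
  have hp : pairNorm (x - x') (P.yStar x - P.yStar x') ≤ c.liftLip * ‖x - x'‖ :=
    hl.pairNorm_yStar_le hc x x'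
  have hs1 := one_le_liftLip c
  have hr : pairNorm (x - x') (P.yStar x - P.yStar x') ≤ 1 / √(2 * (c.Lx1 ^ 2 + c.Ly1 ^ 2)) := by
    rw [one_div_sqrt_eq hc]; exact hp.trans (by gcongr)
  have hz := lg1_mul_norm_zStar_sub_le' hc hs hl x x' hx
  have hX := norm_gradX_yStar_le hc hs hl x
  have h1 : ‖gradX P.f x (P.yStar x) - gradX P.f x' (P.yStar x')‖ ≤
      (c.Lx0 + c.Lx1 * (‖gradient P.Φ x‖ + c.lg1 * c.lf0 / c.μ)) * (c.liftLip * ‖x - x'‖) := by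
    refine (hs.smooth_x _ _ _ _ hr).trans ?_
    have := hc.Lx1_pos
    have := hc.Lx0_pos
    have := hc.lg1_pos
    have := hc.lf0_nonneg
    have : 0 ≤ pairNorm (x - x') (P.yStar x - P.yStar x') := Real.sqrt_nonneg _
    gcongr
  have h2 := norm_hessXY_zStar_sub_le hc hl x x' (P.yStar x) (P.yStar x') hp x
  have h3 : ‖hessXY P.g x' (P.yStar x') (P.zStar x - P.zStar x')‖
      ≤ c.lg1 * ‖P.zStar x - P.zStar x'‖ :=
    (hessXY P.g x' (P.yStar x')).le_of_opNorm_le (hl.norm_hessXY_le hc x' _) _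
  rw [hl.gradient_Φ hc hs.differentiable, hl.gradient_Φ hc hs.differentiable] at *
  -- The Hessian increment is tested on z*(x), whose norm is bounded by l_{f,0}/μ, and the increment
  -- of z* is met by the Hessian at x', bounded by l_{g,1}.
  have e : gradX P.f x (P.yStar x) - hessXY P.g x (P.yStar x) (P.zStar x) -
      (gradX P.f x' (P.yStar x') - hessXY P.g x' (P.yStar x') (P.zStar x')) =
      (gradX P.f x (P.yStar x) - gradX P.f x' (P.yStar x')) -
      (hessXY P.g x (P.yStar x) (P.zStar x) - hessXY P.g x' (P.yStar x') (P.zStar x)) -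
      hessXY P.g x' (P.yStar x') (P.zStar x - P.zStar x') := by
    rw [map_sub]; abel
  rw [e]
  refine (norm_sub_le _ _).trans ((add_le_add_left (norm_sub_le _ _) _).trans ?_)
  refine (add_le_add (add_le_add h1 h2) (h3.trans hz)).trans (le_of_eq ?_)
  rw [L0_eq hc, L1]
  change _ = (_ + c.liftLip * c.Lx1 * _) * _
  ring

/-- The bias of the auxiliary update caused by the lower-level error. -/
lemma zBias_le (x : Vec dx) (y : Vec dy) :
    c.lg1 / c.μ * ‖hessYY P.g x y (P.zStar x) - gradY P.f x y‖
      ≤ c.L0 * (‖y - P.yStar x‖ * Real.exp (c.expRate * ‖y - P.yStar x‖)) := by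
  set d := ‖y - P.yStar x‖ with hd
  set w := d * Real.exp (c.expRate * d) with hw
  have hd0 : 0 ≤ d := norm_nonneg _
  have hr := expRate_pos hc
  have hdw : d ≤ w := le_mul_of_one_le_right hd0 (Real.one_le_exp (by positivity))
  have hp : pairNorm (x - x) (y - P.yStar x) ≤ d := by rw [sub_self, pairNorm_zero_left]
  have h1 := norm_hessYY_zStar_sub_le hc hl x x y (P.yStar x) hp x
  rw [hl.hessYY_zStar hc] at h1
  have h2 := hs.norm_gradY_sub_le hc x (P.yStar x) y
  rw [norm_sub_rev (P.yStar x) y] at h2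
  have h3 : (c.Ly0 + c.Ly1 * ‖gradY P.f x (P.yStar x)‖) * (d * Real.exp (c.Ly1 * d))
      ≤ (c.Ly0 + c.Ly1 * c.lf0) * w := by
    have := hl.bounded x
    have := hc.Ly0_pos
    have := hc.Ly1_pos
    have := hc.lf0_nonneg
    have := Ly1_le_expRate c
    rw [hw]
    gcongr
  have h4 := norm_sub_le_norm_sub_add_norm_sub (hessYY P.g x y (P.zStar x))
    (gradY P.f x (P.yStar x)) (gradY P.f x y)
  have hs1 := one_le_liftLip c
  have hL0 := L0_eq hc
  obtain ⟨p1, p2, p3, p4, p5, p6, p7, p8, -, -, -⟩ := hc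
  have h5 : c.lg2 * (c.lf0 / c.μ) * d ≤ c.lg2 * (c.lf0 / c.μ) * w := by gcongr
  have hw0 : 0 ≤ w := hd0.trans hdw
  calc _ ≤ c.lg1 / c.μ * ((c.Ly0 + c.Ly1 * c.lf0 + c.lg2 * (c.lf0 / c.μ)) * w) := by
        gcongr; linarith
    _ = 1 * (0 + c.lg1 * ((c.Ly0 + c.Ly1 * c.lf0 + c.lg2 * (c.lf0 / c.μ)) / c.μ)) * w := by ring
    _ ≤ c.L0 * w := by
        rw [hL0]
        gcongr
        positivity

/-- The bias of the stochastic hypergradient. -/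
lemma gradBias_le (x : Vec dx) (y z : Vec dy) :
    ‖gradX P.f x y - hessXY P.g x y z - gradient P.Φ x‖
      ≤ (c.L0 + c.L1 * ‖gradient P.Φ x‖) *
        (‖y - P.yStar x‖ * Real.exp (c.expRate * ‖y - P.yStar x‖))
        + c.lg1 * ‖z - P.zStar x‖ := by
  set d := ‖y - P.yStar x‖ with hd
  set w := d * Real.exp (c.expRate * d) with hw
  have hd0 : 0 ≤ d := norm_nonneg _
  have hr := expRate_pos hc
  have hdw : d ≤ w := le_mul_of_one_le_right hd0 (Real.one_le_exp (by positivity))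
  have hw0 : 0 ≤ w := hd0.trans hdw
  have hp : pairNorm (x - x) (y - P.yStar x) ≤ d := by rw [sub_self, pairNorm_zero_left]
  have h1 := norm_hessXY_zStar_sub_le hc hl x x y (P.yStar x) hp x
  have h2 := hs.norm_gradX_sub_le hc x (P.yStar x) y
  have hX := norm_gradX_yStar_le hc hs hl x
  rw [norm_sub_rev (P.yStar x) y] at h2
  have h3 : (c.Lx0 + c.Lx1 * ‖gradX P.f x (P.yStar x)‖) * (d * Real.exp (c.Lx1 * d))
      ≤ (c.Lx0 + c.Lx1 * (‖gradient P.Φ x‖ + c.lg1 * c.lf0 / c.μ)) * w := by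
    have := hc.Lx0_pos
    have := hc.Lx1_pos
    have := hc.lf0_nonneg
    have := hc.lg1_pos
    have := hc.μ_pos
    have := Lx1_le_expRate c
    rw [hw]
    gcongr
  have h6 : ‖hessXY P.g x y (z - P.zStar x)‖ ≤ c.lg1 * ‖z - P.zStar x‖ :=
    (hessXY P.g x y).le_of_opNorm_le (hl.norm_hessXY_le hc x _) _
  have e : gradX P.f x y - hessXY P.g x y z - gradient P.Φ x =
      (-(gradX P.f x (P.yStar x) - gradX P.f x y)) -
      (hessXY P.g x y (P.zStar x) - hessXY P.g x (P.yStar x) (P.zStar x)) -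
      hessXY P.g x y (z - P.zStar x) := by
    rw [hl.gradient_Φ hc hs.differentiable, map_sub]; abel
  have h7 : ‖gradX P.f x y - hessXY P.g x y z - gradient P.Φ x‖ ≤
      ‖gradX P.f x (P.yStar x) - gradX P.f x y‖ +
      ‖hessXY P.g x y (P.zStar x) - hessXY P.g x (P.yStar x) (P.zStar x)‖ +
      ‖hessXY P.g x y (z - P.zStar x)‖ := by
    rw [e]
    refine (norm_sub_le _ _).trans ((add_le_add_left (norm_sub_le _ _) _).trans ?_)
    rw [norm_neg]
  have hs1 := one_le_liftLip c
  have hL0 := L0_eq hc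
  have hL1 : c.L1 = c.liftLip * c.Lx1 := rfl
  obtain ⟨p1, p2, p3, p4, p5, p6, p7, p8, -, -, -⟩ := hc
  have h5 : c.lg2 * (c.lf0 / c.μ) * d ≤ c.lg2 * (c.lf0 / c.μ) * w := by gcongr
  have h8 : 1 * ((c.Lx0 + c.Lx1 * (c.lg1 * c.lf0 / c.μ) + c.lg2 * (c.lf0 / c.μ)) + 0) ≤ c.L0 := by
    rw [hL0]
    gcongr
    positivity
  have h9 : 1 * c.Lx1 * ‖gradient P.Φ x‖ ≤ c.L1 * ‖gradient P.Φ x‖ := by rw [hL1]; gcongr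
  have h10 := mul_le_mul_of_nonneg_right (add_le_add h8 h9) hw0
  linarith

/-- Exponential growth bound for the gradient of the bilevel objective. -/
lemma norm_gradient_Φ_sub_le_exp (x x' : Vec dx) :
    ‖gradient P.Φ x - gradient P.Φ x'‖ ≤ (c.L0 + c.L1 * ‖gradient P.Φ x‖) *
      (‖x - x'‖ * Real.exp (c.L1 * ‖x - x'‖)) :=
  norm_sub_le_of_local (L0_pos hc).le (L1_pos hc).le
    (show 0 < 1 / c.invRadius from one_div_pos.2 (invRadius_pos hc))
    (fun u v huv => norm_gradient_Φ_sub_le hc hs hl u v huv) x x'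

lemma differentiable_Φ : Differentiable ℝ P.Φ := fun x =>
  (hl.hasGradientAt_Φ hc hs.differentiable x).differentiableAt

omit hs hl in
lemma continuous_of_local {V : Type*} [NormedAddCommGroup V] {G : Vec dx → V} {K : Vec dx → ℝ}
    (h : ∀ x x', ‖x - x'‖ ≤ 1 / c.invRadius → ‖G x - G x'‖ ≤ K x * ‖x - x'‖) :
    Continuous G := by
  have hr : 0 < 1 / c.invRadius := one_div_pos.2 (invRadius_pos hc)
  rw [continuous_iff_continuousAt]
  intro x
  rw [ContinuousAt, tendsto_iff_norm_sub_tendsto_zero]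
  have h0 : Tendsto (fun x' => K x * ‖x - x'‖) (𝓝 x) (𝓝 0) := by
    have : Continuous fun x' => K x * ‖x - x'‖ := by fun_prop
    simpa using this.tendsto x
  refine squeeze_zero' (Filter.Eventually.of_forall fun _ => norm_nonneg _) ?_ h0
  filter_upwards [Metric.closedBall_mem_nhds x hr] with x' hx'
  rw [norm_sub_rev]
  refine h x x' ?_
  rwa [Metric.mem_closedBall, dist_eq_norm, norm_sub_rev] at hx'

lemma continuous_gradient_Φ : Continuous (gradient P.Φ) :=
  continuous_of_local hc (fun x x' h => norm_gradient_Φ_sub_le hc hs hl x x' h)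

lemma continuous_zStar : Continuous P.zStar :=
  continuous_of_local hc (K := fun _ => c.L0 / c.lg1) (fun x x' h => by
    have := lg1_mul_norm_zStar_sub_le hc hs hl x x' h
    rw [div_mul_eq_mul_div, le_div_iff₀ hc.lg1_pos]; linarith)

/-- Descent inequality with a prescribed variation of the gradient along the segment. -/
lemma Φ_sub_le {x x' : Vec dx} {K : ℝ}
    (h : ∀ u ∈ segment ℝ x x', ‖gradient P.Φ u - gradient P.Φ x‖ ≤ K) :
    P.Φ x' ≤ P.Φ x + inner ℝ (gradient P.Φ x) (x' - x) + K * ‖x' - x‖ := by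
  have h1 := (convex_segment (𝕜 := ℝ) x x').norm_image_sub_le_of_norm_hasFDerivWithin_le
    (f := fun u => P.Φ u - inner ℝ (gradient P.Φ x) u)
    (f' := fun u => InnerProductSpace.toDual ℝ (Vec dx) (gradient P.Φ u - gradient P.Φ x))
    (C := K) (x := x) (y := x')
    (fun u _ => by
      have e1 := (differentiable_Φ hc hs hl u).hasGradientAt.hasFDerivAt
      have e2 := (InnerProductSpace.toDual ℝ (Vec dx) (gradient P.Φ x)).hasFDerivAt (x := u)
      have e3 := (e1.sub e2).hasFDerivWithinAt (s := segment ℝ x x')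
      rw [← map_sub] at e3
      exact e3)
    (fun u hu => by rw [LinearIsometryEquiv.norm_map]; exact h u hu)
    (left_mem_segment ℝ x x') (right_mem_segment ℝ x x')
  have h2 := (Real.le_norm_self _).trans h1
  rw [inner_sub_right]
  linarith

omit hc hs hl in
lemma norm_sub_le_of_mem_segment {V : Type*} [NormedAddCommGroup V] [NormedSpace ℝ V]
    {x x' u : V} (hu : u ∈ segment ℝ x x') : ‖x - u‖ ≤ ‖x' - x‖ := by
  obtain ⟨t, ht, rfl⟩ := (segment_eq_image' ℝ x x') ▸ hu
  simp only [sub_add_cancel_left, norm_neg, norm_smul, Real.norm_of_nonneg ht.1]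
  exact mul_le_of_le_one_left (norm_nonneg _) ht.2

lemma Φ_sub_le_local {x x' : Vec dx} (hx : ‖x' - x‖ ≤ 1 / c.invRadius) :
    P.Φ x' ≤ P.Φ x + inner ℝ (gradient P.Φ x) (x' - x)
      + (c.L0 + c.L1 * ‖gradient P.Φ x‖) * ‖x' - x‖ * ‖x' - x‖ := by
  refine Φ_sub_le hc hs hl fun u hu => ?_
  have h1 : ‖x - u‖ ≤ ‖x' - x‖ := norm_sub_le_of_mem_segment hu
  have h2 := norm_gradient_Φ_sub_le hc hs hl x u (h1.trans hx)
  rw [norm_sub_rev]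
  refine h2.trans ?_
  have := (L0_pos hc).le
  have := (L1_pos hc).le
  gcongr

/-- Self-bounding property of the gradient. -/
lemma norm_gradient_sq_le (hb : BddBelow (range P.Φ)) (x : Vec dx) :
    ‖gradient P.Φ x‖ ^ 2 ≤ 6 * P.gap x * (c.L0 + c.L1 * ‖gradient P.Φ x‖) := by
  set Γ := ‖gradient P.Φ x‖ with hΓ
  have hL0 := L0_pos hc
  have hL1 := L1_pos hc
  have hΓ0 : 0 ≤ Γ := norm_nonneg _
  set M := c.L0 + c.L1 * Γ with hM
  have hM0 : 0 < M := by positivity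
  -- A gradient step with this t satisfies L₁ t Γ ≤ 1/4, so the exponential factor is at most 4/3
  -- and Φ drops by at least Γ²/(4M) - Γ²/(12M) = Γ²/(6M). The exponential bound is used since this
  -- step may be longer than 1 / `invRadius`.
  set t := 1 / (4 * M) with ht
  have ht0 : 0 < t := by positivity
  set x' := x - t • gradient P.Φ x with hx'
  have hdist : ‖x' - x‖ = t * Γ := by
    rw [hx', sub_sub_cancel_left, norm_neg, norm_smul, Real.norm_of_nonneg ht0.le]
  have hLt : c.L1 * (t * Γ) ≤ 1 / 4 := by
    rw [ht, show c.L1 * (1 / (4 * M) * Γ) = (c.L1 * Γ) / (4 * M) by ring,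
      div_le_iff₀ (by positivity)]
    linarith
  have h1 := Φ_sub_le hc hs hl (x := x) (x' := x') (K := M * (t * Γ * (4 / 3))) (fun u hu => by
    have h1 : ‖x - u‖ ≤ ‖x' - x‖ := norm_sub_le_of_mem_segment hu
    rw [norm_sub_rev]
    refine (norm_gradient_Φ_sub_le_exp hc hs hl x u).trans ?_
    rw [hdist] at h1
    have h2 : Real.exp (c.L1 * ‖x - u‖) ≤ 4 / 3 := by
      have e1 : c.L1 * ‖x - u‖ ≤ 1 / 4 := (mul_le_mul_of_nonneg_left h1 hL1.le).trans hLt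
      have e2 := Real.one_sub_le_exp_neg (c.L1 * ‖x - u‖)
      rw [Real.exp_neg] at e2
      have e3 : (3 / 4 : ℝ) ≤ (Real.exp (c.L1 * ‖x - u‖))⁻¹ := by linarith
      rw [le_inv_comm₀ (by norm_num) (Real.exp_pos _)] at e3
      norm_num at e3
      exact e3
    gcongr)
  have h2 : inner ℝ (gradient P.Φ x) (x' - x) = - (t * Γ ^ 2) := by
    rw [hx', sub_sub_cancel_left, inner_neg_right, inner_smul_right, real_inner_self_eq_norm_sq]
  rw [h2, hdist] at h1
  have h3 : (⨅ x, P.Φ x) ≤ P.Φ x' := ciInf_le hb x'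
  have h4 : t * Γ ^ 2 - M * (t * Γ * (4 / 3)) * (t * Γ) ≤ P.gap x := by
    rw [Problem.gap]; linarith
  have h5 : t * Γ ^ 2 - M * (t * Γ * (4 / 3)) * (t * Γ) = Γ ^ 2 / (6 * M) := by
    rw [ht]; field_simp; ring
  rw [h5, div_le_iff₀ (by positivity)] at h4
  linarith

end Smoothness

/-! ### Exponential moments of light-tailed noise -/

section SubGaussian

open Set Filter Topology

variable {S : Type*} [MeasurableSpace S] {d : ℕ}

/-- The linear term integrates to zero for centered noise, leaving a Gaussian bound without a linear
contribution. -/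
lemma exp_le_add_exp_sq (x : ℝ) : Real.exp x ≤ x + Real.exp (x ^ 2) := by
  have h1 := Real.add_one_le_exp (x ^ 2)
  by_cases h : |x| ≤ 1
  · have := (abs_le.1 (Real.abs_exp_sub_one_sub_id_le h)).2
    linarith
  · rcases lt_abs.1 (not_le.1 h) with h | h
    · have : Real.exp x ≤ Real.exp (x ^ 2) := Real.exp_le_exp.2 (by nlinarith)
      linarith
    · have : Real.exp x ≤ 1 := Real.exp_le_one_iff.2 (by linarith)
      nlinarith

/-- The random vector `n` has mean zero and Gaussian tails of scale `σ`. -/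
structure LightTailed (D : Measure S) (n : S → Vec d) (σ : ℝ) : Prop where
  meas : Measurable n
  integrable : Integrable n D
  mean : ∫ s, n s ∂D = 0
  tail : ∀ l : ℝ, 0 < l → D.real {s | l ≤ ‖n s‖} ≤ 2 * Real.exp (-2 * l ^ 2 / σ ^ 2)

variable {D : Measure S} [IsProbabilityMeasure D] {n : S → Vec d} {σ : ℝ}

/-- Layer cake: the tail at σ√t is at most 2e^{-2t}, and against the density e^t it leaves 2e^{-t},
of integral 2. The remaining 1 is the value of the exponential at zero. -/
lemma LightTailed.lintegral_exp (h : LightTailed D n σ) (hσ : 0 < σ) :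
    ∫⁻ s, ENNReal.ofReal (Real.exp (‖n s‖ ^ 2 / σ ^ 2)) ∂D ≤ 3 := by
  have hm := h.meas
  have h1 := lintegral_comp_eq_lintegral_meas_le_mul D (f := fun s => ‖n s‖ ^ 2 / σ ^ 2)
    (g := Real.exp) (Filter.Eventually.of_forall fun s => by simp only [Pi.zero_apply]; positivity)
    (by fun_prop) (fun t _ => Real.continuous_exp.intervalIntegrable _ _)
    (Filter.Eventually.of_forall fun t => (Real.exp_pos t).le)
  simp only [integral_exp, Real.exp_zero] at h1
  have h2 : ∫⁻ t in Ioi (0 : ℝ), D {a | t ≤ ‖n a‖ ^ 2 / σ ^ 2} * ENNReal.ofReal (Real.exp t)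
      ≤ ∫⁻ t in Ioi (0 : ℝ), ENNReal.ofReal (2 * Real.exp (-t)) := by
    refine lintegral_mono_ae ?_
    filter_upwards [ae_restrict_mem measurableSet_Ioi] with t ht
    have ht : 0 < t := ht
    have e1 : {a | t ≤ ‖n a‖ ^ 2 / σ ^ 2} = {a | σ * √t ≤ ‖n a‖} := by
      ext a
      simp only [mem_ofPred_eq]
      rw [le_div_iff₀ (by positivity), ← abs_of_nonneg (norm_nonneg (n a)), ← Real.sqrt_sq_eq_abs,
        Real.le_sqrt' (by positivity), mul_pow, Real.sq_sqrt ht.le, Real.sqrt_sq_eq_abs, sq_abs,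
        mul_comm]
    have e2 := h.tail (σ * √t) (by positivity)
    rw [mul_pow, Real.sq_sqrt ht.le, show -2 * (σ ^ 2 * t) / σ ^ 2 = -2 * t by field_simp] at e2
    rw [e1, ← ofReal_measureReal, ← ENNReal.ofReal_mul measureReal_nonneg]
    refine ENNReal.ofReal_le_ofReal ?_
    calc _ ≤ 2 * Real.exp (-2 * t) * Real.exp t := by gcongr
      _ = 2 * Real.exp (-t) := by rw [mul_assoc, ← Real.exp_add]; ring_nf
  have h3 : ∫⁻ t in Ioi (0 : ℝ), ENNReal.ofReal (2 * Real.exp (-t)) = 2 := by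
    rw [← ofReal_integral_eq_lintegral_ofReal ((integrableOn_exp_neg_Ioi 0).const_mul 2)
      (Filter.Eventually.of_forall fun t => by positivity), integral_const_mul,
      integral_exp_neg_Ioi_zero]
    norm_num
  calc _ = ∫⁻ s, (ENNReal.ofReal (Real.exp (‖n s‖ ^ 2 / σ ^ 2) - 1) + 1) ∂D := by
        refine lintegral_congr fun s => ?_
        rw [← ENNReal.ofReal_one, ← ENNReal.ofReal_add _ zero_le_one, sub_add_cancel]
        have : 0 ≤ ‖n s‖ ^ 2 / σ ^ 2 := by positivity
        linarith [Real.one_le_exp this]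
    _ = ∫⁻ s, ENNReal.ofReal (Real.exp (‖n s‖ ^ 2 / σ ^ 2) - 1) ∂D + 1 := by
        rw [lintegral_add_right _ measurable_const]; simp
    _ ≤ 2 + 1 := by rw [h1]; gcongr; exact h2.trans_eq h3
    _ = 3 := by norm_num

lemma LightTailed.integrable_exp (h : LightTailed D n σ) (hσ : 0 < σ) :
    Integrable (fun s => Real.exp (‖n s‖ ^ 2 / σ ^ 2)) D := by
  have hm := h.meas
  refine ⟨by fun_prop, ?_⟩
  rw [hasFiniteIntegral_iff_ofReal (Filter.Eventually.of_forall fun s => (Real.exp_pos _).le)]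
  exact (h.lintegral_exp hσ).trans_lt (by norm_num)

lemma LightTailed.integral_exp_le_three (h : LightTailed D n σ) (hσ : 0 < σ) :
    ∫ s, Real.exp (‖n s‖ ^ 2 / σ ^ 2) ∂D ≤ 3 := by
  have h1 := h.lintegral_exp hσ
  rw [← ofReal_integral_eq_lintegral_ofReal (h.integrable_exp hσ)
    (Filter.Eventually.of_forall fun s => (Real.exp_pos _).le)] at h1
  rw [show (3 : ENNReal) = ENNReal.ofReal 3 by simp] at h1
  exact (ENNReal.ofReal_le_ofReal_iff (by norm_num)).1 h1

/-- Convexity of exp between 0 and x. It also serves to turn a contraction inside the exponent into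
a contraction of an exponential moment. -/
lemma exp_mul_le {q x : ℝ} (hq0 : 0 ≤ q) (hq1 : q ≤ 1) :
    Real.exp (q * x) ≤ 1 + q * (Real.exp x - 1) := by
  have h := convexOn_exp.2 (mem_univ x) (mem_univ (0 : ℝ)) hq0 (sub_nonneg.2 hq1) (by ring)
  simp only [smul_eq_mul, mul_zero, add_zero, Real.exp_zero, mul_one] at h
  linarith

lemma LightTailed.exp_mul (h : LightTailed D n σ) (hσ : 0 < σ) {q : ℝ} (hq0 : 0 ≤ q)
    (hq1 : q ≤ 1) : Integrable (fun s => Real.exp (q * (‖n s‖ ^ 2 / σ ^ 2))) D ∧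
      ∫ s, Real.exp (q * (‖n s‖ ^ 2 / σ ^ 2)) ∂D ≤ Real.exp (2 * q) := by
  have hm := h.meas
  have hint := h.integrable_exp hσ
  have hsub : Integrable (fun s => Real.exp (‖n s‖ ^ 2 / σ ^ 2) - 1) D :=
    hint.sub (integrable_const 1)
  have hint2 : Integrable (fun s => 1 + q * (Real.exp (‖n s‖ ^ 2 / σ ^ 2) - 1)) D :=
    (integrable_const 1).add (hsub.const_mul q)
  have hi : Integrable (fun s => Real.exp (q * (‖n s‖ ^ 2 / σ ^ 2))) D :=
    hint2.mono' (by fun_prop) (Filter.Eventually.of_forall fun s => by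
      rw [Real.norm_of_nonneg (Real.exp_pos _).le]; exact exp_mul_le hq0 hq1)
  refine ⟨hi, (integral_mono hi hint2 fun s => exp_mul_le hq0 hq1).trans ?_⟩
  rw [integral_add (integrable_const 1) (hsub.const_mul q),
    integral_const_mul, integral_sub hint (integrable_const 1)]
  simp only [integral_const, probReal_univ, smul_eq_mul, mul_one]
  have h1 := h.integral_exp_le_three hσ
  have h2 := Real.add_one_le_exp (2 * q)
  nlinarith

/-- If 4‖v‖²σ² ≤ 1, the mean-zero property enters through `exp_le_add_exp_sq`. Otherwise Young's
inequality and the bound 3 ≤ e^{1.2} suffice, because then 7‖v‖²σ² exceeds 1.2. -/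
lemma LightTailed.exp_inner (h : LightTailed D n σ) (hσ : 0 < σ) (v : Vec d) :
    Integrable (fun s => Real.exp (2 * inner ℝ v (n s))) D ∧
      ∫ s, Real.exp (2 * inner ℝ v (n s)) ∂D ≤ Real.exp (8 * ‖v‖ ^ 2 * σ ^ 2) := by
  have hm := h.meas
  have hin : Integrable (fun s => inner ℝ v (n s)) D := h.integrable.const_inner v
  by_cases hv : 4 * ‖v‖ ^ 2 * σ ^ 2 ≤ 1
  · obtain ⟨h1, h2⟩ := h.exp_mul hσ (q := 4 * ‖v‖ ^ 2 * σ ^ 2) (by positivity) hv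
    have hb : ∀ s, Real.exp (2 * inner ℝ v (n s)) ≤ 2 * inner ℝ v (n s) +
        Real.exp (4 * ‖v‖ ^ 2 * σ ^ 2 * (‖n s‖ ^ 2 / σ ^ 2)) := fun s => by
      refine (exp_le_add_exp_sq _).trans (add_le_add_right (Real.exp_le_exp.2 ?_) _)
      have h3 := abs_real_inner_le_norm v (n s)
      have h4 : inner ℝ v (n s) ^ 2 ≤ (‖v‖ * ‖n s‖) ^ 2 := by
        rw [← sq_abs]; gcongr
      calc _ = 4 * inner ℝ v (n s) ^ 2 := by ring
        _ ≤ 4 * (‖v‖ * ‖n s‖) ^ 2 := by gcongr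
        _ = _ := by field_simp
    have hi2 := (hin.const_mul 2).add h1
    have hi : Integrable (fun s => Real.exp (2 * inner ℝ v (n s))) D :=
      hi2.mono' (by fun_prop) (Filter.Eventually.of_forall fun s => by
        rw [Real.norm_of_nonneg (Real.exp_pos _).le]; exact hb s)
    refine ⟨hi, (integral_mono hi hi2 hb).trans ?_⟩
    simp only [Pi.add_apply]
    rw [integral_add (hin.const_mul 2) h1, integral_const_mul, integral_inner h.integrable, h.mean,
      inner_zero_right, mul_zero, zero_add]
    exact h2.trans_eq (by ring_nf)
  · have hint := h.integrable_exp hσ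
    have hb : ∀ s, Real.exp (2 * inner ℝ v (n s)) ≤
        Real.exp (‖v‖ ^ 2 * σ ^ 2) * Real.exp (‖n s‖ ^ 2 / σ ^ 2) := fun s => by
      rw [← Real.exp_add]
      refine Real.exp_le_exp.2 ?_
      have h3 := real_inner_le_norm v (n s)
      have h4 : 0 ≤ (‖v‖ * σ - ‖n s‖ / σ) ^ 2 := sq_nonneg _
      have h5 : (‖v‖ * σ - ‖n s‖ / σ) ^ 2 =
          ‖v‖ ^ 2 * σ ^ 2 + ‖n s‖ ^ 2 / σ ^ 2 - 2 * (‖v‖ * ‖n s‖) := by field_simp; ring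
      linarith
    have hi2 := hint.const_mul (Real.exp (‖v‖ ^ 2 * σ ^ 2))
    have hi : Integrable (fun s => Real.exp (2 * inner ℝ v (n s))) D :=
      hi2.mono' (by fun_prop) (Filter.Eventually.of_forall fun s => by
        rw [Real.norm_of_nonneg (Real.exp_pos _).le]; exact hb s)
    refine ⟨hi, (integral_mono hi hi2 hb).trans ?_⟩
    rw [integral_const_mul]
    have h3 : (3 : ℝ) ≤ Real.exp 1.2 := by
      have := Real.quadratic_le_exp_of_nonneg (show (0 : ℝ) ≤ 1.2 by norm_num)
      have h4 : Real.exp 1.2 = Real.exp 0.6 * Real.exp 0.6 := by rw [← Real.exp_add]; norm_num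
      have h5 := Real.quadratic_le_exp_of_nonneg (show (0 : ℝ) ≤ 0.6 by norm_num)
      rw [h4]; nlinarith
    calc _ ≤ Real.exp (‖v‖ ^ 2 * σ ^ 2) * Real.exp 1.2 := by
          gcongr; exact (h.integral_exp_le_three hσ).trans h3
      _ = Real.exp (‖v‖ ^ 2 * σ ^ 2 + 1.2) := by rw [Real.exp_add]
      _ ≤ _ := Real.exp_le_exp.2 (by push Not at hv; linarith)

/-- Moment generating function of a light-tailed vector. -/
lemma LightTailed.exp_inner_add (h : LightTailed D n σ) (hσ : 0 < σ) (v : Vec d) {b : ℝ}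
    (hb0 : 0 ≤ b) (hb1 : 2 * b * σ ^ 2 ≤ 1) :
    Integrable (fun s => Real.exp (inner ℝ v (n s) + b * ‖n s‖ ^ 2)) D ∧
      ∫ s, Real.exp (inner ℝ v (n s) + b * ‖n s‖ ^ 2) ∂D
        ≤ Real.exp (8 * ‖v‖ ^ 2 * σ ^ 2 + 4 * b * σ ^ 2) := by
  have hm := h.meas
  obtain ⟨i1, l1⟩ := h.exp_inner hσ v
  obtain ⟨i2, l2⟩ := h.exp_mul hσ (q := 2 * b * σ ^ 2) (by positivity) hb1
  have hbd : ∀ s, Real.exp (inner ℝ v (n s) + b * ‖n s‖ ^ 2) ≤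
      1 / 2 * Real.exp (2 * inner ℝ v (n s)) +
      1 / 2 * Real.exp (2 * b * σ ^ 2 * (‖n s‖ ^ 2 / σ ^ 2)) := fun s => by
    have h := convexOn_exp.2 (mem_univ (2 * inner ℝ v (n s)))
      (mem_univ (2 * b * σ ^ 2 * (‖n s‖ ^ 2 / σ ^ 2)))
      (show (0 : ℝ) ≤ 1 / 2 by norm_num) (show (0 : ℝ) ≤ 1 / 2 by norm_num) (by norm_num)
    simp only [smul_eq_mul] at h
    refine le_trans (le_of_eq ?_) h
    congr 1
    field_simp
  have hi2 := (i1.const_mul (1 / 2)).add (i2.const_mul (1 / 2))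
  have hi : Integrable (fun s => Real.exp (inner ℝ v (n s) + b * ‖n s‖ ^ 2)) D :=
    hi2.mono' (by fun_prop) (Filter.Eventually.of_forall fun s => by
      rw [Real.norm_of_nonneg (Real.exp_pos _).le]; exact hbd s)
  refine ⟨hi, (integral_mono hi hi2 hbd).trans ?_⟩
  simp only [Pi.add_apply]
  rw [integral_add (i1.const_mul _) (i2.const_mul _), integral_const_mul, integral_const_mul]
  have h3 : Real.exp (8 * ‖v‖ ^ 2 * σ ^ 2) ≤ Real.exp (8 * ‖v‖ ^ 2 * σ ^ 2 + 4 * b * σ ^ 2) :=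
    Real.exp_le_exp.2 (le_add_of_nonneg_right (by positivity))
  have h4 : Real.exp (2 * (2 * b * σ ^ 2)) ≤ Real.exp (8 * ‖v‖ ^ 2 * σ ^ 2 + 4 * b * σ ^ 2) :=
    Real.exp_le_exp.2 (by nlinarith [mul_nonneg (sq_nonneg ‖v‖) (sq_nonneg σ)])
  linarith

end SubGaussian

/-! ### Random recursions driven by independent samples -/

section Iteration

open ProbabilityTheory

variable {σ A : Type*}

/-- The orbit of a time-dependent random recursion driven by the sequence `w`. -/
def orbit (f : ℕ → σ → A → σ) (s₀ : σ) (w : ℕ → A) : ℕ → σ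
  | 0 => s₀
  | t + 1 => f t (orbit f s₀ w t) (w t)

lemma orbit_congr (f : ℕ → σ → A → σ) (s₀ : σ) {w w' : ℕ → A} {t : ℕ}
    (h : ∀ i < t, w i = w' i) : orbit f s₀ w t = orbit f s₀ w' t := by
  induction t with
  | zero => rfl
  | succ t ih =>
    simp only [orbit]
    rw [ih fun i hi => h i (by omega), h t (by omega)]

variable [MeasurableSpace σ] [MeasurableSpace A]

lemma measurable_orbit {f : ℕ → σ → A → σ} (hf : ∀ t, Measurable (Function.uncurry (f t)))
    (s₀ : σ) (t : ℕ) : Measurable fun w : ℕ → A => orbit f s₀ w t := by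
  induction t with
  | zero => exact measurable_const
  | succ t ih =>
    exact (hf t).comp (ih.prodMk (measurable_pi_apply t))

/-- One step of the recursion is independent of the past. -/
lemma lintegral_orbit_succ {f : ℕ → σ → A → σ} (hf : ∀ t, Measurable (Function.uncurry (f t)))
    (μ : Measure A) [IsProbabilityMeasure μ] (s₀ : σ) (t : ℕ) {F : σ → A → ENNReal}
    (hF : Measurable (Function.uncurry F)) :
    ∫⁻ w, F (orbit f s₀ w t) (w t) ∂(Measure.infinitePi fun _ : ℕ => μ)
      = ∫⁻ w, ∫⁻ a, F (orbit f s₀ w t) a ∂μ ∂(Measure.infinitePi fun _ : ℕ => μ) := by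
  set ν := Measure.infinitePi fun _ : ℕ => μ
  have hA : Nonempty A := by
    by_contra h
    rw [not_nonempty_iff] at h
    have := measure_univ (μ := μ)
    rw [Set.eq_empty_of_isEmpty (Set.univ : Set A), measure_empty] at this
    exact zero_ne_one this
  obtain ⟨a0⟩ := hA
  have hO := measurable_orbit hf s₀ t
  have hind : IndepFun (fun w : ℕ → A => orbit f s₀ w t) (fun w => w t) ν := by
    have h1 : iIndepFun (fun i (w : ℕ → A) => w i) ν :=
      iIndepFun_infinitePi (X := fun _ a => a) (fun _ => measurable_id)
    have h2 := h1.indepFun_finset (Finset.range t) {t} (by simp) (fun i => measurable_pi_apply i)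
    -- The orbit at time t depends only on the samples before t. Extending these by an arbitrary
    -- point a0 exhibits it as a function of finitely many coordinates, disjoint from the coordinate
    -- t.
    let ext : ((Finset.range t) → A) → ℕ → A := fun r i =>
      if h : i ∈ Finset.range t then r ⟨i, h⟩ else a0
    have hext : Measurable ext := by
      refine measurable_pi_lambda _ fun i => ?_
      by_cases h : i ∈ Finset.range t
      · simp only [ext, h, dite_true]; exact measurable_pi_apply _
      · simp only [ext, h, dite_false]; exact measurable_const
    have e1 : (fun w : ℕ → A => orbit f s₀ w t) = (fun r => orbit f s₀ (ext r) t) ∘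
        fun w (i : Finset.range t) => w i := by
      funext w
      refine orbit_congr f s₀ fun i hi => ?_
      simp [ext, hi]
    have e2 : (fun w : ℕ → A => w t) =
        (fun r : ({t} : Finset ℕ) → A => r ⟨t, Finset.mem_singleton_self t⟩) ∘
        fun w (i : ({t} : Finset ℕ)) => w i := rfl
    rw [e1, e2]
    exact h2.comp (hO.comp hext) (measurable_pi_apply _)
  have hpt : Measurable fun w : ℕ → A => w t := measurable_pi_apply t
  have hmap := (indepFun_iff_map_prod_eq_prod_map_map hO.aemeasurable hpt.aemeasurable).1 hind
  rw [show ν.map (fun w => w t) = μ from Measure.infinitePi_map_eval _ t] at hmap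
  calc ∫⁻ w, F (orbit f s₀ w t) (w t) ∂ν
      = ∫⁻ p, Function.uncurry F p ∂(ν.map fun w => (orbit f s₀ w t, w t)) := by
        rw [lintegral_map hF (hO.prodMk hpt)]; rfl
    _ = ∫⁻ s, ∫⁻ a, F s a ∂μ ∂(ν.map fun w => orbit f s₀ w t) := by
        rw [hmap, lintegral_prod _ hF.aemeasurable]; rfl
    _ = _ := by
        rw [lintegral_map (Measurable.lintegral_prod_right hF) hO]

end Iteration

/-! ### The stochastic lower-level step and the warm start -/

section LowerStep

open Set Filter Topology Consts

variable {dx dy : ℕ} {Ξ Z : Type*} {c : Consts} {P : Problem dx dy Ξ Z}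
  [MeasurableSpace Ξ] [MeasurableSpace Z] {Df : Measure Ξ} {Dg : Measure Z}
  [IsProbabilityMeasure Dg]

lemma OracleAssumption.lightTailed (ho : OracleAssumption c P Df Dg) (x : Vec dx) (y : Vec dy) :
    LightTailed Dg (fun s => P.Gy x y s - gradY P.g x y) c.σg1 where
  meas := by
    have h : Measurable fun s => P.Gy x y s :=
      ho.meas_Gy.comp (measurable_const.prodMk (measurable_const.prodMk measurable_id))
    exact h.sub_const _
  integrable := (ho.unbiased_Gy x y).1.sub (integrable_const _)
  mean := by
    rw [integral_sub (ho.unbiased_Gy x y).1 (integrable_const _), (ho.unbiased_Gy x y).2]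
    simp
  tail := ho.tail_Gy x y

omit [MeasurableSpace Ξ] [MeasurableSpace Z] in
-- A unit vector compares μ with l_{g,1} through the Hessian. When `dy` is zero there is none and μ
-- may exceed l_{g,1}; every lower-level error then vanishes.
lemma LowerLevel.mu_le_or (hc : c.Valid) (hl : LowerLevel c P) :
    c.μ ≤ c.lg1 ∨ ∀ y : Vec dy, y = 0 := by
  by_contra hcon
  push Not at hcon
  obtain ⟨h1, y, hy⟩ := hcon
  have h2 := (hl.norm_le_hessYY 0 0 y).trans
    ((hessYY P.g 0 0).le_of_opNorm_le (hl.norm_hessYY_le hc 0 0) y)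
  have := norm_pos_iff.2 hy
  nlinarith

/-- Exponential moment of the lower-level error after one stochastic gradient step. -/
lemma lintegral_exp_lowerStep (hc : c.Valid) (hl : LowerLevel c P)
    (ho : OracleAssumption c P Df Dg) {a l : ℝ} (ha : 0 < a) (ha1 : a * c.lg1 ≤ 1)
    (ha2 : a * c.μ ≤ 1 / 2) (hl0 : 0 ≤ l) (hl1 : 64 * (l * a * c.σg1 ^ 2) ≤ c.μ)
    (x : Vec dx) (y : Vec dy) :
    ∫⁻ s, ENNReal.ofReal (Real.exp (l * ‖y - a • P.Gy x y s - P.yStar x‖ ^ 2)) ∂Dg ≤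
      ENNReal.ofReal (Real.exp (l * (1 - a * c.μ / 2) * ‖y - P.yStar x‖ ^ 2
        + 4 * l * a ^ 2 * c.σg1 ^ 2)) := by
  have hμ := hc.μ_pos
  have hn := ho.lightTailed x y
  set n := fun s => P.Gy x y s - gradY P.g x y with hn_def
  set u := y - a • gradY P.g x y - P.yStar x with hu
  have hu1 : ‖u‖ ≤ (1 - a * c.μ) * ‖y - P.yStar x‖ :=
    hl.norm_gradStep_le hc ha ha1 (by linarith) x y
  have hb1 : 2 * (l * a ^ 2) * c.σg1 ^ 2 ≤ 1 := by
    have := mul_le_mul_of_nonneg_left hl1 ha.le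
    nlinarith
  obtain ⟨i1, l1⟩ := hn.exp_inner_add hc.σg1_pos (-(2 * l * a) • u) (b := l * a ^ 2)
    (by positivity) hb1
  have e1 : ∀ s, l * ‖y - a • P.Gy x y s - P.yStar x‖ ^ 2 =
      l * ‖u‖ ^ 2 + (inner ℝ (-(2 * l * a) • u) (n s) + l * a ^ 2 * ‖n s‖ ^ 2) := by
    intro s
    have : y - a • P.Gy x y s - P.yStar x = u - a • n s := by
      simp only [hu, hn_def, smul_sub]; abel
    rw [this, norm_sub_sq_real, norm_smul, inner_smul_left, inner_smul_right,
      Real.norm_of_nonneg ha.le]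
    simp
    ring
  simp_rw [e1, Real.exp_add (l * ‖u‖ ^ 2)]
  rw [← ofReal_integral_eq_lintegral_ofReal (i1.const_mul _)
    (Filter.Eventually.of_forall fun s => by positivity), integral_const_mul]
  refine ENNReal.ofReal_le_ofReal ?_
  calc _ ≤ Real.exp (l * ‖u‖ ^ 2) * _ := mul_le_mul_of_nonneg_left l1 (Real.exp_pos _).le
    _ = Real.exp (l * ‖u‖ ^ 2 + (8 * ‖-(2 * l * a) • u‖ ^ 2 * c.σg1 ^ 2
        + 4 * (l * a ^ 2) * c.σg1 ^ 2)) := (Real.exp_add _ _).symm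
    _ ≤ _ := by
      refine Real.exp_le_exp.2 ?_
      rw [norm_smul, norm_neg, Real.norm_of_nonneg (by positivity)]
      -- The noise contributes 32 l²a²σ²‖u‖², which the cap on l bounds by half of the contraction
      -- aμ. The factor (1 + aμ/2)(1 - aμ)² is still at most 1 - aμ/2.
      have h1 : 8 * (2 * l * a * ‖u‖) ^ 2 * c.σg1 ^ 2 ≤ l * (a * c.μ / 2) * ‖u‖ ^ 2 := by
        have := mul_le_mul_of_nonneg_left hl1 (show 0 ≤ l * a / 2 * ‖u‖ ^ 2 by positivity)
        nlinarith
      have h2 : ‖u‖ ^ 2 ≤ (1 - a * c.μ) ^ 2 * ‖y - P.yStar x‖ ^ 2 := by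
        rw [← mul_pow]; gcongr
      have hk : 0 < a * c.μ := by positivity
      have h3 : (1 + a * c.μ / 2) * ‖u‖ ^ 2 ≤ (1 - a * c.μ / 2) * ‖y - P.yStar x‖ ^ 2 := by
        have h4 : (1 + a * c.μ / 2) * (1 - a * c.μ) ^ 2 ≤ 1 - a * c.μ / 2 := by
          nlinarith [mul_pos hk hk]
        calc _ ≤ (1 + a * c.μ / 2) * ((1 - a * c.μ) ^ 2 * ‖y - P.yStar x‖ ^ 2) := by gcongr
          _ = ((1 + a * c.μ / 2) * (1 - a * c.μ) ^ 2) * ‖y - P.yStar x‖ ^ 2 := by ring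
          _ ≤ _ := by gcongr
      have h5 := mul_le_mul_of_nonneg_left h3 hl0
      nlinarith

omit [IsProbabilityMeasure Dg] in
lemma measurable_lowerStep (ho : OracleAssumption c P Df Dg) (x : Vec dx) (a : ℝ) :
    Measurable (Function.uncurry fun (y : Vec dy) (s : Z) => y - a • P.Gy x y s) := by
  have h : Measurable fun p : Vec dy × Z => P.Gy x p.1 p.2 :=
    ho.meas_Gy.comp (measurable_const.prodMk (measurable_fst.prodMk measurable_snd))
  exact measurable_fst.sub (h.const_smul a)

omit [MeasurableSpace Ξ] [MeasurableSpace Z] in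
lemma sgdDD_eq_orbit (x₀ : Vec dx) (y₀ : Vec dy) (a : ℝ) (s : ℕ → Z) (n : ℕ) :
    (sgdDD P (fun _ => x₀) y₀ a s n).1
      = orbit (fun _ (y : Vec dy) s => y - a • P.Gy x₀ y s) y₀ s n := by
  induction n with
  | zero => rfl
  | succ n ih => simp only [sgdDD, orbit, ih]

omit [MeasurableSpace Ξ] [MeasurableSpace Z] in
lemma sgdDD_calls (xs : ℕ → Vec dx) (y₀ : Vec dy) (a : ℝ) (s : ℕ → Z) (n : ℕ) :
    (sgdDD P xs y₀ a s n).2 = n := by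
  induction n with
  | zero => rfl
  | succ n ih => simp only [sgdDD, ih]

/-- Exponential moment bound for plain stochastic gradient descent on the lower level. -/
lemma lintegral_exp_sgd (hc : c.Valid) (hl : LowerLevel c P)
    (ho : OracleAssumption c P Df Dg) {a l : ℝ} (ha : 0 < a) (ha1 : a * c.lg1 ≤ 1)
    (ha2 : a * c.μ ≤ 1 / 2) (hl0 : 0 ≤ l) (hl1 : 64 * (l * a * c.σg1 ^ 2) ≤ c.μ)
    (x : Vec dx) (y₀ : Vec dy) (n : ℕ) :
    ∫⁻ s, ENNReal.ofReal (Real.exp (l * (‖(sgdDD P (fun _ => x) y₀ a s n).1 - P.yStar x‖ ^ 2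
      - (1 - a * c.μ / 2) ^ n * ‖y₀ - P.yStar x‖ ^ 2))) ∂(Measure.infinitePi fun _ : ℕ => Dg)
      ≤ ENNReal.ofReal 2 := by
  simp_rw [sgdDD_eq_orbit]
  set k := a * c.μ / 2 with hk
  have hk0 : 0 < k := by have := hc.μ_pos; positivity
  have hf : ∀ _ : ℕ, Measurable (Function.uncurry fun (y : Vec dy) (s : Z) => y - a • P.Gy x y s) :=
    fun _ => measurable_lowerStep ho x a
  induction n with
  | zero => simp [orbit]
  | succ n ih =>
    set r := (1 - k) ^ n * ‖y₀ - P.yStar x‖ ^ 2 with hr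
    have hFm : Measurable (Function.uncurry fun (y : Vec dy) (s : Z) => ENNReal.ofReal
        (Real.exp (l * (‖y - a • P.Gy x y s - P.yStar x‖ ^ 2
          - (1 - k) ^ (n + 1) * ‖y₀ - P.yStar x‖ ^ 2)))) := by
      have h1 := hf 0
      have : Measurable fun v : Vec dy => ENNReal.ofReal
        (Real.exp (l * (‖v - P.yStar x‖ ^ 2 - (1 - k) ^ (n + 1) * ‖y₀ - P.yStar x‖ ^ 2))) := by
        fun_prop
      exact this.comp h1
    rw [show (fun s : ℕ → Z => ENNReal.ofReal (Real.exp (l * (‖orbit (fun _ (y : Vec dy) s =>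
        y - a • P.Gy x y s) y₀ s (n + 1) - P.yStar x‖ ^ 2
        - (1 - k) ^ (n + 1) * ‖y₀ - P.yStar x‖ ^ 2)))) = fun s => (fun (y : Vec dy) (s : Z) =>
        ENNReal.ofReal (Real.exp (l * (‖y - a • P.Gy x y s - P.yStar x‖ ^ 2
          - (1 - k) ^ (n + 1) * ‖y₀ - P.yStar x‖ ^ 2)))) (orbit (fun _ (y : Vec dy) s =>
        y - a • P.Gy x y s) y₀ s n) (s n) from rfl,
      lintegral_orbit_succ hf Dg y₀ n hFm]
    have hone : ∀ y : Vec dy, ∫⁻ s, ENNReal.ofReal (Real.exp (l *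
        (‖y - a • P.Gy x y s - P.yStar x‖ ^ 2
          - (1 - k) ^ (n + 1) * ‖y₀ - P.yStar x‖ ^ 2))) ∂Dg ≤
        ENNReal.ofReal (Real.exp (k / 8) * (1 - k)) *
          ENNReal.ofReal (Real.exp (l * (‖y - P.yStar x‖ ^ 2 - r)))
        + ENNReal.ofReal (Real.exp (k / 8) * k) := by
      intro y
      have e1 : ∀ s, ENNReal.ofReal (Real.exp (l * (‖y - a • P.Gy x y s - P.yStar x‖ ^ 2
          - (1 - k) ^ (n + 1) * ‖y₀ - P.yStar x‖ ^ 2))) =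
          ENNReal.ofReal (Real.exp (-(l * ((1 - k) * r)))) *
          ENNReal.ofReal (Real.exp (l * ‖y - a • P.Gy x y s - P.yStar x‖ ^ 2)) := fun s => by
        rw [← ENNReal.ofReal_mul (Real.exp_pos _).le, ← Real.exp_add]
        congr 2; rw [hr]; ring
      simp_rw [e1]
      rw [lintegral_const_mul' _ _ ENNReal.ofReal_ne_top]
      refine (mul_le_mul_right
        (lintegral_exp_lowerStep hc hl ho ha ha1 ha2 hl0 hl1 x y) _).trans ?_
      have hk1 : k ≤ 1 / 4 := by rw [hk]; linarith
      rw [← ENNReal.ofReal_mul (Real.exp_pos _).le, ← Real.exp_add,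
        ← ENNReal.ofReal_mul (mul_nonneg (Real.exp_pos _).le (by linarith)),
        ← ENNReal.ofReal_add (mul_nonneg (mul_nonneg (Real.exp_pos _).le (by linarith))
          (Real.exp_pos _).le) (by positivity)]
      · refine ENNReal.ofReal_le_ofReal ?_
        -- Convexity turns e^{(1-k)X} into (1-k)e^X + k, an affine recursion for the exponential
        -- moment.
        have h1 := exp_mul_le (q := 1 - k) (x := l * (‖y - P.yStar x‖ ^ 2 - r))
          (by linarith) (by linarith)
        have h2 : 4 * l * a ^ 2 * c.σg1 ^ 2 ≤ k / 8 := by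
          have := mul_le_mul_of_nonneg_left hl1 ha.le
          rw [hk]; nlinarith
        calc _ ≤ Real.exp (k / 8 + (1 - k) * (l * (‖y - P.yStar x‖ ^ 2 - r))) :=
              Real.exp_le_exp.2 (by rw [← hk]; linarith)
          _ = Real.exp (k / 8) * Real.exp ((1 - k) * (l * (‖y - P.yStar x‖ ^ 2 - r))) :=
              Real.exp_add _ _
          _ ≤ Real.exp (k / 8) * (1 + (1 - k) * (Real.exp (l * (‖y - P.yStar x‖ ^ 2 - r)) - 1)) :=
              by gcongr
          _ = _ := by ring
    refine (lintegral_mono fun s => hone _).trans ?_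
    have hk1 : k ≤ 1 / 4 := by rw [hk]; linarith
    rw [lintegral_add_right _ measurable_const, lintegral_const_mul' _ _ ENNReal.ofReal_ne_top]
    simp only [lintegral_const, measure_univ, mul_one]
    refine (add_le_add_left (mul_le_mul_right ih _) _).trans ?_
    rw [← ENNReal.ofReal_mul (mul_nonneg (Real.exp_pos _).le (by linarith)),
      ← ENNReal.ofReal_add (mul_nonneg (mul_nonneg (Real.exp_pos _).le (by linarith)) (by norm_num))
        (by positivity)]
    refine ENNReal.ofReal_le_ofReal ?_
    -- The value 2 is preserved by the recursion: e^{k/8}(2(1-k) + k) = e^{k/8}(2 - k) ≤ 2.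
    have h3 : Real.exp (k / 8) ≤ 1 / (1 - k / 8) := by
      have := Real.one_sub_le_exp_neg (k / 8)
      rw [Real.exp_neg] at this
      rw [one_div]
      exact (le_inv_comm₀ (by linarith) (Real.exp_pos _)).1 this
    calc _ = Real.exp (k / 8) * (2 - k) := by ring
      _ ≤ 1 / (1 - k / 8) * (2 - k) := by gcongr; linarith
      _ ≤ 2 := by rw [one_div, inv_mul_le_iff₀ (by linarith)]; linarith

lemma alphaInit_pos (hc : c.Valid) {δ : ℝ} (hδ : 0 < δ) (hδ1 : δ < 1) : 0 < alphaInit c δ := by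
  have h1 := hc.μ_pos
  have h2 := hc.lg1_pos
  have h3 := hc.σg1_pos
  have h4 := L1_pos hc
  have h5 : 0 < Real.log (Real.exp 1 / δ) := Real.log_pos (by
    rw [lt_div_iff₀ hδ]; linarith [Real.add_one_le_exp (1 : ℝ)])
  rw [alphaInit]
  positivity

/-- The warm start reaches the region where the relaxed smoothness is effective. -/
lemma measure_warmStart_le (hc : c.Valid) (hl : LowerLevel c P)
    (ho : OracleAssumption c P Df Dg) {δ : ℝ} (hδ : 0 < δ) (hδ1 : δ < 1)
    (x₀ : Vec dx) (yInit : Vec dy) :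
    (Measure.infinitePi fun _ : ℕ => Dg) {s | ¬ c.L1 * ‖(sgdDD P (fun _ => x₀) yInit
      (alphaInit c δ) s (warmSteps c δ ‖yInit - P.yStar x₀‖)).1 - P.yStar x₀‖ ≤ 1 / 5}
      ≤ ENNReal.ofReal δ := by
  have hμ := hc.μ_pos
  have hlg := hc.lg1_pos
  have hσ := hc.σg1_pos
  have hL1 := L1_pos hc
  rcases hl.mu_le_or hc with hml | h0
  swap
  · simp [h0]
  have ha := alphaInit_pos hc hδ hδ1
  set a := alphaInit c δ with ha_def
  set r := ‖yInit - P.yStar x₀‖ with hr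
  set n := warmSteps c δ r with hn
  have hlog1 : 0 < Real.log (Real.exp 1 / δ) := Real.log_pos (by
    rw [lt_div_iff₀ hδ]; linarith [Real.add_one_le_exp (1 : ℝ)])
  set Lg := Real.log (Real.exp 1 / δ) with hLg
  have ha1 : a * c.lg1 ≤ 1 / 2 := by
    have : a ≤ 1 / (2 * c.lg1) := min_le_left _ _
    calc _ ≤ 1 / (2 * c.lg1) * c.lg1 := by gcongr
      _ = 1 / 2 := by field_simp
  have ha2 : a * c.μ ≤ 1 / 2 := le_trans (by gcongr) ha1
  have ha3 : a * (2048 * c.L1 ^ 2 * c.σg1 ^ 2 * Lg) ≤ c.μ := by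
    have : a ≤ c.μ / (2048 * c.L1 ^ 2 * c.σg1 ^ 2 * Lg) := min_le_right _ _
    rwa [le_div_iff₀ (by positivity)] at this
  -- The largest exponent allowed by `lintegral_exp_sgd`. The second entry of `alphaInit` then reads
  -- l/(32 L₁²) ≥ log(e/δ), with 2048 = 64 · 32, and Markov's inequality yields 2δ/e ≤ δ.
  set l := c.μ / (64 * a * c.σg1 ^ 2) with hl_def
  have hl0 : 0 < l := by positivity
  have hE := lintegral_exp_sgd hc hl ho ha (by linarith) ha2 hl0.le
    (le_of_eq (by rw [hl_def]; field_simp)) x₀ yInit n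
  have hdecay : (1 - a * c.μ / 2) ^ n * r ^ 2 ≤ 1 / (256 * c.L1 ^ 2) := by
    rcases (norm_nonneg (yInit - P.yStar x₀)).eq_or_lt with h0 | h0
    · rw [← hr] at h0
      rw [← h0]; simp only [ne_eq, OfNat.ofNat_ne_zero, not_false_eq_true, zero_pow, mul_zero]
      positivity
    · rw [← hr] at h0
      have hk : 0 < 1 - a * c.μ / 2 := by linarith
      have h1 : 0 < Real.log (2 / (2 - c.μ * a)) := Real.log_pos (by
        rw [lt_div_iff₀ (by linarith)]; nlinarith)
      have h2 : Real.log (256 * c.L1 ^ 2 * r ^ 2) ≤ n * Real.log (2 / (2 - c.μ * a)) := by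
        have := Nat.le_ceil (Real.log (256 * c.L1 ^ 2 * r ^ 2) / Real.log (2 / (2 - c.μ * a)))
        rwa [div_le_iff₀ h1] at this
      have h3 : 2 / (2 - c.μ * a) = (1 - a * c.μ / 2)⁻¹ := by
        rw [← one_div, div_eq_div_iff (by linarith) hk.ne']; ring
      rw [h3, Real.log_inv, mul_neg, ← Real.log_pow, ← Real.log_inv] at h2
      have h4 := (Real.log_le_log_iff (by positivity) (by positivity)).1 h2
      rw [le_inv_comm₀ (by positivity) (by positivity)] at h4
      rw [le_div_iff₀ (by positivity)]
      calc _ = (1 - a * c.μ / 2) ^ n * (256 * c.L1 ^ 2 * r ^ 2) := by ring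
        _ ≤ (256 * c.L1 ^ 2 * r ^ 2)⁻¹ * (256 * c.L1 ^ 2 * r ^ 2) := by gcongr
        _ = 1 := inv_mul_cancel₀ (by positivity)
  have hsub : {s | ¬ c.L1 * ‖(sgdDD P (fun _ => x₀) yInit a s n).1 - P.yStar x₀‖ ≤ 1 / 5} ⊆
      {s | ENNReal.ofReal (Real.exp 1 / δ) ≤ ENNReal.ofReal (Real.exp (l *
        (‖(sgdDD P (fun _ => x₀) yInit a s n).1 - P.yStar x₀‖ ^ 2
          - (1 - a * c.μ / 2) ^ n * r ^ 2)))} := by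
    intro s hs
    simp only [mem_ofPred_eq, not_le] at hs ⊢
    refine ENNReal.ofReal_le_ofReal ?_
    rw [← Real.exp_log (show 0 < Real.exp 1 / δ by positivity), ← hLg]
    refine Real.exp_le_exp.2 ?_
    set D := ‖(sgdDD P (fun _ => x₀) yInit a s n).1 - P.yStar x₀‖
    have h1 : 1 / 25 < c.L1 ^ 2 * D ^ 2 := by
      rw [← mul_pow]; nlinarith
    -- The square of the forbidden radius exceeds 1/(25 L₁²); the decayed initial error takes 1/(256
    -- L₁²), and 1/25 ≥ 1/32 + 1/256.
    have h2 : 1 / (32 * c.L1 ^ 2) ≤ D ^ 2 - (1 - a * c.μ / 2) ^ n * r ^ 2 := by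
      have h3 : 1 / (32 * c.L1 ^ 2) + 1 / (256 * c.L1 ^ 2) ≤ D ^ 2 := by
        rw [show 1 / (32 * c.L1 ^ 2) + 1 / (256 * c.L1 ^ 2) = (9 / 256) / c.L1 ^ 2 by
          field_simp; norm_num, div_le_iff₀ (by positivity)]
        linarith
      linarith
    calc Lg ≤ l * (1 / (32 * c.L1 ^ 2)) := by
          rw [hl_def, div_mul_div_comm, mul_one, le_div_iff₀ (by positivity)]
          linarith
      _ ≤ _ := by gcongr
  refine (measure_mono hsub).trans ?_
  refine (meas_ge_le_lintegral_div (Measurable.aemeasurable ?_) (by positivity)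
    ENNReal.ofReal_ne_top).trans ?_
  · simp_rw [sgdDD_eq_orbit]
    have := measurable_orbit (f := fun _ (y : Vec dy) (s : Z) => y - a • P.Gy x₀ y s)
      (fun _ => measurable_lowerStep ho x₀ a) yInit n
    fun_prop
  · refine (ENNReal.div_le_div_right hE _).trans ?_
    rw [← ENNReal.ofReal_div_of_pos (by positivity)]
    refine ENNReal.ofReal_le_ofReal ?_
    rw [div_div_eq_mul_div, div_le_iff₀ (Real.exp_pos _)]
    nlinarith [Real.add_one_le_exp (1 : ℝ)]

end LowerStep

/-! ### One step of the auxiliary variable and of the momentum -/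

section UpperStep

open Set Filter Topology Consts

variable {dx dy : ℕ} {Ξ Z : Type*}

/-- The constants of the main loop satisfy the relations that the analysis uses; `q` is `1 - β`
and `l` the exponent in the exponential moment of the lower-level error. -/
structure Regime (c : Consts) (h : StepSizes) (ε q l : ℝ) : Prop where
  mu_le : c.μ ≤ c.lg1
  ε_pos : 0 < ε
  q_pos : 0 < q
  q_le : q ≤ 1 / 1000
  α_eq : h.α = 8 * (q / c.μ)
  β_eq : h.β = 1 - q
  γ_eq : h.γ = q / c.μ
  η_pos : 0 < h.η
  η_le : h.η ≤ 1 / c.invRadius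
  η_L0 : h.η * c.L0 ≤ ε * (q / 200)
  α_lg1 : h.α * c.lg1 ≤ 1
  L1_le : c.L1 * ε ≤ c.L0
  noise_le : 32 * (q * c.noise * c.lg1 ^ 2) ≤ c.μ ^ 2 * ε ^ 2
  σg2_le : 10 ^ 6 * (q * c.σg2 ^ 2) ≤ c.μ ^ 2
  l_pos : 0 < l
  l_α : 900 * (l * h.α * c.σg1 ^ 2) ≤ c.μ
  drift : l * (1 + 1 / q) * (c.lg1 / c.μ * h.η) ^ 2 ≤ 57 / 100 * q

lemma sq_add_le {a b t : ℝ} (ht : 0 < t) :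
    (a + b) ^ 2 ≤ (1 + t) * a ^ 2 + (1 + 1 / t) * b ^ 2 := by
  have h : 0 ≤ (t * a - b) ^ 2 / t := by positivity
  have e : (t * a - b) ^ 2 / t = t * a ^ 2 + 1 / t * b ^ 2 - 2 * a * b := by field_simp; ring
  nlinarith

/-- A smoothed norm. -/
noncomputable def smoothNorm {V : Type*} [NormedAddCommGroup V] (s : ℝ) (v : V) : ℝ :=
  √(‖v‖ ^ 2 + s ^ 2)

section smoothNorm

variable {V : Type*} [NormedAddCommGroup V] {s : ℝ}

lemma norm_le_smoothNorm (s : ℝ) (v : V) : ‖v‖ ≤ smoothNorm s v :=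
  Real.le_sqrt_of_sq_le (by nlinarith [sq_nonneg s])

lemma le_smoothNorm (s : ℝ) (v : V) : s ≤ smoothNorm s v :=
  Real.le_sqrt_of_sq_le (by nlinarith [sq_nonneg ‖v‖])

lemma smoothNorm_nonneg (s : ℝ) (v : V) : 0 ≤ smoothNorm s v := Real.sqrt_nonneg _

lemma smoothNorm_sq (s : ℝ) (v : V) : smoothNorm s v ^ 2 = ‖v‖ ^ 2 + s ^ 2 :=
  Real.sq_sqrt (by positivity)

lemma smoothNorm_le_add (hs : 0 ≤ s) (v : V) : smoothNorm s v ≤ ‖v‖ + s := by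
  refine Real.sqrt_le_iff.2 ⟨by positivity, ?_⟩
  nlinarith [norm_nonneg v]

lemma smoothNorm_le_of_sub (s : ℝ) (v w : V) : smoothNorm s v ≤ smoothNorm s w + ‖v - w‖ := by
  have h1 := norm_le_smoothNorm s w
  have h2 := smoothNorm_sq s w
  have h3 := smoothNorm_nonneg s w
  have h4 : ‖v‖ ≤ ‖w‖ + ‖v - w‖ := by
    have := norm_add_le w (v - w); rwa [add_sub_cancel] at this
  refine Real.sqrt_le_iff.2 ⟨by positivity, ?_⟩
  nlinarith [norm_nonneg v, norm_nonneg w, norm_nonneg (v - w)]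

end smoothNorm

section Noise

variable {W S T : Type*} [MeasurableSpace W] [MeasurableSpace S] [MeasurableSpace T]
  {D : Measure W} [IsProbabilityMeasure D] {DS : Measure S} {DT : Measure T}
  [IsProbabilityMeasure DS] [IsProbabilityMeasure DT] {d₁ d₂ : ℕ}

/-- A centered square-integrable random vector with a bound on its second moment. -/
structure Centered (D : Measure W) (ν : W → Vec d₁) (v : ℝ) : Prop where
  meas : Measurable ν
  integrable : Integrable ν D
  mean : ∫ w, ν w ∂D = 0
  sq_integrable : Integrable (fun w => ‖ν w‖ ^ 2) D
  sq_le : ∫ w, ‖ν w‖ ^ 2 ∂D ≤ v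

lemma Centered.norm_add_smul_sq {ν : W → Vec d₁} {v : ℝ} (h : Centered D ν v) (u : Vec d₁)
    (a : ℝ) : Integrable (fun w => ‖u + a • ν w‖ ^ 2) D ∧
      ∫ w, ‖u + a • ν w‖ ^ 2 ∂D ≤ ‖u‖ ^ 2 + a ^ 2 * v := by
  have e : ∀ w, ‖u + a • ν w‖ ^ 2 = ‖u‖ ^ 2 + 2 * a * inner ℝ u (ν w) + a ^ 2 * ‖ν w‖ ^ 2 := by
    intro w
    rw [norm_add_sq_real, norm_smul, inner_smul_right, mul_pow, Real.norm_eq_abs, sq_abs]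
    ring
  have i1 : Integrable (fun w => ‖u‖ ^ 2 + 2 * a * inner ℝ u (ν w)) D :=
    (integrable_const _).add ((h.integrable.const_inner u).const_mul _)
  have i2 := h.sq_integrable.const_mul (a ^ 2)
  simp_rw [e]
  refine ⟨i1.add i2, ?_⟩
  rw [integral_add i1 i2, integral_add (integrable_const _)
    ((h.integrable.const_inner u).const_mul _), integral_const_mul, integral_const_mul,
    integral_inner h.integrable, h.mean]
  simp only [integral_const, probReal_univ, smul_eq_mul, one_mul, inner_zero_right, mul_zero,
    add_zero]
  have := mul_le_mul_of_nonneg_left h.sq_le (sq_nonneg a)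
  linarith

omit [IsProbabilityMeasure DS] [IsProbabilityMeasure DT] in
-- Covers both estimators of the form oracle of f minus matrix oracle applied to z. The second
-- moment is bounded by (a + b)² ≤ 2a² + 2b², so no independence between the two samples enters.
lemma centered_sub {X : S → Vec d₁} {M : T → (Vec d₂ →L[ℝ] Vec d₁)} {x : Vec d₁}
    {A : Vec d₂ →L[ℝ] Vec d₁} {σ τ : ℝ} (hX : Measurable X) (hM : Measurable M)
    (hXu : Unbiased DS X x) (hMu : Unbiased DT M A) (hXv : VarianceLE DS X x σ)
    (hMv : VarianceLE DT M A τ) {f : W → S} {g : W → T} (hf : MeasurePreserving f D DS)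
    (hg : MeasurePreserving g D DT) (z : Vec d₂) :
    Centered D (fun w => (X (f w) - M (g w) z) - (x - A z)) (2 * σ ^ 2 + 2 * τ ^ 2 * ‖z‖ ^ 2) := by
  have hMz : Measurable fun t => M t z := by fun_prop
  have i1 : Integrable (fun w => X (f w)) D := hf.integrable_comp_of_integrable hXu.1
  have i2' : Integrable (fun t => M t z) DT := hMu.1.apply_continuousLinearMap z
  have i2 : Integrable (fun w => M (g w) z) D := hg.integrable_comp_of_integrable i2'
  have j1 : ∫ w, X (f w) ∂D = x := by
    rw [← hXu.2, ← hf.map_eq, integral_map hf.measurable.aemeasurable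
      hX.aestronglyMeasurable]
  have j2 : ∫ w, M (g w) z ∂D = A z := by
    have : ∫ w, M (g w) z ∂D = ∫ t, M t z ∂DT := by
      rw [← hg.map_eq, integral_map hg.measurable.aemeasurable hMz.aestronglyMeasurable]
    rw [this, ← ContinuousLinearMap.integral_apply hMu.1, hMu.2]
  have k1 : Integrable (fun w => ‖X (f w) - x‖ ^ 2) D := hf.integrable_comp_of_integrable hXv.1
  have k2 : Integrable (fun w => ‖M (g w) - A‖ ^ 2) D := hg.integrable_comp_of_integrable hMv.1
  have m1 : ∫ w, ‖X (f w) - x‖ ^ 2 ∂D ≤ σ ^ 2 := by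
    have : ∫ w, ‖X (f w) - x‖ ^ 2 ∂D = ∫ t, ‖X t - x‖ ^ 2 ∂DS := by
      rw [← hf.map_eq, integral_map hf.measurable.aemeasurable (by fun_prop)]
    rw [this]; exact hXv.2
  have m2 : ∫ w, ‖M (g w) - A‖ ^ 2 ∂D ≤ τ ^ 2 := by
    have : ∫ w, ‖M (g w) - A‖ ^ 2 ∂D = ∫ t, ‖M t - A‖ ^ 2 ∂DT := by
      rw [← hg.map_eq, integral_map hg.measurable.aemeasurable]
      exact ((hM.sub_const A).norm.pow_const 2).aestronglyMeasurable
    rw [this]; exact hMv.2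
  have hfm := hf.measurable
  have hgm := hg.measurable
  have hmeas : Measurable (fun w => (X (f w) - M (g w) z) - (x - A z)) :=
    ((hX.comp hfm).sub (hMz.comp hgm)).sub_const _
  have hb : ∀ w, ‖(X (f w) - M (g w) z) - (x - A z)‖ ^ 2 ≤
      2 * ‖X (f w) - x‖ ^ 2 + 2 * ‖z‖ ^ 2 * ‖M (g w) - A‖ ^ 2 := by
    intro w
    have e : (X (f w) - M (g w) z) - (x - A z) = (X (f w) - x) - (M (g w) - A) z := by
      rw [sub_apply]; abel
    have h1 : ‖(M (g w) - A) z‖ ≤ ‖M (g w) - A‖ * ‖z‖ := ContinuousLinearMap.le_opNorm _ _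
    have h2 : ‖(X (f w) - x) - (M (g w) - A) z‖ ≤ ‖X (f w) - x‖ + ‖M (g w) - A‖ * ‖z‖ :=
      (norm_sub_le _ _).trans (by gcongr)
    rw [e]
    calc _ ≤ (‖X (f w) - x‖ + ‖M (g w) - A‖ * ‖z‖) ^ 2 := by gcongr
      _ ≤ _ := by nlinarith [sq_nonneg (‖X (f w) - x‖ - ‖M (g w) - A‖ * ‖z‖)]
  have i3 := (k1.const_mul 2).add (k2.const_mul (2 * ‖z‖ ^ 2))
  have i4 : Integrable (fun w => ‖(X (f w) - M (g w) z) - (x - A z)‖ ^ 2) D :=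
    i3.mono' (hmeas.norm.pow_const 2).aestronglyMeasurable
      (Filter.Eventually.of_forall fun w => by
        rw [Real.norm_of_nonneg (by positivity)]; exact hb w)
  refine ⟨hmeas, (i1.sub i2).sub (integrable_const _), ?_, i4, ?_⟩
  · have i12 : Integrable (fun w => X (f w) - M (g w) z) D := i1.sub i2
    rw [integral_sub i12 (integrable_const _), integral_sub i1 i2, j1, j2]
    simp
  · refine (integral_mono i4 i3 hb).trans ?_
    simp only [Pi.add_apply]
    rw [integral_add (k1.const_mul 2) (k2.const_mul _), integral_const_mul, integral_const_mul]
    have := mul_le_mul_of_nonneg_left m2 (show 0 ≤ 2 * ‖z‖ ^ 2 by positivity)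
    linarith

end Noise

variable {c : Consts} {P : Problem dx dy Ξ Z} {h : StepSizes} {ε q l : ℝ}
  [MeasurableSpace Ξ] [MeasurableSpace Z] {Df : Measure Ξ} {Dg : Measure Z}
  [IsProbabilityMeasure Df] [IsProbabilityMeasure Dg]

/-- The law of the upper-level samples of one iteration. -/
noncomputable abbrev sampleLaw (Df : Measure Ξ) (Dg : Measure Z) : Measure ((Ξ × Ξ) × (Z × Z)) :=
  (Df.prod Df).prod (Dg.prod Dg)

/-- The direction estimate of the auxiliary update. -/
def zDir (P : Problem dx dy Ξ Z) (x : Vec dx) (y z : Vec dy) (w : (Ξ × Ξ) × (Z × Z)) : Vec dy :=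
  P.Gyy x y w.2.1 z - P.Fy x y w.1.1

/-- The stochastic hypergradient. -/
def hyperGrad (P : Problem dx dy Ξ Z) (x : Vec dx) (y z : Vec dy) (w : (Ξ × Ξ) × (Z × Z)) :
    Vec dx :=
  P.Fx x y w.1.2 - P.Gxy x y w.2.2 z

lemma centered_hyperGrad (ho : OracleAssumption c P Df Dg) (x : Vec dx) (y z : Vec dy) :
    Centered (sampleLaw Df Dg)
      (fun w => hyperGrad P x y z w - (gradX P.f x y - hessXY P.g x y z))
      (2 * c.σf1 ^ 2 + 2 * c.σg2 ^ 2 * ‖z‖ ^ 2) := by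
  refine centered_sub (f := fun w : (Ξ × Ξ) × (Z × Z) => w.1.2) (g := fun w => w.2.2)
    (DS := Df) (DT := Dg) (X := P.Fx x y) (M := P.Gxy x y) ?_ ?_ (ho.unbiased_Fx x y)
    (ho.unbiased_Gxy x y) (ho.var_Fx x y) (ho.var_Gxy x y) ?_ ?_ z
  · exact ho.meas_Fx.comp (measurable_const.prodMk (measurable_const.prodMk measurable_id))
  · exact ho.meas_Gxy.comp (measurable_const.prodMk (measurable_const.prodMk measurable_id))
  · exact measurePreserving_snd.comp measurePreserving_fst
  · exact measurePreserving_snd.comp measurePreserving_snd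

lemma centered_zDir (ho : OracleAssumption c P Df Dg) (x : Vec dx) (y z : Vec dy) :
    Centered (sampleLaw Df Dg)
      (fun w => -zDir P x y z w - (gradY P.f x y - hessYY P.g x y z))
      (2 * c.σf1 ^ 2 + 2 * c.σg2 ^ 2 * ‖z‖ ^ 2) := by
  simp only [zDir, neg_sub]
  refine centered_sub (f := fun w : (Ξ × Ξ) × (Z × Z) => w.1.1) (g := fun w => w.2.1)
    (DS := Df) (DT := Dg) (X := P.Fy x y) (M := P.Gyy x y) ?_ ?_ (ho.unbiased_Fy x y)
    (ho.unbiased_Gyy x y) (ho.var_Fy x y) (ho.var_Gyy x y) ?_ ?_ z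
  · exact ho.meas_Fy.comp (measurable_const.prodMk (measurable_const.prodMk measurable_id))
  · exact ho.meas_Gyy.comp (measurable_const.prodMk (measurable_const.prodMk measurable_id))
  · exact measurePreserving_fst.comp measurePreserving_fst
  · exact measurePreserving_fst.comp measurePreserving_snd

/-- The normalized lower-level error `(L₀/ε) d e^{a d}`. -/
noncomputable def lowerErr (c : Consts) (P : Problem dx dy Ξ Z) (ε : ℝ) (x : Vec dx) (y : Vec dy) :
    ℝ :=
  c.L0 / ε * (‖y - P.yStar x‖ * Real.exp (c.expRate * ‖y - P.yStar x‖))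

/-- The squared error of the auxiliary variable. -/
noncomputable def auxErr (c : Consts) (P : Problem dx dy Ξ Z) (x : Vec dx) (z : Vec dy) : ℝ :=
  c.lg1 ^ 2 * ‖z - P.zStar x‖ ^ 2

omit [MeasurableSpace Ξ] [MeasurableSpace Z] in
lemma auxErr_nonneg (x : Vec dx) (z : Vec dy) : 0 ≤ auxErr c P x z := by
  rw [auxErr]; positivity

omit [MeasurableSpace Ξ] [MeasurableSpace Z] in
lemma lowerErr_nonneg (hc : c.Valid) (hε : 0 < ε) (x : Vec dx) (y : Vec dy) :
    0 ≤ lowerErr c P ε x y := by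
  have := L0_pos hc
  rw [lowerErr]; positivity

omit [MeasurableSpace Ξ] [MeasurableSpace Z] in
-- The matrix oracle is applied to z, so its variance grows with ‖z‖. Splitting z around z*, of norm
-- at most l_{f,0}/μ, separates the constant `noise` from a term to be absorbed by the contraction
-- of z.
lemma variance_le (hc : c.Valid) (hl : LowerLevel c P) (x : Vec dx) (z : Vec dy) :
    2 * c.σf1 ^ 2 + 2 * c.σg2 ^ 2 * ‖z‖ ^ 2
      ≤ 2 * c.noise + 4 * c.σg2 ^ 2 * ‖z - P.zStar x‖ ^ 2 := by
  have h1 := hl.norm_zStar_le hc x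
  have h2 : ‖z‖ ≤ ‖z - P.zStar x‖ + c.lf0 / c.μ := by
    have := norm_add_le (z - P.zStar x) (P.zStar x)
    rw [sub_add_cancel] at this; linarith
  have h3 : ‖z‖ ^ 2 ≤ 2 * ‖z - P.zStar x‖ ^ 2 + 2 * (c.lf0 / c.μ) ^ 2 := by
    calc _ ≤ (‖z - P.zStar x‖ + c.lf0 / c.μ) ^ 2 := by gcongr
      _ ≤ _ := by nlinarith [sq_nonneg (‖z - P.zStar x‖ - c.lf0 / c.μ)]
  have h4 := mul_le_mul_of_nonneg_left h3 (show 0 ≤ 2 * c.σg2 ^ 2 by positivity)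
  have e : c.noise = c.σf1 ^ 2 + 2 * c.σg2 ^ 2 * (c.lf0 / c.μ) ^ 2 := by
    rw [Consts.noise, div_pow]; ring
  rw [e]
  linarith

/-- One step of the auxiliary variable. -/
lemma integral_auxErr_le (hc : c.Valid) (hs : RelaxedSmooth c P) (hl : LowerLevel c P)
    (ho : OracleAssumption c P Df Dg) (hr : Regime c h ε q l) (x : Vec dx) (y z : Vec dy) :
    Integrable (fun w => auxErr c P x (z - h.γ • zDir P x y z w)) (sampleLaw Df Dg) ∧
    ∫ w, auxErr c P x (z - h.γ • zDir P x y z w) ∂(sampleLaw Df Dg)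
      ≤ (1 - q + q / 10 ^ 5) * auxErr c P x z + q * ε ^ 2 * lowerErr c P ε x y ^ 2
        + q * ε ^ 2 / 16 := by
  have hμ := hc.μ_pos
  have hlg := hc.lg1_pos
  have hε := hr.ε_pos
  have hq := hr.q_pos
  have hq1 := hr.q_le
  have hcz := centered_zDir ho x y z
  set b := hessYY P.g x y (P.zStar x) - gradY P.f x y with hb
  set u := (z - P.zStar x) - h.γ • hessYY P.g x y (z - P.zStar x) - h.γ • b with hu
  obtain ⟨i1, l1⟩ := hcz.norm_add_smul_sq u h.γ
  have e : ∀ w, auxErr c P x (z - h.γ • zDir P x y z w) = c.lg1 ^ 2 *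
      ‖u + h.γ • (-zDir P x y z w - (gradY P.f x y - hessYY P.g x y z))‖ ^ 2 := by
    intro w
    rw [auxErr]
    congr 3
    simp only [hu, hb, map_sub, smul_sub, smul_neg]
    abel
  simp_rw [e]
  refine ⟨i1.const_mul _, ?_⟩
  rw [integral_const_mul]
  have hγ : 0 < h.γ := by rw [hr.γ_eq]; positivity
  have hγμ : h.γ * c.μ = q := by rw [hr.γ_eq]; field_simp
  have hγl : h.γ * c.lg1 ≤ 1 := by
    have := hr.α_lg1
    rw [hr.α_eq, ← hr.γ_eq] at this
    nlinarith [mul_pos hγ hlg]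
  have h1 := hl.norm_sub_smul_hessYY_le hc hγ hγl (by rw [hγμ]; linarith) x y (z - P.zStar x)
  rw [hγμ] at h1
  have h2 : c.lg1 * (h.γ * ‖b‖) ≤ q * (ε * lowerErr c P ε x y) := by
    have h3 := zBias_le hc hs hl x y
    have e1 : ε * lowerErr c P ε x y =
        c.L0 * (‖y - P.yStar x‖ * Real.exp (c.expRate * ‖y - P.yStar x‖)) := by
      rw [lowerErr]; field_simp
    rw [e1, hr.γ_eq]
    calc _ = q * (c.lg1 / c.μ * ‖b‖) := by ring
      _ ≤ _ := by gcongr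
  set A := c.lg1 * ‖z - P.zStar x‖ with hA
  set F := ε * lowerErr c P ε x y with hF
  have h3 : c.lg1 * ‖u‖ ≤ (1 - q) * A + q * F := by
    have h4 : ‖u‖ ≤ (1 - q) * ‖z - P.zStar x‖ + h.γ * ‖b‖ := by
      refine (norm_sub_le _ _).trans ?_
      rw [norm_smul, Real.norm_of_nonneg hγ.le]
      linarith
    have := mul_le_mul_of_nonneg_left h4 hlg.le
    rw [hA]; nlinarith
  have hA2 : auxErr c P x z = A ^ 2 := by rw [auxErr, hA]; ring
  -- Convexity of the square with weights 1 - q and q: the contraction 1 - q is kept in full and the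
  -- squared bias enters only with weight q.
  have h5 : c.lg1 ^ 2 * ‖u‖ ^ 2 ≤ (1 - q) * A ^ 2 + q * F ^ 2 := by
    calc _ = (c.lg1 * ‖u‖) ^ 2 := by ring
      _ ≤ ((1 - q) * A + q * F) ^ 2 := by gcongr
      _ ≤ _ := by
        have : 0 ≤ q * (1 - q) * (A - F) ^ 2 := by
          have : 0 ≤ 1 - q := by linarith
          positivity
        nlinarith
  have h6 := variance_le hc hl x z
  have h7 : c.lg1 ^ 2 * (h.γ ^ 2 * (2 * c.σf1 ^ 2 + 2 * c.σg2 ^ 2 * ‖z‖ ^ 2)) ≤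
      q / 10 ^ 5 * A ^ 2 + q * ε ^ 2 / 16 := by
    have h8 : q * (q * c.noise * c.lg1 ^ 2) / c.μ ^ 2 ≤ q * ε ^ 2 / 32 := by
      rw [div_le_iff₀ (by positivity)]
      have := mul_le_mul_of_nonneg_left hr.noise_le hq.le
      linarith
    have h9 : q * (q * c.σg2 ^ 2) * A ^ 2 / c.μ ^ 2 ≤ q / 10 ^ 6 * A ^ 2 := by
      rw [div_le_iff₀ (by positivity)]
      have := mul_le_mul_of_nonneg_left hr.σg2_le (show 0 ≤ q * A ^ 2 by positivity)
      nlinarith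
    calc _ ≤ c.lg1 ^ 2 * (h.γ ^ 2 * (2 * c.noise + 4 * c.σg2 ^ 2 * ‖z - P.zStar x‖ ^ 2)) := by
          gcongr
      _ = 2 * (q * (q * c.noise * c.lg1 ^ 2) / c.μ ^ 2)
          + 4 * (q * (q * c.σg2 ^ 2) * A ^ 2 / c.μ ^ 2) := by
          rw [hr.γ_eq, hA]; ring
      _ ≤ _ := by
        have : 0 ≤ q * A ^ 2 := by positivity
        linarith
  have h10 := mul_le_mul_of_nonneg_left l1 (sq_nonneg c.lg1)
  rw [hA2]
  rw [mul_add] at h10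
  have e2 : q * ε ^ 2 * lowerErr c P ε x y ^ 2 = q * F ^ 2 := by rw [hF]; ring
  rw [e2]
  linarith

set_option maxHeartbeats 400000 in
/-- One step of the momentum, measured against the gradient at the old point. -/
lemma integral_smoothNorm_le (hc : c.Valid) (hs : RelaxedSmooth c P) (hl : LowerLevel c P)
    (ho : OracleAssumption c P Df Dg) (hr : Regime c h ε q l) (x : Vec dx) (y z : Vec dy)
    (m : Vec dx) :
    Integrable (fun w => smoothNorm (ε / 4)
      (h.β • m + (1 - h.β) • hyperGrad P x y z w - gradient P.Φ x)) (sampleLaw Df Dg) ∧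
    ∫ w, smoothNorm (ε / 4)
        (h.β • m + (1 - h.β) • hyperGrad P x y z w - gradient P.Φ x) ∂(sampleLaw Df Dg)
      ≤ (1 - q) * smoothNorm (ε / 4) (m - gradient P.Φ x)
        + q * ((ε + ‖gradient P.Φ x‖) * lowerErr c P ε x y + 67 / 100 * ε
          + (1 + 1 / 10 ^ 4) * auxErr c P x z / ε) := by
  have hμ := hc.μ_pos
  have hlg := hc.lg1_pos
  have hε := hr.ε_pos
  have hq := hr.q_pos
  have hq1 := hr.q_le
  have hL0 := L0_pos hc
  have hcz := centered_hyperGrad ho x y z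
  set Gr := gradient P.Φ x with hGr
  set bv := gradX P.f x y - hessXY P.g x y z - Gr with hbv
  set u := (1 - q) • (m - Gr) + q • bv with hu
  obtain ⟨i1, l1⟩ := hcz.norm_add_smul_sq u q
  set H := smoothNorm (ε / 4) (m - Gr) with hH
  set A := c.lg1 * ‖z - P.zStar x‖ with hA
  have hA2 : auxErr c P x z = A ^ 2 := by rw [auxErr, hA]; ring
  have hA0 : 0 ≤ A := by positivity
  set G := (ε + ‖Gr‖) * lowerErr c P ε x y with hG
  have hG0 : 0 ≤ G := mul_nonneg (by positivity) (lowerErr_nonneg hc hε x y)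
  have hH0 : ε / 4 ≤ H := le_smoothNorm _ _
  have hb : ‖bv‖ ≤ G + A := by
    refine (gradBias_le hc hs hl x y z).trans (add_le_add_left ?_ _)
    have : c.L0 + c.L1 * ‖Gr‖ ≤ (ε + ‖Gr‖) * (c.L0 / ε) := by
      have h1 : c.L1 ≤ c.L0 / ε := by rw [le_div_iff₀ hε]; exact hr.L1_le
      have h2 := mul_le_mul_of_nonneg_right h1 (norm_nonneg Gr)
      have h3 : ε * (c.L0 / ε) = c.L0 := by field_simp
      linarith
    calc _ ≤ (ε + ‖Gr‖) * (c.L0 / ε) *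
          (‖y - P.yStar x‖ * Real.exp (c.expRate * ‖y - P.yStar x‖)) := by gcongr
      _ = G := by rw [hG, lowerErr]; ring
  -- Variance budget. The smoothed norm has the floor H ≥ ε/4, so the cross term 2(1-q)qHK of C² is
  -- linear in q. It must cover q² times the variance and the loss (ε/4)² - (1-q)²(ε/4)² ≤ qε²/8 of
  -- the floor, in total (q/2)(3ε²/8 + A²/10⁵). The factor 11/10 pays for 1 - q. Thus the variance
  -- enters a one-step contraction of the norm itself.
  set K := 11 / 10 * (3 / 8 * ε + A ^ 2 / (10 ^ 5 * ε)) with hK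
  have hK0 : 0 ≤ K := by positivity
  set C := (1 - q) * H + q * (G + A + K) with hC
  have hCp : 0 < C := by
    have : 0 < (1 - q) * H := mul_pos (by linarith) (by linarith)
    positivity
  have hu1 : ‖u‖ ≤ (1 - q) * ‖m - Gr‖ + q * (G + A) := by
    refine (norm_add_le _ _).trans ?_
    rw [norm_smul, norm_smul, Real.norm_of_nonneg hq.le, Real.norm_of_nonneg (by linarith)]
    gcongr
  have hvar : q * (2 * c.σf1 ^ 2 + 2 * c.σg2 ^ 2 * ‖z‖ ^ 2) ≤ ε ^ 2 / 16 + A ^ 2 / (2 * 10 ^ 5) := by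
    have h6 := mul_le_mul_of_nonneg_left (variance_le hc hl x z) hq.le
    have hn0 : 0 ≤ c.noise := by rw [Consts.noise]; positivity
    have hml : c.μ ^ 2 ≤ c.lg1 ^ 2 := by have := hr.mu_le; gcongr
    have h7 : q * c.noise ≤ ε ^ 2 / 32 := by
      have h8 : c.lg1 ^ 2 * (32 * (q * c.noise)) ≤ c.lg1 ^ 2 * ε ^ 2 := by
        have := hr.noise_le
        linarith [mul_le_mul_of_nonneg_right hml (sq_nonneg ε)]
      have := le_of_mul_le_mul_left h8 (by positivity)
      linarith
    have h9 : q * c.σg2 ^ 2 * ‖z - P.zStar x‖ ^ 2 ≤ A ^ 2 / 10 ^ 6 := by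
      rw [le_div_iff₀ (by norm_num)]
      have := mul_le_mul_of_nonneg_right (hr.σg2_le.trans hml) (sq_nonneg ‖z - P.zStar x‖)
      rw [hA, mul_pow]; linarith
    have hA20 : 0 ≤ A ^ 2 := sq_nonneg A
    linarith
  have hsq : ‖u‖ ^ 2 + q ^ 2 * (2 * c.σf1 ^ 2 + 2 * c.σg2 ^ 2 * ‖z‖ ^ 2) + (ε / 4) ^ 2 ≤ C ^ 2 := by
    have h1 : ‖u‖ ^ 2 ≤ ((1 - q) * ‖m - Gr‖ + q * (G + A)) ^ 2 := by gcongr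
    have h2 : ‖m - Gr‖ ≤ H := norm_le_smoothNorm _ _
    have h3 : H ^ 2 = ‖m - Gr‖ ^ 2 + (ε / 4) ^ 2 := smoothNorm_sq _ _
    have h4 := mul_le_mul_of_nonneg_left hvar hq.le
    have h5 : ((1 - q) * ‖m - Gr‖ + q * (G + A)) ^ 2 + (1 - q) ^ 2 * (ε / 4) ^ 2
        + 2 * (1 - q) * q * H * K ≤ C ^ 2 := by
      have e1 : C ^ 2 = ((1 - q) * H + q * (G + A)) ^ 2
          + 2 * (1 - q) * q * H * K + (2 * (q * (G + A)) * (q * K) + (q * K) ^ 2) := by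
        rw [hC]; ring
      have e2 : ((1 - q) * H + q * (G + A)) ^ 2 = (1 - q) ^ 2 * H ^ 2
          + 2 * (1 - q) * q * (G + A) * H + (q * (G + A)) ^ 2 := by ring
      rw [e1, e2, h3]
      have h6 : 2 * (1 - q) * q * (G + A) * ‖m - Gr‖ ≤ 2 * (1 - q) * q * (G + A) * H := by
        have : 0 ≤ 1 - q := by linarith
        gcongr
      have h7 : 0 ≤ 2 * (q * (G + A)) * (q * K) + (q * K) ^ 2 := by positivity
      have e3 : ((1 - q) * ‖m - Gr‖ + q * (G + A)) ^ 2 = (1 - q) ^ 2 * ‖m - Gr‖ ^ 2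
          + 2 * (1 - q) * q * (G + A) * ‖m - Gr‖ + (q * (G + A)) ^ 2 := by ring
      rw [e3, mul_add ((1 - q) ^ 2)]
      linarith
    have h6 : ε / 4 * (q * K) ≤ H * (q * K) := by gcongr
    have h7 : 2 * (1 - q) * (ε / 4 * (q * K)) ≤ 2 * (1 - q) * q * H * K := by
      have : 0 ≤ 2 * (1 - q) := by linarith
      calc _ ≤ 2 * (1 - q) * (H * (q * K)) := by gcongr
        _ = _ := by ring
    have h8 : ε * K = 11 / 10 * (3 / 8 * ε ^ 2 + A ^ 2 / 10 ^ 5) := by rw [hK]; field_simp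
    have h9 : 2 * (1 - q) * (ε / 4 * (q * K)) =
        (1 - q) * q / 2 * (11 / 10 * (3 / 8 * ε ^ 2 + A ^ 2 / 10 ^ 5)) := by rw [← h8]; ring
    have h10 : 999 / 1000 * (q / 2 * (11 / 10 * (3 / 8 * ε ^ 2 + A ^ 2 / 10 ^ 5)))
        ≤ (1 - q) * q / 2 * (11 / 10 * (3 / 8 * ε ^ 2 + A ^ 2 / 10 ^ 5)) := by
      have h0 : 0 ≤ q / 2 * (11 / 10 * (3 / 8 * ε ^ 2 + A ^ 2 / 10 ^ 5)) := by positivity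
      calc _ ≤ (1 - q) * (q / 2 * (11 / 10 * (3 / 8 * ε ^ 2 + A ^ 2 / 10 ^ 5))) :=
            mul_le_mul_of_nonneg_right (by linarith) h0
        _ = _ := by ring
    have h11 : (ε / 4) ^ 2 - (1 - q) ^ 2 * (ε / 4) ^ 2 ≤ q * ε ^ 2 / 8 := by
      linarith [mul_nonneg (sq_nonneg q) (sq_nonneg ε)]
    have hqA : 0 ≤ q * A ^ 2 := by positivity
    have hqe : 0 ≤ q * ε ^ 2 := by positivity
    have e0 : q ^ 2 * (2 * c.σf1 ^ 2 + 2 * c.σg2 ^ 2 * ‖z‖ ^ 2) =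
        q * (q * (2 * c.σf1 ^ 2 + 2 * c.σg2 ^ 2 * ‖z‖ ^ 2)) := by ring
    have e1 : q * (ε ^ 2 / 16 + A ^ 2 / (2 * 10 ^ 5)) =
        1 / 16 * (q * ε ^ 2) + 1 / (2 * 10 ^ 5) * (q * A ^ 2) := by ring
    have e2 : 999 / 1000 * (q / 2 * (11 / 10 * (3 / 8 * ε ^ 2 + A ^ 2 / 10 ^ 5))) =
        999 / 2000 * 11 / 10 * 3 / 8 * (q * ε ^ 2)
          + 999 / 2000 * 11 / 10 / 10 ^ 5 * (q * A ^ 2) := by ring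
    rw [e1] at h4
    rw [e2, ← h9] at h10
    rw [e0]
    clear_value A H G K C
    generalize q * (q * (2 * c.σf1 ^ 2 + 2 * c.σg2 ^ 2 * ‖z‖ ^ 2)) = V at h4 ⊢
    linarith
  have e : ∀ w, ‖h.β • m + (1 - h.β) • hyperGrad P x y z w - Gr‖ ^ 2 =
      ‖u + q • (hyperGrad P x y z w - (gradX P.f x y - hessXY P.g x y z))‖ ^ 2 := by
    intro w
    congr 2
    rw [hr.β_eq]
    simp only [hu, hbv, smul_sub, sub_smul, one_smul, sub_sub_cancel]
    abel
  -- The tangent bound s ≤ s²/(2C) + C/2 reduces the mean of the norm to the second moment, which is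
  -- at most C².
  have hpt : ∀ w, smoothNorm (ε / 4) (h.β • m + (1 - h.β) • hyperGrad P x y z w - Gr) ≤
      1 / (2 * C) * ‖u + q • (hyperGrad P x y z w - (gradX P.f x y - hessXY P.g x y z))‖ ^ 2
        + ((ε / 4) ^ 2 / (2 * C) + C / 2) := by
    intro w
    set v := h.β • m + (1 - h.β) • hyperGrad P x y z w - Gr with hv
    rw [← e w]
    have h1 := smoothNorm_sq (ε / 4) v
    have h2 : 0 ≤ (smoothNorm (ε / 4) v - C) ^ 2 / (2 * C) := by positivity
    have h3 : (smoothNorm (ε / 4) v - C) ^ 2 / (2 * C) =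
        1 / (2 * C) * (smoothNorm (ε / 4) v ^ 2) + C / 2 - smoothNorm (ε / 4) v := by
      field_simp; ring
    rw [h3, h1] at h2
    have h4 : 1 / (2 * C) * (‖v‖ ^ 2 + (ε / 4) ^ 2) =
        1 / (2 * C) * ‖v‖ ^ 2 + (ε / 4) ^ 2 / (2 * C) := by ring
    linarith
  have i2 := (i1.const_mul (1 / (2 * C))).add (integrable_const ((ε / 4) ^ 2 / (2 * C) + C / 2))
  have hGm : Measurable fun w => hyperGrad P x y z w := by
    have := hcz.meas.add_const (gradX P.f x y - hessXY P.g x y z)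
    simpa using this
  have i3 : Integrable (fun w => smoothNorm (ε / 4)
      (h.β • m + (1 - h.β) • hyperGrad P x y z w - Gr)) (sampleLaw Df Dg) := by
    refine i2.mono' ?_ (Filter.Eventually.of_forall fun w => ?_)
    · unfold smoothNorm
      exact (by fun_prop : Measurable _).aestronglyMeasurable
    · rw [Real.norm_of_nonneg (smoothNorm_nonneg _ _)]; exact hpt w
  refine ⟨i3, (integral_mono i3 i2 hpt).trans ?_⟩
  simp only [Pi.add_apply]
  rw [integral_add (i1.const_mul _) (integrable_const _), integral_const_mul]
  simp only [integral_const, probReal_univ, smul_eq_mul, one_mul]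
  have h1 : 1 / (2 * C) * ∫ w, ‖u + q • (hyperGrad P x y z w -
      (gradX P.f x y - hessXY P.g x y z))‖ ^ 2 ∂(sampleLaw Df Dg) + ((ε / 4) ^ 2 / (2 * C) + C / 2)
      ≤ C := by
    have h2 : 1 / (2 * C) * (∫ w, ‖u + q • (hyperGrad P x y z w -
      (gradX P.f x y - hessXY P.g x y z))‖ ^ 2 ∂(sampleLaw Df Dg) + (ε / 4) ^ 2)
      ≤ 1 / (2 * C) * C ^ 2 := by
      gcongr; linarith
    have h3 : 1 / (2 * C) * C ^ 2 = C / 2 := by field_simp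
    rw [h3, mul_add] at h2
    have h4 : 1 / (2 * C) * (ε / 4) ^ 2 = (ε / 4) ^ 2 / (2 * C) := by ring
    linarith
  refine h1.trans ?_
  rw [hC, hA2]
  -- The error of z enters the bias linearly but contracts in square; the exchange costs ε/4.
  have h5 : A ≤ A ^ 2 / ε + ε / 4 := by
    have h0 : 0 ≤ (A - ε / 2) ^ 2 / ε := by positivity
    have h1 : (A - ε / 2) ^ 2 / ε = A ^ 2 / ε + ε / 4 - A := by field_simp; ring
    linarith
  have h6 : K = 33 / 80 * ε + 11 / 10 ^ 6 * (A ^ 2 / ε) := by rw [hK]; field_simp; ring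
  have h7 : 0 ≤ A ^ 2 / ε := by positivity
  have h8 : G + A + K ≤ G + 67 / 100 * ε + (1 + 1 / 10 ^ 4) * A ^ 2 / ε := by
    rw [h6, mul_div_assoc]; linarith
  have := mul_le_mul_of_nonneg_left h8 hq.le
  linarith

end UpperStep

/-! ### Combined error, Lyapunov function and exponential moment over one iteration -/

section OneStep

open Set Filter Topology Consts

variable {dx dy : ℕ} {Ξ Z : Type*}

/-- The σ-algebra on the states of the algorithm that forgets the number of oracle calls. -/
instance : MeasurableSpace (State dx dy) :=
  MeasurableSpace.comap (fun s => (s.x, s.y, s.z, s.m)) inferInstance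

lemma measurable_state_iff {Ω : Type*} [MeasurableSpace Ω] {S : Ω → State dx dy} :
    Measurable S ↔ Measurable (fun ω => (S ω).x) ∧ Measurable (fun ω => (S ω).y) ∧
      Measurable (fun ω => (S ω).z) ∧ Measurable (fun ω => (S ω).m) := by
  rw [measurable_comap_iff]
  simp only [Function.comp_def]
  exact ⟨fun h => ⟨h.fst, h.snd.fst, h.snd.snd.fst, h.snd.snd.snd⟩,
    fun h => h.1.prodMk (h.2.1.prodMk (h.2.2.1.prodMk h.2.2.2))⟩

lemma measurable_state : Measurable (State.x : State dx dy → Vec dx) ∧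
    Measurable (State.y : State dx dy → Vec dy) ∧ Measurable (State.z : State dx dy → Vec dy) ∧
    Measurable (State.m : State dx dy → Vec dx) :=
  measurable_state_iff.1 measurable_id

/-- The main loop is read in two ways: driven by the upper-level samples with the lower-level ones
frozen, here, and conversely in `mainLoop_eq_orbit'`. The argument alternates between both. -/
lemma mainLoop_eq_orbit (P : Problem dx dy Ξ Z) (h : StepSizes) (s₀ : State dx dy) (p : ℕ → Z)
    (w : UpperSample Ξ Z) (t : ℕ) :
    mainLoop P h s₀ p w t = orbit (fun i s a => step P h s (p i) a) s₀ w t := by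
  induction t with
  | zero => rfl
  | succ t ih => simp only [mainLoop, orbit, ih]

lemma mainLoop_eq_orbit' (P : Problem dx dy Ξ Z) (h : StepSizes) (s₀ : State dx dy) (p : ℕ → Z)
    (w : UpperSample Ξ Z) (t : ℕ) :
    mainLoop P h s₀ p w t = orbit (fun i s a => step P h s a (w i)) s₀ p t := by
  induction t with
  | zero => rfl
  | succ t ih => simp only [mainLoop, orbit, ih]

variable {c : Consts} {P : Problem dx dy Ξ Z} {h : StepSizes} {ε q l : ℝ}

/-- The size of the gradient of `Φ`, offset by `ε`. -/
noncomputable def gradSize (P : Problem dx dy Ξ Z) (ε : ℝ) (x : Vec dx) : ℝ :=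
  ε + ‖gradient P.Φ x‖

/-- The combined error of the momentum and of the auxiliary variable. -/
noncomputable def momErr (c : Consts) (P : Problem dx dy Ξ Z) (ε : ℝ) (s : State dx dy) : ℝ :=
  smoothNorm (ε / 4) (s.m - gradient P.Φ s.x) + 5 * auxErr c P s.x s.z / ε

/-- The driving term of the recursion for the combined error. -/
noncomputable def drive (c : Consts) (P : Problem dx dy Ξ Z) (ε : ℝ) (s : State dx dy) : ℝ :=
  gradSize P ε s.x * lowerErr c P ε s.x s.y + gradSize P ε s.x / 200 + 197 / 200 * ε
    + 5001 / 1000 * (ε * lowerErr c P ε s.x s.y ^ 2)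

lemma gradSize_pos (hε : 0 < ε) (x : Vec dx) : 0 < gradSize P ε x := by
  rw [gradSize]; positivity

lemma momErr_nonneg (hε : 0 < ε) (s : State dx dy) : 0 ≤ momErr c P ε s := by
  have h1 := smoothNorm_nonneg (ε / 4) (s.m - gradient P.Φ s.x)
  have h2 := auxErr_nonneg (c := c) (P := P) s.x s.z
  rw [momErr]; positivity

lemma drive_nonneg (hc : c.Valid) (hε : 0 < ε) (s : State dx dy) : 0 ≤ drive c P ε s := by
  have h1 := gradSize_pos (P := P) hε s.x
  have h2 := lowerErr_nonneg (P := P) hc hε s.x s.y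
  rw [drive]; positivity

/-- An inequality rather than an equality: the zero vector is included, since 0⁻¹ = 0. -/
lemma norm_normalize_smul_le {V : Type*} [NormedAddCommGroup V] [NormedSpace ℝ V] {a : ℝ}
    (ha : 0 ≤ a) (v : V) : ‖a • (‖v‖⁻¹ • v)‖ ≤ a := by
  rw [norm_smul, norm_smul, norm_inv, norm_norm, Real.norm_of_nonneg ha]
  exact mul_le_of_le_one_right ha inv_mul_le_one

lemma norm_step_sub_le (hη : 0 ≤ h.η) (s : State dx dy) (p : Z) (w : (Ξ × Ξ) × (Z × Z)) :
    ‖(step P h s p w).x - s.x‖ ≤ h.η := by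
  have := norm_normalize_smul_le hη (step P h s p w).m
  have e : (step P h s p w).x - s.x
      = -(h.η • (‖(step P h s p w).m‖⁻¹ • (step P h s p w).m)) := by
    simp only [step]; abel
  rwa [e, norm_neg]

section Geometry

variable (hc : c.Valid) (hs : RelaxedSmooth c P) (hl : LowerLevel c P) (hr : Regime c h ε q l)
include hc hs hl hr

omit hc hs hl in
lemma Regime.relaxed_le (x : Vec dx) :
    c.L0 + c.L1 * ‖gradient P.Φ x‖ ≤ c.L0 / ε * gradSize P ε x := by
  have hε := hr.ε_pos
  have h1 : c.L1 ≤ c.L0 / ε := by rw [le_div_iff₀ hε]; exact hr.L1_le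
  have h2 := mul_le_mul_of_nonneg_right h1 (norm_nonneg (gradient P.Φ x))
  have h3 : c.L0 / ε * ε = c.L0 := by field_simp
  rw [gradSize]
  nlinarith

omit hc hs hl in
lemma Regime.relaxed_mul_eta_le (x : Vec dx) :
    (c.L0 + c.L1 * ‖gradient P.Φ x‖) * h.η ≤ q / 200 * gradSize P ε x := by
  have hε := hr.ε_pos
  have hg := gradSize_pos (P := P) hε x
  calc _ ≤ c.L0 / ε * gradSize P ε x * h.η := by
        have := hr.η_pos
        gcongr; exact hr.relaxed_le x
    _ = h.η * c.L0 * (gradSize P ε x / ε) := by ring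
    _ ≤ ε * (q / 200) * (gradSize P ε x / ε) :=
        mul_le_mul_of_nonneg_right hr.η_L0 (by positivity)
    _ = _ := by field_simp

lemma norm_gradient_step_sub_le {x x' : Vec dx} (hx : ‖x' - x‖ ≤ h.η) :
    ‖gradient P.Φ x' - gradient P.Φ x‖ ≤ q / 200 * gradSize P ε x := by
  rw [norm_sub_rev] at hx ⊢
  refine (norm_gradient_Φ_sub_le hc hs hl x x' (hx.trans hr.η_le)).trans ?_
  refine le_trans ?_ (hr.relaxed_mul_eta_le x)
  have := L0_pos hc
  have := L1_pos hc
  gcongr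

/-- Normalized steps have length at most η, so the offset gradient changes by a bounded factor
whatever the noise does. This is what allows it as a weight in the exponential moments. -/
lemma gradSize_step {x x' : Vec dx} (hx : ‖x' - x‖ ≤ h.η) :
    gradSize P ε x' ≤ (1 + q / 200) * gradSize P ε x ∧
      (1 - q / 200) * gradSize P ε x ≤ gradSize P ε x' := by
  have h1 := norm_gradient_step_sub_le hc hs hl hr hx
  have h2 := abs_norm_sub_norm_le (gradient P.Φ x') (gradient P.Φ x)
  rw [abs_le] at h2
  constructor <;> simp only [gradSize] at * <;> linarith [h2.1, h2.2]

lemma auxErr_step {x x' : Vec dx} (hx : ‖x' - x‖ ≤ h.η) (z : Vec dy) :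
    auxErr c P x' z ≤ (1 + q / 10) * auxErr c P x z + q * ε ^ 2 / 3000 := by
  have hε := hr.ε_pos
  have hq := hr.q_pos
  have hq1 := hr.q_le
  have hlg := hc.lg1_pos
  have h1 := lg1_mul_norm_zStar_sub_le hc hs hl x' x (hx.trans hr.η_le)
  have h2 : c.lg1 * ‖P.zStar x' - P.zStar x‖ ≤ ε * (q / 200) := by
    refine h1.trans ((mul_le_mul_of_nonneg_left hx (L0_pos hc).le).trans ?_)
    rw [mul_comm]; exact hr.η_L0
  have h3 : ‖z - P.zStar x'‖ ≤ ‖z - P.zStar x‖ + ‖P.zStar x' - P.zStar x‖ := by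
    rw [norm_sub_rev (P.zStar x')]
    exact norm_sub_le_norm_sub_add_norm_sub _ _ _
  have h4 : c.lg1 * ‖z - P.zStar x'‖ ≤ c.lg1 * ‖z - P.zStar x‖ + ε * (q / 200) := by
    have := mul_le_mul_of_nonneg_left h3 hlg.le
    linarith
  -- Young's weight q/10 keeps the growth caused by the motion of z* small against the contraction 1
  -- - q of the z step.
  have h5 := sq_add_le (a := c.lg1 * ‖z - P.zStar x‖) (b := ε * (q / 200))
    (show 0 < q / 10 by positivity)
  have h6 : (1 + 1 / (q / 10)) * (ε * (q / 200)) ^ 2 = (q + 10) * (q * ε ^ 2) / 40000 := by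
    field_simp; ring
  have h7 : 0 ≤ q * ε ^ 2 := by positivity
  rw [auxErr, auxErr, ← mul_pow, ← mul_pow]
  calc _ ≤ (c.lg1 * ‖z - P.zStar x‖ + ε * (q / 200)) ^ 2 := by gcongr
    _ ≤ _ := by rw [h6] at h5; nlinarith

lemma gap_step {x x' : Vec dx} (hx : ‖x' - x‖ ≤ h.η) :
    P.gap x' ≤ P.gap x + 101 / 100 * (h.η * gradSize P ε x) := by
  have hη := hr.η_pos
  have h1 := Φ_sub_le_local hc hs hl (hx.trans hr.η_le)
  have h2 := real_inner_le_norm (gradient P.Φ x) (x' - x)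
  have h3 := hr.relaxed_mul_eta_le (P := P) x
  have hL0 := L0_pos hc
  have hL1 := L1_pos hc
  have hg := gradSize_pos (P := P) hr.ε_pos x
  have h4 : (c.L0 + c.L1 * ‖gradient P.Φ x‖) * ‖x' - x‖ * ‖x' - x‖ ≤
      q / 200 * gradSize P ε x * h.η := by
    calc _ ≤ (c.L0 + c.L1 * ‖gradient P.Φ x‖) * h.η * h.η := by gcongr
      _ ≤ _ := by gcongr
  have h5 : ‖gradient P.Φ x‖ * ‖x' - x‖ ≤ gradSize P ε x * h.η := by
    have : ‖gradient P.Φ x‖ ≤ gradSize P ε x := by rw [gradSize]; linarith [hr.ε_pos]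
    gcongr
  have h6 : q / 200 * (gradSize P ε x * h.η) ≤ 1 / 100 * (gradSize P ε x * h.η) := by
    have := hr.q_le
    have := hr.η_pos
    exact mul_le_mul_of_nonneg_right (by linarith) (by positivity)
  simp only [Problem.gap]
  linarith

/-- A unit step along m loses at most 2‖m - ∇Φ‖ against the ideal decrease ‖∇Φ‖, by the triangle
inequality and Cauchy-Schwarz. For m = 0 nothing moves and the bound is trivial, as ‖∇Φ‖ - 2‖∇Φ‖ ≤
0. -/
lemma gap_step_normalized {x m : Vec dx} :
    P.gap (x - h.η • (‖m‖⁻¹ • m)) ≤ P.gap x - h.η * ‖gradient P.Φ x‖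
      + 2 * (h.η * ‖m - gradient P.Φ x‖) + h.η * (q / 200 * gradSize P ε x) := by
  have hη := hr.η_pos
  set x' := x - h.η • (‖m‖⁻¹ • m) with hx'
  set G := gradient P.Φ x with hG
  have e : x' - x = -(h.η • (‖m‖⁻¹ • m)) := by rw [hx']; abel
  have hx : ‖x' - x‖ ≤ h.η := by
    rw [e, norm_neg]; exact norm_normalize_smul_le hη.le m
  have h1 := Φ_sub_le_local hc hs hl (hx.trans hr.η_le)
  have h3 := hr.relaxed_mul_eta_le (P := P) x
  have hL0 := L0_pos hc
  have hL1 := L1_pos hc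
  rw [← hG] at h1 h3
  have h4 : (c.L0 + c.L1 * ‖G‖) * ‖x' - x‖ * ‖x' - x‖ ≤ h.η * (q / 200 * gradSize P ε x) := by
    calc _ ≤ (c.L0 + c.L1 * ‖G‖) * h.η * h.η := by gcongr
      _ ≤ q / 200 * gradSize P ε x * h.η := by gcongr
      _ = _ := by ring
  have h5 : ‖G‖ - 2 * ‖m - G‖ ≤ ‖m‖⁻¹ * inner ℝ G m := by
    have h6 : ‖G‖ ≤ ‖m‖ + ‖m - G‖ := by
      have := norm_sub_le m (m - G); rwa [sub_sub_cancel] at this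
    rcases eq_or_ne m 0 with hm | hm
    · subst hm
      simp only [norm_zero, zero_sub, norm_neg, inner_zero_right, mul_zero]
      linarith [norm_nonneg G]
    · have hm0 : 0 < ‖m‖ := norm_pos_iff.2 hm
      rw [inv_mul_eq_div, le_div_iff₀ hm0]
      have h7 : inner ℝ G m = ‖m‖ ^ 2 - inner ℝ (m - G) m := by
        rw [inner_sub_left, real_inner_self_eq_norm_sq]; ring
      have h8 := real_inner_le_norm (m - G) m
      nlinarith
  have h6 : inner ℝ G (x' - x) = -(h.η * (‖m‖⁻¹ * inner ℝ G m)) := by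
    rw [e, inner_neg_right, inner_smul_right, inner_smul_right]
  have h7 := mul_le_mul_of_nonneg_left h5 hη.le
  simp only [Problem.gap]
  rw [h6] at h1
  linarith

end Geometry

variable [MeasurableSpace Ξ] [MeasurableSpace Z] {Df : Measure Ξ} {Dg : Measure Z}
  [IsProbabilityMeasure Df] [IsProbabilityMeasure Dg]

/-- The combined error after one step has an integrable majorant with a contracting mean. -/
lemma exists_momErr_majorant (hc : c.Valid) (hs : RelaxedSmooth c P) (hl : LowerLevel c P)
    (ho : OracleAssumption c P Df Dg) (hr : Regime c h ε q l) (s : State dx dy) (p : Z) :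
    ∃ M : (Ξ × Ξ) × (Z × Z) → ℝ, Integrable M (sampleLaw Df Dg) ∧
      (∀ w, momErr c P ε (step P h s p w) ≤ M w) ∧
      (∀ w, ‖(step P h s p w).m - gradient P.Φ s.x‖ ≤ M w) ∧
      ∫ w, M w ∂(sampleLaw Df Dg) ≤ (1 - 69 / 100 * q) * momErr c P ε s + q * drive c P ε s := by
  have hε := hr.ε_pos
  have hq := hr.q_pos
  have hq1 := hr.q_le
  obtain ⟨i1, l1⟩ := integral_auxErr_le hc hs hl ho hr s.x s.y s.z
  obtain ⟨i2, l2⟩ := integral_smoothNorm_le hc hs hl ho hr s.x s.y s.z s.m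
  set N : (Ξ × Ξ) × (Z × Z) → ℝ := fun w => smoothNorm (ε / 4)
    (h.β • s.m + (1 - h.β) • hyperGrad P s.x s.y s.z w - gradient P.Φ s.x) with hN
  set A : (Ξ × Ξ) × (Z × Z) → ℝ :=
    fun w => auxErr c P s.x (s.z - h.γ • zDir P s.x s.y s.z w) with hA
  have hA0 : ∀ w, 0 ≤ A w := fun w => auxErr_nonneg _ _
  have hg := gradSize_pos (P := P) hε s.x
  set K := q / 200 * gradSize P ε s.x + 5 * (q * ε ^ 2 / 3000) / ε with hK
  have hK0 : 0 ≤ K := by positivity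
  have i3 : Integrable (fun w => N w + 5 * (1 + q / 10) / ε * A w) (sampleLaw Df Dg) :=
    i2.add (i1.const_mul _)
  refine ⟨fun w => N w + 5 * (1 + q / 10) / ε * A w + K, i3.add (integrable_const K), fun w => ?_,
    fun w => ?_, ?_⟩
  · have hx := norm_step_sub_le (P := P) hr.η_pos.le s p w
    have h1 := norm_gradient_step_sub_le hc hs hl hr hx
    have h2 := auxErr_step hc hs hl hr hx (step P h s p w).z
    have h3 := smoothNorm_le_of_sub (ε / 4) ((step P h s p w).m - gradient P.Φ (step P h s p w).x)
      ((step P h s p w).m - gradient P.Φ s.x)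
    rw [sub_sub_sub_cancel_left, norm_sub_rev] at h3
    have h4 : smoothNorm (ε / 4) ((step P h s p w).m - gradient P.Φ s.x) = N w := rfl
    have h5 : auxErr c P s.x (step P h s p w).z = A w := rfl
    rw [h4] at h3
    rw [h5] at h2
    rw [momErr]
    have h6 : 5 * auxErr c P (step P h s p w).x (step P h s p w).z / ε ≤
        5 * ((1 + q / 10) * A w + q * ε ^ 2 / 3000) / ε := by gcongr
    have h7 : 5 * ((1 + q / 10) * A w + q * ε ^ 2 / 3000) / ε =
        5 * (1 + q / 10) / ε * A w + 5 * (q * ε ^ 2 / 3000) / ε := by ring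
    rw [h7] at h6
    simp only [hK]
    linarith
  · have h1 : ‖(step P h s p w).m - gradient P.Φ s.x‖ ≤ N w := norm_le_smoothNorm _ _
    have h2 : 0 ≤ 5 * (1 + q / 10) / ε * A w := mul_nonneg (by positivity) (hA0 w)
    linarith
  · rw [integral_add i3 (integrable_const K), integral_add i2 (i1.const_mul _), integral_const_mul]
    simp only [integral_const, probReal_univ, smul_eq_mul, one_mul]
    have h1 := mul_le_mul_of_nonneg_left l1 (show 0 ≤ 5 * (1 + q / 10) / ε by positivity)
    have hφ := lowerErr_nonneg (P := P) hc hε s.x s.y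
    rw [momErr, drive, hK]
    rw [show ε + ‖gradient P.Φ s.x‖ = gradSize P ε s.x from rfl] at l2
    set φ := lowerErr c P ε s.x s.y
    set G := gradSize P ε s.x
    set H := smoothNorm (ε / 4) (s.m - gradient P.Φ s.x) with hH
    have hH0 : 0 ≤ H := smoothNorm_nonneg _ _
    have hz := auxErr_nonneg (c := c) (P := P) s.x s.z
    set ζ := auxErr c P s.x s.z
    have e1 : 5 * (1 + q / 10) / ε * ((1 - q + q / 10 ^ 5) * ζ + q * ε ^ 2 * φ ^ 2 + q * ε ^ 2 / 16)
        = 5 * (1 + q / 10) * (1 - q + q / 10 ^ 5) * (ζ / ε)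
          + 5 * (1 + q / 10) * (q * (ε * φ ^ 2)) + 5 * (1 + q / 10) / 16 * (q * ε) := by
      field_simp
    have e2 : 5 * (q * ε ^ 2 / 3000) / ε = 1 / 600 * (q * ε) := by field_simp; ring
    have e3 : q * ((1 + 1 / 10 ^ 4) * ζ / ε) = (1 + 1 / 10 ^ 4) * q * (ζ / ε) := by ring
    have e4 : 5 * ζ / ε = 5 * (ζ / ε) := by ring
    rw [e1] at h1
    rw [e2, e4]
    have hz' : 0 ≤ ζ / ε := by positivity
    set ζ' := ζ / ε
    -- The weight 5 of the z error is chosen here: its contraction, about 4.5 q, absorbs the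
    -- coefficient q with which the z error enters the momentum and still leaves 0.69 · 5 q.
    have k1 : (5 * (1 + q / 10) * (1 - q + q / 10 ^ 5) + (1 + 1 / 10 ^ 4) * q) * ζ' ≤
        (1 - 69 / 100 * q) * 5 * ζ' := by
      gcongr; nlinarith
    have k2 : 5 * (1 + q / 10) * (q * (ε * φ ^ 2)) ≤ 5001 / 1000 * (q * (ε * φ ^ 2)) := by
      gcongr; linarith
    have k3 : 5 * (1 + q / 10) / 16 * (q * ε) ≤ 5001 / 16000 * (q * ε) := by
      gcongr ?_ * _; linarith
    have k4 : (1 - q) * H ≤ (1 - 69 / 100 * q) * H := by gcongr; linarith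
    have k5 : 0 ≤ q * ε := by positivity
    rw [mul_add, mul_add, e3] at l2
    linarith

omit [IsProbabilityMeasure Df] [IsProbabilityMeasure Dg] in
lemma measurable_step (ho : OracleAssumption c P Df Dg) {Ω : Type*} [MeasurableSpace Ω]
    {hh : Ω → StepSizes} (hα : Measurable fun ω => (hh ω).α) (hβ : Measurable fun ω => (hh ω).β)
    (hγ : Measurable fun ω => (hh ω).γ) (hη : Measurable fun ω => (hh ω).η)
    {s : Ω → State dx dy} (hs : Measurable s) {p : Ω → Z} (hp : Measurable p)
    {w : Ω → (Ξ × Ξ) × (Z × Z)} (hw : Measurable w) :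
    Measurable fun ω => step P (hh ω) (s ω) (p ω) (w ω) := by
  obtain ⟨hx, hy, hz, hm⟩ := measurable_state_iff.1 hs
  have happ : ∀ {d : ℕ} {A : Ω → (Vec dy →L[ℝ] Vec d)}, Measurable A →
      Measurable fun ω => A ω (s ω).z := fun {d A} hA =>
    (isBoundedBilinearMap_apply (𝕜 := ℝ) (E := Vec dy) (F := Vec d)).continuous.measurable.comp
      (hA.prodMk hz)
  have hm' : Measurable fun ω => (hh ω).β • (s ω).m + (1 - (hh ω).β) •
      (P.Fx (s ω).x (s ω).y (w ω).1.2 - P.Gxy (s ω).x (s ω).y (w ω).2.2 (s ω).z) :=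
    (hβ.smul hm).add ((hβ.const_sub 1).smul
      ((ho.meas_Fx.comp (hx.prodMk (hy.prodMk hw.fst.snd))).sub
        (happ (ho.meas_Gxy.comp (hx.prodMk (hy.prodMk hw.snd.snd))))))
  refine measurable_state_iff.2 ⟨hx.sub (hη.smul (hm'.norm.inv.smul hm')),
    hy.sub (hα.smul (ho.meas_Gy.comp (hx.prodMk (hy.prodMk hp)))), ?_, hm'⟩
  exact hz.sub (hγ.smul ((happ (ho.meas_Gyy.comp (hx.prodMk (hy.prodMk hw.snd.fst)))).sub
    (ho.meas_Fy.comp (hx.prodMk (hy.prodMk hw.fst.fst)))))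

omit [IsProbabilityMeasure Df] [IsProbabilityMeasure Dg] in
lemma measurable_mainLoop (ho : OracleAssumption c P Df Dg) {Ω : Type*} [MeasurableSpace Ω]
    {hh : Ω → StepSizes} (hα : Measurable fun ω => (hh ω).α) (hβ : Measurable fun ω => (hh ω).β)
    (hγ : Measurable fun ω => (hh ω).γ) (hη : Measurable fun ω => (hh ω).η)
    {s : Ω → State dx dy} (hs : Measurable s) {p : Ω → ℕ → Z} (hp : Measurable p)
    {w : Ω → UpperSample Ξ Z} (hw : Measurable w) (t : ℕ) :
    Measurable fun ω => mainLoop P (hh ω) (s ω) (p ω) (w ω) t := by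
  induction t with
  | zero => exact hs
  | succ t ih =>
    exact measurable_step ho hα hβ hγ hη ih (measurable_pi_iff.1 hp t) (measurable_pi_iff.1 hw t)

/-- The combined error contracts in mean. -/
lemma lintegral_momErr_step_le (hc : c.Valid) (hs : RelaxedSmooth c P) (hl : LowerLevel c P)
    (ho : OracleAssumption c P Df Dg) (hr : Regime c h ε q l) (s : State dx dy) (p : Z) :
    ∫⁻ w, ENNReal.ofReal (momErr c P ε (step P h s p w)) ∂(sampleLaw Df Dg) ≤
      ENNReal.ofReal (1 - 69 / 100 * q) * ENNReal.ofReal (momErr c P ε s)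
        + ENNReal.ofReal q * ENNReal.ofReal (drive c P ε s) := by
  obtain ⟨M, hM, h1, -, h2⟩ := exists_momErr_majorant hc hs hl ho hr s p
  have hq := hr.q_pos
  have hq1 := hr.q_le
  have h3 := momErr_nonneg (c := c) (P := P) hr.ε_pos
  have h4 := drive_nonneg (P := P) hc hr.ε_pos s
  calc _ ≤ ∫⁻ w, ENNReal.ofReal (M w) ∂(sampleLaw Df Dg) :=
        lintegral_mono fun w => ENNReal.ofReal_le_ofReal (h1 w)
    _ = ENNReal.ofReal (∫ w, M w ∂(sampleLaw Df Dg)) :=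
        (ofReal_integral_eq_lintegral_ofReal hM (Eventually.of_forall fun w =>
          (h3 _).trans (h1 w))).symm
    _ ≤ _ := ENNReal.ofReal_le_ofReal h2
    _ = _ := by
        have h5 : 0 ≤ 1 - 69 / 100 * q := by linarith
        rw [ENNReal.ofReal_add (mul_nonneg h5 (h3 s)) (mul_nonneg hq.le h4),
          ENNReal.ofReal_mul h5, ENNReal.ofReal_mul hq.le]

/-- The Lyapunov function of the main loop. -/
noncomputable def potential (c : Consts) (P : Problem dx dy Ξ Z) (η q ε : ℝ) (s : State dx dy) :
    ℝ :=
  P.gap s.x + 3 * η / q * momErr c P ε s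

omit [MeasurableSpace Ξ] [MeasurableSpace Z] in
lemma gap_nonneg (hb : BddBelow (Set.range P.Φ)) (x : Vec dx) : 0 ≤ P.gap x :=
  sub_nonneg.2 (ciInf_le hb x)

/-- The Lyapunov function decreases in mean. -/
lemma lintegral_potential_step_le (hc : c.Valid) (hs : RelaxedSmooth c P) (hl : LowerLevel c P)
    (ho : OracleAssumption c P Df Dg) (hb : BddBelow (Set.range P.Φ)) (hr : Regime c h ε q l)
    (s : State dx dy) (p : Z) :
    ∫⁻ w, ENNReal.ofReal (potential c P h.η q ε (step P h s p w)) ∂(sampleLaw Df Dg)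
        + ENNReal.ofReal h.η * ENNReal.ofReal ‖gradient P.Φ s.x‖ ≤
      ENNReal.ofReal (potential c P h.η q ε s)
        + ENNReal.ofReal (h.η * (301 / 100)) * ENNReal.ofReal (drive c P ε s) := by
  obtain ⟨M, hM, h1, h1', h2⟩ := exists_momErr_majorant hc hs hl ho hr s p
  have hq := hr.q_pos
  have hq1 := hr.q_le
  have hη := hr.η_pos
  have hε := hr.ε_pos
  have h3 := momErr_nonneg (c := c) (P := P) hε
  have h4 := drive_nonneg (P := P) hc hε s
  have h0 : ∀ s, 0 ≤ potential c P h.η q ε s := fun s =>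
    add_nonneg (gap_nonneg hb _) (mul_nonneg (by positivity) (h3 s))
  set G := ‖gradient P.Φ s.x‖ with hG
  set K := P.gap s.x - h.η * G + h.η * (q / 200 * gradSize P ε s.x) with hK
  have h5 : ∀ w, potential c P h.η q ε (step P h s p w) ≤ K + (2 * h.η + 3 * h.η / q) * M w := by
    intro w
    have h6 := gap_step_normalized hc hs hl hr (x := s.x) (m := (step P h s p w).m)
    have h7 : P.gap (s.x - h.η • (‖(step P h s p w).m‖⁻¹ • (step P h s p w).m)) =
      P.gap (step P h s p w).x := rfl
    have h8 := mul_le_mul_of_nonneg_left (h1' w) hη.le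
    have h9 := mul_le_mul_of_nonneg_left (h1 w) (show 0 ≤ 3 * h.η / q by positivity)
    rw [h7] at h6
    rw [potential]
    linarith
  have i1 : Integrable (fun w => K + (2 * h.η + 3 * h.η / q) * M w) (sampleLaw Df Dg) :=
    (integrable_const K).add (hM.const_mul _)
  have h6 : ∫ w, (K + (2 * h.η + 3 * h.η / q) * M w) ∂(sampleLaw Df Dg) + h.η * G ≤
      potential c P h.η q ε s + h.η * (301 / 100) * drive c P ε s := by
    rw [integral_add (integrable_const K) (hM.const_mul _), integral_const_mul]
    simp only [integral_const, probReal_univ, smul_eq_mul, one_mul]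
    have h7 := mul_le_mul_of_nonneg_left h2 (show 0 ≤ 2 * h.η + 3 * h.η / q by positivity)
    have h8 : gradSize P ε s.x / 200 ≤ drive c P ε s := by
      have h9 := gradSize_pos (P := P) hε s.x
      have h10 := lowerErr_nonneg (P := P) hc hε s.x s.y
      have h11 : 0 ≤ gradSize P ε s.x * lowerErr c P ε s.x s.y
        + 5001 / 1000 * (ε * lowerErr c P ε s.x s.y ^ 2) := by positivity
      rw [drive]; linarith
    have h9 := mul_le_mul_of_nonneg_left h8 (show 0 ≤ h.η * q by positivity)
    -- The weight 3η/q contracts by 2.07 η, more than the loss 2η of the normalized step, so the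
    -- combined error drops out with a favourable sign.
    have e1 : (2 * h.η + 3 * h.η / q) * ((1 - 69 / 100 * q) * momErr c P ε s + q * drive c P ε s) =
        3 * h.η / q * momErr c P ε s - (7 / 100 * h.η + 69 / 50 * (h.η * q)) * momErr c P ε s
        + 3 * h.η * drive c P ε s + 2 * (h.η * q * drive c P ε s) := by
      field_simp; ring
    have h10 : 0 ≤ (7 / 100 * h.η + 69 / 50 * (h.η * q)) * momErr c P ε s :=
      mul_nonneg (by positivity) (h3 s)
    have h11 : h.η * q * drive c P ε s ≤ h.η * (1 / 1000) * drive c P ε s := by gcongr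
    have h12 : 0 ≤ h.η * drive c P ε s := by positivity
    rw [e1] at h7
    rw [potential]
    linarith
  calc _ ≤ ENNReal.ofReal (∫ w, (K + (2 * h.η + 3 * h.η / q) * M w) ∂(sampleLaw Df Dg))
        + ENNReal.ofReal (h.η * G) := by
        rw [ENNReal.ofReal_mul hη.le]
        gcongr
        rw [ofReal_integral_eq_lintegral_ofReal i1 (Eventually.of_forall fun w =>
          (h0 _).trans (h5 w))]
        exact lintegral_mono fun w => ENNReal.ofReal_le_ofReal (h5 w)
    _ = ENNReal.ofReal (∫ w, (K + (2 * h.η + 3 * h.η / q) * M w) ∂(sampleLaw Df Dg) + h.η * G) := by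
        rw [ENNReal.ofReal_add (integral_nonneg fun w => (h0 _).trans (h5 w)) (by positivity)]
    _ ≤ _ := ENNReal.ofReal_le_ofReal h6
    _ = _ := by
        rw [ENNReal.ofReal_add (h0 s) (by positivity), ENNReal.ofReal_mul (by positivity)]

/-- The exponential moment of the lower-level error, relative to the level `r`. -/
noncomputable def expMoment (P : Problem dx dy Ξ Z) (l r : ℝ) (s : State dx dy) : ℝ :=
  Real.exp (l * (‖s.y - P.yStar s.x‖ ^ 2 - r))

omit [IsProbabilityMeasure Df] in
/-- One step of the exponential moment of the lower-level error for fixed upper-level samples. -/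
lemma lintegral_expMoment_step_le (hc : c.Valid) (hs : RelaxedSmooth c P) (hl : LowerLevel c P)
    (ho : OracleAssumption c P Df Dg) (hr : Regime c h ε q l) (s : State dx dy) (r : ℝ)
    (w : (Ξ × Ξ) × (Z × Z)) :
    ∫⁻ p, ENNReal.ofReal (gradSize P ε (step P h s p w).x *
        expMoment P l ((1 - 3 * q) * r) (step P h s p w)) ∂Dg ≤
      ENNReal.ofReal (1 - 2 * q) * ENNReal.ofReal (gradSize P ε s.x * expMoment P l r s)
        + ENNReal.ofReal (31 / 10 * q) * ENNReal.ofReal (gradSize P ε s.x) := by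
  have hε := hr.ε_pos
  have hq := hr.q_pos
  have hq1 := hr.q_le
  have hμ := hc.μ_pos
  have hl0 := hr.l_pos
  have hη := hr.η_pos
  rcases isEmpty_or_nonempty Z with hZ | ⟨⟨p0⟩⟩
  · rw [lintegral_of_isEmpty]; exact zero_le
  -- The new x does not depend on the lower-level sample, so an arbitrary p0 names it.
  set x' := (step P h s p0 w).x with hx'
  have hx : ‖x' - s.x‖ ≤ h.η := norm_step_sub_le hη.le s p0 w
  have hαμ : h.α * c.μ = 8 * q := by rw [hr.α_eq]; field_simp
  have hα : 0 < h.α := by rw [hr.α_eq]; positivity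
  set D := c.lg1 / c.μ * h.η with hD
  have hyx : ‖P.yStar s.x - P.yStar x'‖ ≤ D := by
    refine (hl.yStar_lipschitz hc _ _).trans ?_
    rw [norm_sub_rev]
    have := hc.lg1_pos
    exact mul_le_mul_of_nonneg_left hx (by positivity)
  have h1 : ∀ p, expMoment P l ((1 - 3 * q) * r) (step P h s p w) ≤
      Real.exp (57 / 100 * q - l * ((1 - 3 * q) * r)) *
        Real.exp (l * (1 + q) * ‖s.y - h.α • P.Gy s.x s.y p - P.yStar s.x‖ ^ 2) := by
    intro p
    rw [← Real.exp_add, expMoment]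
    refine Real.exp_le_exp.2 ?_
    change l * (‖s.y - h.α • P.Gy s.x s.y p - P.yStar x'‖ ^ 2 - _) ≤ _
    have h2 : ‖s.y - h.α • P.Gy s.x s.y p - P.yStar x'‖ ≤
        ‖s.y - h.α • P.Gy s.x s.y p - P.yStar s.x‖ + D :=
      (norm_sub_le_norm_sub_add_norm_sub _ (P.yStar s.x) _).trans (by gcongr)
    have h3 : ‖s.y - h.α • P.Gy s.x s.y p - P.yStar x'‖ ^ 2 ≤
        (1 + q) * ‖s.y - h.α • P.Gy s.x s.y p - P.yStar s.x‖ ^ 2 + (1 + 1 / q) * D ^ 2 :=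
      (pow_le_pow_left₀ (norm_nonneg _) h2 2).trans (sq_add_le hq)
    have h4 := mul_le_mul_of_nonneg_left h3 hl0.le
    have h5 := hr.drift
    rw [← hD] at h5
    linarith
  have hσ : l * (1 + q) * h.α * c.σg1 ^ 2 ≤ 1001 / 1000 * (c.μ / 900) := by
    have h2 := hr.l_α
    have h3 : 0 ≤ l * h.α * c.σg1 ^ 2 := by positivity
    nlinarith
  have h2 := lintegral_exp_lowerStep hc hl ho (a := h.α) (l := l * (1 + q)) hα hr.α_lg1
    (by rw [hαμ]; linarith) (by positivity) (by linarith) s.x s.y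
  have h3 : Real.exp (l * (1 + q) * (1 - h.α * c.μ / 2) * ‖s.y - P.yStar s.x‖ ^ 2
      + 4 * (l * (1 + q)) * h.α ^ 2 * c.σg1 ^ 2) * Real.exp (57 / 100 * q - l * ((1 - 3 * q) * r)) ≤
      Real.exp (61 / 100 * q) * ((1 - 3 * q) * expMoment P l r s + 3 * q) := by
    have h4 : Real.exp ((1 - 3 * q) * (l * (‖s.y - P.yStar s.x‖ ^ 2 - r))) ≤
        (1 - 3 * q) * expMoment P l r s + 3 * q := by
      refine (exp_mul_le (by linarith) (by linarith)).trans (le_of_eq ?_)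
      rw [expMoment]; ring
    refine le_trans ?_ (mul_le_mul_of_nonneg_left h4 (Real.exp_pos _).le)
    rw [← Real.exp_add, ← Real.exp_add]
    refine Real.exp_le_exp.2 ?_
    have h5 : 4 * (l * (1 + q)) * h.α ^ 2 * c.σg1 ^ 2 ≤ 4 / 100 * q := by
      have h6 := mul_le_mul_of_nonneg_left hσ hα.le
      have h7 : h.α * (1001 / 1000 * (c.μ / 900)) = 1001 / 1000 / 900 * (8 * q) := by
        rw [← hαμ]; ring
      rw [h7] at h6
      linarith
    -- α = 8γ gives αμ/2 = 4q. Young's factor 1 + q for the drift of y* costs one q, which leaves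
    -- the rate 1 - 3q of the level.
    have h6 : l * (1 + q) * (1 - h.α * c.μ / 2) * ‖s.y - P.yStar s.x‖ ^ 2 ≤
        l * (1 - 3 * q) * ‖s.y - P.yStar s.x‖ ^ 2 := by
      rw [hαμ, mul_assoc l]; gcongr; nlinarith
    linarith
  have hg := gradSize_pos (P := P) hε s.x
  have hg' := (gradSize_step hc hs hl hr hx).1
  have hY : 0 < expMoment P l r s := Real.exp_pos _
  have h4 : (1 + q / 200) * Real.exp (61 / 100 * q) ≤ 1 + 62 / 100 * q := by
    have h5 := Real.exp_bound' (x := 61 / 100 * q) (by positivity) (by linarith) (n := 2) (by norm_num)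
    simp only [Finset.sum_range_succ, Finset.sum_range_zero] at h5
    norm_num [Nat.factorial] at h5
    nlinarith
  have h5 : gradSize P ε x' * (Real.exp (61 / 100 * q) * ((1 - 3 * q) * expMoment P l r s + 3 * q)) ≤
      (1 - 2 * q) * (gradSize P ε s.x * expMoment P l r s) + 31 / 10 * q * gradSize P ε s.x := by
    have h7 : 0 ≤ (1 - 3 * q) * expMoment P l r s + 3 * q := by
      have : 0 ≤ 1 - 3 * q := by linarith
      positivity
    calc _ ≤ (1 + q / 200) * gradSize P ε s.x *
          (Real.exp (61 / 100 * q) * ((1 - 3 * q) * expMoment P l r s + 3 * q)) := by gcongr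
      _ = gradSize P ε s.x * ((1 + q / 200) * Real.exp (61 / 100 * q)) *
          ((1 - 3 * q) * expMoment P l r s + 3 * q) := by ring
      _ ≤ gradSize P ε s.x * (1 + 62 / 100 * q) *
          ((1 - 3 * q) * expMoment P l r s + 3 * q) := by gcongr
      _ = (1 + 62 / 100 * q) * (1 - 3 * q) * (gradSize P ε s.x * expMoment P l r s)
          + (1 + 62 / 100 * q) * (3 * q) * gradSize P ε s.x := by ring
      _ ≤ _ := by
        refine add_le_add (mul_le_mul_of_nonneg_right ?_ (by positivity))
          (mul_le_mul_of_nonneg_right ?_ hg.le) <;> nlinarith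
  have hg0 := gradSize_pos (P := P) hε x'
  calc _ ≤ ∫⁻ p, ENNReal.ofReal (gradSize P ε x' *
          Real.exp (57 / 100 * q - l * ((1 - 3 * q) * r))) * ENNReal.ofReal
          (Real.exp (l * (1 + q) * ‖s.y - h.α • P.Gy s.x s.y p - P.yStar s.x‖ ^ 2)) ∂Dg := by
        refine lintegral_mono fun p => ?_
        rw [← ENNReal.ofReal_mul (by positivity)]
        refine ENNReal.ofReal_le_ofReal ?_
        rw [mul_assoc]
        exact mul_le_mul_of_nonneg_left (h1 p) hg0.le
    _ = ENNReal.ofReal (gradSize P ε x' *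
          Real.exp (57 / 100 * q - l * ((1 - 3 * q) * r))) * ∫⁻ p, ENNReal.ofReal
          (Real.exp (l * (1 + q) * ‖s.y - h.α • P.Gy s.x s.y p - P.yStar s.x‖ ^ 2)) ∂Dg :=
        lintegral_const_mul' _ _ ENNReal.ofReal_ne_top
    _ ≤ _ := by
        refine (mul_le_mul_right h2 _).trans ?_
        have h6 : 0 ≤ 1 - 2 * q := by linarith
        rw [← ENNReal.ofReal_mul (by positivity), ← ENNReal.ofReal_mul h6,
          ← ENNReal.ofReal_mul (by positivity),
          ← ENNReal.ofReal_add (by positivity) (by positivity)]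
        refine ENNReal.ofReal_le_ofReal (le_trans ?_ h5)
        rw [mul_assoc, mul_comm (Real.exp (57 / 100 * q - _))]
        exact mul_le_mul_of_nonneg_left h3 hg0.le

end OneStep

/-! ### Bounding the driving term by the exponential moment -/

section Pathwise

open Consts

/-- Here u is the normalized distance and κ its excess over the level, scaled by 512. For κ ≤ 1
already u ≤ 0.045. Beyond that u e^{6u} and its square grow at most like e^{2(κ-1)} and e^{4(κ-1)},
far below e^{b(κ-1)}, which is the exponential moment divided by B. -/
lemma steady_bound {u κ b : ℝ} (hu : 0 ≤ u) (hb : 58 ≤ b) (hκ : u ^ 2 ≤ 1 / 10 ^ 5 + κ / 512) :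
    u * Real.exp (6 * u) ≤ 6 / 100 + Real.exp (b * (κ - 1)) ∧
      (u * Real.exp (6 * u)) ^ 2 ≤ 36 / 10 ^ 4 + Real.exp (b * (κ - 1)) := by
  have h0 : Real.exp (27 / 100) ≤ 132 / 100 := by
    have h5 := Real.exp_bound' (x := 27 / 100) (by norm_num) (by norm_num) (n := 4) (by norm_num)
    simp only [Finset.sum_range_succ, Finset.sum_range_zero] at h5
    norm_num [Nat.factorial] at h5
    linarith
  have hE := Real.exp_pos (b * (κ - 1))
  rcases le_total κ 1 with h | h
  · have h1 : u ≤ 45 / 1000 := by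
      refine abs_le_of_sq_le_sq' ?_ (by norm_num) |>.2
      linarith
    have h2 : Real.exp (6 * u) ≤ Real.exp (27 / 100) := Real.exp_le_exp.2 (by linarith)
    have h3 : u * Real.exp (6 * u) ≤ 6 / 100 := by
      have := mul_le_mul h1 (h2.trans h0) (Real.exp_pos _).le (by norm_num)
      linarith
    have h4 : (u * Real.exp (6 * u)) ^ 2 ≤ (6 / 100) ^ 2 := by gcongr
    constructor <;> linarith
  · have h1 : u ≤ 45 / 1000 * κ := by
      refine abs_le_of_sq_le_sq' ?_ (by positivity) |>.2
      nlinarith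
    have h2 : κ ≤ Real.exp (κ - 1) := by linarith [Real.add_one_le_exp (κ - 1)]
    have h3 : Real.exp (6 * u) ≤ Real.exp (27 / 100) * Real.exp (κ - 1) := by
      rw [← Real.exp_add]; exact Real.exp_le_exp.2 (by linarith)
    have h4 : u * Real.exp (6 * u) ≤ 6 / 100 * Real.exp (2 * (κ - 1)) := by
      calc _ ≤ (45 / 1000 * Real.exp (κ - 1)) * (132 / 100 * Real.exp (κ - 1)) := by
            gcongr
            · exact h1.trans (by gcongr)
            · exact h3.trans (by gcongr)
        _ = 45 / 1000 * (132 / 100) * Real.exp (2 * (κ - 1)) := by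
            rw [two_mul, Real.exp_add]; ring
        _ ≤ _ := by gcongr; norm_num
    have h5 : Real.exp (4 * (κ - 1)) ≤ Real.exp (b * (κ - 1)) :=
      Real.exp_le_exp.2 (by nlinarith)
    have h6 : Real.exp (2 * (κ - 1)) ≤ Real.exp (b * (κ - 1)) :=
      Real.exp_le_exp.2 (by nlinarith)
    have h7 : (u * Real.exp (6 * u)) ^ 2 ≤ (6 / 100) ^ 2 * Real.exp (4 * (κ - 1)) := by
      calc _ ≤ (6 / 100 * Real.exp (2 * (κ - 1))) ^ 2 := by gcongr
        _ = _ := by rw [mul_pow, ← Real.exp_nat_mul]; ring_nf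
    constructor <;> linarith

/-- The same dichotomy before the initial error has decayed, with the threshold at κ = 2Θ². -/
lemma transient_bound {u κ b Θ : ℝ} (hu : 0 ≤ u) (hb : 58 ≤ b) (hΘ : 1 ≤ Θ)
    (hκ : u ^ 2 ≤ Θ ^ 2 + κ / 512) :
    u * Real.exp (6 * u) ≤
        1002 / 1000 * Θ * Real.exp (6012 / 1000 * Θ) + Real.exp (b * (κ - 1)) ∧
      (u * Real.exp (6 * u)) ^ 2 ≤
        (1002 / 1000 * Θ * Real.exp (6012 / 1000 * Θ)) ^ 2 + Real.exp (b * (κ - 1)) := by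
  have hE := Real.exp_pos (b * (κ - 1))
  rcases le_total κ (2 * Θ ^ 2) with h | h
  · have h1 : u ≤ 1002 / 1000 * Θ := by
      refine abs_le_of_sq_le_sq' ?_ (by positivity) |>.2
      nlinarith
    have h3 : u * Real.exp (6 * u) ≤ 1002 / 1000 * Θ * Real.exp (6012 / 1000 * Θ) := by
      gcongr ?_ * Real.exp ?_
      linarith
    have h4 : (u * Real.exp (6 * u)) ^ 2 ≤
      (1002 / 1000 * Θ * Real.exp (6012 / 1000 * Θ)) ^ 2 := by gcongr
    constructor <;> linarith
  · have hκ2 : 2 ≤ κ := by nlinarith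
    have h1 : u ≤ 71 / 100 * κ := by
      refine abs_le_of_sq_le_sq' ?_ (by positivity) |>.2
      nlinarith
    have h2 : κ ≤ Real.exp κ := by linarith [Real.add_one_le_exp κ]
    have h4 : u * Real.exp (6 * u) ≤ Real.exp (526 / 100 * κ) := by
      calc _ ≤ Real.exp κ * Real.exp (426 / 100 * κ) := by
            gcongr ?_ * Real.exp ?_
            · linarith
            · linarith
        _ = _ := by rw [← Real.exp_add]; ring_nf
    have h5 : (u * Real.exp (6 * u)) ^ 2 ≤ Real.exp (b * (κ - 1)) := by
      calc _ ≤ Real.exp (526 / 100 * κ) ^ 2 := by gcongr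
        _ = Real.exp (1052 / 100 * κ) := by rw [← Real.exp_nat_mul]; ring_nf
        _ ≤ _ := Real.exp_le_exp.2 (by nlinarith)
    have h6 : u * Real.exp (6 * u) ≤ Real.exp (b * (κ - 1)) :=
      h4.trans (Real.exp_le_exp.2 (by nlinarith))
    have h7 : 0 ≤ 1002 / 1000 * Θ * Real.exp (6012 / 1000 * Θ) := by positivity
    constructor
    · linarith
    · nlinarith [sq_nonneg (1002 / 1000 * Θ * Real.exp (6012 / 1000 * Θ))]

variable {dx dy : ℕ} {Ξ Z : Type*} {c : Consts} {P : Problem dx dy Ξ Z} {ε l B : ℝ}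

/-- The normalized lower-level error in terms of the normalized distance, together with the
exponent of `expMoment / B`. -/
lemma lowerErr_aux (hc : c.Valid) (hε : 0 < ε) (ha : c.expRate * ε ≤ 6 * c.L0)
    (hl : l = 512 * (c.L0 / ε) ^ 2 * Real.log B) (hB : 0 < B) (r : ℝ) (s : State dx dy) :
    ∃ u, 0 ≤ u ∧ lowerErr c P ε s.x s.y ≤ u * Real.exp (6 * u) ∧ ∃ κ,
      u ^ 2 = (c.L0 / ε) ^ 2 * r + κ / 512 ∧
      expMoment P l r s / B = Real.exp (Real.log B * (κ - 1)) := by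
  have hL0 := L0_pos hc
  set d := ‖s.y - P.yStar s.x‖ with hd
  refine ⟨c.L0 / ε * d, by positivity, ?_,
    512 * (c.L0 / ε) ^ 2 * (d ^ 2 - r), by ring, ?_⟩
  · rw [lowerErr, ← hd, mul_assoc]
    refine mul_le_mul_of_nonneg_left (mul_le_mul_of_nonneg_left (Real.exp_le_exp.2 ?_)
      (norm_nonneg _)) (by positivity)
    have h1 : c.expRate * d = c.expRate * ε * (d / ε) := by field_simp
    have h2 : 6 * (c.L0 / ε * d) = 6 * c.L0 * (d / ε) := by field_simp
    rw [h1, h2]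
    gcongr
  · rw [expMoment, ← hd, hl]
    nth_rewrite 2 [← Real.exp_log hB]
    rw [← Real.exp_sub]
    ring_nf

lemma drive_le_of_lowerErr (hε : 0 < ε) {s : State dx dy} {A A2 E : ℝ} (hE : 0 ≤ E)
    (h1 : lowerErr c P ε s.x s.y ≤ A + E) (h2 : lowerErr c P ε s.x s.y ^ 2 ≤ A2 + E) :
    drive c P ε s ≤ gradSize P ε s.x * A + gradSize P ε s.x / 200 + 197 / 200 * ε
      + 5001 / 1000 * (ε * A2) + 7 * (gradSize P ε s.x * E) := by
  have hg := gradSize_pos (P := P) hε s.x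
  have hg1 : ε ≤ gradSize P ε s.x := by rw [gradSize]; linarith [norm_nonneg (gradient P.Φ s.x)]
  have h3 := mul_le_mul_of_nonneg_left h1 hg.le
  have h4 := mul_le_mul_of_nonneg_left h2 hε.le
  have h5 := mul_le_mul_of_nonneg_right hg1 hE
  have h6 : 0 ≤ gradSize P ε s.x * E := by positivity
  rw [drive]
  linarith

/-- The coefficient 0.065 of the gradient is what matters: multiplied by 3.01 in the Lyapunov
inequality it stays well below 1 and can be moved to the left side. -/
lemma drive_le_steady (hc : c.Valid) (hε : 0 < ε) (ha : c.expRate * ε ≤ 6 * c.L0)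
    (hl : l = 512 * (c.L0 / ε) ^ 2 * Real.log B) (hB : 0 < B) (hb : 58 ≤ Real.log B) {r : ℝ}
    (hr : (c.L0 / ε) ^ 2 * r ≤ 1 / 10 ^ 5) (s : State dx dy) :
    drive c P ε s ≤ 65 / 1000 * gradSize P ε s.x + 1004 / 1000 * ε
      + 7 * (gradSize P ε s.x * expMoment P l r s / B) := by
  obtain ⟨u, hu, h1, κ, h2, h3⟩ := lowerErr_aux (P := P) hc hε ha hl hB r s
  obtain ⟨h4, h5⟩ := steady_bound hu hb (κ := κ) (by linarith)
  rw [← h3] at h4 h5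
  have h0 := lowerErr_nonneg (P := P) hc hε s.x s.y
  have hE : 0 ≤ expMoment P l r s / B := div_nonneg (Real.exp_pos _).le hB.le
  have h6 := drive_le_of_lowerErr hε hE (h1.trans h4)
    ((pow_le_pow_left₀ h0 h1 2).trans h5)
  rw [mul_div_assoc]
  linarith

/-- A crude bound for the initial phase. The polynomial factors Θ² are hidden in the exponential,
and the rate 14.1 is what the subsequent contraction has to beat. -/
lemma drive_le_transient (hc : c.Valid) (hε : 0 < ε) (ha : c.expRate * ε ≤ 6 * c.L0)
    (hl : l = 512 * (c.L0 / ε) ^ 2 * Real.log B) (hB : 0 < B) (hb : 58 ≤ Real.log B) {r Θ G : ℝ}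
    (hΘ : 1 ≤ Θ) (hr : (c.L0 / ε) ^ 2 * r ≤ Θ ^ 2) (s : State dx dy)
    (hG : gradSize P ε s.x ≤ G) :
    drive c P ε s ≤ G * Real.exp (141 / 10 * Θ)
      + 7 * (gradSize P ε s.x * expMoment P l r s / B) := by
  obtain ⟨u, hu, h1, κ, h2, h3⟩ := lowerErr_aux (P := P) hc hε ha hl hB r s
  obtain ⟨h4, h5⟩ := transient_bound hu hb hΘ (κ := κ) (by linarith)
  rw [← h3] at h4 h5
  have h0 := lowerErr_nonneg (P := P) hc hε s.x s.y
  have hE : 0 ≤ expMoment P l r s / B := div_nonneg (Real.exp_pos _).le hB.le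
  have h6 := drive_le_of_lowerErr hε hE (h1.trans h4)
    ((pow_le_pow_left₀ h0 h1 2).trans h5)
  rw [mul_div_assoc]
  have hg := gradSize_pos (P := P) hε s.x
  have hg1 : ε ≤ gradSize P ε s.x := by rw [gradSize]; linarith [norm_nonneg (gradient P.Φ s.x)]
  have hG0 := hg.trans_le hG
  set W := Real.exp (6012 / 1000 * Θ) with hW
  have hW1 : 1 ≤ W := Real.one_le_exp (by positivity)
  have k0 : 1 ≤ Θ ^ 2 * W ^ 2 := by
    have : 1 ≤ Θ * W := one_le_mul_of_one_le_of_one_le hΘ hW1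
    nlinarith
  have k1 : Θ * W ≤ Θ ^ 2 * W ^ 2 := by
    have : 1 ≤ Θ * W := one_le_mul_of_one_le_of_one_le hΘ hW1
    nlinarith
  have k2 : gradSize P ε s.x * (1002 / 1000 * Θ * W) ≤ 1002 / 1000 * (G * (Θ ^ 2 * W ^ 2)) := by
    calc _ = 1002 / 1000 * (gradSize P ε s.x * (Θ * W)) := by ring
      _ ≤ _ := by gcongr
  have k3 : G ≤ G * (Θ ^ 2 * W ^ 2) := le_mul_of_one_le_right hG0.le k0
  have k4 : ε * (1002 / 1000 * Θ * W) ^ 2 ≤ 1005 / 1000 * (G * (Θ ^ 2 * W ^ 2)) := by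
    have k5 : ε * (Θ ^ 2 * W ^ 2) ≤ G * (Θ ^ 2 * W ^ 2) := by gcongr; linarith
    have k6 : 0 ≤ G * (Θ ^ 2 * W ^ 2) := by positivity
    calc _ = (1002 / 1000) ^ 2 * (ε * (Θ ^ 2 * W ^ 2)) := by ring
      _ ≤ (1002 / 1000) ^ 2 * (G * (Θ ^ 2 * W ^ 2)) := by gcongr
      _ ≤ _ := by gcongr; norm_num
  have k7 : Θ ^ 2 * W ^ 2 * 7.1 ≤ Real.exp (141 / 10 * Θ) := by
    have e1 : Θ ≤ Real.exp (Θ - 1) := by linarith [Real.add_one_le_exp (Θ - 1)]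
    have e2 : (7.1 : ℝ) ≤ Real.exp 2 := by
      have := Real.exp_one_gt_d9
      rw [show (2 : ℝ) = 1 + 1 by norm_num, Real.exp_add]; nlinarith
    calc _ ≤ Real.exp (Θ - 1) ^ 2 * W ^ 2 * Real.exp 2 := by gcongr
      _ = Real.exp (2 * (Θ - 1) + 2 * (6012 / 1000 * Θ) + 2) := by
          rw [Real.exp_add, Real.exp_add, hW, ← Real.exp_nat_mul, ← Real.exp_nat_mul]
          norm_num
      _ ≤ _ := Real.exp_le_exp.2 (by linarith)
  have k8 := mul_le_mul_of_nonneg_left k7 hG0.le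
  have k9 : 0 ≤ G * (Θ ^ 2 * W ^ 2) := by positivity
  linarith

end Pathwise

/-! ### Deterministic bounds along a trajectory -/

section Path

open Consts

variable {dx dy : ℕ} {Ξ Z : Type*} {c : Consts} {P : Problem dx dy Ξ Z} {h : StepSizes}
  {ε q l : ℝ}

lemma norm_mainLoop_sub_le (hη : 0 ≤ h.η) (s₀ : State dx dy) (p : ℕ → Z) (w : UpperSample Ξ Z)
    (t : ℕ) : ‖(mainLoop P h s₀ p w t).x - s₀.x‖ ≤ h.η * t := by
  induction t with
  | zero => simp [mainLoop]
  | succ t ih =>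
    have h1 := norm_step_sub_le (P := P) hη (mainLoop P h s₀ p w t) (p t) (w t)
    have h2 := norm_sub_le_norm_sub_add_norm_sub (mainLoop P h s₀ p w (t + 1)).x
      (mainLoop P h s₀ p w t).x s₀.x
    simp only [mainLoop] at h2 ⊢
    push_cast
    linarith

/-- A deterministic bound on the gradient along the iterates. -/
lemma norm_gradient_mainLoop_le (hc : c.Valid) (hs : RelaxedSmooth c P) (hl : LowerLevel c P)
    (hη : 0 ≤ h.η) (s₀ : State dx dy) (p : ℕ → Z) (w : UpperSample Ξ Z) (t : ℕ) :
    ‖gradient P.Φ (mainLoop P h s₀ p w t).x‖ ≤ ‖gradient P.Φ s₀.x‖ +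
      (c.L0 + c.L1 * ‖gradient P.Φ s₀.x‖) * (h.η * t * Real.exp (c.L1 * (h.η * t))) := by
  have h1 := norm_mainLoop_sub_le (P := P) hη s₀ p w t
  have h2 := norm_gradient_Φ_sub_le_exp hc hs hl s₀.x (mainLoop P h s₀ p w t).x
  rw [norm_sub_rev, norm_sub_rev s₀.x] at h2
  have hL0 := L0_pos hc
  have hL1 := L1_pos hc
  have h3 : (c.L0 + c.L1 * ‖gradient P.Φ s₀.x‖) * (‖(mainLoop P h s₀ p w t).x - s₀.x‖ *
      Real.exp (c.L1 * ‖(mainLoop P h s₀ p w t).x - s₀.x‖)) ≤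
      (c.L0 + c.L1 * ‖gradient P.Φ s₀.x‖) * (h.η * t * Real.exp (c.L1 * (h.η * t))) := by
    gcongr
  have h4 := norm_add_le (gradient P.Φ s₀.x)
    (gradient P.Φ (mainLoop P h s₀ p w t).x - gradient P.Φ s₀.x)
  rw [add_sub_cancel] at h4
  linarith

/-- The gradient bound over the initial phase. -/
lemma gradSize_mainLoop_le (hc : c.Valid) (hs : RelaxedSmooth c P) (hl : LowerLevel c P)
    (hr : Regime c h ε q l) {Θ : ℝ} (hΘ : 1 ≤ Θ) (hL1 : 5 * (c.L1 * ε * Θ) ≤ c.L0)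
    (s₀ : State dx dy) (p : ℕ → Z) (w : UpperSample Ξ Z) {t : ℕ} (ht : q * t ≤ 2801 / 100 * Θ) :
    gradSize P ε (mainLoop P h s₀ p w t).x ≤
      115 / 100 * (Θ * ε) + 103 / 100 * ‖gradient P.Φ s₀.x‖ := by
  have h1 := norm_gradient_mainLoop_le (P := P) hc hs hl hr.η_pos.le s₀ p w t
  have hL0 := L0_pos hc
  have hL1p := L1_pos hc
  have hε := hr.ε_pos
  have hη := hr.η_pos
  set Γ := ‖gradient P.Φ s₀.x‖ with hΓ
  have h2 : c.L0 * (h.η * t) ≤ 141 / 1000 * (Θ * ε) := by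
    have h3 := mul_le_mul_of_nonneg_right hr.η_L0 (Nat.cast_nonneg (α := ℝ) t)
    have h4 := mul_le_mul_of_nonneg_left ht hε.le
    nlinarith [mul_pos (zero_lt_one.trans_le hΘ) hε]
  have h3 : c.L1 * (h.η * t) ≤ 282 / 10000 := by
    have h4 := mul_le_mul_of_nonneg_left h2 hL1p.le
    have h5 : c.L0 * (c.L1 * (h.η * t)) ≤ c.L0 * (282 / 10000) := by nlinarith
    exact le_of_mul_le_mul_left h5 hL0
  have h4 : Real.exp (c.L1 * (h.η * t)) ≤ 103 / 100 := by
    refine (Real.exp_le_exp.2 h3).trans ?_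
    have h5 := Real.exp_bound' (x := 282 / 10000) (by norm_num) (by norm_num) (n := 2) (by norm_num)
    simp only [Finset.sum_range_succ, Finset.sum_range_zero] at h5
    norm_num [Nat.factorial] at h5
    linarith
  have h5 : (c.L0 + c.L1 * Γ) * (h.η * t * Real.exp (c.L1 * (h.η * t))) ≤
      (141 / 1000 * (Θ * ε) + 282 / 10000 * Γ) * (103 / 100) := by
    calc _ = (c.L0 * (h.η * t) + c.L1 * (h.η * t) * Γ) * Real.exp (c.L1 * (h.η * t)) := by ring
      _ ≤ _ := by gcongr
  have h6 : ε ≤ Θ * ε := le_mul_of_one_le_left hε.le hΘ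
  have h7 : 0 ≤ Γ := norm_nonneg _
  rw [gradSize]
  linarith

lemma gap_mainLoop_le (hc : c.Valid) (hs : RelaxedSmooth c P) (hl : LowerLevel c P)
    (hr : Regime c h ε q l) {G : ℝ} (s₀ : State dx dy) (p : ℕ → Z) (w : UpperSample Ξ Z) {n : ℕ}
    (hG : ∀ t < n, gradSize P ε (mainLoop P h s₀ p w t).x ≤ G) :
    P.gap (mainLoop P h s₀ p w n).x ≤ P.gap s₀.x + 101 / 100 * (h.η * n * G) := by
  induction n with
  | zero => simp [mainLoop]
  | succ n ih =>
    have h1 := ih fun t ht => hG t (by omega)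
    have h2 := gap_step (P := P) hc hs hl hr
      (norm_step_sub_le (P := P) hr.η_pos.le (mainLoop P h s₀ p w n) (p n) (w n))
    have h3 := mul_le_mul_of_nonneg_left (hG n (by omega)) hr.η_pos.le
    simp only [mainLoop]
    push_cast
    linarith

end Path

/-! ### Discrete Gronwall and telescoping in the extended nonnegative reals -/

section Sums

open scoped ENNReal

lemma ENNReal_gronwall {a β : ℕ → ℝ≥0∞} {r K : ℝ} (hr0 : 0 ≤ r) (hr1 : r ≤ 1) (hK : 0 ≤ K)
    {n : ℕ} (h : ∀ t < n, a (t + 1) ≤ ENNReal.ofReal (1 - r) * a t + ENNReal.ofReal (r * K) + β t) :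
    a n ≤ ENNReal.ofReal ((1 - r) ^ n) * a 0 + ENNReal.ofReal K + ∑ t ∈ Finset.range n, β t := by
  induction n with
  | zero => simp
  | succ n ih =>
    have h1 : 0 ≤ 1 - r := by linarith
    have h2 : ENNReal.ofReal (1 - r) ≤ 1 := by
      rw [← ENNReal.ofReal_one]; exact ENNReal.ofReal_le_ofReal (by linarith)
    calc a (n + 1) ≤ ENNReal.ofReal (1 - r) * a n + ENNReal.ofReal (r * K) + β n :=
          h n (by omega)
      _ ≤ ENNReal.ofReal (1 - r) * (ENNReal.ofReal ((1 - r) ^ n) * a 0 + ENNReal.ofReal K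
            + ∑ t ∈ Finset.range n, β t) + ENNReal.ofReal (r * K) + β n := by
          gcongr; exact ih fun t ht => h t (by omega)
      _ = ENNReal.ofReal ((1 - r) ^ (n + 1)) * a 0 + (ENNReal.ofReal ((1 - r) * K)
            + ENNReal.ofReal (r * K))
            + (ENNReal.ofReal (1 - r) * ∑ t ∈ Finset.range n, β t + β n) := by
          rw [pow_succ, mul_comm ((1 - r) ^ n), ENNReal.ofReal_mul h1, ENNReal.ofReal_mul h1]
          ring
      _ ≤ ENNReal.ofReal ((1 - r) ^ (n + 1)) * a 0 + ENNReal.ofReal K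
            + (1 * ∑ t ∈ Finset.range n, β t + β n) := by
          rw [← ENNReal.ofReal_add (by positivity) (by positivity)]
          gcongr
          linarith
      _ = _ := by rw [one_mul, Finset.sum_range_succ]

/-- The decrease x is kept on the left, because subtraction is truncated here. -/
lemma ENNReal_telescope {v x y : ℕ → ℝ≥0∞} {m n : ℕ} (hmn : m ≤ n)
    (h : ∀ t, m ≤ t → t < n → v (t + 1) + x t ≤ v t + y t) :
    v n + ∑ t ∈ Finset.Ico m n, x t ≤ v m + ∑ t ∈ Finset.Ico m n, y t := by
  induction n, hmn using Nat.le_induction with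
  | base => simp
  | succ n hmn ih =>
    rw [Finset.sum_Ico_succ_top hmn, Finset.sum_Ico_succ_top hmn]
    have h1 := h n hmn (by omega)
    have h2 := ih fun t ht ht' => h t ht (by omega)
    calc _ = v (n + 1) + x n + ∑ t ∈ Finset.Ico m n, x t := by ring
      _ ≤ v n + y n + ∑ t ∈ Finset.Ico m n, x t := by gcongr
      _ = v n + ∑ t ∈ Finset.Ico m n, x t + y n := by ring
      _ ≤ v m + ∑ t ∈ Finset.Ico m n, y t + y n := by gcongr
      _ = _ := by ring

end Sums

/-! ### Averages over the upper-level samples for frozen lower-level samples -/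

section FixedLower

open Consts Filter
open scoped ENNReal

variable {dx dy : ℕ} {Ξ Z : Type*} [MeasurableSpace Ξ] [MeasurableSpace Z]
  {c : Consts} {P : Problem dx dy Ξ Z} {h : StepSizes} {ε q l B Θ : ℝ} {T : ℕ}
  {Df : Measure Ξ} {Dg : Measure Z} [IsProbabilityMeasure Df] [IsProbabilityMeasure Dg]

section Measurability

variable (hc : c.Valid) (hs : RelaxedSmooth c P) (hl : LowerLevel c P)
include hc hs hl

omit [MeasurableSpace Ξ] [MeasurableSpace Z] in
lemma measurable_gradSize : Measurable fun s : State dx dy => gradSize P ε s.x := by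
  have h1 := (continuous_gradient_Φ hc hs hl).measurable.comp (measurable_state (dx := dx) (dy := dy)).1
  exact h1.norm.const_add ε

omit [MeasurableSpace Ξ] [MeasurableSpace Z] in
lemma measurable_norm_gradient : Measurable fun s : State dx dy => ‖gradient P.Φ s.x‖ :=
  ((continuous_gradient_Φ hc hs hl).measurable.comp (measurable_state (dx := dx) (dy := dy)).1).norm

omit [MeasurableSpace Ξ] [MeasurableSpace Z] in
lemma measurable_momErr : Measurable (momErr c P ε : State dx dy → ℝ) := by
  obtain ⟨hx, -, hz, hm⟩ := measurable_state (dx := dx) (dy := dy)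
  have h1 := (continuous_gradient_Φ hc hs hl).measurable.comp hx
  have h2 := (continuous_zStar hc hs hl).measurable.comp hx
  have h3 := (((hm.sub h1).norm.pow_const 2).add_const ((ε / 4) ^ 2)).sqrt
  have h4 := ((((hz.sub h2).norm.pow_const 2).const_mul (c.lg1 ^ 2)).const_mul 5).div_const ε
  exact h3.add h4

omit [MeasurableSpace Ξ] [MeasurableSpace Z] in
lemma measurable_potential (η : ℝ) : Measurable (potential c P η q ε : State dx dy → ℝ) := by
  have hx := (measurable_state (dx := dx) (dy := dy)).1
  have h1 := ((differentiable_Φ hc hs hl).continuous.measurable.comp hx).sub_const (⨅ x, P.Φ x)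
  exact h1.add ((measurable_momErr hc hs hl).const_mul _)

omit [MeasurableSpace Ξ] [MeasurableSpace Z] hs in
lemma measurable_expMoment (r : ℝ) : Measurable (expMoment P l r : State dx dy → ℝ) := by
  obtain ⟨hx, hy, -, -⟩ := measurable_state (dx := dx) (dy := dy)
  have h1 := (hl.continuous_yStar hc).measurable.comp hx
  exact ((((hy.sub h1).norm.pow_const 2).sub_const r).const_mul l).exp

end Measurability

/-- The mean over the upper-level samples of a function of the state at time `t`. -/
noncomputable def upperMean (Df : Measure Ξ) (Dg : Measure Z) [IsProbabilityMeasure Df]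
    [IsProbabilityMeasure Dg] (P : Problem dx dy Ξ Z) (h : StepSizes) (s₀ : State dx dy)
    (p : ℕ → Z) (F : State dx dy → ℝ) (t : ℕ) : ℝ≥0∞ :=
  ∫⁻ w, ENNReal.ofReal (F (mainLoop P h s₀ p w t)) ∂(upperLaw Df Dg)

variable {s₀ : State dx dy} {p : ℕ → Z}

omit [IsProbabilityMeasure Df] [IsProbabilityMeasure Dg] in
lemma measurable_mainLoop_upper (ho : OracleAssumption c P Df Dg) (t : ℕ) :
    Measurable fun w => mainLoop P h s₀ p w t :=
  measurable_mainLoop ho (hh := fun _ => h) measurable_const measurable_const measurable_const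
    measurable_const measurable_const measurable_const measurable_id t

lemma upperMean_succ (ho : OracleAssumption c P Df Dg) {F : State dx dy → ℝ} (hF : Measurable F)
    (t : ℕ) : upperMean Df Dg P h s₀ p F (t + 1) =
      ∫⁻ w, ∫⁻ a, ENNReal.ofReal (F (step P h (mainLoop P h s₀ p w t) (p t) a))
        ∂(sampleLaw Df Dg) ∂(upperLaw Df Dg) := by
  simp only [upperMean, mainLoop]
  simp_rw [mainLoop_eq_orbit]
  have hstep : ∀ i, Measurable (Function.uncurry fun (s : State dx dy) (a : (Ξ × Ξ) × (Z × Z)) =>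
      step P h s (p i) a) := fun i =>
    measurable_step ho (hh := fun _ => h) measurable_const measurable_const measurable_const
      measurable_const measurable_fst measurable_const measurable_snd
  exact lintegral_orbit_succ hstep (sampleLaw Df Dg) s₀ t
    (F := fun s a => ENNReal.ofReal (F (step P h s (p t) a)))
    (hF.ennreal_ofReal.comp (hstep t))

lemma upperMean_le (ho : OracleAssumption c P Df Dg) {F F₁ F₂ : State dx dy → ℝ} {K k₁ k₂ : ℝ}
    {t : ℕ} (hF₁ : Measurable F₁) (hF₁0 : ∀ s, 0 ≤ F₁ s) (hF₂0 : ∀ s, 0 ≤ F₂ s) (hK : 0 ≤ K)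
    (hk₁ : 0 ≤ k₁) (hk₂ : 0 ≤ k₂)
    (hle : ∀ w, F (mainLoop P h s₀ p w t) ≤ K + k₁ * F₁ (mainLoop P h s₀ p w t)
      + k₂ * F₂ (mainLoop P h s₀ p w t)) :
    upperMean Df Dg P h s₀ p F t ≤ ENNReal.ofReal K
      + ENNReal.ofReal k₁ * upperMean Df Dg P h s₀ p F₁ t
      + ENNReal.ofReal k₂ * upperMean Df Dg P h s₀ p F₂ t := by
  have hm := measurable_mainLoop_upper (h := h) (s₀ := s₀) (p := p) ho t
  have : IsProbabilityMeasure (upperLaw Df Dg) := by unfold upperLaw; infer_instance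
  calc _ ≤ ∫⁻ w, (ENNReal.ofReal K
        + ENNReal.ofReal k₁ * ENNReal.ofReal (F₁ (mainLoop P h s₀ p w t))
        + ENNReal.ofReal k₂ * ENNReal.ofReal (F₂ (mainLoop P h s₀ p w t))) ∂(upperLaw Df Dg) := by
        refine lintegral_mono fun w => (ENNReal.ofReal_le_ofReal (hle w)).trans (le_of_eq ?_)
        have h1 := hF₁0 (mainLoop P h s₀ p w t)
        have h2 := hF₂0 (mainLoop P h s₀ p w t)
        rw [ENNReal.ofReal_add (by positivity) (by positivity),
          ENNReal.ofReal_add (by positivity) (by positivity), ENNReal.ofReal_mul hk₁,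
          ENNReal.ofReal_mul hk₂]
    _ = _ := by
        have h1 : Measurable fun w =>
            ENNReal.ofReal k₁ * ENNReal.ofReal (F₁ (mainLoop P h s₀ p w t)) :=
          (hF₁.comp hm).ennreal_ofReal.const_mul _
        have h2 : Measurable fun w => ENNReal.ofReal K +
            ENNReal.ofReal k₁ * ENNReal.ofReal (F₁ (mainLoop P h s₀ p w t)) := h1.const_add _
        rw [lintegral_add_left h2, lintegral_add_left measurable_const,
          lintegral_const_mul' _ _ ENNReal.ofReal_ne_top,
          lintegral_const_mul' _ _ ENNReal.ofReal_ne_top]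
        simp [upperMean]

lemma upperMean_momErr_succ_le (hc : c.Valid) (hs : RelaxedSmooth c P) (hl : LowerLevel c P)
    (ho : OracleAssumption c P Df Dg) (hr : Regime c h ε q l) (t : ℕ) :
    upperMean Df Dg P h s₀ p (momErr c P ε) (t + 1) ≤
      ENNReal.ofReal (1 - 69 / 100 * q) * upperMean Df Dg P h s₀ p (momErr c P ε) t
        + ENNReal.ofReal q * upperMean Df Dg P h s₀ p (drive c P ε) t := by
  have hm := measurable_mainLoop_upper (h := h) (s₀ := s₀) (p := p) ho t
  rw [upperMean_succ ho (measurable_momErr hc hs hl)]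
  refine (lintegral_mono fun w => lintegral_momErr_step_le hc hs hl ho hr _ (p t)).trans
    (le_of_eq ?_)
  rw [lintegral_add_left, lintegral_const_mul' _ _ ENNReal.ofReal_ne_top,
    lintegral_const_mul' _ _ ENNReal.ofReal_ne_top]
  · rfl
  · exact (((measurable_momErr hc hs hl).comp hm).ennreal_ofReal).const_mul _

lemma upperMean_potential_succ_le (hc : c.Valid) (hs : RelaxedSmooth c P) (hl : LowerLevel c P)
    (ho : OracleAssumption c P Df Dg) (hb : BddBelow (Set.range P.Φ)) (hr : Regime c h ε q l)
    (t : ℕ) :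
    upperMean Df Dg P h s₀ p (potential c P h.η q ε) (t + 1) +
      ENNReal.ofReal h.η * upperMean Df Dg P h s₀ p (fun s => ‖gradient P.Φ s.x‖) t ≤
      upperMean Df Dg P h s₀ p (potential c P h.η q ε) t
        + ENNReal.ofReal (h.η * (301 / 100)) * upperMean Df Dg P h s₀ p (drive c P ε) t := by
  have hm := measurable_mainLoop_upper (h := h) (s₀ := s₀) (p := p) ho t
  rw [upperMean_succ ho (measurable_potential hc hs hl _), upperMean, upperMean, upperMean,
    ← lintegral_const_mul' _ _ ENNReal.ofReal_ne_top,
    ← lintegral_const_mul' _ _ ENNReal.ofReal_ne_top, ← lintegral_add_right, ← lintegral_add_left]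
  · exact lintegral_mono fun w => lintegral_potential_step_le hc hs hl ho hb hr _ (p t)
  · exact ((measurable_potential hc hs hl _).comp hm).ennreal_ofReal
  · exact (((measurable_norm_gradient hc hs hl).comp hm).ennreal_ofReal).const_mul _

/-- The lower bounds on the number of iterations that the summation uses. -/
structure Budget (c : Consts) (P : Problem dx dy Ξ Z) (h : StepSizes) (ε q l B Θ : ℝ) (T : ℕ)
    (s₀ : State dx dy) : Prop where
  expRate_le : c.expRate * ε ≤ 6 * c.L0
  l_eq : l = 512 * (c.L0 / ε) ^ 2 * Real.log B
  B_pos : 0 < B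
  log_ge : 58 ≤ Real.log B
  m_eq : s₀.m = 0
  Θ_eq : Θ = c.L0 / ε * ‖s₀.y - P.yStar s₀.x‖
  Θ_ge : 1 ≤ Θ
  L1_Θ : 5 * (c.L1 * ε * Θ) ≤ c.L0
  T_Θ : 32 * Θ ^ 2 ≤ q * T
  T_ΘΓ : 49 * (Θ * ‖gradient P.Φ s₀.x‖) ≤ ε * (q * T)
  T_aux : 32 * auxErr c P s₀.x s₀.z ≤ ε ^ 2 * (q * T)
  T_ge : 464 ≤ q * T
  T_gap : 4 * P.gap s₀.x ≤ h.η * ε * T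

/-- The exponential moment of the lower-level error at time `t`, weighted by the gradient. -/
noncomputable def weightedMoment (P : Problem dx dy Ξ Z) (ε q l B r : ℝ) (t : ℕ)
    (s : State dx dy) : ℝ :=
  gradSize P ε s.x * expMoment P l ((1 - 3 * q) ^ t * r) s / B

omit [MeasurableSpace Ξ] [MeasurableSpace Z] in
lemma weightedMoment_nonneg (hε : 0 < ε) (hB : 0 < B) (r : ℝ) (t : ℕ) (s : State dx dy) :
    0 ≤ weightedMoment P ε q l B r t s := by
  have h1 := gradSize_pos (P := P) hε s.x
  have h2 : 0 < expMoment P l ((1 - 3 * q) ^ t * r) s := Real.exp_pos _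
  rw [weightedMoment]; positivity

/-- The end of the transient phase: the combined error is moderate. -/
lemma upperMean_momErr_le (hc : c.Valid) (hs : RelaxedSmooth c P) (hl : LowerLevel c P)
    (ho : OracleAssumption c P Df Dg) (hr : Regime c h ε q l) (hB : Budget c P h ε q l B Θ T s₀)
    {G : ℝ} {m n : ℕ} (hm : 4 * Θ ≤ q * m) (hn : 24 * Θ ≤ q * n)
    (hG : ∀ t < m + n, ∀ w, gradSize P ε (mainLoop P h s₀ p w t).x ≤ G)
    (hsteady : ∀ t, m ≤ t → (c.L0 / ε) ^ 2 * ((1 - 3 * q) ^ t * ‖s₀.y - P.yStar s₀.x‖ ^ 2)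
      ≤ 1 / 10 ^ 5) :
    upperMean Df Dg P h s₀ p (momErr c P ε) (m + n) ≤
      ENNReal.ofReal (momErr c P ε s₀ + 23 / 100 * G + 146 / 100 * ε) +
      ENNReal.ofReal (14 * q) * ∑ t ∈ Finset.range (m + n), upperMean Df Dg P h s₀ p
        (weightedMoment P ε q l B (‖s₀.y - P.yStar s₀.x‖ ^ 2) t) t := by
  have hε := hr.ε_pos
  have hq := hr.q_pos
  have hq1 := hr.q_le
  have hΘ := hB.Θ_ge
  set r := ‖s₀.y - P.yStar s₀.x‖ ^ 2 with hr_def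
  set u := upperMean Df Dg P h s₀ p (momErr c P ε) with hu
  set x := upperMean Df Dg P h s₀ p (drive c P ε) with hx
  set e := fun t => upperMean Df Dg P h s₀ p (weightedMoment P ε q l B r t) t with he
  have hmn : 0 < m + n := by
    rcases Nat.eq_zero_or_pos (m + n) with h0 | h0
    · have : m = 0 := by omega
      subst this
      simp only [Nat.cast_zero, mul_zero] at hm
      linarith
    · exact h0
  have hG0 : 0 < G := by
    have := hG 0 hmn (fun _ => by
      have := nonempty_of_isProbabilityMeasure (sampleLaw Df Dg); exact this.some)
    exact (gradSize_pos hε _).trans_le this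
  set M₁ := G * Real.exp (141 / 10 * Θ) with hM₁
  set M₂ := 65 / 1000 * G + 1004 / 1000 * ε with hM₂
  have hx1 : ∀ t < m, x t ≤ ENNReal.ofReal M₁ + ENNReal.ofReal 7 * e t := by
    intro t ht
    have h1 := upperMean_le (Df := Df) (Dg := Dg) (P := P) (h := h) (s₀ := s₀) (p := p) (t := t) ho
      (F := drive c P ε) (F₁ := fun _ => 0) (F₂ := weightedMoment P ε q l B r t) (K := M₁)
      (k₁ := 0) (k₂ := 7) measurable_const (fun _ => le_rfl)
      (weightedMoment_nonneg hε hB.B_pos r t) (by positivity) le_rfl (by norm_num) (fun w => by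
        have h2 := drive_le_transient (P := P) hc hε hB.expRate_le hB.l_eq hB.B_pos hB.log_ge hΘ
          (r := (1 - 3 * q) ^ t * r) (by
            have h3 : (1 - 3 * q) ^ t ≤ 1 := pow_le_one₀ (by linarith) (by linarith)
            have h4 : Θ ^ 2 = (c.L0 / ε) ^ 2 * r := by rw [hB.Θ_eq, mul_pow]
            rw [h4]
            gcongr
            exact mul_le_of_le_one_left (by positivity) h3) _ (hG t (by omega) w)
        rw [weightedMoment]
        linarith)
    simpa using h1
  have hx2 : ∀ t, m ≤ t → t < m + n → x t ≤ ENNReal.ofReal M₂ + ENNReal.ofReal 7 * e t := by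
    intro t ht ht'
    have h1 := upperMean_le (Df := Df) (Dg := Dg) (P := P) (h := h) (s₀ := s₀) (p := p) (t := t) ho
      (F := drive c P ε) (F₁ := fun _ => 0) (F₂ := weightedMoment P ε q l B r t) (K := M₂)
      (k₁ := 0) (k₂ := 7) measurable_const (fun _ => le_rfl)
      (weightedMoment_nonneg hε hB.B_pos r t) (by positivity) le_rfl (by norm_num) (fun w => by
        have h2 := drive_le_steady (P := P) hc hε hB.expRate_le hB.l_eq hB.B_pos hB.log_ge
          (hsteady t ht) (mainLoop P h s₀ p w t)
        have h3 := hG t ht' w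
        rw [weightedMoment]
        linarith)
    simpa using h1
  have hrec : ∀ {K : ℝ} {t : ℕ}, 0 ≤ K → x t ≤ ENNReal.ofReal K + ENNReal.ofReal 7 * e t →
      u (t + 1) ≤ ENNReal.ofReal (1 - 69 / 100 * q) * u t
        + ENNReal.ofReal (69 / 100 * q * (100 / 69 * K)) + ENNReal.ofReal (7 * q) * e t := by
    intro K t hK hxt
    refine (upperMean_momErr_succ_le hc hs hl ho hr t).trans ?_
    rw [add_assoc]
    refine add_le_add le_rfl ((mul_le_mul_right hxt _).trans (le_of_eq ?_))
    rw [mul_add, ← mul_assoc, ← ENNReal.ofReal_mul hq.le, ← ENNReal.ofReal_mul hq.le]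
    ring_nf
  -- Two applications of Gronwall: over m steps with the crude transient bound, until the level has
  -- decayed, then over n steps with the steady bound, which contract what the first phase left
  -- behind.
  have hA := ENNReal_gronwall (a := u) (β := fun t => ENNReal.ofReal (7 * q) * e t)
    (r := 69 / 100 * q) (K := 100 / 69 * M₁) (by positivity) (by linarith) (by positivity)
    (n := m) (fun t ht => hrec (by positivity) (hx1 t ht))
  have hC := ENNReal_gronwall (a := fun t => u (m + t))
    (β := fun t => ENNReal.ofReal (7 * q) * e (m + t))
    (r := 69 / 100 * q) (K := 100 / 69 * M₂) (by positivity) (by linarith) (by positivity)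
    (n := n) (fun t ht => hrec (by positivity) (hx2 (m + t) (by omega) (by omega)))
  have hu0 : u 0 = ENNReal.ofReal (momErr c P ε s₀) := by
    have : IsProbabilityMeasure (upperLaw Df Dg) := by unfold upperLaw; infer_instance
    simp [hu, upperMean, mainLoop]
  have hU0 := momErr_nonneg (c := c) (P := P) hε s₀
  simp only [add_zero] at hC
  have hp1 : ∀ k : ℕ, (1 - 69 / 100 * q) ^ k ≤ 1 := fun k =>
    pow_le_one₀ (by linarith) (by linarith)
  have hp0 : ∀ k : ℕ, 0 ≤ (1 - 69 / 100 * q) ^ k := fun k => pow_nonneg (by linarith) k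
  -- The second phase has qn ≥ 24Θ and contracts by e^{-16.56Θ}, against e^{14.1Θ} from the first.
  -- The surplus e^{-2.46Θ} with Θ ≥ 1 gives the factor 0.0897.
  have hdecay : (1 - 69 / 100 * q) ^ n * (100 / 69 * M₁) ≤ 13 / 100 * G := by
    have h1 : (1 - 69 / 100 * q) ^ n ≤ Real.exp (-(1656 / 100 * Θ)) := by
      calc _ ≤ Real.exp (-(69 / 100 * q)) ^ n := by
            gcongr
            · linarith
            · linarith [Real.add_one_le_exp (-(69 / 100 * q))]
        _ = Real.exp (-(69 / 100 * (q * n))) := by rw [← Real.exp_nat_mul]; ring_nf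
        _ ≤ _ := Real.exp_le_exp.2 (by linarith)
    have h2 : Real.exp (-(1656 / 100 * Θ)) * Real.exp (141 / 10 * Θ) ≤ 897 / 10000 := by
      rw [← Real.exp_add]
      have h3 : Real.exp (-(1656 / 100 * Θ) + 141 / 10 * Θ) ≤ Real.exp (-(246 / 100)) :=
        Real.exp_le_exp.2 (by linarith)
      refine h3.trans ?_
      rw [Real.exp_neg]
      refine inv_le_of_inv_le₀ (by norm_num) ?_
      have h4 : (7.38 : ℝ) ≤ Real.exp 2 := by
        have := Real.exp_one_gt_d9
        rw [show (2 : ℝ) = 1 + 1 by norm_num, Real.exp_add]; nlinarith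
      have h5 := Real.quadratic_le_exp_of_nonneg (show (0 : ℝ) ≤ 46 / 100 by norm_num)
      rw [show (246 / 100 : ℝ) = 2 + 46 / 100 by norm_num, Real.exp_add]
      calc _ ≤ (7.38 : ℝ) * (1 + 46 / 100 + (46 / 100) ^ 2 / 2) := by norm_num
        _ ≤ _ := by gcongr
    calc _ ≤ Real.exp (-(1656 / 100 * Θ)) * (100 / 69 * M₁) := by gcongr
      _ = 100 / 69 * G * (Real.exp (-(1656 / 100 * Θ)) * Real.exp (141 / 10 * Θ)) := by
          rw [hM₁]; ring
      _ ≤ 100 / 69 * G * (897 / 10000) := by gcongr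
      _ = _ := by ring
  calc u (m + n) ≤ ENNReal.ofReal ((1 - 69 / 100 * q) ^ n) * u m + ENNReal.ofReal (100 / 69 * M₂)
        + ∑ t ∈ Finset.range n, ENNReal.ofReal (7 * q) * e (m + t) := hC
    _ ≤ ENNReal.ofReal ((1 - 69 / 100 * q) ^ n) * (1 * ENNReal.ofReal (momErr c P ε s₀)
        + ENNReal.ofReal (100 / 69 * M₁) + ∑ t ∈ Finset.range m, ENNReal.ofReal (7 * q) * e t)
        + ENNReal.ofReal (100 / 69 * M₂)
        + ∑ t ∈ Finset.range n, ENNReal.ofReal (7 * q) * e (m + t) := by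
        gcongr
        refine hA.trans ?_
        rw [hu0]
        gcongr
        rw [← ENNReal.ofReal_one]
        exact ENNReal.ofReal_le_ofReal (hp1 m)
    _ ≤ (ENNReal.ofReal (momErr c P ε s₀) + ENNReal.ofReal (13 / 100 * G)
        + ∑ t ∈ Finset.range m, ENNReal.ofReal (7 * q) * e t)
        + ENNReal.ofReal (100 / 69 * M₂)
        + ∑ t ∈ Finset.range n, ENNReal.ofReal (7 * q) * e (m + t) := by
        have h1 : ENNReal.ofReal ((1 - 69 / 100 * q) ^ n) ≤ 1 := by
          rw [← ENNReal.ofReal_one]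
          exact ENNReal.ofReal_le_ofReal (hp1 n)
        have h2 : ENNReal.ofReal ((1 - 69 / 100 * q) ^ n) * ENNReal.ofReal (100 / 69 * M₁) ≤
            ENNReal.ofReal (13 / 100 * G) := by
          rw [← ENNReal.ofReal_mul (hp0 n)]
          exact ENNReal.ofReal_le_ofReal hdecay
        rw [mul_add, mul_add, one_mul]
        gcongr
        · exact mul_le_of_le_one_left zero_le h1
        · exact mul_le_of_le_one_left zero_le h1
    _ = ENNReal.ofReal (momErr c P ε s₀ + 13 / 100 * G + 100 / 69 * M₂)
        + ENNReal.ofReal (7 * q) * ∑ t ∈ Finset.range (m + n), e t := by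
        rw [Finset.sum_range_add, ← Finset.mul_sum, ← Finset.mul_sum,
          ENNReal.ofReal_add (by positivity) (by positivity),
          ENNReal.ofReal_add (by positivity) (by positivity)]
        ring
    _ ≤ _ := by
        gcongr ENNReal.ofReal ?_ + ENNReal.ofReal ?_ * _
        · rw [hM₂]; linarith
        · linarith

end FixedLower

/-! ### The averaged gradient for every fixed lower-level path -/

section Summation

open Consts Filter
open scoped ENNReal

variable {dx dy : ℕ} {Ξ Z : Type*} [MeasurableSpace Ξ] [MeasurableSpace Z]
  {c : Consts} {P : Problem dx dy Ξ Z} {h : StepSizes} {ε q l B Θ : ℝ} {T : ℕ}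
  {Df : Measure Ξ} {Dg : Measure Z} [IsProbabilityMeasure Df] [IsProbabilityMeasure Dg]
  {s₀ : State dx dy} {p : ℕ → Z}

instance : IsProbabilityMeasure (upperLaw Df Dg) := by unfold upperLaw; infer_instance

lemma exists_phase {q Θ a : ℝ} (hq : 0 < q) (hq1 : q ≤ 1 / 1000) (hΘ : 0 ≤ a * Θ) :
    ∃ m : ℕ, a * Θ ≤ q * m ∧ q * m ≤ a * Θ + 1 / 1000 := by
  refine ⟨⌈a * Θ / q⌉₊, ?_, ?_⟩
  · have h1 := Nat.le_ceil (a * Θ / q)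
    rw [div_le_iff₀ hq] at h1; linarith
  · have h1 := (Nat.ceil_lt_add_one (show 0 ≤ a * Θ / q by positivity)).le
    have h2 := mul_le_mul_of_nonneg_left h1 hq.le
    have h3 : q * (a * Θ / q + 1) = a * Θ + q := by field_simp
    linarith

/-- After 4Θ/q steps the level has shrunk by e^{-12Θ}, which beats Θ² and leaves at most e^{-12}. -/
lemma steady_level {q Θ : ℝ} (hq : 0 < q) (hq1 : q ≤ 1 / 1000) (hΘ : 1 ≤ Θ) {m t : ℕ}
    (hm : 4 * Θ ≤ q * m) (ht : m ≤ t) : (1 - 3 * q) ^ t * Θ ^ 2 ≤ 1 / 10 ^ 5 := by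
  have h1 : (1 - 3 * q) ^ t ≤ Real.exp (-(12 * Θ)) := by
    calc _ ≤ Real.exp (-(3 * q)) ^ t := by
          gcongr
          · linarith
          · linarith [Real.add_one_le_exp (-(3 * q))]
      _ = Real.exp (-(3 * (q * t))) := by rw [← Real.exp_nat_mul]; ring_nf
      _ ≤ _ := Real.exp_le_exp.2 (by
          have : q * m ≤ q * t := by gcongr
          linarith)
  have h2 : Θ ≤ Real.exp (Θ - 1) := by linarith [Real.add_one_le_exp (Θ - 1)]
  calc _ ≤ Real.exp (-(12 * Θ)) * Real.exp (Θ - 1) ^ 2 := by gcongr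
    _ = Real.exp (-(12 * Θ) + 2 * (Θ - 1)) := by
        rw [Real.exp_add, ← Real.exp_nat_mul]; norm_num
    _ ≤ Real.exp (-(12 : ℝ)) := Real.exp_le_exp.2 (by linarith)
    _ ≤ 1 / 10 ^ 5 := by
        rw [Real.exp_neg, ← one_div]
        refine one_div_le_one_div_of_le (by norm_num) ?_
        have h3 := Real.exp_one_gt_d9
        have h4 : Real.exp 12 = Real.exp 1 ^ 12 := by rw [← Real.exp_nat_mul]; norm_num
        rw [h4]
        calc _ ≤ (2.7 : ℝ) ^ 12 := by norm_num
          _ ≤ _ := by gcongr; linarith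

omit [MeasurableSpace Ξ] [MeasurableSpace Z] in
lemma initial_momErr_le (hr : Regime c h ε q l)
    (hB : Budget c P h ε q l B Θ T s₀) :
    momErr c P ε s₀ ≤ 18 / 100 * (ε * (q * T)) := by
  have hε := hr.ε_pos
  have h1 := smoothNorm_le_add (show 0 ≤ ε / 4 by positivity) (s₀.m - gradient P.Φ s₀.x)
  rw [hB.m_eq, zero_sub, norm_neg] at h1
  have h2 : 5 * auxErr c P s₀.x s₀.z / ε ≤ 5 / 32 * (ε * (q * T)) := by
    rw [div_le_iff₀ hε]
    have := hB.T_aux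
    nlinarith
  have h3 : ‖gradient P.Φ s₀.x‖ ≤ Θ * ‖gradient P.Φ s₀.x‖ :=
    le_mul_of_one_le_left (norm_nonneg _) hB.Θ_ge
  have h4 := hB.T_ΘΓ
  have h5 := mul_le_mul_of_nonneg_left hB.T_ge hε.le
  rw [momErr, hB.m_eq, zero_sub]
  linarith

set_option maxHeartbeats 1000000 in
/-- For fixed lower-level samples, the gradients are small on average up to the weighted
exponential moments. -/
lemma sum_upperMean_gradSize_le (hc : c.Valid) (hs : RelaxedSmooth c P) (hl : LowerLevel c P)
    (ho : OracleAssumption c P Df Dg) (hb : BddBelow (Set.range P.Φ)) (hr : Regime c h ε q l)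
    (hB : Budget c P h ε q l B Θ T s₀) :
    ∑ t ∈ Finset.range T, upperMean Df Dg P h s₀ p (fun s => gradSize P ε s.x) t ≤
      ENNReal.ofReal (10 * (ε * T)) + 80 * ∑ t ∈ Finset.range T, upperMean Df Dg P h s₀ p
        (weightedMoment P ε q l B (‖s₀.y - P.yStar s₀.x‖ ^ 2) t) t := by
  have hε := hr.ε_pos
  have hq := hr.q_pos
  have hq1 := hr.q_le
  have hη := hr.η_pos
  have hΘ := hB.Θ_ge
  set r := ‖s₀.y - P.yStar s₀.x‖ ^ 2 with hr_def
  set u := upperMean Df Dg P h s₀ p (momErr c P ε) with hu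
  set x := upperMean Df Dg P h s₀ p (drive c P ε) with hx
  set v := upperMean Df Dg P h s₀ p (potential c P h.η q ε) with hv
  set γ := upperMean Df Dg P h s₀ p (fun s => gradSize P ε s.x) with hγ
  set N := upperMean Df Dg P h s₀ p (fun s => ‖gradient P.Φ s.x‖) with hN
  set e := fun t => upperMean Df Dg P h s₀ p (weightedMoment P ε q l B r t) t with he
  set Γ := ‖gradient P.Φ s₀.x‖ with hΓ
  have hΓ0 : 0 ≤ Γ := norm_nonneg _
  -- Lengths of the two phases: 4Θ/q steps for the level to decay, then 24Θ/q steps to contract the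
  -- combined error. The Lyapunov argument starts only at time m + n.
  obtain ⟨m, hm, hm'⟩ := exists_phase (a := 4) (Θ := Θ) hq hq1 (by positivity)
  obtain ⟨n, hn, hn'⟩ := exists_phase (a := 24) (Θ := Θ) hq hq1 (by positivity)
  set G := 115 / 100 * (Θ * ε) + 103 / 100 * Γ with hG_def
  have hG0 : 0 < G := by positivity
  have hmn : q * ((m + n : ℕ) : ℝ) ≤ 2801 / 100 * Θ := by push_cast; linarith
  have hmnT : m + n ≤ T := by
    have h1 : q * ((m + n : ℕ) : ℝ) ≤ q * T := by
      have := hB.T_Θ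
      nlinarith
    exact_mod_cast le_of_mul_le_mul_left h1 hq
  have hG : ∀ t ≤ m + n, ∀ w, gradSize P ε (mainLoop P h s₀ p w t).x ≤ G := fun t ht w => by
    refine gradSize_mainLoop_le hc hs hl hr hΘ hB.L1_Θ s₀ p w (le_trans ?_ hmn)
    gcongr
  have hsteady : ∀ t, m ≤ t → (c.L0 / ε) ^ 2 * ((1 - 3 * q) ^ t * r) ≤ 1 / 10 ^ 5 := fun t ht => by
    have h1 := steady_level hq hq1 hΘ hm ht
    have h2 : Θ ^ 2 = (c.L0 / ε) ^ 2 * r := by rw [hB.Θ_eq, mul_pow]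
    rw [h2] at h1
    linarith
  -- If the weighted moments have infinite sum the claim is trivial; otherwise all quantities can be
  -- treated as real numbers.
  by_cases hfin : ∑ t ∈ Finset.range T, e t = ∞
  · rw [hfin, ENNReal.mul_top (by norm_num), add_top]; exact le_top
  have hu1 := upperMean_momErr_le (Df := Df) (Dg := Dg) (p := p) hc hs hl ho hr hB hm hn
    (fun t ht => hG t ht.le) hsteady
  have hsub : ∑ t ∈ Finset.range (m + n), e t ≤ ∑ t ∈ Finset.range T, e t :=
    Finset.sum_le_sum_of_subset (Finset.range_mono hmnT)
  set b := (∑ t ∈ Finset.range T, e t).toReal with hb_def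
  have hb_eq : ∑ t ∈ Finset.range T, e t = ENNReal.ofReal b := (ENNReal.ofReal_toReal hfin).symm
  have hb0 : 0 ≤ b := ENNReal.toReal_nonneg
  -- Finiteness, from the deterministic bound on the gradient, is needed because the sum of
  -- gradients will appear on both sides.
  have hNt : ∀ t, N t ≠ ∞ := fun t => by
    refine ne_top_of_le_ne_top ?_ (lintegral_mono fun w => ENNReal.ofReal_le_ofReal
      (norm_gradient_mainLoop_le (P := P) hc hs hl hη.le s₀ p w t))
    rw [lintegral_const]
    simp
  have hγN : ∀ t, γ t = ENNReal.ofReal ε + N t := fun t => by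
    simp only [hγ, hN, upperMean, gradSize]
    simp_rw [ENNReal.ofReal_add hε.le (norm_nonneg _)]
    rw [lintegral_add_left measurable_const]
    simp
  set NS := (∑ t ∈ Finset.Ico (m + n) T, N t).toReal with hNS
  have hNS_eq : ∑ t ∈ Finset.Ico (m + n) T, N t = ENNReal.ofReal NS :=
    (ENNReal.ofReal_toReal (ENNReal.sum_ne_top.2 fun t _ => hNt t)).symm
  have hNS0 : 0 ≤ NS := ENNReal.toReal_nonneg
  have hxt : ∀ t, m + n ≤ t → x t ≤ ENNReal.ofReal (1069 / 1000 * ε)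
      + ENNReal.ofReal (65 / 1000) * N t + ENNReal.ofReal 7 * e t := by
    intro t ht
    refine upperMean_le (F₁ := fun s => ‖gradient P.Φ s.x‖)
      (F₂ := weightedMoment P ε q l B r t) ho (measurable_norm_gradient hc hs hl)
      (fun _ => norm_nonneg _) (weightedMoment_nonneg hε hB.B_pos r t) (by positivity)
      (by norm_num) (by norm_num) (fun w => ?_)
    have h2 := drive_le_steady (P := P) hc hε hB.expRate_le hB.l_eq hB.B_pos hB.log_ge
      (hsteady t (by omega)) (mainLoop P h s₀ p w t)
    rw [weightedMoment]
    rw [gradSize] at h2 ⊢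
    linarith
  have hxs : ∑ t ∈ Finset.Ico (m + n) T, x t ≤ ENNReal.ofReal (1069 / 1000 * (ε * T))
      + ENNReal.ofReal (65 / 1000) * ENNReal.ofReal NS + ENNReal.ofReal 7 * ENNReal.ofReal b := by
    calc _ ≤ ∑ t ∈ Finset.Ico (m + n) T, (ENNReal.ofReal (1069 / 1000 * ε)
          + ENNReal.ofReal (65 / 1000) * N t + ENNReal.ofReal 7 * e t) :=
          Finset.sum_le_sum fun t ht => hxt t (Finset.mem_Ico.1 ht).1
      _ = ENNReal.ofReal ((T - (m + n) : ℕ) * (1069 / 1000 * ε))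
          + ENNReal.ofReal (65 / 1000) * ENNReal.ofReal NS
          + ENNReal.ofReal 7 * ∑ t ∈ Finset.Ico (m + n) T, e t := by
          rw [Finset.sum_add_distrib, Finset.sum_add_distrib, ← Finset.mul_sum, ← Finset.mul_sum,
            hNS_eq, Finset.sum_const, Nat.card_Ico, nsmul_eq_mul,
            ENNReal.ofReal_mul (Nat.cast_nonneg _), ENNReal.ofReal_natCast]
      _ ≤ _ := by
          gcongr ENNReal.ofReal ?_ + _ + _ * ?_
          · have : ((T - (m + n) : ℕ) : ℝ) ≤ T := by exact_mod_cast Nat.sub_le _ _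
            have := mul_le_mul_of_nonneg_right this (show 0 ≤ 1069 / 1000 * ε by positivity)
            linarith
          · rw [← hb_eq]
            refine Finset.sum_le_sum_of_subset fun t ht => ?_
            rw [Finset.mem_range]; exact (Finset.mem_Ico.1 ht).2
  have htel := ENNReal_telescope (v := v) (x := fun t => ENNReal.ofReal h.η * N t)
    (y := fun t => ENNReal.ofReal (h.η * (301 / 100)) * x t) hmnT
    (fun t _ _ => upperMean_potential_succ_le hc hs hl ho hb hr t)
  rw [← Finset.mul_sum, ← Finset.mul_sum, hNS_eq] at htel
  have hΔ0 : 0 ≤ P.gap s₀.x := gap_nonneg hb _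
  set Δ := P.gap s₀.x with hΔ
  -- At the start of the telescoping, the gap is bounded pathwise by the length travelled and the
  -- combined error by its mean after the transient phase.
  have hv1 : v (m + n) ≤ ENNReal.ofReal (Δ + 101 / 100 * (h.η * (m + n : ℕ) * G))
      + ENNReal.ofReal (3 * h.η / q) * u (m + n) := by
    have h1 := upperMean_le (Df := Df) (Dg := Dg) (P := P) (h := h) (s₀ := s₀) (p := p)
      (t := m + n) ho (F := potential c P h.η q ε) (F₁ := momErr c P ε) (F₂ := fun _ => 0)
      (K := Δ + 101 / 100 * (h.η * (m + n : ℕ) * G)) (k₁ := 3 * h.η / q) (k₂ := 0)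
      (measurable_momErr hc hs hl) (momErr_nonneg hε) (fun _ => le_rfl) (by positivity)
      (by positivity) le_rfl (fun w => by
        have := gap_mainLoop_le hc hs hl hr s₀ p w (fun t ht => hG t (le_of_lt ht) w)
        rw [potential]
        linarith)
    simpa using h1
  set U := momErr c P ε s₀ + 23 / 100 * G + 146 / 100 * ε with hU
  have hU0 : 0 ≤ U := by
    have := momErr_nonneg (c := c) (P := P) hε s₀
    positivity
  have hmain : ENNReal.ofReal h.η * ENNReal.ofReal NS ≤
      (ENNReal.ofReal (Δ + 101 / 100 * (h.η * (m + n : ℕ) * G))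
        + ENNReal.ofReal (3 * h.η / q) * (ENNReal.ofReal U
          + ENNReal.ofReal (14 * q) * ENNReal.ofReal b))
      + ENNReal.ofReal (h.η * (301 / 100)) * (ENNReal.ofReal (1069 / 1000 * (ε * T))
      + ENNReal.ofReal (65 / 1000) * ENNReal.ofReal NS + ENNReal.ofReal 7 * ENNReal.ofReal b) := by
    refine le_add_self.trans (htel.trans ?_)
    refine add_le_add (hv1.trans ?_) (mul_le_mul_right hxs _)
    refine add_le_add le_rfl (mul_le_mul_right (hu1.trans ?_) _)
    refine add_le_add le_rfl (mul_le_mul_right (hsub.trans hb_eq.le) _)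
  have h3q : 0 ≤ 3 * h.η / q := by positivity
  have hK1 : 0 ≤ Δ + 101 / 100 * (h.η * (m + n : ℕ) * G) := by positivity
  have hK2 : 0 ≤ 1069 / 1000 * (ε * T) := by positivity
  rw [← ENNReal.ofReal_mul hη.le, ← ENNReal.ofReal_mul (by positivity : 0 ≤ 14 * q),
    ← ENNReal.ofReal_add hU0 (by positivity), ← ENNReal.ofReal_mul h3q,
    ← ENNReal.ofReal_add hK1 (by positivity), ← ENNReal.ofReal_mul (by norm_num),
    ← ENNReal.ofReal_mul (by norm_num), ← ENNReal.ofReal_add hK2 (by positivity),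
    ← ENNReal.ofReal_add (by positivity) (by positivity), ← ENNReal.ofReal_mul (by positivity),
    ← ENNReal.ofReal_add (by positivity) (by positivity),
    ENNReal.ofReal_le_ofReal_iff (by positivity)] at hmain
  have hmG : ((m + n : ℕ) : ℝ) * G ≤ 1596 / 1000 * (ε * T) := by
    have h1 := mul_le_mul_of_nonneg_right hmn hG0.le
    have h2 := hB.T_ΘΓ
    have h3 := mul_le_mul_of_nonneg_left hB.T_Θ hε.le
    have h4 : q * (((m + n : ℕ) : ℝ) * G) ≤ q * (1596 / 1000 * (ε * T)) := by
      have e1 : 2801 / 100 * Θ * G = 2801 / 100 * (115 / 100) * (ε * Θ ^ 2)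
          + 2801 / 100 * (103 / 100) * (Θ * Γ) := by rw [hG_def]; ring
      have h5 : 0 ≤ ε * (q * T) := by positivity
      rw [e1] at h1
      linarith
    exact le_of_mul_le_mul_left h4 hq
  have hUq : U ≤ q * (197 / 1000 * (ε * T)) := by
    have h1 := initial_momErr_le hr hB
    have h2 := hB.T_ΘΓ
    have h3 := mul_le_mul_of_nonneg_left hB.T_Θ hε.le
    have h4 := mul_le_mul_of_nonneg_left hB.T_ge hε.le
    have h5 : Γ ≤ Θ * Γ := le_mul_of_one_le_left hΓ0 hΘ
    have h6 : Θ * ε ≤ ε * Θ ^ 2 := by nlinarith [mul_pos hε (zero_lt_one.trans_le hΘ)]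
    have h7 : 0 ≤ ε * (q * T) := by positivity
    rw [hU, hG_def]
    linarith
  have hUq' : 3 * h.η / q * (U + 14 * q * b) ≤ h.η * (591 / 1000 * (ε * T) + 42 * b) := by
    calc _ ≤ 3 * h.η / q * (q * (197 / 1000 * (ε * T)) + 14 * q * b) := by gcongr
      _ = _ := by field_simp; ring
  have hΔ' : Δ ≤ h.η * (1 / 4 * (ε * T)) := by have := hB.T_gap; linarith
  have hmG' := mul_le_mul_of_nonneg_left hmG hη.le
  -- The gradient sum on the right has coefficient 3.01 · 0.065 < 0.2 and is absorbed; dividing by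
  -- the remaining 0.8 produces the constants 7.1 and 80.
  have hNS1 : NS ≤ 71 / 10 * (ε * T) + 80 * b := by
    have h1 : h.η * NS ≤ h.η * (1 / 4 * (ε * T) + 101 / 100 * (1596 / 1000 * (ε * T))
        + (591 / 1000 * (ε * T) + 42 * b)
        + 301 / 100 * (1069 / 1000 * (ε * T) + 65 / 1000 * NS + 7 * b)) := by linarith
    have h2 := le_of_mul_le_mul_left h1 hη
    have h3 : 0 ≤ ε * T := by positivity
    linarith
  have hsplit : ∑ t ∈ Finset.range T, γ t ≤ ENNReal.ofReal (((m + n : ℕ) : ℝ) * G)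
      + (ENNReal.ofReal (ε * T) + ENNReal.ofReal NS) := by
    rw [← Finset.sum_range_add_sum_Ico _ hmnT]
    refine add_le_add ?_ ?_
    · have h1 : ∀ t ∈ Finset.range (m + n), γ t ≤ ENNReal.ofReal G := fun t ht => by
        have h2 : γ t ≤ ∫⁻ w, ENNReal.ofReal G ∂(upperLaw Df Dg) :=
          lintegral_mono fun w => ENNReal.ofReal_le_ofReal (hG t (Finset.mem_range.1 ht).le w)
        simpa using h2
      refine (Finset.sum_le_card_nsmul _ _ _ h1).trans (le_of_eq ?_)
      rw [Finset.card_range, nsmul_eq_mul, ENNReal.ofReal_mul (Nat.cast_nonneg _),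
        ENNReal.ofReal_natCast]
    · rw [Finset.sum_congr rfl fun t _ => hγN t, Finset.sum_add_distrib, hNS_eq]
      refine add_le_add ?_ le_rfl
      rw [Finset.sum_const, Nat.card_Ico, nsmul_eq_mul, ← ENNReal.ofReal_natCast,
        ← ENNReal.ofReal_mul (Nat.cast_nonneg _), mul_comm ε]
      gcongr
      exact Nat.sub_le _ _
  refine hsplit.trans ?_
  rw [hb_eq, show (80 : ℝ≥0∞) = ENNReal.ofReal 80 by simp, ← ENNReal.ofReal_mul (by norm_num),
    ← ENNReal.ofReal_add (by positivity) hNS0, ← ENNReal.ofReal_add (by positivity) (by positivity),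
    ← ENNReal.ofReal_add (by positivity) (by positivity)]
  refine ENNReal.ofReal_le_ofReal ?_
  have h3 : 0 ≤ ε * T := by positivity
  linarith

end Summation

/-! ### Averages over the lower-level samples for frozen upper-level samples -/

section FixedUpper

open Filter
open scoped ENNReal

variable {dx dy : ℕ} {Ξ Z : Type*} [MeasurableSpace Ξ] [MeasurableSpace Z]
  {c : Consts} {P : Problem dx dy Ξ Z} {h : StepSizes} {ε q l B : ℝ}
  {Df : Measure Ξ} {Dg : Measure Z} [IsProbabilityMeasure Df] [IsProbabilityMeasure Dg]
  {s₀ : State dx dy}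

/-- The law of the lower-level samples of the main loop. -/
noncomputable abbrev loopLaw (Dg : Measure Z) : Measure (ℕ → Z) := Measure.infinitePi fun _ => Dg

omit [IsProbabilityMeasure Df] in
lemma lintegral_mainLoop_succ_lower (ho : OracleAssumption c P Df Dg) {F : State dx dy → ℝ}
    (hF : Measurable F) (w : UpperSample Ξ Z) (t : ℕ) :
    ∫⁻ p, ENNReal.ofReal (F (mainLoop P h s₀ p w (t + 1))) ∂(loopLaw Dg) =
      ∫⁻ p, ∫⁻ a, ENNReal.ofReal (F (step P h (mainLoop P h s₀ p w t) a (w t))) ∂Dg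
        ∂(loopLaw Dg) := by
  simp only [mainLoop]
  simp_rw [mainLoop_eq_orbit']
  have hstep : ∀ i, Measurable (Function.uncurry fun (s : State dx dy) (a : Z) =>
      step P h s a (w i)) := fun i =>
    measurable_step ho (hh := fun _ => h) measurable_const measurable_const measurable_const
      measurable_const measurable_fst measurable_snd measurable_const
  exact lintegral_orbit_succ hstep Dg s₀ t
    (F := fun s a => ENNReal.ofReal (F (step P h s a (w t))))
    (hF.ennreal_ofReal.comp (hstep t))

omit [IsProbabilityMeasure Df] in
/-- For fixed upper-level samples, the weighted exponential moment of the lower-level error is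
controlled by the gradient. -/
lemma lintegral_weightedMoment_le (hc : c.Valid) (hs : RelaxedSmooth c P) (hl : LowerLevel c P)
    (ho : OracleAssumption c P Df Dg) (hr : Regime c h ε q l) (w : UpperSample Ξ Z) (t : ℕ) :
    ∫⁻ p, ENNReal.ofReal (gradSize P ε (mainLoop P h s₀ p w t).x *
        expMoment P l ((1 - 3 * q) ^ t * ‖s₀.y - P.yStar s₀.x‖ ^ 2) (mainLoop P h s₀ p w t))
        ∂(loopLaw Dg) ≤
      2 * ∫⁻ p, ENNReal.ofReal (gradSize P ε (mainLoop P h s₀ p w t).x) ∂(loopLaw Dg) := by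
  have hε := hr.ε_pos
  have hq := hr.q_pos
  have hq1 := hr.q_le
  set r := ‖s₀.y - P.yStar s₀.x‖ ^ 2 with hr_def
  induction t with
  | zero =>
    have e : expMoment P l ((1 - 3 * q) ^ 0 * r) s₀ = 1 := by
      rw [expMoment, pow_zero, one_mul, hr_def]; simp
    simp only [mainLoop, e, mul_one, lintegral_const, measure_univ]
    exact le_mul_of_one_le_left zero_le (by norm_num)
  | succ t ih =>
    have hm : Measurable fun p => mainLoop P h s₀ p w t :=
      measurable_mainLoop ho (hh := fun _ => h) measurable_const measurable_const measurable_const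
        measurable_const measurable_const measurable_id measurable_const t
    have hg := measurable_gradSize (P := P) (ε := ε) hc hs hl
    have h0 := lintegral_mainLoop_succ_lower (h := h) (s₀ := s₀) ho
      (F := fun s => gradSize P ε s.x * expMoment P l ((1 - 3 * q) ^ (t + 1) * r) s)
      (hg.mul (measurable_expMoment hc hl _)) w t
    rw [h0]
    have h1 : ∀ p, ∫⁻ a, ENNReal.ofReal (gradSize P ε (step P h (mainLoop P h s₀ p w t) a (w t)).x *
        expMoment P l ((1 - 3 * q) ^ (t + 1) * r) (step P h (mainLoop P h s₀ p w t) a (w t))) ∂Dg ≤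
        ENNReal.ofReal (1 - 2 * q) * ENNReal.ofReal (gradSize P ε (mainLoop P h s₀ p w t).x *
          expMoment P l ((1 - 3 * q) ^ t * r) (mainLoop P h s₀ p w t))
        + ENNReal.ofReal (31 / 10 * q) *
          ENNReal.ofReal (gradSize P ε (mainLoop P h s₀ p w t).x) := fun p => by
      have := lintegral_expMoment_step_le hc hs hl ho hr (mainLoop P h s₀ p w t)
        ((1 - 3 * q) ^ t * r) (w t)
      rwa [← mul_assoc, ← pow_succ'] at this
    set X := ∫⁻ p, ENNReal.ofReal (gradSize P ε (mainLoop P h s₀ p w t).x) ∂(loopLaw Dg) with hX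
    -- The weight itself may shrink between t and t + 1, but only by the factor 1 - q/200.
    have h2 : ENNReal.ofReal (1 - q / 200) * X ≤
        ∫⁻ p, ENNReal.ofReal (gradSize P ε (mainLoop P h s₀ p w (t + 1)).x) ∂(loopLaw Dg) := by
      rw [hX, ← lintegral_const_mul' _ _ ENNReal.ofReal_ne_top]
      refine lintegral_mono fun p => ?_
      rw [← ENNReal.ofReal_mul (by linarith)]
      exact ENNReal.ofReal_le_ofReal (gradSize_step hc hs hl hr
        (norm_step_sub_le (P := P) hr.η_pos.le (mainLoop P h s₀ p w t) (p t) (w t))).2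
    refine (lintegral_mono h1).trans ?_
    have hgm : Measurable fun p => ENNReal.ofReal (31 / 10 * q) *
        ENNReal.ofReal (gradSize P ε (mainLoop P h s₀ p w t).x) :=
      ((hg.comp hm).ennreal_ofReal).const_mul _
    rw [lintegral_add_right _ hgm,
      lintegral_const_mul' _ _ ENNReal.ofReal_ne_top,
      lintegral_const_mul' _ _ ENNReal.ofReal_ne_top]
    -- The factor 2 reproduces itself: 2(1 - 2q) + 3.1q = 2 - 0.9q is at most 2(1 - q/200).
    calc _ ≤ ENNReal.ofReal (1 - 2 * q) * (2 * X) + ENNReal.ofReal (31 / 10 * q) * X := by gcongr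
      _ = ENNReal.ofReal ((1 - 2 * q) * 2 + 31 / 10 * q) * X := by
          have h3 : 0 ≤ 1 - 2 * q := by linarith
          rw [ENNReal.ofReal_add (by positivity) (by positivity), ENNReal.ofReal_mul h3]
          simp; ring
      _ ≤ ENNReal.ofReal (2 * (1 - q / 200)) * X := by gcongr; linarith
      _ = 2 * (ENNReal.ofReal (1 - q / 200) * X) := by
          rw [ENNReal.ofReal_mul (by norm_num)]; simp; ring
      _ ≤ _ := by gcongr

end FixedUpper

/-! ### Closing the estimate and Markov's inequality -/

section HighProbability

open Filter
open scoped ENNReal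

variable {dx dy : ℕ} {Ξ Z : Type*} [MeasurableSpace Ξ] [MeasurableSpace Z]
  {c : Consts} {P : Problem dx dy Ξ Z} {h : StepSizes} {ε q l B Θ : ℝ} {T : ℕ}
  {Df : Measure Ξ} {Dg : Measure Z} [IsProbabilityMeasure Df] [IsProbabilityMeasure Dg]
  {s₀ : State dx dy}

omit [MeasurableSpace Ξ] [MeasurableSpace Z] in
lemma measurable_weightedMoment (hc : c.Valid) (hs : RelaxedSmooth c P) (hl : LowerLevel c P)
    (r : ℝ) (t : ℕ) : Measurable (weightedMoment P ε q l B r t) :=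
  ((measurable_gradSize hc hs hl).mul (measurable_expMoment hc hl _)).div_const B

omit [IsProbabilityMeasure Df] [IsProbabilityMeasure Dg] in
lemma measurable_mainLoop_prod (ho : OracleAssumption c P Df Dg) (t : ℕ) :
    Measurable fun ω : (ℕ → Z) × UpperSample Ξ Z => mainLoop P h s₀ ω.1 ω.2 t :=
  measurable_mainLoop ho (hh := fun _ => h) measurable_const measurable_const measurable_const
    measurable_const measurable_const measurable_fst measurable_snd t

lemma measurable_upperMean (ho : OracleAssumption c P Df Dg) {F : State dx dy → ℝ}
    (hF : Measurable F) (t : ℕ) : Measurable fun p => upperMean Df Dg P h s₀ p F t :=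
  ((hF.comp (measurable_mainLoop_prod (h := h) (s₀ := s₀) ho t)).ennreal_ofReal).lintegral_prod_right'

lemma lintegral_upperMean (ho : OracleAssumption c P Df Dg) {F : State dx dy → ℝ}
    (hF : Measurable F) (t : ℕ) : ∫⁻ p, upperMean Df Dg P h s₀ p F t ∂(loopLaw Dg) =
      ∫⁻ w, ∫⁻ p, ENNReal.ofReal (F (mainLoop P h s₀ p w t)) ∂(loopLaw Dg) ∂(upperLaw Df Dg) :=
  lintegral_lintegral_swap
    ((hF.comp (measurable_mainLoop_prod (h := h) (s₀ := s₀) ho t)).ennreal_ofReal).aemeasurable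

/-- Tonelli exchanges the averages: the moment, defined after averaging over the upper level, is
estimated with the upper-level samples frozen. -/
lemma lintegral_upperMean_weightedMoment_le (hc : c.Valid) (hs : RelaxedSmooth c P)
    (hl : LowerLevel c P) (ho : OracleAssumption c P Df Dg) (hr : Regime c h ε q l) (hB : 0 < B)
    (t : ℕ) :
    ∫⁻ p, upperMean Df Dg P h s₀ p
        (weightedMoment P ε q l B (‖s₀.y - P.yStar s₀.x‖ ^ 2) t) t ∂(loopLaw Dg) ≤
      ENNReal.ofReal (2 / B) *
        ∫⁻ p, upperMean Df Dg P h s₀ p (fun s => gradSize P ε s.x) t ∂(loopLaw Dg) := by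
  rw [lintegral_upperMean ho (measurable_weightedMoment hc hs hl _ t),
    lintegral_upperMean ho (measurable_gradSize hc hs hl),
    ← lintegral_const_mul' _ _ ENNReal.ofReal_ne_top]
  refine lintegral_mono fun w => ?_
  have h1 := lintegral_weightedMoment_le (s₀ := s₀) hc hs hl ho hr w t
  calc _ = ∫⁻ p, ENNReal.ofReal (1 / B) * ENNReal.ofReal (gradSize P ε (mainLoop P h s₀ p w t).x *
        expMoment P l ((1 - 3 * q) ^ t * ‖s₀.y - P.yStar s₀.x‖ ^ 2) (mainLoop P h s₀ p w t))
        ∂(loopLaw Dg) := by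
        refine lintegral_congr fun p => ?_
        rw [← ENNReal.ofReal_mul (by positivity), weightedMoment]
        congr 1; ring
    _ ≤ ENNReal.ofReal (1 / B) *
        (2 * ∫⁻ p, ENNReal.ofReal (gradSize P ε (mainLoop P h s₀ p w t).x) ∂(loopLaw Dg)) := by
        rw [lintegral_const_mul' _ _ ENNReal.ofReal_ne_top]
        gcongr
    _ = _ := by
        rw [← mul_assoc, show (2 : ℝ≥0∞) = ENNReal.ofReal 2 by simp,
          ← ENNReal.ofReal_mul (by positivity)]
        congr 2; ring

/-- With high probability over the lower-level samples of the main loop, the weighted exponential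
moments are small. -/
lemma measure_weightedMoment_le (hc : c.Valid) (hs : RelaxedSmooth c P) (hl : LowerLevel c P)
    (ho : OracleAssumption c P Df Dg) (hb : BddBelow (Set.range P.Φ)) (hr : Regime c h ε q l)
    (hB : Budget c P h ε q l B Θ T s₀) {δ : ℝ} (hδ1 : δ < 1) (hBδ : 3200 ≤ δ * B) :
    loopLaw Dg {p | ENNReal.ofReal (ε * T) ≤ 80 * ∑ t ∈ Finset.range T, upperMean Df Dg P h s₀ p
        (weightedMoment P ε q l B (‖s₀.y - P.yStar s₀.x‖ ^ 2) t) t} ≤ ENNReal.ofReal δ := by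
  have hε := hr.ε_pos
  have hBp := hB.B_pos
  have hB1 : 3200 ≤ B := by nlinarith
  have hT : 0 < (T : ℝ) := by
    have h1 := hB.T_ge
    by_contra h2
    have h3 : (T : ℝ) = 0 := le_antisymm (not_lt.1 h2) (Nat.cast_nonneg _)
    rw [h3] at h1; linarith
  set r := ‖s₀.y - P.yStar s₀.x‖ ^ 2
  set A : (ℕ → Z) → ℝ≥0∞ := fun p => ∑ t ∈ Finset.range T,
    upperMean Df Dg P h s₀ p (fun s => gradSize P ε s.x) t with hA
  set W : (ℕ → Z) → ℝ≥0∞ := fun p => ∑ t ∈ Finset.range T,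
    upperMean Df Dg P h s₀ p (weightedMoment P ε q l B r t) t with hW
  have hWm : Measurable W := Finset.measurable_sum _ fun t _ =>
    measurable_upperMean ho (measurable_weightedMoment hc hs hl r t) t
  have h1 : ∀ p, A p ≤ ENNReal.ofReal (10 * (ε * T)) + 80 * W p := fun p =>
    sum_upperMean_gradSize_le hc hs hl ho hb hr hB
  have h2 : ∫⁻ p, W p ∂(loopLaw Dg) ≤ ENNReal.ofReal (2 / B) * ∫⁻ p, A p ∂(loopLaw Dg) := by
    rw [hW, hA, lintegral_finsetSum _ fun t _ =>
      measurable_upperMean ho (measurable_weightedMoment hc hs hl r t) t,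
      lintegral_finsetSum _ fun t _ => measurable_upperMean ho (measurable_gradSize hc hs hl) t,
      Finset.mul_sum]
    exact Finset.sum_le_sum fun t _ =>
      lintegral_upperMean_weightedMoment_le hc hs hl ho hr hBp t
  -- Finiteness makes the absorption below legitimate. It holds because the gradient is bounded
  -- deterministically along the finite trajectory.
  have hAfin : ∫⁻ p, A p ∂(loopLaw Dg) ≠ ∞ := by
    set C := fun t : ℕ => ε + (‖gradient P.Φ s₀.x‖ + (c.L0 + c.L1 * ‖gradient P.Φ s₀.x‖) *
      (h.η * t * Real.exp (c.L1 * (h.η * t)))) with hC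
    have h3 : ∀ p, A p ≤ ∑ t ∈ Finset.range T, ENNReal.ofReal (C t) := fun p => by
      refine Finset.sum_le_sum fun t _ => ?_
      have h4 : upperMean Df Dg P h s₀ p (fun s => gradSize P ε s.x) t ≤
          ∫⁻ w, ENNReal.ofReal (C t) ∂(upperLaw Df Dg) :=
        lintegral_mono fun w => ENNReal.ofReal_le_ofReal
          (add_le_add le_rfl (norm_gradient_mainLoop_le hc hs hl hr.η_pos.le s₀ p w t))
      simpa using h4
    refine ne_top_of_le_ne_top ?_ (lintegral_mono h3)
    rw [lintegral_const]
    simp [ENNReal.sum_eq_top]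
  set a := (∫⁻ p, A p ∂(loopLaw Dg)).toReal with ha
  have ha_eq : ∫⁻ p, A p ∂(loopLaw Dg) = ENNReal.ofReal a := (ENNReal.ofReal_toReal hAfin).symm
  have ha0 : 0 ≤ a := ENNReal.toReal_nonneg
  have h3 : a ≤ 20 * (ε * T) := by
    have h4 : ENNReal.ofReal a ≤ ENNReal.ofReal (10 * (ε * T))
        + 80 * (ENNReal.ofReal (2 / B) * ENNReal.ofReal a) := by
      rw [← ha_eq]
      calc _ ≤ ∫⁻ p, (ENNReal.ofReal (10 * (ε * T)) + 80 * W p) ∂(loopLaw Dg) := lintegral_mono h1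
        _ = ENNReal.ofReal (10 * (ε * T)) + 80 * ∫⁻ p, W p ∂(loopLaw Dg) := by
            rw [lintegral_add_left measurable_const, lintegral_const_mul _ hWm]; simp
        _ ≤ _ := by gcongr
    rw [show (80 : ℝ≥0∞) = ENNReal.ofReal 80 by simp, ← ENNReal.ofReal_mul (by positivity),
      ← ENNReal.ofReal_mul (by positivity), ← ENNReal.ofReal_add (by positivity) (by positivity),
      ENNReal.ofReal_le_ofReal_iff (by positivity)] at h4
    -- With B ≥ 3200 the term 80 · 2/B is at most 1/20, so the mean of A is bounded by itself only
    -- up to this fraction.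
    have h5 : 2 / B ≤ 2 / 3200 := by gcongr
    have h6 : 2 / B * a ≤ 2 / 3200 * a := by gcongr
    have h7 : 0 ≤ ε * T := by positivity
    linarith
  have h4 : ∫⁻ p, 80 * W p ∂(loopLaw Dg) ≤ ENNReal.ofReal (3200 * (ε * T) / B) := by
    rw [lintegral_const_mul _ hWm]
    refine (mul_le_mul_right h2 _).trans ?_
    rw [ha_eq, show (80 : ℝ≥0∞) = ENNReal.ofReal 80 by simp, ← ENNReal.ofReal_mul (by positivity),
      ← ENNReal.ofReal_mul (by positivity)]
    refine ENNReal.ofReal_le_ofReal ?_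
    calc _ ≤ 80 * (2 / B * (20 * (ε * T))) := by gcongr
      _ = _ := by ring
  -- Markov's inequality; the constant 3200 is 80 · 2 · 20, and 3200/B ≤ δ by hypothesis.
  refine (meas_ge_le_lintegral_div (hWm.const_mul 80).aemeasurable
    (by simp; positivity) ENNReal.ofReal_ne_top).trans ?_
  refine ENNReal.div_le_of_le_mul (h4.trans ?_)
  rw [← ENNReal.ofReal_mul (by nlinarith)]
  refine ENNReal.ofReal_le_ofReal ?_
  rw [div_le_iff₀ hBp]
  have : 0 ≤ ε * T := by positivity
  nlinarith

end HighProbability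

/-! ### Consequences of the choice of the parameters -/

section Parameters

open Consts

lemma capRatio_le (m a b : ℝ) : capRatio m a b ≤ m := by
  unfold capRatio; split_ifs
  · exact le_rfl
  · exact min_le_left _ _

/-- In product form the bound also holds for b = 0, so the convention a/0 = +∞ needs no separate
treatment later. -/
lemma capRatio_mul_le {m a b : ℝ} (ha : 0 ≤ a) (hb : 0 ≤ b) : capRatio m a b * b ≤ a := by
  unfold capRatio; split_ifs with h
  · rw [h, mul_zero]; exact ha
  · have hb' : 0 < b := lt_of_le_of_ne hb (Ne.symm h)
    exact (le_div_iff₀ hb').1 (min_le_right _ _)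

lemma capRatio_pos {m a b : ℝ} (hm : 0 < m) (ha : 0 < a) (hb : 0 ≤ b) : 0 < capRatio m a b := by
  unfold capRatio; split_ifs with h
  · exact hm
  · have hb' : 0 < b := lt_of_le_of_ne hb (Ne.symm h)
    exact lt_min hm (div_pos ha hb')

lemma le_capRatio {t m a b : ℝ} (hb : 0 ≤ b) (hm : t ≤ m) (ha : t * b ≤ a) :
    t ≤ capRatio m a b := by
  unfold capRatio; split_ifs with h
  · exact hm
  · have hb' : 0 < b := lt_of_le_of_ne hb (Ne.symm h)
    exact le_min hm ((le_div_iff₀ hb').2 ha)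

/-- Admissible parameters of the algorithm. -/
structure Setting (c : Consts) (d : InitData) (δ ε : ℝ) : Prop where
  valid : c.Valid
  mu_le : c.μ ≤ c.lg1
  δ_pos : 0 < δ
  δ_lt : δ < 1
  ε_pos : 0 < ε
  Δ_nonneg : 0 ≤ d.Δ
  Δy_nonneg : 0 ≤ d.Δy
  Γ_nonneg : 0 ≤ d.Γ
  small : EpsSmall c d δ ε

/-- The third entry in the definition of `1 - β`. -/
noncomputable def leadBeta (c : Consts) (d : InitData) (δ ε : ℝ) : ℝ :=
  c.μ ^ 2 * ε ^ 2 / (64 * 1024 * c.L0 ^ 2 * c.σg1 ^ 2 * Real.log (paramB c d δ ε) ^ 2)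

/-- The fourth root of `paramB`. -/
noncomputable def rootB (c : Consts) (d : InitData) (δ ε : ℝ) : ℝ :=
  2 ^ 21 * baseR c d δ / ε ^ 4

/-- The square root of `paramA`. -/
noncomputable def rootA (c : Consts) (d : InitData) (δ ε : ℝ) : ℝ :=
  32 * baseQ c d δ / (ε ^ 2 * oneSubBeta c d δ ε)

variable {c : Consts} {d : InitData} {δ ε : ℝ}

lemma noise_nonneg (c : Consts) : 0 ≤ c.noise := by rw [Consts.noise]; positivity

lemma oneSubBeta_le (c : Consts) (d : InitData) (δ ε : ℝ) :
    oneSubBeta c d δ ε ≤ c.μ / (16 * c.lg1) ∧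
    oneSubBeta c d δ ε ≤ leadBeta c d δ ε ∧
    oneSubBeta c d δ ε * c.noise ≤ min 1 (c.μ ^ 2 / (32 * c.lg1 ^ 2)) * ε ^ 2 ∧
    oneSubBeta c d δ ε ≤ 32 * baseQ c d δ / (ε ^ 2 * expo1 c) ∧
    oneSubBeta c d δ ε ≤ 32 * baseQ c d δ / (ε ^ 2 * expo2 c d) ∧
    oneSubBeta c d δ ε ≤ 32 * baseQ c d δ / (ε ^ 2 * expo3 c d) := by
  unfold oneSubBeta leadBeta
  extract_lets m₁ m₂ m₃ m₄ m₅ m₆ m₇ m₈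
  have h8 : min m₈ (32 * baseQ c d δ / (ε ^ 2 * expo3 c d)) ≤ m₈ := min_le_left _ _
  have h7 : m₈ ≤ m₇ := min_le_left _ _
  have h6 : m₇ ≤ m₆ := min_le_left _ _
  have h5 : m₆ ≤ m₅ := capRatio_le _ _ _
  have h4 : m₅ ≤ m₄ := capRatio_le _ _ _
  have h3 : m₄ ≤ m₃ := capRatio_le _ _ _
  have h2 : m₃ ≤ m₂ := min_le_left _ _
  have h1 : m₂ ≤ m₁ := min_le_left _ _
  have hm4 : min m₈ (32 * baseQ c d δ / (ε ^ 2 * expo3 c d)) ≤ m₄ := by linarith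
  refine ⟨(by linarith : _ ≤ m₁).trans (min_le_right _ _),
    (by linarith : _ ≤ m₃).trans (min_le_right _ _),
    (mul_le_mul_of_nonneg_right hm4 (noise_nonneg c)).trans
      (capRatio_mul_le (by positivity) (noise_nonneg c)),
    (by linarith : _ ≤ m₇).trans (min_le_right _ _), h8.trans (min_le_right _ _),
    min_le_right _ _⟩

namespace Setting

variable (hS : Setting c d δ ε)
include hS

/-- Forced by admissibility: the square root of a nonpositive number is 0, which would bound ε > 0.
Positivity of Δ₀ follows the same way in `Δ_pos`. -/
lemma baseQ_pos : 0 < baseQ c d δ := by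
  have h1 := hS.small.h4
  by_contra h
  rw [Real.sqrt_eq_zero_of_nonpos (by linarith)] at h1
  linarith [hS.ε_pos]

lemma Δ_pos : 0 < d.Δ := by
  refine lt_of_le_of_ne hS.Δ_nonneg fun h => ?_
  have := hS.baseQ_pos
  rw [baseQ, ← h] at this
  simp at this

lemma baseR_eq : baseR c d δ = baseQ c d δ * (c.L0 ^ 2 * c.σg1 ^ 2 / c.μ ^ 2) := by
  have := hS.valid.μ_pos
  have := hS.δ_pos
  rw [baseR, baseQ]; field_simp

lemma baseR_pos : 0 < baseR c d δ := by
  have h1 := hS.valid.μ_pos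
  have h2 := hS.valid.σg1_pos
  have h3 := L0_pos hS.valid
  have h4 := hS.baseQ_pos
  rw [hS.baseR_eq]; positivity

lemma rootB_pos : 0 < rootB c d δ ε := by
  have h4 := hS.baseR_pos
  have := hS.ε_pos
  rw [rootB]; positivity

omit hS in
lemma paramB_eq : paramB c d δ ε = rootB c d δ ε ^ 4 := rfl

omit hS in
lemma paramA_eq : paramA c d δ ε = rootA c d δ ε ^ 2 := rfl

omit hS in
lemma log_paramB : Real.log (paramB c d δ ε) = 4 * Real.log (rootB c d δ ε) := by
  rw [paramB_eq, Real.log_pow]; norm_num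

omit hS in
lemma log_paramA : Real.log (paramA c d δ ε) = 2 * Real.log (rootA c d δ ε) := by
  rw [paramA_eq, Real.log_pow]; norm_num

lemma ε_sq_le : ε ^ 2 * (c.μ * c.lg1) ≤ c.L0 ^ 2 * c.σg1 ^ 2 := by
  have h1 := hS.small.h11
  have h2 := hS.valid.μ_pos
  have h3 := hS.valid.lg1_pos
  have h4 := hS.ε_pos
  rw [le_div_iff₀ (by positivity)] at h1
  calc _ = (ε * √(c.μ * c.lg1)) ^ 2 := by rw [mul_pow, Real.sq_sqrt (by positivity)]
    _ ≤ (c.L0 * c.σg1) ^ 2 := by gcongr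
    _ = _ := by ring

lemma ε_sq_le' : ε ^ 2 * c.μ ^ 2 ≤ c.L0 ^ 2 * c.σg1 ^ 2 := by
  refine le_trans ?_ hS.ε_sq_le
  have := hS.valid.μ_pos
  have := hS.mu_le
  rw [sq c.μ]; gcongr

/-- The ratio `Δ₀ L₀ / ε²` controls the fourth root of `B`. -/
lemma ratio_le_rootB : 2 ^ 21 * (Real.exp 1 / δ * (d.Δ * c.L0 / ε ^ 2)) ≤ rootB c d δ ε := by
  have h1 := hS.ε_sq_le'
  have hμ := hS.valid.μ_pos
  have hl := hS.valid.lg1_pos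
  have hε := hS.ε_pos
  have hδ := hS.δ_pos
  have hΔ := hS.Δ_pos
  have hL := L0_pos hS.valid
  have e1 : rootB c d δ ε = 2 ^ 21 * (Real.exp 1 / δ * (d.Δ * c.L0 / ε ^ 2)) *
      ((c.lg1 / c.μ) * (c.L0 ^ 2 * c.σg1 ^ 2 / (ε ^ 2 * c.μ ^ 2))) := by
    rw [rootB, baseR]; field_simp
  rw [e1]
  refine le_mul_of_one_le_right (by positivity) (one_le_mul_of_one_le_of_one_le ?_ ?_)
  · rw [one_le_div hμ]; exact hS.mu_le
  · rw [one_le_div (by positivity)]; exact h1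

lemma ε_pow_le : ε ^ 4 ≤ 256 * baseR c d δ := by
  have h5 := hS.small.h5
  have hR := hS.baseR_pos
  calc ε ^ 4 ≤ (4 * baseR c d δ ^ (1 / 4 : ℝ)) ^ 4 := by
        have := hS.ε_pos
        gcongr
    _ = 256 * (baseR c d δ ^ (1 / 4 : ℝ)) ^ (4 : ℕ) := by ring
    _ = _ := by rw [← Real.rpow_natCast, ← Real.rpow_mul hR.le]; norm_num

/-- Admissibility gives R/ε⁴ ≥ 2⁻⁸, so the fourth root of B is at least 2¹³, and 4 · 13 · log 2 >
36. -/
lemma thirtySix_le_log_paramB : 36 ≤ Real.log (paramB c d δ ε) := by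
  have h1 : (2 : ℝ) ^ 13 ≤ rootB c d δ ε := by
    have := hS.ε_pos
    rw [rootB, le_div_iff₀ (by positivity)]
    have := hS.ε_pow_le
    linarith
  have h2 := Real.log_le_log (by positivity) h1
  rw [Real.log_pow] at h2
  have h3 := Real.log_two_gt_d9
  rw [log_paramB]
  push_cast at h2
  linarith

lemma paramB_pos : 0 < paramB c d δ ε := by
  rw [paramB_eq]; exact pow_pos hS.rootB_pos 4

lemma oneSubBeta_pos : 0 < oneSubBeta c d δ ε := by
  have hμ := hS.valid.μ_pos
  have hl := hS.valid.lg1_pos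
  have hε := hS.ε_pos
  have hQ := hS.baseQ_pos
  have hσ := hS.valid.σg1_pos
  have hL := L0_pos hS.valid
  have hB : 0 < Real.log (paramB c d δ ε) := by linarith [hS.thirtySix_le_log_paramB]
  unfold oneSubBeta
  have h1 : 0 < expo1 c := Real.exp_pos _
  have h2 : 0 < expo2 c d := Real.exp_pos _
  have h3 : 0 < expo3 c d := Real.exp_pos _
  refine lt_min (lt_min (lt_min ?_ (by positivity)) (by positivity)) (by positivity)
  refine capRatio_pos (capRatio_pos (capRatio_pos ?_ ?_ (noise_nonneg c)) (by positivity)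
    (by positivity)) (by positivity) (by positivity)
  · refine lt_min (lt_min (lt_min one_pos ?_) ?_) ?_ <;> positivity
  · have : 0 < min 1 (c.μ ^ 2 / (32 * c.lg1 ^ 2)) := lt_min one_pos (by positivity)
    positivity

lemma oneSubBeta_mul_le : oneSubBeta c d δ ε * (64 * 1024 * c.L0 ^ 2 * c.σg1 ^ 2 *
    Real.log (paramB c d δ ε) ^ 2) ≤ c.μ ^ 2 * ε ^ 2 := by
  have h := (oneSubBeta_le c d δ ε).2.1
  have hσ := hS.valid.σg1_pos
  have hL := L0_pos hS.valid
  have hB : 0 < Real.log (paramB c d δ ε) := by linarith [hS.thirtySix_le_log_paramB]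
  rw [leadBeta, le_div_iff₀ (by positivity)] at h
  exact h

/-- The entry `leadBeta` bounds 1 - β, and putting this bound into the definition of A gives the
fourth root of B times log²B ≥ 1. -/
lemma rootB_le_rootA : rootB c d δ ε ≤ rootA c d δ ε := by
  have hq := hS.oneSubBeta_pos
  have hε := hS.ε_pos
  have hQ := hS.baseQ_pos
  have hμ := hS.valid.μ_pos
  have hσ := hS.valid.σg1_pos
  have hL := L0_pos hS.valid
  have hB := hS.thirtySix_le_log_paramB
  have h1 := hS.oneSubBeta_mul_le
  rw [rootA, rootB, le_div_iff₀ (by positivity), hS.baseR_eq]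
  have h2 : oneSubBeta c d δ ε * (64 * 1024 * c.L0 ^ 2 * c.σg1 ^ 2) ≤ c.μ ^ 2 * ε ^ 2 := by
    refine le_trans ?_ h1
    have : 1 ≤ Real.log (paramB c d δ ε) ^ 2 := by nlinarith
    calc _ ≤ oneSubBeta c d δ ε * (64 * 1024 * c.L0 ^ 2 * c.σg1 ^ 2) *
          Real.log (paramB c d δ ε) ^ 2 := le_mul_of_one_le_right (by positivity) this
      _ = _ := by ring
  have e : 2 ^ 21 * (baseQ c d δ * (c.L0 ^ 2 * c.σg1 ^ 2 / c.μ ^ 2)) / ε ^ 4 *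
      (ε ^ 2 * oneSubBeta c d δ ε) = 32 * baseQ c d δ / (c.μ ^ 2 * ε ^ 2) *
      (oneSubBeta c d δ ε * (64 * 1024 * c.L0 ^ 2 * c.σg1 ^ 2)) := by
    field_simp; ring
  rw [e]
  calc _ ≤ 32 * baseQ c d δ / (c.μ ^ 2 * ε ^ 2) * (c.μ ^ 2 * ε ^ 2) := by gcongr
    _ = _ := by field_simp

lemma log_paramB_le : Real.log (paramB c d δ ε) ≤ 2 * Real.log (paramA c d δ ε) := by
  have := Real.log_le_log hS.rootB_pos hS.rootB_le_rootA
  rw [log_paramB, log_paramA]; linarith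

lemma eighteen_le_log_paramA : 18 ≤ Real.log (paramA c d δ ε) := by
  have := hS.log_paramB_le
  have := hS.thirtySix_le_log_paramB
  linarith

section LargeRatio

variable (hv : 1 / 2 ≤ d.Δ * c.L0 / ε ^ 2)
include hv

lemma le_rootB : 2 ^ 20 * Real.exp 1 / δ ≤ rootB c d δ ε := by
  refine le_trans ?_ hS.ratio_le_rootB
  have h1 := mul_le_mul_of_nonneg_left hv
    (show 0 ≤ 2 ^ 21 * (Real.exp 1 / δ) by have := hS.δ_pos; positivity)
  calc _ = 2 ^ 21 * (Real.exp 1 / δ) * (1 / 2) := by ring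
    _ ≤ _ := h1.trans (le_of_eq (by ring))

/-- With Δ₀L₀ ≥ ε²/2 the fourth root of B is at least 2²⁰e/δ; 58 is just below 4(20 log 2 + 1). -/
lemma le_log_paramB : 58 ≤ Real.log (paramB c d δ ε) := by
  have h1 := hS.le_rootB hv
  have h2 : (2 : ℝ) ^ 20 * Real.exp 1 ≤ rootB c d δ ε := by
    refine le_trans ?_ h1
    rw [le_div_iff₀ hS.δ_pos]
    have := hS.δ_lt
    exact mul_le_of_le_one_right (by positivity) this.le
  have h3 := Real.log_le_log (by positivity) h2
  rw [Real.log_mul (by positivity) (by positivity), Real.log_pow, Real.log_exp] at h3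
  have h4 := Real.log_two_gt_d9
  rw [log_paramB]
  push_cast at h3
  linarith

/-- One factor of the fourth root of B cancels δ, and the other three are at least 1. -/
lemma le_mul_paramB : 3200 ≤ δ * paramB c d δ ε := by
  have h1 := hS.le_rootB hv
  have hδ := hS.δ_pos
  have h0 := Real.one_lt_exp_iff.2 (zero_lt_one (α := ℝ))
  have h2 : 2 ^ 20 ≤ δ * rootB c d δ ε := by
    rw [div_le_iff₀ hδ] at h1
    nlinarith
  have h3 : 2 ^ 20 ≤ rootB c d δ ε := by
    have := hS.δ_lt
    have := hS.rootB_pos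
    nlinarith
  have h4 : (1 : ℝ) ≤ rootB c d δ ε ^ 3 := one_le_pow₀ (by linarith)
  rw [paramB_eq]
  calc (3200 : ℝ) ≤ δ * rootB c d δ ε * 1 := by linarith
    _ ≤ δ * rootB c d δ ε * rootB c d δ ε ^ 3 := by
        have := hS.rootB_pos
        gcongr
    _ = _ := by ring

lemma le_log_paramA : 29 ≤ Real.log (paramA c d δ ε) := by
  have := hS.log_paramB_le
  have := hS.le_log_paramB hv
  linarith

end LargeRatio

end Setting

/-- The upper bounds on the step size of the upper level. -/
lemma eta_le (hΔ : 0 ≤ d.Δ) (hε : 0 ≤ ε) (hq : 0 ≤ oneSubBeta c d δ ε) :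
    eta c d δ ε * (d.Δy ^ 2 * c.L0 ^ 2) ≤ oneSubBeta c d δ ε / 8 * (ε * d.Δ) ∧
    eta c d δ ε * (c.lg1 ^ 2 * d.Δz ^ 2) ≤ oneSubBeta c d δ ε / 8 * (ε * d.Δ) ∧
    eta c d δ ε ≤ oneSubBeta c d δ ε / 8 *
      (c.μ * ε / (c.lg1 * c.L0 * Real.log (paramA c d δ ε))) ∧
    eta c d δ ε ≤ 1 / c.invRadius := by
  unfold eta
  extract_lets n₁ n₂ n₃ n₄ n₅
  set q := oneSubBeta c d δ ε
  have h5 : n₅ ≤ n₄ := min_le_left _ _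
  have h4 : n₄ ≤ n₃ := capRatio_le _ _ _
  have h3 : n₃ ≤ n₂ := capRatio_le _ _ _
  have h0 : min (1 / 8 * n₅ * q) (1 / c.invRadius) ≤ 1 / 8 * n₅ * q := min_le_left _ _
  have key : ∀ {n X Y : ℝ}, n₅ ≤ n → 0 ≤ X → n * X ≤ Y →
      min (1 / 8 * n₅ * q) (1 / c.invRadius) * X ≤ q / 8 * Y := by
    intro n X Y hn hX hY
    calc _ ≤ 1 / 8 * n₅ * q * X := by gcongr
      _ = q / 8 * (n₅ * X) := by ring
      _ ≤ q / 8 * (n * X) := by gcongr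
      _ ≤ _ := by gcongr
  refine ⟨key (n := n₂) (by linarith) (by positivity) (capRatio_mul_le (by positivity)
      (by positivity)), key (n := n₄) h5 (by positivity) (capRatio_mul_le (by positivity)
      (by positivity)), ?_, min_le_right _ _⟩
  have := key (n := n₅) (X := 1) (Y := c.μ * ε / (c.lg1 * c.L0 * Real.log (paramA c d δ ε))) le_rfl
    zero_le_one (by rw [mul_one]; exact min_le_right _ _)
  rwa [mul_one] at this

namespace Setting

variable (hS : Setting c d δ ε)
include hS

lemma eta_pos : 0 < eta c d δ ε := by
  have hq := hS.oneSubBeta_pos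
  have hμ := hS.valid.μ_pos
  have hl := hS.valid.lg1_pos
  have hε := hS.ε_pos
  have hL := L0_pos hS.valid
  have hL1 := L1_pos hS.valid
  have hΔ := hS.Δ_pos
  have hA := hS.eighteen_le_log_paramA
  have hA' : 0 < Real.log (paramA c d δ ε) := by linarith
  have hρ := invRadius_pos hS.valid
  unfold eta
  refine lt_min (mul_pos (mul_pos (by norm_num) (lt_min ?_ (by positivity))) hq) (by positivity)
  refine capRatio_pos (capRatio_pos (capRatio_pos (lt_min ?_ ?_) ?_ ?_) ?_ hS.Γ_nonneg) ?_ ?_ <;>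
    positivity

end Setting

set_option maxHeartbeats 400000 in
-- The bound `hlead` carries most of the relations. As L₀σ_{g,1} dominates both εμ and εσ_{g,2}, it
-- makes q and qσ_{g,2}²/μ² tiny, and with one factor log B moved into l it bounds lα. The logarithm
-- LA in the bound on η controls the drift of y*.
lemma regime_of_le {c : Consts} {h : StepSizes} {ε q LB LA : ℝ} (hc : c.Valid) (hml : c.μ ≤ c.lg1)
    (hε : 0 < ε) (hq : 0 < q) (hη : 0 < h.η) (hα : h.α = 8 * (q / c.μ)) (hβ : h.β = 1 - q)
    (hγ : h.γ = q / c.μ) (hA : 29 ≤ LA) (hB : 58 ≤ LB) (hBA : LB ≤ 2 * LA)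
    (hlead : q * (64 * 1024 * c.L0 ^ 2 * c.σg1 ^ 2 * LB ^ 2) ≤ c.μ ^ 2 * ε ^ 2)
    (b1 : q ≤ c.μ / (16 * c.lg1))
    (b3 : q * c.noise ≤ min 1 (c.μ ^ 2 / (32 * c.lg1 ^ 2)) * ε ^ 2)
    (e3 : h.η ≤ q / 8 * (c.μ * ε / (c.lg1 * c.L0 * LA))) (e4 : h.η ≤ 1 / c.invRadius)
    (h01 : ε ≤ c.L0 / c.L1) (h10 : ε * c.σg2 ≤ c.L0 * c.σg1)
    (hεμ : ε ^ 2 * c.μ ^ 2 ≤ c.L0 ^ 2 * c.σg1 ^ 2) :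
    Regime c h ε q (512 * (c.L0 / ε) ^ 2 * LB) := by
  have hμ := hc.μ_pos
  have hl := hc.lg1_pos
  have hσ := hc.σg1_pos
  have hσ2 := hc.σg2_nonneg
  have hL := L0_pos hc
  have hL1 := L1_pos hc
  have hq1 : q ≤ 1 / 1000 := by
    have h1 : q * (64 * 1024 * 58 ^ 2) * (ε ^ 2 * c.μ ^ 2) ≤ c.μ ^ 2 * ε ^ 2 := by
      refine le_trans ?_ hlead
      calc _ ≤ q * (64 * 1024 * 58 ^ 2) * (c.L0 ^ 2 * c.σg1 ^ 2) := by gcongr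
        _ = q * (64 * 1024 * c.L0 ^ 2 * c.σg1 ^ 2 * 58 ^ 2) := by ring
        _ ≤ _ := by gcongr
    have h2 : 0 < ε ^ 2 * c.μ ^ 2 := by positivity
    by_contra hcon
    push Not at hcon
    nlinarith
  have hηL : h.η * (c.lg1 * c.L0) * LA ≤ q / 8 * (c.μ * ε) := by
    have h1 := mul_le_mul_of_nonneg_right e3 (show 0 ≤ c.lg1 * c.L0 * LA by positivity)
    have h2 : q / 8 * (c.μ * ε / (c.lg1 * c.L0 * LA)) * (c.lg1 * c.L0 * LA) =
      q / 8 * (c.μ * ε) := by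
      have : LA ≠ 0 := by linarith
      field_simp
    linarith
  refine { mu_le := hml, ε_pos := hε, q_pos := hq, q_le := hq1, α_eq := hα, β_eq := hβ,
           γ_eq := hγ, η_pos := hη, η_le := e4,
           η_L0 := ?_, α_lg1 := ?_, L1_le := ?_, noise_le := ?_, σg2_le := ?_,
           l_pos := by positivity, l_α := ?_, drift := ?_ }
  · have h1 : c.lg1 * (h.η * c.L0 * LA) ≤ c.lg1 * (q / 8 * ε) := by
      calc _ = h.η * (c.lg1 * c.L0) * LA := by ring
        _ ≤ q / 8 * (c.μ * ε) := hηL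
        _ ≤ q / 8 * (c.lg1 * ε) := by gcongr
        _ = _ := by ring
    have h2 := le_of_mul_le_mul_left h1 hl
    have h3 : h.η * c.L0 * 29 ≤ h.η * c.L0 * LA := by gcongr
    have h4 : 0 < q * ε := by positivity
    linarith
  · rw [hα]
    rw [le_div_iff₀ (by positivity)] at b1
    calc 8 * (q / c.μ) * c.lg1 = q * (16 * c.lg1) / (2 * c.μ) := by field_simp; ring
      _ ≤ c.μ / (2 * c.μ) := by gcongr
      _ ≤ 1 := by rw [div_le_one (by positivity)]; linarith
  · have := h01
    rw [le_div_iff₀ hL1] at this; linarith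
  · have h1 : q * c.noise ≤ c.μ ^ 2 / (32 * c.lg1 ^ 2) * ε ^ 2 :=
      b3.trans (by gcongr; exact min_le_right _ _)
    calc _ = 32 * c.lg1 ^ 2 * (q * c.noise) := by ring
      _ ≤ 32 * c.lg1 ^ 2 * (c.μ ^ 2 / (32 * c.lg1 ^ 2) * ε ^ 2) := by gcongr
      _ = _ := by field_simp
  · have h1 : (ε * c.σg2) ^ 2 ≤ (c.L0 * c.σg1) ^ 2 := by gcongr
    have h2 : q * (64 * 1024 * 58 ^ 2) * (ε * c.σg2) ^ 2 ≤ c.μ ^ 2 * ε ^ 2 := by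
      refine le_trans ?_ hlead
      calc _ ≤ q * (64 * 1024 * 58 ^ 2) * (c.L0 * c.σg1) ^ 2 := by gcongr
        _ = q * (64 * 1024 * c.L0 ^ 2 * c.σg1 ^ 2 * 58 ^ 2) := by ring
        _ ≤ _ := by gcongr
    have h3 : ε ^ 2 * (10 ^ 6 * (q * c.σg2 ^ 2)) ≤ ε ^ 2 * c.μ ^ 2 := by
      have : 0 ≤ q * (ε * c.σg2) ^ 2 := by positivity
      nlinarith
    exact le_of_mul_le_mul_left h3 (by positivity)
  · rw [hα]
    -- Since 64 · 1024 = 16 · 512 · 8, one factor LB ≥ 58 remains in the denominator, and 16 · 58 =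
    -- 928 exceeds the required 900.
    have h1 : 512 * (c.L0 / ε) ^ 2 * LB * (8 * (q / c.μ)) * c.σg1 ^ 2 =
        q * (64 * 1024 * c.L0 ^ 2 * c.σg1 ^ 2 * LB ^ 2) / (16 * LB * (c.μ * ε ^ 2)) := by
      have : LB ≠ 0 := by linarith
      field_simp; ring
    have h2 : q * (64 * 1024 * c.L0 ^ 2 * c.σg1 ^ 2 * LB ^ 2) / (16 * LB * (c.μ * ε ^ 2)) ≤
        c.μ / 928 := by
      rw [div_le_div_iff₀ (by positivity) (by norm_num)]
      calc _ ≤ c.μ ^ 2 * ε ^ 2 * 928 := by gcongr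
        _ = c.μ * (16 * 58 * (c.μ * ε ^ 2)) := by ring
        _ ≤ _ := by gcongr
    rw [h1]; linarith
  -- Drift: y* moves by at most (q/8)ε/(L₀LA) per step, and LB/LA² ≤ 2/29 because LB ≤ 2LA and LA ≥
  -- 29. The result is (16/29)(q + 1)q.
  · have h1 : c.lg1 / c.μ * h.η * (c.L0 * LA) ≤ q / 8 * ε := by
      calc _ = h.η * (c.lg1 * c.L0) * LA / c.μ := by ring
        _ ≤ q / 8 * (c.μ * ε) / c.μ := by gcongr
        _ = _ := by field_simp
    have h2 : (c.lg1 / c.μ * h.η * (c.L0 * LA)) ^ 2 ≤ (q / 8 * ε) ^ 2 := by gcongr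
    have h3 : 512 * (c.L0 / ε) ^ 2 * LB * (1 + 1 / q) * (c.lg1 / c.μ * h.η) ^ 2 =
        512 * (LB / LA ^ 2) * ((q + 1) / (q * ε ^ 2)) * (c.lg1 / c.μ * h.η * (c.L0 * LA)) ^ 2 := by
      have : LA ≠ 0 := by linarith
      field_simp
    rw [h3]
    have h5 : LB / LA ^ 2 ≤ 2 / 29 := by
      rw [div_le_div_iff₀ (by positivity) (by norm_num)]
      calc LB * 29 ≤ 2 * LA * LA := by gcongr
        _ = _ := by ring
    calc _ ≤ 512 * (2 / 29) * ((q + 1) / (q * ε ^ 2)) * (q / 8 * ε) ^ 2 := by gcongr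
      _ = 16 / 29 * ((q + 1) * q) := by field_simp; ring
      _ ≤ _ := by nlinarith

namespace Setting

variable (hS : Setting c d δ ε) (hv : 1 / 2 ≤ d.Δ * c.L0 / ε ^ 2)
include hS hv

lemma regime : Regime c (stepSizes c d δ ε) ε (oneSubBeta c d δ ε)
    (512 * (c.L0 / ε) ^ 2 * Real.log (paramB c d δ ε)) := by
  have hq := hS.oneSubBeta_pos
  obtain ⟨b1, -, b3, -, -, -⟩ := oneSubBeta_le c d δ ε
  obtain ⟨-, -, e3, e4⟩ := eta_le (c := c) (δ := δ) hS.Δ_nonneg hS.ε_pos.le hq.le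
  exact regime_of_le hS.valid hS.mu_le hS.ε_pos hq hS.eta_pos rfl rfl rfl
    (hS.le_log_paramA hv) (hS.le_log_paramB hv) hS.log_paramB_le hS.oneSubBeta_mul_le
    b1 b3 e3 e4 hS.small.h1 hS.small.h10 hS.ε_sq_le'

end Setting

end Parameters

/-! ### Lower bounds on the number of iterations -/

section Horizon

open Consts

variable {c : Consts} {d : InitData} {δ ε : ℝ}

namespace Setting

variable (hS : Setting c d δ ε)
include hS

/-- The third admissibility condition with l_{g,1}/μ ≤ `liftLip` gives √2 · `expRate` · ε ≤ 8L₀, and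
8/√2 < 6. -/
lemma expRate_mul_le : c.expRate * ε ≤ 6 * c.L0 := by
  have hμ := hS.valid.μ_pos
  have hl := hS.valid.lg1_pos
  have hL := L0_pos hS.valid
  have hρ := invRadius_pos hS.valid
  have h3 := hS.small.h3
  have h4 := lg1_div_le_liftLip c
  rw [div_le_iff₀ hμ] at h4
  rw [le_div_iff₀ (by positivity), invRadius_eq hS.valid] at h3
  have hlift : 0 < c.liftLip := by
    by_contra h
    push Not at h
    nlinarith
  have h5 : (c.liftLip * c.μ) * (√2 * (c.expRate * ε)) ≤ (c.liftLip * c.μ) * (8 * c.L0) := by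
    nlinarith
  have h6 := le_of_mul_le_mul_left h5 (by positivity)
  have h7 : (4 / 3 : ℝ) ≤ √2 := Real.le_sqrt_of_sq_le (by norm_num)
  by_contra h
  push Not at h
  nlinarith

variable (hv : 1 / 2 ≤ d.Δ * c.L0 / ε ^ 2)
include hv

omit hv in
lemma four_mul_le_horizon : 4 * d.Δ ≤ eta c d δ ε * ε * horizon c d δ ε := by
  have h1 : 0 < eta c d δ ε * ε := mul_pos hS.eta_pos hS.ε_pos
  have h2 := Nat.le_ceil (4 * d.Δ / (eta c d δ ε * ε))
  rw [div_le_iff₀ h1] at h2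
  rw [horizon]; linarith

omit hv in
-- Since T ≥ 4Δ₀/(ηε), every upper bound on η in terms of qεΔ₀/8 becomes a lower bound on qT; the
-- factor is 32 = 4 · 8.
lemma mul_le_horizon {X : ℝ} (hX : 0 ≤ X)
    (h : eta c d δ ε * X ≤ oneSubBeta c d δ ε / 8 * (ε * d.Δ)) :
    32 * X ≤ ε ^ 2 * (oneSubBeta c d δ ε * horizon c d δ ε) := by
  have h1 := mul_le_mul_of_nonneg_left (hS.four_mul_le_horizon) hX
  have h2 := mul_le_mul_of_nonneg_right h
    (mul_nonneg hS.ε_pos.le (Nat.cast_nonneg (horizon c d δ ε)))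
  have h3 : d.Δ * (32 * X) ≤ d.Δ * (ε ^ 2 * (oneSubBeta c d δ ε * horizon c d δ ε)) := by
    linarith
  exact le_of_mul_le_mul_left h3 hS.Δ_pos

/-- The entry of η with log A ≥ 29 supplies the factor 928 = 32 · 29. -/
lemma mul_Δ_le_horizon :
    928 * (d.Δ * c.L0) ≤ ε ^ 2 * (oneSubBeta c d δ ε * horizon c d δ ε) := by
  have hq := hS.oneSubBeta_pos
  have hη := hS.eta_pos
  have hμ := hS.valid.μ_pos
  have hl := hS.valid.lg1_pos
  have hL := L0_pos hS.valid
  have hA := hS.le_log_paramA hv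
  have hΔ := hS.Δ_pos
  have hml := hS.mu_le
  have hε := hS.ε_pos
  obtain ⟨-, -, e3, -⟩ := eta_le (c := c) (δ := δ) hS.Δ_nonneg hS.ε_pos.le hq.le
  have h1 := hS.mul_le_horizon (X := d.Δ * (c.lg1 * c.L0 * Real.log (paramA c d δ ε) / c.μ))
    (by positivity) (by
      calc _ ≤ oneSubBeta c d δ ε / 8 *
          (c.μ * ε / (c.lg1 * c.L0 * Real.log (paramA c d δ ε))) *
          (d.Δ * (c.lg1 * c.L0 * Real.log (paramA c d δ ε) / c.μ)) := by gcongr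
        _ = _ := by
          have : Real.log (paramA c d δ ε) ≠ 0 := by linarith
          field_simp)
  refine le_trans ?_ h1
  have h2 : c.L0 * 29 ≤ c.lg1 * c.L0 * Real.log (paramA c d δ ε) / c.μ := by
    rw [le_div_iff₀ hμ]
    calc _ = c.μ * c.L0 * 29 := by ring
      _ ≤ _ := by gcongr
  have h3 := mul_le_mul_of_nonneg_left h2 hΔ.le
  linarith

omit hv in
lemma mul_Δy_sq_le_horizon :
    32 * (c.L0 / ε * d.Δy) ^ 2 ≤ oneSubBeta c d δ ε * horizon c d δ ε := by
  have hq := hS.oneSubBeta_pos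
  have hε := hS.ε_pos
  obtain ⟨e1, -, -, -⟩ := eta_le (c := c) (δ := δ) hS.Δ_nonneg hS.ε_pos.le hq.le
  have h1 := hS.mul_le_horizon (by positivity) e1
  have h2 : ε ^ 2 * (32 * (c.L0 / ε * d.Δy) ^ 2) = 32 * (d.Δy ^ 2 * c.L0 ^ 2) := by
    field_simp
  rw [← h2] at h1
  exact le_of_mul_le_mul_left h1 (by positivity)

/-- Two cases of the self-bounding inequality. If L₁Γ ≤ L₀, then Γ² ≤ 12Δ₀L₀ and the product is
bounded by multiplying two lower bounds on qT. Otherwise Γ ≤ 12Δ₀L₁, and the warm start cancels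
L₁Δ_{y,0}. -/
lemma mul_Γ_le_horizon (hL : 5 * (c.L1 * d.Δy) ≤ 1)
    (hΓ : d.Γ ^ 2 ≤ 6 * d.Δ * (c.L0 + c.L1 * d.Γ)) :
    49 * (c.L0 / ε * d.Δy * d.Γ) ≤ ε * (oneSubBeta c d δ ε * horizon c d δ ε) := by
  have hq := hS.oneSubBeta_pos
  have hε := hS.ε_pos
  have hL0 := L0_pos hS.valid
  have hL1 := L1_pos hS.valid
  have hΔ := hS.Δ_pos
  have hΔy := hS.Δy_nonneg
  have hΓ0 := hS.Γ_nonneg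
  have h1 := hS.mul_Δ_le_horizon hv
  have h2 := hS.mul_Δy_sq_le_horizon
  set N := oneSubBeta c d δ ε * horizon c d δ ε
  have hN : 0 ≤ N := le_trans (by positivity) h2
  rcases le_total (c.L1 * d.Γ) c.L0 with h | h
  · have h3 : d.Γ ^ 2 ≤ 12 * (d.Δ * c.L0) := by nlinarith
    refine le_of_sq_le_sq ?_ (by positivity)
    calc (49 * (c.L0 / ε * d.Δy * d.Γ)) ^ 2 = 49 ^ 2 * (c.L0 / ε * d.Δy) ^ 2 * d.Γ ^ 2 := by ring
      _ ≤ 49 ^ 2 * (N / 32) * (12 * (ε ^ 2 * N / 928)) := by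
          gcongr
          · linarith
          · linarith
      _ ≤ (ε * N) ^ 2 := by nlinarith [sq_nonneg (ε * N)]
  · have h3 : d.Γ ≤ 12 * (d.Δ * c.L1) := by
      rcases hΓ0.eq_or_lt with h0 | h0
      · rw [← h0]; positivity
      · refine le_of_mul_le_mul_right ?_ h0
        nlinarith
    have h4 : ε * (49 * (c.L0 / ε * d.Δy * d.Γ)) ≤ ε * (ε * N) := by
      calc _ = 49 * (c.L0 * d.Δy) * d.Γ := by field_simp
        _ ≤ 49 * (c.L0 * d.Δy) * (12 * (d.Δ * c.L1)) := by gcongr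
        _ = 588 / 5 * (d.Δ * c.L0) * (5 * (c.L1 * d.Δy)) := by ring
        _ ≤ 588 / 5 * (d.Δ * c.L0) * 1 := by gcongr
        _ ≤ _ := by
          have : 0 ≤ d.Δ * c.L0 := by positivity
          linarith
    exact le_of_mul_le_mul_left h4 hε

variable {dx dy : ℕ} {Ξ Z : Type*} {P : Problem dx dy Ξ Z}

lemma budget {s₀ : State dx dy} (hΔ : d.Δ = P.gap s₀.x) (hΓ : d.Γ = ‖gradient P.Φ s₀.x‖)
    (hΔy : d.Δy = ‖s₀.y - P.yStar s₀.x‖) (hΔz : d.Δz = ‖s₀.z - P.zStar s₀.x‖) (hm : s₀.m = 0)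
    (hL : 5 * (c.L1 * d.Δy) ≤ 1) (hΓ' : d.Γ ^ 2 ≤ 6 * d.Δ * (c.L0 + c.L1 * d.Γ)) :
    Budget c P (stepSizes c d δ ε) ε (oneSubBeta c d δ ε)
      (512 * (c.L0 / ε) ^ 2 * Real.log (paramB c d δ ε)) (paramB c d δ ε) (c.L0 / ε * d.Δy)
      (horizon c d δ ε) s₀ := by
  have hq := hS.oneSubBeta_pos
  have hε := hS.ε_pos
  have hL0 := L0_pos hS.valid
  have hΔ' := hS.mul_Δ_le_horizon hv
  refine { expRate_le := hS.expRate_mul_le, l_eq := rfl, B_pos := hS.paramB_pos,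
           log_ge := hS.le_log_paramB hv, m_eq := hm, Θ_eq := by rw [hΔy], Θ_ge := ?_,
           L1_Θ := ?_, T_Θ := hS.mul_Δy_sq_le_horizon, T_ΘΓ := ?_, T_aux := ?_, T_ge := ?_,
           T_gap := ?_ }
  · have := hS.small.h2
    rw [div_mul_eq_mul_div, one_le_div hε]; linarith
  · calc _ = c.L0 * (5 * (c.L1 * d.Δy)) := by field_simp
      _ ≤ c.L0 * 1 := by gcongr
      _ = _ := mul_one _
  · rw [← hΓ]; exact hS.mul_Γ_le_horizon hv hL hΓ'
  · obtain ⟨-, e2, -, -⟩ := eta_le (c := c) (δ := δ) hS.Δ_nonneg hS.ε_pos.le hq.le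
    have h1 := hS.mul_le_horizon (by positivity) e2
    rw [hΔz] at h1
    exact h1
  · have h1 : ε ^ 2 * 464 ≤ ε ^ 2 * (oneSubBeta c d δ ε * horizon c d δ ε) := by
      rw [le_div_iff₀ (by positivity)] at hv
      linarith
    exact le_of_mul_le_mul_left h1 (by positivity)
  · rw [← hΔ]; exact hS.four_mul_le_horizon

end Setting

end Horizon

/-! ### Measurability of the parameters in the random warm-start output -/

section ParameterMeasurability

variable {Ω : Type*} [MeasurableSpace Ω]

lemma measurable_capRatio {m a b : Ω → ℝ} (hm : Measurable m) (ha : Measurable a)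
    (hb : Measurable b) : Measurable fun ω => capRatio (m ω) (a ω) (b ω) :=
  Measurable.ite (measurableSet_eq_fun hb measurable_const) hm (hm.min (ha.div hb))

variable {c : Consts} {D : Ω → InitData} {δ ε : ℝ} (hΔ : Measurable fun ω => (D ω).Δ)
  (hΔy : Measurable fun ω => (D ω).Δy) (hΔz : Measurable fun ω => (D ω).Δz)
  (hΓ : Measurable fun ω => (D ω).Γ)

include hΔ in
lemma measurable_baseQ : Measurable fun ω => baseQ c (D ω) δ := by
  unfold baseQ; fun_prop

include hΔ in
lemma measurable_baseR : Measurable fun ω => baseR c (D ω) δ := by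
  unfold baseR; fun_prop

include hΔ hΔz in
lemma measurable_expo2 : Measurable fun ω => expo2 c (D ω) := by
  unfold expo2; fun_prop

include hΔ hΔy in
lemma measurable_expo3 : Measurable fun ω => expo3 c (D ω) := by
  unfold expo3; fun_prop

include hΔ in
lemma measurable_paramB : Measurable fun ω => paramB c (D ω) δ ε := by
  have := measurable_baseR (c := c) (δ := δ) hΔ
  unfold paramB; fun_prop

include hΔ hΔy hΔz in
lemma measurable_oneSubBeta : Measurable fun ω => oneSubBeta c (D ω) δ ε := by
  have hQ := measurable_baseQ (c := c) (δ := δ) hΔ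
  have hB := measurable_paramB (c := c) (δ := δ) (ε := ε) hΔ
  have h2 := measurable_expo2 (c := c) hΔ hΔz
  have h3 := measurable_expo3 (c := c) hΔ hΔy
  unfold oneSubBeta
  refine Measurable.min (Measurable.min (Measurable.min (measurable_capRatio (measurable_capRatio
    (measurable_capRatio (Measurable.min (Measurable.min (Measurable.min ?_ ?_) ?_) ?_) ?_ ?_)
    ?_ ?_) ?_ ?_) ?_) ?_) ?_ <;> fun_prop

include hΔ hΔy hΔz in
lemma measurable_paramA : Measurable fun ω => paramA c (D ω) δ ε := by
  have hQ := measurable_baseQ (c := c) (δ := δ) hΔ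
  have hq := measurable_oneSubBeta (c := c) (δ := δ) (ε := ε) hΔ hΔy hΔz
  unfold paramA; fun_prop

include hΔ hΔy hΔz hΓ in
lemma measurable_eta : Measurable fun ω => eta c (D ω) δ ε := by
  have hA := measurable_paramA (c := c) (δ := δ) (ε := ε) hΔ hΔy hΔz
  have hq := measurable_oneSubBeta (c := c) (δ := δ) (ε := ε) hΔ hΔy hΔz
  unfold eta
  refine Measurable.min (Measurable.mul (Measurable.mul ?_ (Measurable.min (measurable_capRatio
    (measurable_capRatio (measurable_capRatio (Measurable.min ?_ ?_) ?_ ?_) ?_ ?_) ?_ ?_) ?_)) ?_) ?_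
    <;> fun_prop

include hΔ hΔy hΔz hΓ in
lemma measurable_horizon : Measurable fun ω => horizon c (D ω) δ ε := by
  have hη := measurable_eta (c := c) (δ := δ) (ε := ε) hΔ hΔy hΔz hΓ
  unfold horizon
  exact Nat.measurable_ceil.comp (by fun_prop)

include hΔ hΔy hΔz hΓ in
lemma measurableSet_epsSmall : MeasurableSet {ω | EpsSmall c (D ω) δ ε} := by
  have hQ := measurable_baseQ (c := c) (δ := δ) hΔ
  have hR := measurable_baseR (c := c) (δ := δ) hΔ
  have h2 := measurable_expo2 (c := c) hΔ hΔz
  have h3 := measurable_expo3 (c := c) hΔ hΔy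
  have e : {ω | EpsSmall c (D ω) δ ε} = {ω | ε ≤ c.L0 / c.L1} ∩ {ω | ε ≤ (D ω).Δy * c.L0} ∩
      {ω | ε ≤ 8 * c.lg1 * c.L0 / (c.μ * c.invRadius)} ∩ {ω | ε ≤ √(16 * baseQ c (D ω) δ)} ∩
      {ω | ε ≤ 4 * baseR c (D ω) δ ^ (1 / 4 : ℝ)} ∩
      {ω | ε ≤ √(32 * baseQ c (D ω) δ / expo1 c)} ∩
      {ω | ε ≤ √(32 * baseQ c (D ω) δ / expo2 c (D ω))} ∩
      {ω | ε ≤ √(32 * baseQ c (D ω) δ / expo3 c (D ω))} ∩ {ω | ε * (D ω).Γ ≤ (D ω).Δ * c.L0} ∩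
      {ω | ε * c.σg2 ≤ c.L0 * c.σg1} ∩ {ω | ε ≤ c.L0 * c.σg1 / √(c.μ * c.lg1)} ∩
      {ω | ε ≤ (2 ^ 21 * baseR c (D ω) δ) ^ (1 / 4 : ℝ) *
        Real.exp (-(c.lg1 * √c.noise) / (512 * c.L0 * c.σg1))} := by
    ext ω
    simp only [Set.mem_inter_iff, Set.mem_ofPred_eq]
    exact ⟨fun ⟨a1, a2, a3, a4, a5, a6, a7, a8, a9, a10, a11, a12⟩ =>
      ⟨⟨⟨⟨⟨⟨⟨⟨⟨⟨⟨a1, a2⟩, a3⟩, a4⟩, a5⟩, a6⟩, a7⟩, a8⟩, a9⟩, a10⟩, a11⟩, a12⟩,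
      fun ⟨⟨⟨⟨⟨⟨⟨⟨⟨⟨⟨a1, a2⟩, a3⟩, a4⟩, a5⟩, a6⟩, a7⟩, a8⟩, a9⟩, a10⟩, a11⟩, a12⟩ =>
        ⟨a1, a2, a3, a4, a5, a6, a7, a8, a9, a10, a11, a12⟩⟩
  rw [e]
  refine .inter (.inter (.inter (.inter (.inter (.inter (.inter (.inter (.inter (.inter (.inter
    ?_ ?_) ?_) ?_) ?_) ?_) ?_) ?_) ?_) ?_) ?_) ?_ <;>
    exact measurableSet_le (by fun_prop) (by fun_prop)

end ParameterMeasurability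

/-! ### The case of a small initial gap -/

section SmallRatio

open scoped ENNReal

variable {dx dy : ℕ} {Ξ Z : Type*} [MeasurableSpace Ξ] [MeasurableSpace Z]
  {c : Consts} {P : Problem dx dy Ξ Z} {h : StepSizes} {d : InitData} {δ ε : ℝ}
  {Df : Measure Ξ} {Dg : Measure Z} [IsProbabilityMeasure Df] [IsProbabilityMeasure Dg]
  {s₀ : State dx dy}

omit [MeasurableSpace Ξ] [MeasurableSpace Z] in
/-- If the initial gap is small compared to `ε²`, then the gradient stays small along every path. -/
lemma sum_norm_gradient_mainLoop_le (hc : c.Valid) (hs : RelaxedSmooth c P) (hl : LowerLevel c P)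
    (hη : 0 < h.η) (hε : 0 < ε) {Δ : ℝ} (hΔ : 0 ≤ Δ) (hv : Δ * c.L0 / ε ^ 2 ≤ 1 / 2)
    (hL1 : ε ≤ c.L0 / c.L1) (hΓ : ε * ‖gradient P.Φ s₀.x‖ ≤ Δ * c.L0) (p : ℕ → Z)
    (w : UpperSample Ξ Z) :
    ∑ t ∈ Finset.range ⌈4 * Δ / (h.η * ε)⌉₊, ‖gradient P.Φ (mainLoop P h s₀ p w t).x‖
      ≤ 14 * (ε * ⌈4 * Δ / (h.η * ε)⌉₊) := by
  set T := ⌈4 * Δ / (h.η * ε)⌉₊ with hT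
  have hL0 := Consts.L0_pos hc
  have hL1p := Consts.L1_pos hc
  rw [div_le_iff₀ (by positivity)] at hv
  rw [le_div_iff₀ hL1p] at hL1
  set Γ := ‖gradient P.Φ s₀.x‖ with hΓd
  have hΓ0 : 0 ≤ Γ := norm_nonneg _
  have hΓ1 : Γ ≤ ε / 2 := by
    refine le_of_mul_le_mul_left ?_ hε
    linarith
  -- Because of the rounding up only T - 1 steps are controlled; this suffices, as the last point of
  -- the average is reached after T - 1 steps.
  have hTη : (T - 1) * (h.η * ε) ≤ 4 * Δ := by
    rw [← le_div_iff₀ (by positivity)]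
    have := Nat.ceil_lt_add_one (show 0 ≤ 4 * Δ / (h.η * ε) by positivity)
    rw [← hT] at this
    linarith
  have he : Real.exp 2 ≤ 7.39 := by
    have h1 := Real.exp_one_lt_d9
    rw [show (2 : ℝ) = 1 + 1 by norm_num, Real.exp_add]
    nlinarith [Real.exp_pos 1]
  have h1 : ∀ t ∈ Finset.range T, ‖gradient P.Φ (mainLoop P h s₀ p w t).x‖ ≤
      ε / 2 + 3 / 2 * c.L0 * h.η * 7.39 * t := fun t ht => by
    have h2 := norm_gradient_mainLoop_le hc hs hl hη.le s₀ p w t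
    rw [← hΓd] at h2
    refine h2.trans ?_
    have h3 : (t : ℝ) ≤ T - 1 := by
      have : t + 1 ≤ T := Finset.mem_range.1 ht
      have : ((t + 1 : ℕ) : ℝ) ≤ T := by exact_mod_cast this
      push_cast at this; linarith
    have h4 : h.η * t * ε ≤ 4 * Δ := by
      refine le_trans ?_ hTη
      calc _ = t * (h.η * ε) := by ring
        _ ≤ _ := by gcongr
    have h5 : c.L1 * (h.η * t) ≤ 2 := by
      refine le_of_mul_le_mul_right ?_ (show 0 < ε ^ 2 by positivity)
      calc _ = (ε * c.L1) * (h.η * t * ε) := by ring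
        _ ≤ c.L0 * (4 * Δ) := by gcongr
        _ ≤ _ := by linarith
    have h6 : c.L1 * Γ ≤ c.L0 / 2 := by
      calc _ ≤ c.L1 * (ε / 2) := by gcongr
        _ ≤ _ := by linarith
    have h7 : Real.exp (c.L1 * (h.η * t)) ≤ 7.39 := (Real.exp_le_exp.2 h5).trans he
    calc _ ≤ ε / 2 + (c.L0 + c.L0 / 2) * (h.η * t * 7.39) := by gcongr
      _ = _ := by ring
  have h2 : ∑ t ∈ Finset.range T, (t : ℝ) = T * (T - 1) / 2 := by
    induction T with
    | zero => simp
    | succ n ih => rw [Finset.sum_range_succ, ih]; push_cast; ring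
  refine (Finset.sum_le_sum h1).trans ?_
  rw [Finset.sum_add_distrib, ← Finset.mul_sum, h2]
  simp only [Finset.sum_const, Finset.card_range, nsmul_eq_mul]
  have h3 : 0 ≤ (T : ℝ) := Nat.cast_nonneg _
  -- Averaging t over the run gives (T - 1)/2, so the total is (1/2 + 3/2 · 7.39) ε T, below 14 ε T.
  have h4 : c.L0 * ((T - 1) * h.η) ≤ 2 * ε := by
    refine le_of_mul_le_mul_right ?_ hε
    have := mul_le_mul_of_nonneg_left hTη hL0.le
    linarith
  have h5 := mul_le_mul_of_nonneg_left h4 h3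
  nlinarith

end SmallRatio

/-! ### Conditioning on the warm start and the probability bound -/

section Assembly

open scoped ENNReal

variable {dx dy : ℕ} {Ξ Z : Type*}

/-- The initial quantities of the main loop started at `(x₀, y, z₀)`. -/
noncomputable def startData (P : Problem dx dy Ξ Z) (x₀ : Vec dx) (z₀ y : Vec dy) : InitData where
  Δ := P.gap x₀
  Δy := ‖y - P.yStar x₀‖
  Δz := ‖z₀ - P.zStar x₀‖
  Γ := ‖gradient P.Φ x₀‖

/-- The initial state of the main loop started at `(x₀, y, z₀)` after `n` oracle calls. -/
def startState (x₀ : Vec dx) (z₀ : Vec dy) (n : ℕ) (y : Vec dy) : State dx dy where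
  x := x₀
  y := y
  z := z₀
  m := 0
  calls := n

variable [MeasurableSpace Ξ] [MeasurableSpace Z] {c : Consts} {P : Problem dx dy Ξ Z}
  {Df : Measure Ξ} {Dg : Measure Z} [IsProbabilityMeasure Df] [IsProbabilityMeasure Dg]
  {δ ε : ℝ} {x₀ : Vec dx} {z₀ : Vec dy} {n : ℕ}

/-- The sum of the mean gradient norms, for fixed lower-level samples in the main loop. -/
noncomputable def gradSum (Df : Measure Ξ) (Dg : Measure Z) [IsProbabilityMeasure Df]
    [IsProbabilityMeasure Dg] (c : Consts) (P : Problem dx dy Ξ Z) (δ ε : ℝ) (x₀ : Vec dx)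
    (z₀ : Vec dy) (n : ℕ) (y : Vec dy) (p : ℕ → Z) : ℝ≥0∞ :=
  ∑ t ∈ Finset.range (horizon c (startData P x₀ z₀ y) δ ε),
    upperMean Df Dg P (stepSizes c (startData P x₀ z₀ y) δ ε) (startState x₀ z₀ n y) p
      (fun s => ‖gradient P.Φ s.x‖) t

variable (hc : c.Valid) (hs : RelaxedSmooth c P) (hl : LowerLevel c P)
  (ho : OracleAssumption c P Df Dg)

include ho in
lemma measurable_sum_upperMean {Ω : Type*} [MeasurableSpace Ω] {F : State dx dy → ℝ}
    (hF : Measurable F) {hh : Ω → StepSizes} (hα : Measurable fun ω => (hh ω).α)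
    (hβ : Measurable fun ω => (hh ω).β) (hγ : Measurable fun ω => (hh ω).γ)
    (hη : Measurable fun ω => (hh ω).η) {s : Ω → State dx dy} (hs : Measurable s)
    {p : Ω → ℕ → Z} (hp : Measurable p) {T : Ω → ℕ} (hT : Measurable T) :
    Measurable fun ω => ∑ t ∈ Finset.range (T ω), upperMean Df Dg P (hh ω) (s ω) (p ω) F t := by
  have hU : ∀ t, Measurable fun ω => upperMean Df Dg P (hh ω) (s ω) (p ω) F t := fun t => by
    have h1 : Measurable fun a : Ω × UpperSample Ξ Z =>
        mainLoop P (hh a.1) (s a.1) (p a.1) a.2 t :=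
      measurable_mainLoop ho (hh := fun a : Ω × UpperSample Ξ Z => hh a.1)
        (hα.comp measurable_fst) (hβ.comp measurable_fst) (hγ.comp measurable_fst)
        (hη.comp measurable_fst) (hs.comp measurable_fst) (hp.comp measurable_fst) measurable_snd t
    exact (hF.comp h1).ennreal_ofReal.lintegral_prod_right'
  -- The number of summands depends on the warm start. Treating it as an extra coordinate in a
  -- countable space reduces measurability to a fixed number of summands.
  have h2 : Measurable fun a : ℕ × Ω => ∑ t ∈ Finset.range a.1,
      upperMean Df Dg P (hh a.2) (s a.2) (p a.2) F t :=
    measurable_from_prod_countable_right fun T => Finset.measurable_sum (Finset.range T)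
      fun t _ => hU t
  exact h2.comp (hT.prodMk measurable_id)

include ho in
lemma sum_upperMean_le {F : State dx dy → ℝ} (hF : Measurable F) (hF0 : ∀ s, 0 ≤ F s)
    {h : StepSizes} {s₀ : State dx dy} {p : ℕ → Z} {T : ℕ} {K : ℝ}
    (hK : ∀ w, ∑ t ∈ Finset.range T, F (mainLoop P h s₀ p w t) ≤ K) :
    ∑ t ∈ Finset.range T, upperMean Df Dg P h s₀ p F t ≤ ENNReal.ofReal K := by
  have hm : ∀ t, Measurable fun w => F (mainLoop P h s₀ p w t) := fun t =>
    hF.comp ((measurable_mainLoop_prod ho t).comp (measurable_const.prodMk measurable_id))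
  simp only [upperMean]
  rw [← lintegral_finsetSum _ fun t _ => (hm t).ennreal_ofReal]
  have h1 : ∀ w, ∑ t ∈ Finset.range T, ENNReal.ofReal (F (mainLoop P h s₀ p w t)) ≤
      ENNReal.ofReal K := fun w => by
    rw [← ENNReal.ofReal_sum_of_nonneg fun t _ => hF0 _]
    exact ENNReal.ofReal_le_ofReal (hK w)
  refine (lintegral_mono h1).trans ?_
  rw [lintegral_const, measure_univ, mul_one]

section Measurability

variable {Ω : Type*} [MeasurableSpace Ω] {Y : Ω → Vec dy} (hY : Measurable Y)
include hY

omit [MeasurableSpace Ξ] [MeasurableSpace Z] in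
lemma measurable_startData : (Measurable fun ω => (startData P x₀ z₀ (Y ω)).Δ) ∧
    (Measurable fun ω => (startData P x₀ z₀ (Y ω)).Δy) ∧
    (Measurable fun ω => (startData P x₀ z₀ (Y ω)).Δz) ∧
    (Measurable fun ω => (startData P x₀ z₀ (Y ω)).Γ) :=
  ⟨measurable_const, (hY.sub_const _).norm, measurable_const, measurable_const⟩

lemma measurable_startState : Measurable fun ω => startState x₀ z₀ n (Y ω) :=
  measurable_state_iff.2 ⟨measurable_const, hY, measurable_const, measurable_const⟩

include hc hs hl ho in
lemma measurable_gradSum {p : Ω → ℕ → Z} (hp : Measurable p) :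
    Measurable fun ω => gradSum Df Dg c P δ ε x₀ z₀ n (Y ω) (p ω) := by
  obtain ⟨d1, d2, d3, d4⟩ := measurable_startData (P := P) (x₀ := x₀) (z₀ := z₀) hY
  have hq := measurable_oneSubBeta (c := c) (δ := δ) (ε := ε) d1 d2 d3
  have hη := measurable_eta (c := c) (δ := δ) (ε := ε) d1 d2 d3 d4
  have hT := measurable_horizon (c := c) (δ := δ) (ε := ε) d1 d2 d3 d4
  exact measurable_sum_upperMean ho (measurable_norm_gradient hc hs hl)
    (hh := fun ω => stepSizes c (startData P x₀ z₀ (Y ω)) δ ε)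
    ((hq.div_const c.μ).const_mul 8) (hq.const_sub 1) (hq.div_const c.μ) hη
    (measurable_startState hY) hp hT

end Measurability

omit [MeasurableSpace Ξ] [MeasurableSpace Z] in
include hc hl in
lemma setting_startData (hb : BddBelow (Set.range P.Φ)) (hδ : 0 < δ) (hδ1 : δ < 1) (hε : 0 < ε)
    {y : Vec dy} (h : EpsSmall c (startData P x₀ z₀ y) δ ε) :
    Setting c (startData P x₀ z₀ y) δ ε where
  valid := hc
  mu_le := by
    -- In dimension zero Δ_{y,0} = 0, and admissibility would give ε ≤ 0.
    refine (hl.mu_le_or hc).resolve_right fun h0 => ?_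
    have h2 := h.h2
    have h3 : (startData P x₀ z₀ y).Δy = 0 := by
      rw [startData, h0 (y - P.yStar x₀), norm_zero]
    rw [h3, zero_mul] at h2
    linarith
  δ_pos := hδ
  δ_lt := hδ1
  ε_pos := hε
  Δ_nonneg := gap_nonneg hb x₀
  Δy_nonneg := norm_nonneg _
  Γ_nonneg := norm_nonneg _
  small := h

lemma horizon_eq (c : Consts) (d : InitData) (δ ε : ℝ) :
    horizon c d δ ε = ⌈4 * d.Δ / ((stepSizes c d δ ε).η * ε)⌉₊ := rfl

/-- A nonpositive step size makes the quotient nonpositive (division by 0 gives 0), and the rounding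
to a natural number returns 0. Statements about all t < T are then empty. -/
lemma horizon_eq_zero {d : InitData} (hΔ : 0 ≤ d.Δ) (hε : 0 < ε) (hη : (stepSizes c d δ ε).η ≤ 0) :
    horizon c d δ ε = 0 := by
  rw [horizon_eq]
  exact Nat.ceil_eq_zero.2 (div_nonpos_of_nonneg_of_nonpos (by positivity)
    (mul_nonpos_of_nonpos_of_nonneg hη hε.le))

section Fixed

variable {d : InitData} (hS : Setting c d δ ε) {s₀ : State dx dy} {p : ℕ → Z}
  (hΔ : d.Δ = P.gap s₀.x) (hΓ : d.Γ = ‖gradient P.Φ s₀.x‖)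

include hc hs hl ho hS hΓ in
lemma sum_upperMean_le_of_ratio_le (hv : d.Δ * c.L0 / ε ^ 2 ≤ 1 / 2) :
    ∑ t ∈ Finset.range (horizon c d δ ε), upperMean Df Dg P (stepSizes c d δ ε) s₀ p
      (fun s => ‖gradient P.Φ s.x‖) t ≤ ENNReal.ofReal (14 * (ε * horizon c d δ ε)) := by
  have h9 := hS.small.h9
  rw [hΓ] at h9
  rcases le_or_gt (stepSizes c d δ ε).η 0 with hη | hη
  · rw [horizon_eq_zero hS.Δ_nonneg hS.ε_pos hη]; simp
  · rw [horizon_eq]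
    exact sum_upperMean_le ho (measurable_norm_gradient hc hs hl) (fun _ => norm_nonneg _)
      fun w => sum_norm_gradient_mainLoop_le hc hs hl hη hS.ε_pos hS.Δ_nonneg hv hS.small.h1 h9 p w

include hc hs hl ho hS hΔ hΓ in
-- The two regimes of Δ₀L₀/ε² meet here. A small ratio leaves no exceptional set; a large one gives
-- 10 + 1 ≤ 14 outside the event excluded by Markov's inequality.
lemma measure_sum_upperMean_le (hb : BddBelow (Set.range P.Φ))
    (hΔy : d.Δy = ‖s₀.y - P.yStar s₀.x‖) (hΔz : d.Δz = ‖s₀.z - P.zStar s₀.x‖) (hm : s₀.m = 0)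
    (hL : c.L1 * d.Δy ≤ 1 / 5) :
    loopLaw Dg {p | ENNReal.ofReal (14 * (ε * horizon c d δ ε)) <
      ∑ t ∈ Finset.range (horizon c d δ ε), upperMean Df Dg P (stepSizes c d δ ε) s₀ p
        (fun s => ‖gradient P.Φ s.x‖) t} ≤ ENNReal.ofReal δ := by
  have hε := hS.ε_pos
  rcases le_total (d.Δ * c.L0 / ε ^ 2) (1 / 2) with hv | hv
  · refine le_trans (le_of_eq ?_) zero_le
    convert measure_empty (μ := loopLaw Dg)
    refine Set.eq_empty_of_forall_notMem fun p hp => ?_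
    exact (sum_upperMean_le_of_ratio_le hc hs hl ho hS hΓ hv).not_gt hp
  · have hB := hS.budget (P := P) (s₀ := s₀) hv hΔ hΓ hΔy hΔz hm (by linarith)
      (by rw [hΔ, hΓ]; exact norm_gradient_sq_le hc hs hl hb s₀.x)
    have hR := hS.regime hv
    refine (measure_mono fun p hp => ?_).trans (measure_weightedMoment_le hc hs hl ho hb hR hB
      hS.δ_lt (hS.le_mul_paramB hv))
    rw [Set.mem_ofPred_eq] at hp ⊢
    have h1 := sum_upperMean_gradSize_le (p := p) hc hs hl ho hb hR hB
    by_contra hcon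
    rw [not_le] at hcon
    refine hp.not_ge ?_
    have hT0 : 0 ≤ ε * horizon c d δ ε := by positivity
    calc _ ≤ ∑ t ∈ Finset.range (horizon c d δ ε),
          upperMean Df Dg P (stepSizes c d δ ε) s₀ p (fun s => gradSize P ε s.x) t :=
          Finset.sum_le_sum fun t _ => lintegral_mono fun w => ENNReal.ofReal_le_ofReal
            (le_add_of_nonneg_left hε.le)
      _ ≤ ENNReal.ofReal (10 * (ε * horizon c d δ ε)) + ENNReal.ofReal (ε * horizon c d δ ε) :=
          h1.trans (add_le_add le_rfl hcon.le)
      _ = ENNReal.ofReal (10 * (ε * horizon c d δ ε) + ε * horizon c d δ ε) :=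
          (ENNReal.ofReal_add (by positivity) hT0).symm
      _ ≤ _ := ENNReal.ofReal_le_ofReal (by linarith)

end Fixed

include hc hs hl ho in
lemma measure_gradSum_le (hb : BddBelow (Set.range P.Φ)) (hδ : 0 < δ) (hδ1 : δ < 1) (hε : 0 < ε)
    {y : Vec dy} (hy : c.L1 * ‖y - P.yStar x₀‖ ≤ 1 / 5)
    (h : EpsSmall c (startData P x₀ z₀ y) δ ε) :
    loopLaw Dg {p | ENNReal.ofReal (14 * (ε * horizon c (startData P x₀ z₀ y) δ ε)) <
      gradSum Df Dg c P δ ε x₀ z₀ n y p} ≤ ENNReal.ofReal δ :=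
  measure_sum_upperMean_le (s₀ := startState x₀ z₀ n y) hc hs hl ho
    (setting_startData hc hl hb hδ hδ1 hε h) rfl rfl hb rfl rfl rfl hy

variable (c P δ ε x₀ z₀) in
/-- The mean gradient along the run is small, provided `ε` is admissible. -/
def GoodRun (Df : Measure Ξ) (Dg : Measure Z) [IsProbabilityMeasure Df] [IsProbabilityMeasure Dg]
    (yInit : Vec dy) (ωL : LowerSample Z) : Prop :=
  Admissible c P δ ε x₀ yInit z₀ ωL →
    gradSum Df Dg c P δ ε x₀ z₀ (warmStart c P δ x₀ yInit ωL).2 (warmStart c P δ x₀ yInit ωL).1 ωL.2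
      ≤ ENNReal.ofReal (14 * (ε * iterations c P δ ε x₀ yInit z₀ ωL))

include hc hs hl ho in
-- The bad event is cut into sections over the warm-start samples. A failed warm start costs δ. For
-- each successful one the parameters are fixed, admissibility is decided, and the independent
-- samples of the main loop cost another δ.
lemma le_measure_goodRun (hb : BddBelow (Set.range P.Φ)) (hδ : 0 < δ) (hδ1 : δ < 1) (hε : 0 < ε)
    (yInit : Vec dy) :
    ENNReal.ofReal (1 - 2 * δ) ≤
      lowerLaw Dg {ωL | GoodRun c P δ ε x₀ z₀ Df Dg yInit ωL} := by
  set N := warmSteps c δ ‖yInit - P.yStar x₀‖ with hN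
  set Y : (ℕ → Z) → Vec dy := fun s =>
    (sgdDD P (fun _ => x₀) yInit (alphaInit c δ) s N).1 with hYd
  have hY : Measurable Y := by
    rw [hYd]
    simp_rw [sgdDD_eq_orbit]
    exact measurable_orbit (fun _ => measurable_lowerStep ho x₀ _) yInit N
  have hw : ∀ ωL : LowerSample Z, warmStart c P δ x₀ yInit ωL = (Y ωL.1, N) := fun ωL =>
    Prod.ext rfl (sgdDD_calls _ _ _ _ _)
  set E : Set (LowerSample Z) := {ωL | EpsSmall c (startData P x₀ z₀ (Y ωL.1)) δ ε} ∩
    {ωL | ENNReal.ofReal (14 * (ε * horizon c (startData P x₀ z₀ (Y ωL.1)) δ ε)) <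
      gradSum Df Dg c P δ ε x₀ z₀ N (Y ωL.1) ωL.2} with hE
  have hY1 : Measurable fun ωL : LowerSample Z => Y ωL.1 := hY.comp measurable_fst
  obtain ⟨d1, d2, d3, d4⟩ := measurable_startData (P := P) (x₀ := x₀) (z₀ := z₀) hY1
  have hEm : MeasurableSet E := by
    refine (measurableSet_epsSmall d1 d2 d3 d4).inter (measurableSet_lt ?_
      (measurable_gradSum hc hs hl ho hY1 measurable_snd))
    have hT := measurable_horizon (c := c) (δ := δ) (ε := ε) d1 d2 d3 d4
    have : Measurable fun ωL : LowerSample Z =>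
        (horizon c (startData P x₀ z₀ (Y ωL.1)) δ ε : ℝ) := measurable_from_nat.comp hT
    exact ((this.const_mul ε).const_mul 14).ennreal_ofReal
  have hgood : {ωL | GoodRun c P δ ε x₀ z₀ Df Dg yInit ωL} = Eᶜ := by
    ext ωL
    have e1 : initData c P δ x₀ yInit z₀ ωL = startData P x₀ z₀ (Y ωL.1) := rfl
    rw [Set.mem_ofPred_eq, GoodRun, Admissible, iterations, e1, hw, Set.mem_compl_iff, hE,
      Set.mem_inter_iff, not_and, Set.mem_ofPred_eq, Set.mem_ofPred_eq, not_lt]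
  set N1 : Set (ℕ → Z) := {s | ¬ c.L1 * ‖Y s - P.yStar x₀‖ ≤ 1 / 5} with hN1
  have hN1m : MeasurableSet N1 :=
    (measurableSet_le ((hY.sub_const _).norm.const_mul _) measurable_const).compl
  have h1 : loopLaw Dg N1 ≤ ENNReal.ofReal δ := measure_warmStart_le hc hl ho hδ hδ1 x₀ yInit
  have h2 : lowerLaw Dg E ≤ ENNReal.ofReal (2 * δ) := by
    rw [lowerLaw, Measure.prod_apply hEm]
    -- Sections over inadmissible outputs are empty, so these cost nothing.
    have h3 : ∀ s, loopLaw Dg (Prod.mk s ⁻¹' E) ≤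
        N1.indicator (fun _ => 1) s + ENNReal.ofReal δ := fun s => by
      by_cases hsN : s ∈ N1
      · rw [Set.indicator_of_mem hsN]
        exact prob_le_one.trans le_self_add
      · rw [Set.indicator_of_notMem hsN, zero_add]
        have h4 : c.L1 * ‖Y s - P.yStar x₀‖ ≤ 1 / 5 := by
          by_contra hcon; exact hsN hcon
        by_cases h5 : EpsSmall c (startData P x₀ z₀ (Y s)) δ ε
        · refine (measure_mono fun p hp => ?_).trans
            (measure_gradSum_le (n := N) hc hs hl ho hb hδ hδ1 hε h4 h5)
          exact hp.2
        · have : Prod.mk s ⁻¹' E = ∅ :=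
            Set.eq_empty_of_forall_notMem fun p hp => h5 hp.1
          rw [this, measure_empty]; exact zero_le
    refine (lintegral_mono h3).trans ?_
    rw [lintegral_add_right _ measurable_const, lintegral_indicator_const hN1m, lintegral_const,
      measure_univ, one_mul, mul_one, two_mul, ENNReal.ofReal_add hδ.le hδ.le]
    gcongr
  have : IsProbabilityMeasure (lowerLaw Dg) := by unfold lowerLaw; infer_instance
  rw [hgood, prob_compl_eq_one_sub hEm, ENNReal.ofReal_sub _ (by positivity), ENNReal.ofReal_one]
  gcongr

include hc hs hl ho in
omit [IsProbabilityMeasure Df] [IsProbabilityMeasure Dg] in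
lemma measurable_norm_gradient_mainLoop {h : StepSizes} {s₀ : State dx dy} (p : ℕ → Z) (t : ℕ) :
    Measurable fun w : UpperSample Ξ Z => ‖gradient P.Φ (mainLoop P h s₀ p w t).x‖ :=
  (measurable_norm_gradient hc hs hl).comp
    ((measurable_mainLoop_prod ho t).comp (measurable_const.prodMk measurable_id))

include hc hs hl ho in
-- Passage from extended nonnegative integrals to real ones; integrability comes from the
-- deterministic bound on the gradient along the run.
lemma mean_gradient_le (hb : BddBelow (Set.range P.Φ)) (hε : 0 < ε) {yInit : Vec dy}
    {ωL : LowerSample Z} (hA : Admissible c P δ ε x₀ yInit z₀ ωL)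
    (hg : GoodRun c P δ ε x₀ z₀ Df Dg yInit ωL) :
    (∀ t < iterations c P δ ε x₀ yInit z₀ ωL,
      Integrable (fun ωU => ‖gradient P.Φ (run c P δ ε x₀ yInit z₀ ωL ωU t).x‖)
        (upperLaw Df Dg)) ∧
      (1 / (iterations c P δ ε x₀ yInit z₀ ωL : ℝ)) *
        ∑ t ∈ Finset.range (iterations c P δ ε x₀ yInit z₀ ωL),
          ∫ ωU, ‖gradient P.Φ (run c P δ ε x₀ yInit z₀ ωL ωU t).x‖ ∂(upperLaw Df Dg)
        ≤ 14 * ε := by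
  have h1 := hg hA
  set T := iterations c P δ ε x₀ yInit z₀ ωL with hT
  set d := initData c P δ x₀ yInit z₀ ωL with hd
  have hint : ∀ t < T, Integrable (fun ωU => ‖gradient P.Φ (run c P δ ε x₀ yInit z₀ ωL ωU t).x‖)
      (upperLaw Df Dg) := fun t ht => by
    have hη : 0 < eta c d δ ε := by
      by_contra hη
      have : T = 0 := horizon_eq_zero (gap_nonneg hb x₀) hε (not_lt.1 hη)
      omega
    have h3 := norm_gradient_mainLoop_le hc hs hl (h := stepSizes c d δ ε) hη.le
      { x := x₀, y := (warmStart c P δ x₀ yInit ωL).1, z := z₀, m := 0,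
        calls := (warmStart c P δ x₀ yInit ωL).2 } ωL.2
    exact Integrable.of_bound
      (measurable_norm_gradient_mainLoop hc hs hl ho _ t).aestronglyMeasurable _
      (Filter.Eventually.of_forall fun w => by rw [norm_norm]; exact h3 w t)
  refine ⟨hint, ?_⟩
  have h2 : ENNReal.ofReal (∑ t ∈ Finset.range T,
      ∫ ωU, ‖gradient P.Φ (run c P δ ε x₀ yInit z₀ ωL ωU t).x‖ ∂(upperLaw Df Dg)) ≤
      ENNReal.ofReal (14 * (ε * T)) := by
    refine le_trans (le_of_eq ?_) h1
    rw [ENNReal.ofReal_sum_of_nonneg fun t _ => integral_nonneg fun _ => norm_nonneg _]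
    refine Finset.sum_congr rfl fun t ht => ?_
    exact ofReal_integral_eq_lintegral_ofReal (hint t (Finset.mem_range.1 ht))
      (Filter.Eventually.of_forall fun _ => norm_nonneg _)
  rw [ENNReal.ofReal_le_ofReal_iff (by positivity)] at h2
  -- For T = 0 the average is 0 by the convention 1/0 = 0.
  rcases Nat.eq_zero_or_pos T with h0 | h0
  · rw [h0]; simp; positivity
  · have : (0 : ℝ) < T := by exact_mod_cast h0
    rw [one_div_mul_eq_div, div_le_iff₀ this]
    linarith

end Assembly

/-! ### Number of oracle calls -/

section Complexity

open Consts

variable {c : Consts} {d : InitData} {δ ε : ℝ}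

/-- The logarithmic factor of the complexity bound. -/
noncomputable def logFactor (δ ε : ℝ) : ℝ := 1 + |Real.log (1 / ε)| + |Real.log (1 / δ)|

lemma one_le_logFactor (δ ε : ℝ) : 1 ≤ logFactor δ ε := by
  rw [logFactor]; linarith [abs_nonneg (Real.log (1 / ε)), abs_nonneg (Real.log (1 / δ))]

namespace Setting

variable (hS : Setting c d δ ε)
include hS

lemma leadBeta_mul : leadBeta c d δ ε * (64 * 1024 * c.L0 ^ 2 * c.σg1 ^ 2 *
    Real.log (paramB c d δ ε) ^ 2) = c.μ ^ 2 * ε ^ 2 := by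
  have hX := hS.thirtySix_le_log_paramB
  have hσ := hS.valid.σg1_pos
  have hL := L0_pos hS.valid
  have : Real.log (paramB c d δ ε) ≠ 0 := by linarith
  rw [leadBeta]
  field_simp

lemma leadBeta_pos : 0 < leadBeta c d δ ε :=
  hS.oneSubBeta_pos.trans_le (oneSubBeta_le c d δ ε).2.1

/-- The logarithm of the last admissibility condition. It prevents the entry of 1 - β with the
upper-level noise from being the smallest. -/
lemma sqrt_noise_le :
    c.lg1 * √c.noise ≤ 32 * (c.L0 * c.σg1 * Real.log (paramB c d δ ε)) := by
  have h12 := hS.small.h12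
  have hε := hS.ε_pos
  have hR := hS.baseR_pos
  have hσ := hS.valid.σg1_pos
  have hL := L0_pos hS.valid
  have h1 := Real.log_le_log hε h12
  rw [Real.log_mul (by positivity) (Real.exp_pos _).ne', Real.log_exp,
    Real.log_rpow (by positivity)] at h1
  have h2 : Real.log (rootB c d δ ε) = Real.log (2 ^ 21 * baseR c d δ) - 4 * Real.log ε := by
    rw [rootB, Real.log_div (by positivity) (by positivity), Real.log_pow]; norm_num
  rw [log_paramB, h2]
  have h3 : c.lg1 * √c.noise / (512 * c.L0 * c.σg1) ≤
      (Real.log (2 ^ 21 * baseR c d δ) - 4 * Real.log ε) / 4 := by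
    have e : -(c.lg1 * √c.noise) / (512 * c.L0 * c.σg1) =
      -(c.lg1 * √c.noise / (512 * c.L0 * c.σg1)) := neg_div _ _
    rw [e] at h1
    linarith
  rw [div_le_iff₀ (by positivity)] at h3
  exact h3.trans (le_of_eq (by ring))

lemma one_le_div_of_le_sqrt {X E : ℝ} (hE : 0 < E) (h : ε ≤ √(X / E)) : 1 ≤ X / (ε ^ 2 * E) := by
  have hε := hS.ε_pos
  have h1 : ε ^ 2 ≤ X / E := by
    rw [← Real.le_sqrt' hε]; exact h
  rw [one_le_div (by positivity)]
  rwa [le_div_iff₀ hE] at h1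

/-- Compares `leadBeta` with the entries free of ε; used with Y = μ l_{g,1} and Y = σ_{g,2}². -/
lemma leadBeta_mul_le {Y : ℝ} (hY0 : 0 ≤ Y) (hY : ε ^ 2 * Y ≤ c.L0 ^ 2 * c.σg1 ^ 2) :
    leadBeta c d δ ε * (64 * 1024 * 36 ^ 2 * Y) ≤ c.μ ^ 2 := by
  have hX := hS.thirtySix_le_log_paramB
  have hq := hS.leadBeta_pos
  have hε := hS.ε_pos
  have h1 := hS.leadBeta_mul
  have h3 : ε ^ 2 * (leadBeta c d δ ε * (64 * 1024 * 36 ^ 2 * Y)) ≤ ε ^ 2 * c.μ ^ 2 := by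
    calc _ = leadBeta c d δ ε * (64 * 1024 * 36 ^ 2) * (ε ^ 2 * Y) := by ring
      _ ≤ leadBeta c d δ ε * (64 * 1024 * Real.log (paramB c d δ ε) ^ 2) *
          (c.L0 ^ 2 * c.σg1 ^ 2) := by gcongr
      _ = leadBeta c d δ ε * (64 * 1024 * c.L0 ^ 2 * c.σg1 ^ 2 *
          Real.log (paramB c d δ ε) ^ 2) := by ring
      _ = _ := by rw [h1]; ring
  exact le_of_mul_le_mul_left h3 (by positivity)

/-- Each admissibility condition removes one competitor of the entry with σ_{g,1}. Hence 1 - β is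
exactly of order ε²/log²B, which the lower bound on η requires. -/
lemma oneSubBeta_eq : oneSubBeta c d δ ε = leadBeta c d δ ε := by
  have hX := hS.thirtySix_le_log_paramB
  have hq := hS.leadBeta_pos
  have hμ := hS.valid.μ_pos
  have hl := hS.valid.lg1_pos
  have hσ := hS.valid.σg1_pos
  have hσ2 := hS.valid.σg2_nonneg
  have hL := L0_pos hS.valid
  have hε := hS.ε_pos
  have hml := hS.mu_le
  have hsq : c.μ ^ 2 ≤ c.lg1 ^ 2 := by gcongr
  have b1 : leadBeta c d δ ε ≤ c.μ / (16 * c.lg1) := by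
    have h1 := hS.leadBeta_mul_le (Y := c.μ * c.lg1) (by positivity) hS.ε_sq_le
    rw [le_div_iff₀ (by positivity)]
    refine le_of_mul_le_mul_left ?_ hμ
    have : 0 ≤ leadBeta c d δ ε * (c.μ * c.lg1) := by positivity
    nlinarith
  have b0 : leadBeta c d δ ε ≤ 1 := b1.trans (by
    rw [div_le_one (by positivity)]; linarith)
  have bσ : leadBeta c d δ ε * (16 * c.σg2 ^ 2) ≤ c.μ ^ 2 := by
    have h1 := hS.leadBeta_mul_le (Y := c.σg2 ^ 2) (by positivity)
      (by
        have h2 : (ε * c.σg2) ^ 2 ≤ (c.L0 * c.σg1) ^ 2 := by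
          have := hS.small.h10; gcongr
        linarith [mul_pow ε c.σg2 2, mul_pow c.L0 c.σg1 2])
    have : 0 ≤ leadBeta c d δ ε * c.σg2 ^ 2 := by positivity
    nlinarith
  have bS : leadBeta c d δ ε * c.noise ≤ min 1 (c.μ ^ 2 / (32 * c.lg1 ^ 2)) * ε ^ 2 := by
    have h0 : c.μ ^ 2 / (32 * c.lg1 ^ 2) ≤ 1 := by
      rw [div_le_one (by positivity)]; nlinarith
    rw [min_eq_right h0, div_mul_eq_mul_div, le_div_iff₀ (by positivity)]
    have h1 : (c.lg1 * √c.noise) ^ 2 ≤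
        (32 * (c.L0 * c.σg1 * Real.log (paramB c d δ ε))) ^ 2 := by
      have := hS.sqrt_noise_le; gcongr
    rw [mul_pow, Real.sq_sqrt (noise_nonneg c)] at h1
    rw [← hS.leadBeta_mul]
    calc _ = leadBeta c d δ ε * (32 * (c.lg1 ^ 2 * c.noise)) := by ring
      _ ≤ leadBeta c d δ ε *
          (64 * (32 * (c.L0 * c.σg1 * Real.log (paramB c d δ ε))) ^ 2) := by
          have h2 := noise_nonneg c
          gcongr
          norm_num
      _ = _ := by ring
  refine le_antisymm (oneSubBeta_le c d δ ε).2.1 ?_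
  have hQ : ∀ {E : ℝ}, 0 < E → ε ≤ √(32 * baseQ c d δ / E) →
      leadBeta c d δ ε ≤ 32 * baseQ c d δ / (ε ^ 2 * E) := fun hE h =>
    b0.trans (hS.one_le_div_of_le_sqrt hE h)
  unfold oneSubBeta
  refine le_min (le_min (le_min (le_capRatio (by positivity) (le_capRatio (by positivity)
    (le_capRatio (noise_nonneg c) (le_min (le_min (le_min b0 b1) ?_) le_rfl) bS) ?_) bσ)
    (hQ (Real.exp_pos _) hS.small.h6)) (hQ (Real.exp_pos _) hS.small.h7))
    (hQ (Real.exp_pos _) hS.small.h8)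
  · refine b0.trans ?_
    have h1 := hS.one_le_div_of_le_sqrt (X := 16 * baseQ c d δ) one_pos
      (by rw [div_one]; exact hS.small.h4)
    rwa [mul_one] at h1
  · have : 0 ≤ leadBeta c d δ ε * c.σg2 ^ 2 := by positivity
    linarith

/-- The exponents in the definition of `1 - β` are dominated by `log A`. -/
lemma le_log_paramA_of_le {E : ℝ} (h : oneSubBeta c d δ ε ≤ 32 * baseQ c d δ / (ε ^ 2 * Real.exp E)) :
    2 * E ≤ Real.log (paramA c d δ ε) := by
  have hε := hS.ε_pos
  have hq := hS.oneSubBeta_pos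
  rw [log_paramA]
  have h1 : Real.exp E ≤ rootA c d δ ε := by
    rw [rootA, le_div_iff₀ (by positivity)]
    rw [le_div_iff₀ (by positivity)] at h
    linarith
  have h2 := Real.log_le_log (Real.exp_pos _) h1
  rw [Real.log_exp] at h2
  linarith

/-- The exponentials `expo1`, `expo2`, `expo3` in 1 - β make log A dominate the corresponding ratios
of initial errors, so the entry with log A is the smallest inside η. The third and ninth
admissibility conditions handle the radius and the initial gradient. -/
lemma le_eta : oneSubBeta c d δ ε / 8 *
    (c.μ * ε / (c.lg1 * c.L0 * Real.log (paramA c d δ ε))) ≤ eta c d δ ε := by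
  have hq := hS.oneSubBeta_pos
  have hμ := hS.valid.μ_pos
  have hl := hS.valid.lg1_pos
  have hL := L0_pos hS.valid
  have hL1 := L1_pos hS.valid
  have hρ := invRadius_pos hS.valid
  have hε := hS.ε_pos
  have hml := hS.mu_le
  have hΔ := hS.Δ_pos
  have hA := hS.eighteen_le_log_paramA
  obtain ⟨b1, -, -, e1, e2, e3⟩ := oneSubBeta_le c d δ ε
  have a1 := hS.le_log_paramA_of_le e1
  have a2 := hS.le_log_paramA_of_le e2
  have a3 := hS.le_log_paramA_of_le e3
  unfold eta
  generalize hA' : Real.log (paramA c d δ ε) = A at *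
  have hA0 : 0 < A := by linarith
  have hq1 : oneSubBeta c d δ ε ≤ 1 := b1.trans (by
    rw [div_le_one (by positivity)]; linarith)
  have a1' : c.μ ≤ A * c.lg1 := by
    rw [← div_le_iff₀ hl]; calc _ = 2 * (c.μ / (2 * c.lg1)) := by field_simp
      _ ≤ A := a1
  have a2' : c.μ * c.lg1 * d.Δz ^ 2 ≤ A * (d.Δ * c.L0) := by
    rw [← div_le_iff₀ (by positivity)]
    calc _ = 2 * (c.μ * c.lg1 * d.Δz ^ 2 / (2 * d.Δ * c.L0)) := by field_simp
      _ ≤ A := a2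
  have a3' : c.μ * d.Δy ^ 2 * c.L0 ≤ A * (c.lg1 * d.Δ) := by
    rw [← div_le_iff₀ (by positivity)]
    calc _ = 2 * (c.μ * d.Δy ^ 2 * c.L0 / (2 * c.lg1 * d.Δ)) := by field_simp
      _ ≤ A := a3
  have u1 : c.μ * ε / (c.lg1 * c.L0 * A) ≤ ε / c.L0 := by
    rw [div_le_div_iff₀ (by positivity) hL]
    calc _ = ε * c.L0 * c.μ := by ring
      _ ≤ ε * c.L0 * (A * c.lg1) := by gcongr
      _ = _ := by ring
  have u2 : ε / c.L0 ≤ 1 / c.L1 := by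
    have := hS.small.h1
    rw [le_div_iff₀ hL1] at this
    rw [div_le_div_iff₀ hL hL1]; linarith
  refine le_min ?_ ?_
  · rw [show ∀ q n : ℝ, 1 / 8 * n * q = q / 8 * n from fun q n => by ring]
    refine mul_le_mul_of_nonneg_left ?_ (by positivity)
    refine le_min (le_capRatio (by positivity) (le_capRatio hS.Γ_nonneg
      (le_capRatio (by positivity) (le_min (u1.trans u2) u1) ?_) ?_) ?_) le_rfl
    · rw [div_mul_eq_mul_div, div_le_iff₀ (by positivity)]
      calc _ = ε * c.L0 * (c.μ * d.Δy ^ 2 * c.L0) := by ring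
        _ ≤ ε * c.L0 * (A * (c.lg1 * d.Δ)) := by gcongr
        _ = _ := by ring
    · have h9 := hS.small.h9
      have hΓ := hS.Γ_nonneg
      calc _ ≤ ε / c.L0 * d.Γ := by gcongr
        _ = ε * d.Γ / c.L0 := by ring
        _ ≤ _ := by rw [div_le_iff₀ hL]; exact h9
    · rw [div_mul_eq_mul_div, div_le_iff₀ (by positivity)]
      calc _ = ε * c.lg1 * (c.μ * c.lg1 * d.Δz ^ 2) := by ring
        _ ≤ ε * c.lg1 * (A * (d.Δ * c.L0)) := by gcongr
        _ = _ := by ring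
  · have h3 := hS.small.h3
    rw [le_div_iff₀ (by positivity)] at h3
    rw [div_mul_div_comm, div_le_div_iff₀ (by positivity) hρ]
    calc _ = oneSubBeta c d δ ε * (ε * (c.μ * c.invRadius)) := by ring
      _ ≤ 1 * (8 * c.lg1 * c.L0) := by gcongr
      _ ≤ A * (8 * c.lg1 * c.L0) := by gcongr; linarith
      _ = _ := by ring

/-- With 1 - β known exactly, √A is the fourth root of B times log²B. So log A is half of log B plus
4 log log B, and log X ≤ X - 1. -/
lemma log_paramA_le : Real.log (paramA c d δ ε) ≤ 9 / 2 * Real.log (paramB c d δ ε) := by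
  have hX := hS.thirtySix_le_log_paramB
  have hμ := hS.valid.μ_pos
  have hε := hS.ε_pos
  have hB := hS.rootB_pos
  have hσ := hS.valid.σg1_pos
  have hL := L0_pos hS.valid
  have e : rootA c d δ ε = rootB c d δ ε * Real.log (paramB c d δ ε) ^ 2 := by
    have : Real.log (paramB c d δ ε) ≠ 0 := by linarith
    rw [rootA, hS.oneSubBeta_eq, leadBeta, rootB, hS.baseR_eq]
    field_simp
    ring
  have h1 := Real.log_le_sub_one_of_pos (show 0 < Real.log (paramB c d δ ε) by linarith)
  have h2 : Real.log (rootA c d δ ε) = Real.log (rootB c d δ ε) +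
      2 * Real.log (Real.log (paramB c d δ ε)) := by
    rw [e, Real.log_mul hB.ne' (pow_ne_zero _ (by linarith)), Real.log_pow]; norm_num
  rw [log_paramA, h2]
  have h3 := log_paramB (c := c) (d := d) (δ := δ) (ε := ε)
  linarith

lemma log_paramB_le_logFactor : Real.log (paramB c d δ ε) ≤
    (16 + 4 * |Real.log (2 ^ 21 * Real.exp 1 * c.lg1 * d.Δ * c.L0 ^ 3 * c.σg1 ^ 2 / c.μ ^ 3)|) *
      logFactor δ ε := by
  have hμ := hS.valid.μ_pos
  have hl := hS.valid.lg1_pos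
  have hε := hS.ε_pos
  have hδ := hS.δ_pos
  have hΔ := hS.Δ_pos
  have hσ := hS.valid.σg1_pos
  have hL := L0_pos hS.valid
  set K := 2 ^ 21 * Real.exp 1 * c.lg1 * d.Δ * c.L0 ^ 3 * c.σg1 ^ 2 / c.μ ^ 3 with hK
  have hK0 : 0 < K := by positivity
  have e : rootB c d δ ε = K * (1 / δ) * (1 / ε) ^ 4 := by
    rw [rootB, baseR, hK]; field_simp
  rw [log_paramB, e, Real.log_mul (by positivity) (by positivity),
    Real.log_mul (by positivity) (by positivity), Real.log_pow]
  have h1 := le_abs_self (Real.log K)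
  have h2 := le_abs_self (Real.log (1 / δ))
  have h3 := le_abs_self (Real.log (1 / ε))
  have h4 := abs_nonneg (Real.log K)
  have h5 := one_le_logFactor δ ε
  have h6 : |Real.log K| * 1 ≤ |Real.log K| * logFactor δ ε := by gcongr
  have h7 := abs_nonneg (Real.log (1 / δ))
  rw [logFactor] at h6 ⊢
  push_cast
  linarith

/-- Allows terms without a power of ε, namely the warm start and the roundings, to be absorbed into
ε⁻⁴. -/
lemma one_le_mul_inv_pow :
    1 ≤ c.L0 ^ 4 * c.σg1 ^ 4 / (c.μ * c.lg1) ^ 2 * ε⁻¹ ^ 4 := by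
  have h1 := hS.ε_sq_le
  have hμ := hS.valid.μ_pos
  have hl := hS.valid.lg1_pos
  have hε := hS.ε_pos
  rw [inv_pow, ← div_eq_mul_inv, div_div, one_le_div (by positivity)]
  calc _ = (ε ^ 2 * (c.μ * c.lg1)) ^ 2 := by ring
    _ ≤ (c.L0 ^ 2 * c.σg1 ^ 2) ^ 2 := by gcongr
    _ = _ := by ring

/-- The iteration complexity of the main loop. -/
lemma horizon_le : (horizon c d δ ε : ℝ) ≤
    9 * 2 ^ 20 * (c.lg1 * c.L0 ^ 3 * c.σg1 ^ 2 / c.μ ^ 3) * d.Δ *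
      Real.log (paramB c d δ ε) ^ 3 * ε⁻¹ ^ 4 + 1 := by
  have hX := hS.thirtySix_le_log_paramB
  have hμ := hS.valid.μ_pos
  have hl := hS.valid.lg1_pos
  have hε := hS.ε_pos
  have hη := hS.eta_pos
  have hΔ := hS.Δ_pos
  have hσ := hS.valid.σg1_pos
  have hL := L0_pos hS.valid
  have hA := hS.eighteen_le_log_paramA
  have hAX := hS.log_paramA_le
  have hq := hS.leadBeta_pos
  refine (Nat.ceil_lt_add_one (by positivity)).le.trans ?_
  gcongr
  have h1 := hS.le_eta
  rw [hS.oneSubBeta_eq] at h1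
  have hlead := hS.leadBeta_mul
  generalize Real.log (paramA c d δ ε) = A at *
  generalize Real.log (paramB c d δ ε) = X at *
  generalize leadBeta c d δ ε = q at *
  have hq' : q = c.μ ^ 2 * ε ^ 2 / (64 * 1024 * c.L0 ^ 2 * c.σg1 ^ 2 * X ^ 2) := by
    rw [eq_div_iff]
    · exact hlead
    · have : 0 < X := by linarith
      positivity
  have hA0 : 0 < A := by linarith
  have hX0 : 0 < X := by linarith
  calc 4 * d.Δ / (eta c d δ ε * ε) ≤ 4 * d.Δ / (q / 8 * (c.μ * ε / (c.lg1 * c.L0 * A)) * ε) := by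
        gcongr
    _ = 2 ^ 21 * (c.lg1 * c.L0 ^ 3 * c.σg1 ^ 2 / c.μ ^ 3) * d.Δ * (X ^ 2 * A) * ε⁻¹ ^ 4 := by
        rw [hq']; field_simp; norm_num
    _ ≤ 2 ^ 21 * (c.lg1 * c.L0 ^ 3 * c.σg1 ^ 2 / c.μ ^ 3) * d.Δ * (X ^ 2 * (9 / 2 * X)) *
        ε⁻¹ ^ 4 := by gcongr
    _ = _ := by ring

/-- The iteration complexity of the warm start. -/
lemma warmSteps_le (r : ℝ) : (warmSteps c δ r : ℝ) ≤
    |Real.log (256 * c.L1 ^ 2 * r ^ 2)| *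
      (2 / c.μ * (2 * c.lg1 + 2048 * c.L1 ^ 2 * c.σg1 ^ 2 / c.μ)) * logFactor δ ε + 1 := by
  have hμ := hS.valid.μ_pos
  have hl := hS.valid.lg1_pos
  have hσ := hS.valid.σg1_pos
  have hL1 := L1_pos hS.valid
  have hδ := hS.δ_pos
  have hml := hS.mu_le
  have hlog : Real.log (Real.exp 1 / δ) = 1 + Real.log (1 / δ) := by
    rw [Real.log_div (Real.exp_pos _).ne' hδ.ne', Real.log_exp, one_div, Real.log_inv]; ring
  have hlogδ : 0 ≤ Real.log (1 / δ) := Real.log_nonneg (by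
    rw [one_le_div hδ]; exact hS.δ_lt.le)
  have hΛ : 1 + Real.log (1 / δ) ≤ logFactor δ ε := by
    have := abs_nonneg (Real.log (1 / ε))
    have := le_abs_self (Real.log (1 / δ))
    rw [logFactor]; linarith
  have hΛ1 := one_le_logFactor δ ε
  have ha := alphaInit_pos hS.valid hδ hS.δ_lt
  have ha1 : alphaInit c δ ≤ 1 / (2 * c.lg1) := min_le_left _ _
  have hainv : 1 / alphaInit c δ ≤
      (2 * c.lg1 + 2048 * c.L1 ^ 2 * c.σg1 ^ 2 / c.μ) * logFactor δ ε := by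
    have h1 : 2 * c.lg1 * 1 ≤ 2 * c.lg1 * logFactor δ ε := by gcongr
    have h2 : 2048 * c.L1 ^ 2 * c.σg1 ^ 2 / c.μ * (1 + Real.log (1 / δ)) ≤
      2048 * c.L1 ^ 2 * c.σg1 ^ 2 / c.μ * logFactor δ ε := by gcongr
    have h3 : 0 ≤ 2048 * c.L1 ^ 2 * c.σg1 ^ 2 / c.μ * logFactor δ ε := by positivity
    have h4 : 0 ≤ 2 * c.lg1 * logFactor δ ε := by positivity
    rw [alphaInit, hlog]
    rcases min_cases (1 / (2 * c.lg1))
      (c.μ / (2048 * c.L1 ^ 2 * c.σg1 ^ 2 * (1 + Real.log (1 / δ)))) with h | h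
    · rw [h.1, one_div_one_div]; linarith
    · rw [h.1, one_div_div]
      have : 2048 * c.L1 ^ 2 * c.σg1 ^ 2 * (1 + Real.log (1 / δ)) / c.μ =
        2048 * c.L1 ^ 2 * c.σg1 ^ 2 / c.μ * (1 + Real.log (1 / δ)) := by ring
      linarith
  set a := alphaInit c δ with had
  have hx : c.μ * a ≤ 1 / 2 := by
    calc _ ≤ c.lg1 * (1 / (2 * c.lg1)) := by gcongr
      _ = 1 / 2 := by field_simp
  -- log(2/(2 - x)) = -log(1 - x/2) ≥ x/2, so the warm start needs of order 1/(μα^init) steps, each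
  -- factor costing at most log(1/δ).
  have hden : c.μ * a / 2 ≤ Real.log (2 / (2 - c.μ * a)) := by
    have h1 := Real.log_le_sub_one_of_pos (show 0 < (2 - c.μ * a) / 2 by linarith)
    have h2 : Real.log (2 / (2 - c.μ * a)) = -Real.log ((2 - c.μ * a) / 2) := by
      rw [← Real.log_inv, inv_div]
    rw [h2]; linarith
  have hden0 : 0 < c.μ * a / 2 := by positivity
  have hceil : (warmSteps c δ r : ℝ) ≤
      |Real.log (256 * c.L1 ^ 2 * r ^ 2)| / Real.log (2 / (2 - c.μ * a)) + 1 := by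
    rw [warmSteps, ← had]
    refine (Nat.cast_le.2 (Nat.ceil_mono (div_le_div_of_nonneg_right (le_abs_self _)
      (hden0.trans_le hden).le))).trans ?_
    exact (Nat.ceil_lt_add_one (div_nonneg (abs_nonneg _) (hden0.trans_le hden).le)).le
  refine hceil.trans ?_
  gcongr
  calc _ ≤ |Real.log (256 * c.L1 ^ 2 * r ^ 2)| / (c.μ * a / 2) := by gcongr
    _ = |Real.log (256 * c.L1 ^ 2 * r ^ 2)| * (2 / c.μ) * (1 / a) := by field_simp
    _ ≤ |Real.log (256 * c.L1 ^ 2 * r ^ 2)| * (2 / c.μ) *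
        ((2 * c.lg1 + 2048 * c.L1 ^ 2 * c.σg1 ^ 2 / c.μ) * logFactor δ ε) := by gcongr
    _ = _ := by ring

end Setting

/-- The constant in the complexity bound. -/
noncomputable def complexityConst (c : Consts) (Δ r : ℝ) : ℝ :=
  c.L0 ^ 4 * c.σg1 ^ 4 / (c.μ * c.lg1) ^ 2 * (|Real.log (256 * c.L1 ^ 2 * r ^ 2)| *
      (2 / c.μ * (2 * c.lg1 + 2048 * c.L1 ^ 2 * c.σg1 ^ 2 / c.μ)) + 6) +
    45 * 2 ^ 20 * (c.lg1 * c.L0 ^ 3 * c.σg1 ^ 2 / c.μ ^ 3) * Δ *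
      (16 + 4 * |Real.log (2 ^ 21 * Real.exp 1 * c.lg1 * Δ * c.L0 ^ 3 * c.σg1 ^ 2 / c.μ ^ 3)|) ^ 3

/-- The exponent 3 comes from the two logarithms in 1 - β and the one in η. The warm start has a
single logarithm and is absorbed through `one_le_mul_inv_pow`. -/
lemma Setting.calls_le (hS : Setting c d δ ε) (r : ℝ) :
    (warmSteps c δ r : ℝ) + 5 * horizon c d δ ε ≤
      complexityConst c d.Δ r * ε⁻¹ ^ 4 * logFactor δ ε ^ 3 := by
  have h1 := hS.warmSteps_le r
  have h2 := hS.horizon_le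
  have h3 := hS.log_paramB_le_logFactor
  have h4 := hS.one_le_mul_inv_pow
  have hX := hS.thirtySix_le_log_paramB
  have hμ := hS.valid.μ_pos
  have hl := hS.valid.lg1_pos
  have hε := hS.ε_pos
  have hΔ := hS.Δ_pos
  have hσ := hS.valid.σg1_pos
  have hL := L0_pos hS.valid
  have hΛ := one_le_logFactor δ ε
  rw [complexityConst]
  set W := |Real.log (256 * c.L1 ^ 2 * r ^ 2)| *
      (2 / c.μ * (2 * c.lg1 + 2048 * c.L1 ^ 2 * c.σg1 ^ 2 / c.μ)) with hW
  have hW0 : 0 ≤ W := by positivity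
  set V := 16 + 4 * |Real.log (2 ^ 21 * Real.exp 1 * c.lg1 * d.Δ * c.L0 ^ 3 * c.σg1 ^ 2 /
    c.μ ^ 3)| with hV
  set K := c.lg1 * c.L0 ^ 3 * c.σg1 ^ 2 / c.μ ^ 3 with hK
  have hK0 : 0 ≤ K := by positivity
  set M := c.L0 ^ 4 * c.σg1 ^ 4 / (c.μ * c.lg1) ^ 2 * ε⁻¹ ^ 4 with hM
  generalize Real.log (paramB c d δ ε) = X at *
  generalize logFactor δ ε = Λ at *
  have hΛ3 : Λ ≤ Λ ^ 3 := by
    calc Λ = Λ ^ 1 := (pow_one Λ).symm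
      _ ≤ Λ ^ 3 := pow_le_pow_right₀ hΛ (by norm_num)
  have h5 : X ^ 3 ≤ V ^ 3 * Λ ^ 3 := by
    rw [← mul_pow]
    have : 0 ≤ X := by linarith
    gcongr
  have h6 : W * Λ + 6 ≤ M * (W + 6) * Λ ^ 3 := by
    calc _ ≤ 1 * (W + 6) * Λ ^ 3 := by nlinarith
      _ ≤ _ := by gcongr
  have h7 : 45 * 2 ^ 20 * K * d.Δ * X ^ 3 * ε⁻¹ ^ 4 ≤
      45 * 2 ^ 20 * K * d.Δ * (V ^ 3 * Λ ^ 3) * ε⁻¹ ^ 4 := by gcongr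
  have h8 : (c.L0 ^ 4 * c.σg1 ^ 4 / (c.μ * c.lg1) ^ 2 * (W + 6) + 45 * 2 ^ 20 * K * d.Δ * V ^ 3) *
      ε⁻¹ ^ 4 * Λ ^ 3 = M * (W + 6) * Λ ^ 3 +
      45 * 2 ^ 20 * K * d.Δ * (V ^ 3 * Λ ^ 3) * ε⁻¹ ^ 4 := by rw [hM]; ring
  rw [h8]
  linarith

end Complexity

/-! ### Counting the oracle calls -/

section Calls

variable {dx dy : ℕ} {Ξ Z : Type*} {P : Problem dx dy Ξ Z}

lemma mainLoop_calls (h : StepSizes) (s₀ : State dx dy) (p : ℕ → Z) (w : UpperSample Ξ Z) (t : ℕ) :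
    (mainLoop P h s₀ p w t).calls = s₀.calls + 5 * t := by
  induction t with
  | zero => rfl
  | succ t ih => simp only [mainLoop, step, ih]; ring

end Calls

end SLIP

theorem theorem1 (c : Consts) (hc : c.Valid) :
    ∃ (C : ℝ → ℝ → ℝ) (k : ℕ),
      ∀ (dx dy : ℕ) (Ξ Z : Type*) [MeasurableSpace Ξ] [MeasurableSpace Z]
        (Df : Measure Ξ) (Dg : Measure Z) [IsProbabilityMeasure Df] [IsProbabilityMeasure Dg]
        (P : Problem dx dy Ξ Z),
        RelaxedSmooth c P → LowerLevel c P → OracleAssumption c P Df Dg →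
        BddBelow (Set.range P.Φ) →
        ∀ (x₀ : Vec dx) (yInit z₀ : Vec dy),
          Differentiable ℝ P.Φ ∧
          ∀ δ ε : ℝ, 0 < δ → δ < 1 → 0 < ε →
            ENNReal.ofReal (1 - 2 * δ) ≤ lowerLaw Dg {ωL : LowerSample Z |
              Admissible c P δ ε x₀ yInit z₀ ωL →
                let T := iterations c P δ ε x₀ yInit z₀ ωL
                (∀ t < T, Integrable
                  (fun ωU => ‖gradient P.Φ (run c P δ ε x₀ yInit z₀ ωL ωU t).x‖)
                  (upperLaw Df Dg)) ∧
                (1 / (T : ℝ)) * ∑ t ∈ Finset.range T,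
                  ∫ ωU, ‖gradient P.Φ (run c P δ ε x₀ yInit z₀ ωL ωU t).x‖ ∂(upperLaw Df Dg)
                    ≤ 14 * ε} ∧
            ∀ (ωL : LowerSample Z) (ωU : UpperSample Ξ Z),
              Admissible c P δ ε x₀ yInit z₀ ωL →
                ((run c P δ ε x₀ yInit z₀ ωL ωU (iterations c P δ ε x₀ yInit z₀ ωL)).calls : ℝ)
                  ≤ C (P.gap x₀) ‖yInit - P.yStar x₀‖ * ε⁻¹ ^ 4
                      * (1 + |Real.log (1 / ε)| + |Real.log (1 / δ)|) ^ k := by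
  refine ⟨complexityConst c, 3, fun dx dy Ξ Z _ _ Df Dg _ _ P hs hl ho hb x₀ yInit z₀ =>
    ⟨differentiable_Φ hc hs hl, fun δ ε hδ hδ1 hε => ⟨?_, fun ωL ωU hA => ?_⟩⟩⟩
  · exact (le_measure_goodRun hc hs hl ho hb hδ hδ1 hε yInit).trans
      (measure_mono fun ωL hg hA => mean_gradient_le hc hs hl ho hb hε hA hg)
  -- By definition `initData` is `startData` at the warm-start output, so admissibility is the
  -- smallness condition required here. The bound on the calls holds for every sample, not only with
  -- high probability.
  · have hS := setting_startData (z₀ := z₀) (y := (warmStart c P δ x₀ yInit ωL).1)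
      hc hl hb hδ hδ1 hε hA
    have h1 : (run c P δ ε x₀ yInit z₀ ωL ωU (iterations c P δ ε x₀ yInit z₀ ωL)).calls =
        warmSteps c δ ‖yInit - P.yStar x₀‖ + 5 * iterations c P δ ε x₀ yInit z₀ ωL := by
      rw [run, mainLoop_calls, warmStart, sgdDD_calls]
    rw [h1]
    push_cast
    exact hS.calls_le _
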